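/- **Setting.** Let $dS_3$ be the unit hyperboloid with metric $h^{(0)}=-d\tau^2+\cosh^2\tau\,(d\theta^2+\sin^2\theta\,d\phi^2)$, Levi-Civita connection $\mathcal D$, $\square=\mathcal D^a\mathcal D_a$, volume form $\epsilon$ with $\epsilon_{\tau\theta\phi}>0$, and $(\mathrm{curl}\,T)_{ab}=\epsilon_a{}^{cd}\mathcal D_cT_{db}$. For a scalar $\Phi$ put $(S\Phi)_{ab}=\mathcal D_a\mathcal D_b\Phi+h^{(0)}_{ab}\Phi$. Let $\mathcal N=\{\theta\neq\pi\}$ and $\mathcal S=\{\theta\ne0\}$. A *two-patch tensor* is a pair of smooth tensor fields, one on $\mathcal N$ and one on $\mathcal S$; its *transition function* is the difference (south minus north) on the overlap. It is *regular* if this vanishes, i.e. if it is a smooth tensor field on $dS_3$. Let $n=(\cos\theta,\sin\theta\cos\phi,\sin\theta\sin\phi)$, and $$\zeta_{(0)}=\sinh\tau,\quad \zeta_{(i)}=\cosh\tau\,n_i,\qquad \hat\zeta_{(0)}=\frac{\cosh2\tau}{\cosh\tau},\quad \hat\zeta_{(i)}=\Big(2\sinh\tau+\frac{\tanh\tau}{\cosh\tau}\Big)n_i\quad(i=1,2,3).$$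 A *configuration* is a pair $(\sigma,h^{(1)})$ with $\sigma$ a smooth function on $dS_3$ and $h^{(1)}$ a symmetric two-patch tensor such that, with $k_{ab}=h^{(1)}_{ab}+2\sigma h^{(0)}_{ab}$, the tensor $B^{(1)}$ below is regular. Put $$E^{(1)}=-S\sigma,\qquad B^{(1)}=\tfrac12\,\mathrm{curl}\,k$$ (the first-order electric and magnetic parts of the Weyl tensor of the Beig–Schmidt metric $(1+\sigma/\rho)^2d\rho^2+\rho^2(h^{(0)}_{ab}+h^{(1)}_{ab}/\rho+\dots)dx^adx^b$). The configuration is *on shell* if the first-order vacuum equations hold, where $k=k_a{}^a$: $$\square\sigma+3\sigma=0,\qquad \mathcal D^bk_{ab}-\mathcal D_ak=0,\qquad (\square-3)k_{ab}+k\,h^{(0)}_{ab}-\mathcal D_a\mathcal D_bk=0 .$$ A *supertranslation* by a smooth function $\omega$ on $dS_3$ maps $(\sigma,h^{(1)})$ to $(\sigma,h^{(1)}+S\omega)$, so $k\mapsto k+S\omega$; it is a *translation* if $\omega\in\mathrm{span}\{\zeta_{(\mu)}\}$. The singular representatives are given on $0<\theta<\pi$ by the following components (components not listed are zero, symmetric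 ones are understood), with $A=3\tanh\tau/\cosh\tau$, $w=8c-9\cos\theta+\cos3\theta$, $q=\cos^4\theta-4c\cos\theta+3$, and $c=1$ in the north, $c=-1$ in the south: * $k_{(0)}$: $k_{\tau\phi}=\frac{2(c-\cos\theta)}{\cosh\tau}$, $k_{\theta\phi}=\sinh\tau\,\frac{\cos2\theta-4c\cos\theta+3}{2\sin\theta}$; * $k_{(1)}$: $k_{\tau\phi}=-A\sin^2\theta$, $k_{\theta\phi}=-\frac{w}{4\sin\theta}\cosh\tau$; * $k_{(2)}$: $k_{\tau\theta}=A\sin\phi$, $k_{\tau\phi}=A\cos\theta\sin\theta\cos\phi$, $k_{\theta\theta}=\frac{w}{2\sin^3\theta}\cosh\tau\sin\phi$, $k_{\theta\phi}=\frac{q}{\sin^2\theta}\cosh\tau\cos\phi$, $k_{\phi\phi}=-\frac{w}{2\sin\theta}\cosh\tau\sin\phi$; * $k_{(3)}$: $k_{(2)}$ with $(\sin\phi,\cos\phi)$ replaced by $(-\cos\phi,\sin\phi)$. Let $\delta k_{(\mu)}=k_{(\mu)}|_{c=-1}-k_{(\mu)}|_{c=1}$. **Statement.** 1. For every configuration,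 $E^{(1)}$ is symmetric and curl-free and $B^{(1)}$ is traceless. It is on shell if and only if $E^{(1)}$ is traceless and $B^{(1)}$ is symmetric and curl-free. On shell, both $E^{(1)}$ and $B^{(1)}$ are smooth on $dS_3$, symmetric, traceless, curl-free, divergence-free, and annihilated by $\square-3$. 2. On shell, $E^{(1)}=S(-\sigma)$ with $(\square+3)(-\sigma)=0$, and there is a smooth function $\sigma^D$ on $dS_3$ with $\square\sigma^D+3\sigma^D=0$ and $B^{(1)}=S\sigma^D$. Smooth functions $\Phi,\Phi'$ on $dS_3$ satisfy $S\Phi=S\Phi'$ if and only if $\Phi'-\Phi\in\mathrm{span}\{\zeta_{(\mu)}\}$. 3. Every smooth solution $\Phi$ of $\square\Phi+3\Phi=0$ on $dS_3$ has unique coefficients $\alpha_{(\mu)},\hat\alpha_{(\mu)}$ such that $\Phi-\sum_\mu(\alpha_{(\mu)}\zeta_{(\mu)}+\hat\alpha_{(\mu)}\hat\zeta_{(\mu)})$ contains only spherical harmonics with $l\ge2$ on each sphere $\tau=\mathrm{const}$. 4. A supertranslation maps configurations to configurations. It preserves $B^{(1)}$, the on-shell condition, and any transition function of the form $\sum_\mu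 N_{(\mu)}\delta k_{(\mu)}$. If $k_{ab}$ is traceless, then it stays traceless if and only if $\square\omega+3\omega=0$. Two symmetric two-patch tensors $k,k'$ with $k'-k$ regular satisfy $\mathrm{curl}\,k'=\mathrm{curl}\,k$ if and only if $k'=k+S\omega$ for a smooth function $\omega$ on $dS_3$; if $k$ and $k'$ are traceless, any such $\omega$ satisfies $\square\omega+3\omega=0$. 5. The $k_{(\mu)}$ extend to two-patch tensors. They are symmetric, traceless, divergence-free, annihilated by $\square-3$, and satisfy $\mathrm{curl}\,k_{(\mu)}=S\hat\zeta_{(\mu)}$. Let $\Phi$, $\hat\alpha_{(\mu)}$ be as in 3 (in particular $\Phi=\sigma^D$, or $\Phi=-\sigma$). Then: * there is a regular symmetric traceless divergence-free $P_{ab}$ such that $k'=P+\sum_\mu2\hat\alpha_{(\mu)}k_{(\mu)}$ is traceless and divergence-free, has transition function $\sum_\mu2\hat\alpha_{(\mu)}\delta k_{(\mu)}$, and satisfies $\tfrac12\mathrm{curl}\,k'=S\Phi$; moreover every symmetric two-patch tensor $k$ with $\tfrac12\mathrm{curl}\,k=S\Phi$ equals $k'+S\omega$ on each patch, with $\omega$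 smooth on each patch (possibly different functions on the two patches); * $S\Phi=\tfrac12\mathrm{curl}\,P$ for some regular symmetric $P$ if and only if all $\hat\alpha_{(\mu)}=0$; * if a symmetric two-patch tensor $k$ with $\tfrac12\mathrm{curl}\,k=S\Phi$ has transition function $\sum_\mu N_{(\mu)}\delta k_{(\mu)}$, then $N_{(\mu)}=2\hat\alpha_{(\mu)}$ for every $\mu$. 6. Let $(\sigma,h^{(1)})$ be an on-shell configuration with $h^{(1)}|_{\mathcal S}-h^{(1)}|_{\mathcal N}=\sum_\mu N_{(\mu)}\delta k_{(\mu)}$, for arbitrary NUT charges $N_{(\mu)}\in\mathbb R$. * (Only singular terms.) There is a supertranslation after which $k=\sum_\mu N_{(\mu)}k_{(\mu)}$ if and only if $B^{(1)}\in\mathrm{span}\{S\hat\zeta_{(\mu)}\}$. If two supertranslations $\omega,\omega'$ bring $k$ to the forms $\sum_\mu M_{(\mu)}k_{(\mu)}$ and $\sum_\mu M'_{(\mu)}k_{(\mu)}$, then $M=M'=N$, $S\omega=S\omega'$, and $\omega'-\omega$ is a translation. * (Inverse of the curl operator.) Call a *curl inverse* a map $C$ that assigns to each smooth symmetric traceless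 curl-free tensor $T$ on $dS_3$ a symmetric traceless divergence-free two-patch tensor $C(T)$ with $\tfrac12\mathrm{curl}\,C(T)=T$, whose transition function is a linear combination of the $\delta k_{(\mu)}$. Curl inverses exist. For every curl inverse $C$ there is a supertranslation after which $k=C(B^{(1)})$; if two supertranslations $\omega,\omega'$ both achieve this, then $S\omega=S\omega'$ and $\omega'-\omega$ is a translation. -/

import Mathlib

noncomputable section

namespace DeSitter

/-! ### Three-dimensional de Sitter space in two charts

The unit hyperboloid `dS₃ = ℝ × S²` is covered by two charts, each with coordinates
`(τ, x, y) ∈ ℝ³`. The northern chart `dS₃ \ {θ = π}` uses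
`x + i y = tan (θ/2) exp (i φ)`, the southern chart `dS₃ \ {θ = 0}` uses
`x + i y = cot (θ/2) exp (-i φ)`. Both have the orientation of `(τ, θ, φ)`, and
`-dτ² + cosh² τ (dθ² + sin² θ dφ²)` has the same form in both of them. -/

/-- The two patches. -/
inductive Patch
  | north
  | south

/-- Coordinate space of a chart: `(τ, x, y)`, or `(τ, θ, φ)`. -/
abbrev Coord := Fin 3 → ℝ

/-- A scalar on each patch, as a function of the coordinates of the patch. -/
abbrev ScalarField := Patch → Coord → ℝ

/-- A covariant two-tensor on each patch, through its components in the chart of the patch. The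
two parts are independent; see `TensorField.IsGlobal`. -/
abbrev TensorField := Patch → Coord → Fin 3 → Fin 3 → ℝ

/-- Partial derivative `∂_a f`. -/
def pd (a : Fin 3) (f : Coord → ℝ) (x : Coord) : ℝ := fderiv ℝ f x (Pi.single a 1)

/-- Components of `h⁽⁰⁾ = -dτ² + 4 cosh² τ (dx² + dy²) / (1 + x² + y²)²`. -/
def metric (x : Coord) : Matrix (Fin 3) (Fin 3) ℝ :=
  Matrix.diagonal ![-1,
    4 * Real.cosh (x 0) ^ 2 / (1 + x 1 ^ 2 + x 2 ^ 2) ^ 2,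
    4 * Real.cosh (x 0) ^ 2 / (1 + x 1 ^ 2 + x 2 ^ 2) ^ 2]

/-- Inverse metric `h⁽⁰⁾ᵃᵇ`. -/
def metricInv (x : Coord) : Matrix (Fin 3) (Fin 3) ℝ := (metric x)⁻¹

/-- Christoffel symbols `Γᵉ_ab` of the Levi-Civita connection. -/
def christoffel (x : Coord) (e a b : Fin 3) : ℝ :=
  (1 / 2) * ∑ d, metricInv x e d *
    (pd a (fun y => metric y d b) x + pd b (fun y => metric y d a) x
      - pd d (fun y => metric y a b) x)

/-- `D_a V_b`. -/
def covD1 (V : Coord → Fin 3 → ℝ) (x : Coord) (a b : Fin 3) : ℝ :=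
  pd a (fun y => V y b) x - ∑ e, christoffel x e a b * V x e

/-- `D_c T_ab`. -/
def covD2 (T : Coord → Fin 3 → Fin 3 → ℝ) (x : Coord) (c a b : Fin 3) : ℝ :=
  pd c (fun y => T y a b) x - ∑ e, christoffel x e c a * T x e b
    - ∑ e, christoffel x e c b * T x a e

/-- `D_d U_cab`. -/
def covD3 (U : Coord → Fin 3 → Fin 3 → Fin 3 → ℝ) (x : Coord) (d c a b : Fin 3) : ℝ :=
  pd d (fun y => U y c a b) x - ∑ e, christoffel x e d c * U x e a b
    - ∑ e, christoffel x e d a * U x c e b - ∑ e, christoffel x e d b * U x c a e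

/-- `D_a D_b Φ`. -/
def hess (Φ : Coord → ℝ) (x : Coord) (a b : Fin 3) : ℝ :=
  covD1 (fun y e => pd e Φ y) x a b

/-- `□ Φ = Dᵃ D_a Φ`. -/
def boxScalar (Φ : Coord → ℝ) (x : Coord) : ℝ :=
  ∑ a, ∑ b, metricInv x a b * hess Φ x a b

/-- `T_aᵃ`. -/
def trace (T : Coord → Fin 3 → Fin 3 → ℝ) (x : Coord) : ℝ :=
  ∑ a, ∑ b, metricInv x a b * T x a b

/-- `Dᵇ T_ab`. -/
def divergence (T : Coord → Fin 3 → Fin 3 → ℝ) (x : Coord) (a : Fin 3) : ℝ :=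
  ∑ b, ∑ c, metricInv x b c * covD2 T x c a b

/-- `□ T_ab`. -/
def boxTensor (T : Coord → Fin 3 → Fin 3 → ℝ) (x : Coord) (a b : Fin 3) : ℝ :=
  ∑ c, ∑ d, metricInv x c d * covD3 (covD2 T) x c d a b

/-- The totally antisymmetric symbol with value `1` at `(0, 1, 2)`. -/
def levi (a b c : Fin 3) : ℝ :=
  (((b : ℕ) : ℝ) - ((a : ℕ) : ℝ)) * (((c : ℕ) : ℝ) - ((b : ℕ) : ℝ))
    * (((c : ℕ) : ℝ) - ((a : ℕ) : ℝ)) / 2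

/-- The volume form `ε_abc`. -/
def volumeForm (x : Coord) (a b c : Fin 3) : ℝ :=
  Real.sqrt |(metric x).det| * levi a b c

/-- `(curl T)_ab = ε_aᶜᵈ D_c T_db`. -/
def curl (T : Coord → Fin 3 → Fin 3 → ℝ) (x : Coord) (a b : Fin 3) : ℝ :=
  ∑ c, ∑ d, ∑ c', ∑ d', volumeForm x a c' d' * metricInv x c' c * metricInv x d' d *
    covD2 T x c d b

/-! ### Spherical coordinates and gluing of the patches -/

/-- The chart coordinates of the point with spherical coordinates `y = (τ, θ, φ)`. -/
def sphChart : Patch → Coord → Coord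
  | .north, y => ![y 0, Real.tan (y 1 / 2) * Real.cos (y 2), Real.tan (y 1 / 2) * Real.sin (y 2)]
  | .south, y =>
    ![y 0, (Real.tan (y 1 / 2))⁻¹ * Real.cos (y 2), -((Real.tan (y 1 / 2))⁻¹ * Real.sin (y 2))]

/-- The range `0 < θ < π` of spherical coordinates, which parametrizes the overlap. -/
def InOverlap (y : Coord) : Prop := 0 < y 1 ∧ y 1 < Real.pi

/-- Components in the coordinates `(τ, θ, φ)` of the part of `T` on the patch `p`. -/
def sphComponents (T : TensorField) (p : Patch) (y : Coord) (a b : Fin 3) : ℝ :=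
  ∑ c, ∑ d, pd a (fun z => sphChart p z c) y * pd b (fun z => sphChart p z d) y *
    T p (sphChart p y) c d

theorem pd_radial_mul {f g : ℝ → ℝ} {f' g' : ℝ} {y : Coord} (hf : HasDerivAt f f' (y 1))
    (hg : HasDerivAt g g' (y 2)) (a : Fin 3) :
    pd a (fun z => f (z 1) * g (z 2)) y =
      ![0, f' * g (y 2), f (y 1) * g'] a := by
  have h1 : HasFDerivAt (fun z : Coord => z 1)
      (ContinuousLinearMap.proj (R := ℝ) (φ := fun _ : Fin 3 => ℝ) 1) y := hasFDerivAt_apply 1 y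
  have h2 : HasFDerivAt (fun z : Coord => z 2)
      (ContinuousLinearMap.proj (R := ℝ) (φ := fun _ : Fin 3 => ℝ) 2) y := hasFDerivAt_apply 2 y
  have h := (hf.comp_hasFDerivAt y h1).mul (hg.comp_hasFDerivAt y h2)
  have h' : fderiv ℝ (fun z : Coord => f (z 1) * g (z 2)) y = _ := h.fderiv
  unfold pd
  rw [h']
  fin_cases a <;> (simp; try ring)

theorem pd_time (a : Fin 3) (y : Coord) : pd a (fun z => z 0) y = ![1, 0, 0] a := by
  have h1 : HasFDerivAt (fun z : Coord => z 0)
      (ContinuousLinearMap.proj (R := ℝ) (φ := fun _ : Fin 3 => ℝ) 0) y := hasFDerivAt_apply 0 y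
  unfold pd
  rw [h1.fderiv]
  fin_cases a <;> simp

theorem half_angle_ne (y : Coord) (hy : InOverlap y) :
    Real.sin (y 1 / 2) ≠ 0 ∧ Real.cos (y 1 / 2) ≠ 0 := by
  obtain ⟨h0, h1⟩ := hy
  exact ⟨(Real.sin_pos_of_pos_of_lt_pi (by linarith) (by linarith)).ne',
    (Real.cos_pos_of_mem_Ioo ⟨by linarith, by linarith⟩).ne'⟩

/-- In spherical coordinates the metric is `-dτ² + cosh² τ (dθ² + sin² θ dφ²)`. -/
theorem sphComponents_metric (p : Patch) (y : Coord) (hy : InOverlap y) :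
    (Matrix.of (sphComponents (fun _ => metric) p y)) =
      Matrix.diagonal ![-1, Real.cosh (y 0) ^ 2, Real.cosh (y 0) ^ 2 * Real.sin (y 1) ^ 2] := by
  obtain ⟨hs, hc⟩ := half_angle_ne y hy
  have e : Real.sin (y 1) = 2 * Real.sin (y 1 / 2) * Real.cos (y 1 / 2) := by
    rw [← Real.sin_two_mul]; ring_nf
  have dt : HasDerivAt (fun t : ℝ => Real.tan (t / 2)) (1 / Real.cos (y 1 / 2) ^ 2 * (1 / 2))
      (y 1) := HasDerivAt.comp (h := fun t : ℝ => t / 2) (h₂ := Real.tan) (y 1)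
        (Real.hasDerivAt_tan hc) ((hasDerivAt_id' (y 1)).div_const 2)
  have ht : Real.tan (y 1 / 2) ≠ 0 := by
    rw [Real.tan_eq_sin_div_cos]; exact div_ne_zero hs hc
  have dti := dt.fun_inv ht
  have dc := Real.hasDerivAt_cos (y 2)
  have ds := Real.hasDerivAt_sin (y 2)
  have ds' : HasDerivAt (fun t : ℝ => -Real.sin t) (-Real.cos (y 2)) (y 2) := ds.fun_neg
  have q1 := Real.sin_sq_add_cos_sq (y 1 / 2)
  have q2 := Real.sin_sq_add_cos_sq (y 2)
  cases p with
  | north =>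
    have j0 : ∀ a, pd a (fun z => sphChart .north z 0) y = _ := fun a => pd_time a y
    have j1 : ∀ a, pd a (fun z => sphChart .north z 1) y = _ := fun a => pd_radial_mul dt dc a
    have j2 : ∀ a, pd a (fun z => sphChart .north z 2) y = _ := fun a => pd_radial_mul dt ds a
    have hd : 1 + (Real.tan (y 1 / 2) * Real.cos (y 2)) ^ 2 +
        (Real.tan (y 1 / 2) * Real.sin (y 2)) ^ 2 = (Real.cos (y 1 / 2) ^ 2)⁻¹ := by
      rw [Real.tan_eq_sin_div_cos]
      field_simp
      linear_combination q1 + Real.sin (y 1 / 2) ^ 2 * q2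
    have hm : metric (sphChart .north y) = Matrix.diagonal ![-1,
        4 * Real.cosh (y 0) ^ 2 * (Real.cos (y 1 / 2) ^ 2) ^ 2,
        4 * Real.cosh (y 0) ^ 2 * (Real.cos (y 1 / 2) ^ 2) ^ 2] := by
      simp only [metric, sphChart, Matrix.cons_val, hd, div_inv_eq_mul, inv_pow]
    ext a b
    simp only [Matrix.of_apply, sphComponents, Fin.sum_univ_three, j0, j1, j2, hm]
    fin_cases a <;> fin_cases b <;> simp [e, Real.tan_eq_sin_div_cos] <;> field_simp <;>
      first | ring1 | linear_combination 4 * q2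
  | south =>
    have j0 : ∀ a, pd a (fun z => sphChart .south z 0) y = _ := fun a => pd_time a y
    have j1 : ∀ a, pd a (fun z => sphChart .south z 1) y = _ := fun a => pd_radial_mul dti dc a
    have j2 : ∀ a, pd a (fun z => sphChart .south z 2) y = _ := fun a => by
      have := pd_radial_mul dti ds' a
      simp only [mul_neg] at this
      exact this
    have hd : 1 + ((Real.tan (y 1 / 2))⁻¹ * Real.cos (y 2)) ^ 2 +
        ((Real.tan (y 1 / 2))⁻¹ * Real.sin (y 2)) ^ 2 = (Real.sin (y 1 / 2) ^ 2)⁻¹ := by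
      rw [Real.tan_eq_sin_div_cos]
      field_simp
      linear_combination q1 + Real.cos (y 1 / 2) ^ 2 * q2
    have hm : metric (sphChart .south y) = Matrix.diagonal ![-1,
        4 * Real.cosh (y 0) ^ 2 * (Real.sin (y 1 / 2) ^ 2) ^ 2,
        4 * Real.cosh (y 0) ^ 2 * (Real.sin (y 1 / 2) ^ 2) ^ 2] := by
      simp only [metric, sphChart, Matrix.cons_val, even_two.neg_pow, hd, div_inv_eq_mul, inv_pow]
    ext a b
    simp only [Matrix.of_apply, sphComponents, Fin.sum_univ_three, j0, j1, j2, hm]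
    fin_cases a <;> fin_cases b <;> simp [e, Real.tan_eq_sin_div_cos] <;> field_simp <;>
      first | ring1 | linear_combination 4 * q2

/-- Smoothness on each patch. -/
def ScalarField.IsSmooth (Φ : ScalarField) : Prop := ∀ p, ContDiff ℝ (⊤ : ℕ∞) (Φ p)

/-- The two parts of `Φ` agree on the overlap, so that `Φ` is a function on `dS₃`. -/
def ScalarField.IsGlobal (Φ : ScalarField) : Prop :=
  ∀ y, InOverlap y → Φ .north (sphChart .north y) = Φ .south (sphChart .south y)

/-- `Φ` is a smooth function on the whole of `dS₃`. -/
def ScalarField.IsRegular (Φ : ScalarField) : Prop := Φ.IsSmooth ∧ Φ.IsGlobal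

/-- Smoothness on each patch. -/
def TensorField.IsSmooth (T : TensorField) : Prop := ∀ p, ContDiff ℝ (⊤ : ℕ∞) (T p)

/-- The two parts of `T` agree on the overlap, so that `T` is a tensor field on `dS₃`. -/
def TensorField.IsGlobal (T : TensorField) : Prop :=
  ∀ y, InOverlap y → sphComponents T .north y = sphComponents T .south y

/-- `T` is a smooth tensor field on the whole of `dS₃`. -/
def TensorField.IsRegular (T : TensorField) : Prop := T.IsSmooth ∧ T.IsGlobal

/-- `T_ab = T_ba`. -/
def TensorField.IsSymmetric (T : TensorField) : Prop := ∀ p x a b, T p x a b = T p x b a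

/-- `T_aᵃ = 0`. -/
def TensorField.IsTraceless (T : TensorField) : Prop := ∀ p x, trace (T p) x = 0

/-- `Dᵇ T_ab = 0`. -/
def TensorField.IsDivFree (T : TensorField) : Prop := ∀ p x a, divergence (T p) x a = 0

/-- `curl T = 0`. -/
def TensorField.IsCurlFree (T : TensorField) : Prop := ∀ p x a b, curl (T p) x a b = 0

/-- `(□ - 3) T_ab = 0`. -/
def TensorField.BoxMinusThree (T : TensorField) : Prop :=
  ∀ p x a b, boxTensor (T p) x a b - 3 * T p x a b = 0

/-- `□ Φ + 3 Φ = 0`. -/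
def ScalarField.BoxPlusThree (Φ : ScalarField) : Prop :=
  ∀ p x, boxScalar (Φ p) x + 3 * Φ p x = 0

/-- `D_a D_b Φ + h⁽⁰⁾_ab Φ`. -/
def hessPlus (Φ : ScalarField) : TensorField :=
  fun p x a b => hess (Φ p) x a b + metric x a b * Φ p x

/-! ### First-order fields -/

/-- `k_ab = h⁽¹⁾_ab + 2 σ h⁽⁰⁾_ab`. -/
def tensorPotential (σ : ScalarField) (h1 : TensorField) : TensorField :=
  fun p x a b => h1 p x a b + 2 * σ p x * metric x a b

/-- First-order electric part of the Weyl tensor, `E_ab = -D_a D_b σ - h⁽⁰⁾_ab σ`. -/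
def electric (σ : ScalarField) : TensorField :=
  fun p x a b => -hess (σ p) x a b - metric x a b * σ p x

/-- First-order magnetic part of the Weyl tensor, `B_ab = ½ ε_aᶜᵈ D_c k_db`. -/
def magnetic (k : TensorField) : TensorField :=
  fun p x a b => (1 / 2) * curl (k p) x a b

/-- First-order data `(σ, h⁽¹⁾)`: `σ` is smooth on `dS₃`, `h⁽¹⁾` is symmetric and smooth on each
patch and may jump between the patches, but the magnetic curvature may not. -/
structure IsConfiguration (σ : ScalarField) (h1 : TensorField) : Prop where
  regular_mass_aspect : σ.IsRegular
  smooth : h1.IsSmooth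
  symmetric : h1.IsSymmetric
  curvature_global : (magnetic (tensorPotential σ h1)).IsGlobal

/-- The first-order vacuum Einstein equations. -/
structure OnShell (σ : ScalarField) (k : TensorField) : Prop where
  eq_scalar : ∀ p x, boxScalar (σ p) x + 3 * σ p x = 0
  eq_vector : ∀ p x a, divergence (k p) x a - pd a (trace (k p)) x = 0
  eq_tensor : ∀ p x a b,
    (boxTensor (k p) x a b - 3 * k p x a b) + trace (k p) x * metric x a b
      - hess (trace (k p)) x a b = 0

/-! ### The lowest harmonics -/

/-- The point `(cos θ, sin θ cos φ, sin θ sin φ)` of the unit sphere, in chart coordinates. -/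
def dir : Patch → Coord → Fin 3 → ℝ
  | .north, x => ![(1 - x 1 ^ 2 - x 2 ^ 2) / (1 + x 1 ^ 2 + x 2 ^ 2),
      2 * x 1 / (1 + x 1 ^ 2 + x 2 ^ 2), 2 * x 2 / (1 + x 1 ^ 2 + x 2 ^ 2)]
  | .south, x => ![-((1 - x 1 ^ 2 - x 2 ^ 2) / (1 + x 1 ^ 2 + x 2 ^ 2)),
      2 * x 1 / (1 + x 1 ^ 2 + x 2 ^ 2), -(2 * x 2 / (1 + x 1 ^ 2 + x 2 ^ 2))]

/-- `1, cos θ, sin θ cos φ, sin θ sin φ` as functions of `(τ, θ, φ)`. -/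
def sphHarmonic (y : Coord) : Fin 4 → ℝ :=
  ![1, Real.cos (y 1), Real.sin (y 1) * Real.cos (y 2), Real.sin (y 1) * Real.sin (y 2)]

theorem dir_sphChart (p : Patch) (y : Coord) (hy : InOverlap y) (i : Fin 3) :
    dir p (sphChart p y) i = sphHarmonic y i.succ := by
  obtain ⟨hs, hc⟩ := half_angle_ne y hy
  have e : Real.sin (y 1) = 2 * Real.sin (y 1 / 2) * Real.cos (y 1 / 2) := by
    rw [← Real.sin_two_mul]; ring_nf
  have e' : Real.cos (y 1) = Real.cos (y 1 / 2) ^ 2 - Real.sin (y 1 / 2) ^ 2 := by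
    rw [← Real.cos_two_mul']; ring_nf
  have q1 := Real.sin_sq_add_cos_sq (y 1 / 2)
  have q2 := Real.sin_sq_add_cos_sq (y 2)
  have hn : 1 + (Real.tan (y 1 / 2) * Real.cos (y 2)) ^ 2 +
      (Real.tan (y 1 / 2) * Real.sin (y 2)) ^ 2 = (Real.cos (y 1 / 2) ^ 2)⁻¹ := by
    rw [Real.tan_eq_sin_div_cos]
    field_simp
    linear_combination q1 + Real.sin (y 1 / 2) ^ 2 * q2
  have hd : 1 + ((Real.tan (y 1 / 2))⁻¹ * Real.cos (y 2)) ^ 2 +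
      ((Real.tan (y 1 / 2))⁻¹ * Real.sin (y 2)) ^ 2 = (Real.sin (y 1 / 2) ^ 2)⁻¹ := by
    rw [Real.tan_eq_sin_div_cos]
    field_simp
    linear_combination q1 + Real.cos (y 1 / 2) ^ 2 * q2
  cases p <;> fin_cases i
  all_goals
    simp only [dir, sphChart, sphHarmonic, Matrix.cons_val, Fin.reduceFinMk,
      even_two.neg_pow, hn, hd, sub_sub]
    rw [Real.tan_eq_sin_div_cos]
    simp [e, e']
    field_simp
  · linear_combination (-Real.sin (y 1 / 2) ^ 2) * q2
  · linear_combination Real.cos (y 1 / 2) ^ 2 * q2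

/-- `ζ₀ = sinh τ`, `ζ₁ = cosh τ cos θ`, `ζ₂ = cosh τ sin θ cos φ`, `ζ₃ = cosh τ sin θ sin φ`. -/
def zeta (μ : Fin 4) : ScalarField := fun p x =>
  ![Real.sinh (x 0), Real.cosh (x 0) * dir p x 0, Real.cosh (x 0) * dir p x 1,
    Real.cosh (x 0) * dir p x 2] μ

/-- `ζ̂₀ = cosh 2τ / cosh τ`, and `ζ̂ᵢ = (2 sinh τ + tanh τ / cosh τ) nᵢ` with
`n = (cos θ, sin θ cos φ, sin θ sin φ)`. -/
def zetaHat (μ : Fin 4) : ScalarField := fun p x =>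
  ![Real.cosh (2 * x 0) / Real.cosh (x 0),
    (2 * Real.sinh (x 0) + Real.tanh (x 0) / Real.cosh (x 0)) * dir p x 0,
    (2 * Real.sinh (x 0) + Real.tanh (x 0) / Real.cosh (x 0)) * dir p x 1,
    (2 * Real.sinh (x 0) + Real.tanh (x 0) / Real.cosh (x 0)) * dir p x 2] μ

/-- `Φ - ∑ (α_μ ζ_μ + α̂_μ ζ̂_μ)` contains only spherical harmonics with `l ≥ 2`: on each sphere
`τ = const` it is orthogonal to those with `l ≤ 1`. -/
def HasLowestHarmonics (Φ : ScalarField) (α αHat : Fin 4 → ℝ) : Prop :=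
  ∀ (τ : ℝ) (ν : Fin 4),
    ∫ θ in (0 : ℝ)..Real.pi, ∫ φ in (0 : ℝ)..(2 * Real.pi),
      (Φ - ∑ μ, (α μ • zeta μ + αHat μ • zetaHat μ)) .north (sphChart .north ![τ, θ, φ])
        * sphHarmonic ![τ, θ, φ] ν * Real.sin θ = 0

/-- `ω` is a combination of the `ζ_μ`, that is, a translation. -/
def IsTranslation (ω : ScalarField) : Prop := ∃ c : Fin 4 → ℝ, ω = ∑ μ, c μ • zeta μ

/-! ### Singular representatives of the tensor potential -/

/-- The symmetric array with the given entries on and above the diagonal. -/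
def symArray (m00 m01 m02 m11 m12 m22 : ℝ) : Fin 3 → Fin 3 → ℝ :=
  ![![m00, m01, m02], ![m01, m11, m12], ![m02, m12, m22]]

/-- Components in `(τ, θ, φ)` of the singular representatives `k_(μ)ab`; `c = 1` gives the
representative that is regular in the north, `c = -1` the one that is regular in the south. -/
def singularComponents (c : ℝ) (μ : Fin 4) (y : Coord) : Fin 3 → Fin 3 → ℝ :=
  let τ := y 0
  let θ := y 1
  let φ := y 2
  let A := 3 * (Real.tanh τ / Real.cosh τ)
  let w := 8 * c - 9 * Real.cos θ + Real.cos (3 * θ)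
  let q := Real.cos θ ^ 4 - 4 * c * Real.cos θ + 3
  ![symArray 0 0 (2 * ((c - Real.cos θ) / Real.cosh τ))
      0 (Real.sinh τ * ((Real.cos (2 * θ) - 4 * c * Real.cos θ + 3) / (2 * Real.sin θ)))
      0,
    symArray 0 0 (-A * Real.sin θ ^ 2)
      0 (-w / (4 * Real.sin θ) * Real.cosh τ)
      0,
    symArray 0 (A * Real.sin φ) (A * Real.cos θ * Real.sin θ * Real.cos φ)
      (w / (2 * Real.sin θ ^ 3) * Real.cosh τ * Real.sin φ)
      (q / Real.sin θ ^ 2 * Real.cosh τ * Real.cos φ)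
      (-w / (2 * Real.sin θ) * Real.cosh τ * Real.sin φ),
    symArray 0 (-A * Real.cos φ) (A * Real.cos θ * Real.sin θ * Real.sin φ)
      (-w / (2 * Real.sin θ ^ 3) * Real.cosh τ * Real.cos φ)
      (q / Real.sin θ ^ 2 * Real.cosh τ * Real.sin φ)
      (w / (2 * Real.sin θ) * Real.cosh τ * Real.cos φ)] μ

/-- Components in `(τ, θ, φ)` of the transition functions `δk_(μ)ab`. -/
def deltaK (μ : Fin 4) (y : Coord) : Fin 3 → Fin 3 → ℝ :=
  let τ := y 0
  let θ := y 1
  let φ := y 2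
  ![symArray 0 0 (-(4 / Real.cosh τ)) 0 (4 * (Real.cos θ / Real.sin θ) * Real.sinh τ) 0,
    symArray 0 0 0 0 (4 * (Real.cosh τ / Real.sin θ)) 0,
    symArray 0 0 0
      (-(8 / Real.sin θ ^ 3) * Real.cosh τ * Real.sin φ)
      (8 * Real.cos θ / Real.sin θ ^ 2 * Real.cosh τ * Real.cos φ)
      (8 / Real.sin θ * Real.cosh τ * Real.sin φ),
    symArray 0 0 0
      (8 / Real.sin θ ^ 3 * Real.cosh τ * Real.cos φ)
      (8 * Real.cos θ / Real.sin θ ^ 2 * Real.cosh τ * Real.sin φ)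
      (-(8 / Real.sin θ) * Real.cosh τ * Real.cos φ)] μ

/-- `κ` is the two-patch tensor `k_(μ)`: smooth on each patch, with the components of `k_(μ)` for
`c = 1` in the north and for `c = -1` in the south. -/
structure IsSingularRepresentative (μ : Fin 4) (κ : TensorField) : Prop where
  smooth : κ.IsSmooth
  north : ∀ y, InOverlap y → sphComponents κ .north y = singularComponents 1 μ y
  south : ∀ y, InOverlap y → sphComponents κ .south y = singularComponents (-1) μ y

/-- The transition function from north to south is `∑ N_μ δk_μ`. -/
def HasNUTTransition (T : TensorField) (N : Fin 4 → ℝ) : Prop :=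
  ∀ y, InOverlap y →
    sphComponents T .south y - sphComponents T .north y = ∑ μ, N μ • deltaK μ y

/-- Smooth tensor fields on `dS₃` that are symmetric, traceless and curl-free. -/
structure IsWeylType (T : TensorField) : Prop where
  regular : T.IsRegular
  symmetric : T.IsSymmetric
  traceless : T.IsTraceless
  curlFree : T.IsCurlFree

/-- `C` selects, for each `T` as in `IsWeylType`, one tensor potential of `T`. It is smooth on the
patches, has a transition function `∑ N_μ δk_μ`, and is symmetric, traceless and
divergence-free. -/
structure IsCurlInverse (C : TensorField → TensorField) : Prop where
  smooth : ∀ T, IsWeylType T → (C T).IsSmooth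
  transition : ∀ T, IsWeylType T → ∃ N, HasNUTTransition (C T) N
  symmetric : ∀ T, IsWeylType T → (C T).IsSymmetric
  traceless : ∀ T, IsWeylType T → (C T).IsTraceless
  divFree : ∀ T, IsWeylType T → (C T).IsDivFree
  magnetic_eq : ∀ T, IsWeylType T → magnetic (C T) = T

end DeSitter

end

noncomputable section

namespace DeSitter

open MeasureTheory Set Filter Topology

/-! ### Integrals depending on parameters -/

/-! The functions ζ_μ are the coordinates X_μ of the embedding of dS₃ as the hyperboloid X·X = 1 in
Minkowski space, and with their help tensor equations become equations for four differential forms.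
A symmetric tensor T is replaced by the one-forms T_ab E^{bμ} (`formOf`), where E^μ is the raised
gradient of X^μ. Then T is curl-free iff the four forms are closed (`closed_formOf_iff`), and for T
= SΦ they are the differentials of F^μ (`ambGrad`), the ambient gradient of the extension of Φ of
degree one (`pd_ambGrad`). The Poincaré lemma on each chart, followed by an adjustment of four
constants on the connected overlap, gives scalar potentials on dS₃ (`exists_hessPlus_eq`). The
kernel of S consists of the Φ with constant F^μ, which are the translations (`hessPlus_eq_iff`).

For the field equations, the antisymmetric part of curl k is dual to the vector equation
(`curl_symm_iff`), and curl curl k = (□ - 3) k + (tr k) h - D div k (`curl_curl`) becomes the tensor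
equation once the vector equation holds. This is `onShell_iff`.

The moments of a solution of □Φ + 3Φ = 0 with the harmonics l ≤ 1 satisfy second-order ordinary
differential equations in τ, for which the radial factors of ζ and ζ̂ are fundamental systems. This
yields the coefficients α, α̂ (`existsUnique_lowestHarmonics`).

To solve curl K = SΦ, one looks for one-forms A^μ with dA^μ = *dF^μ. Each F^μ is harmonic, so *dF^μ
is closed on ℝ × S², and it is exact if its flux through the sphere vanishes. The flux is built from
the l ≤ 1 moments of Φ (`moment_ambGrad`), so after subtraction of the lowest harmonics there is no
obstruction (`exists_conjugate_form`). Removing the normal component of A by exact forms makes K = ∑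
A^μ ⊗ dX_μ symmetric (`exists_symmetric_potential`). Adding SΨ with □Ψ + 3Ψ = -tr K makes it
traceless; Ψ comes from Kirchhoff's retarded potential in the flat ambient space, applied to a
source of degree -1 (`exists_box_eq`). Of the subtracted harmonics, ζ contributes nothing to SΦ, and
ζ̂ is provided for by the explicit tensors k_(μ) (`magnetic_two_sing`).

The singular terms cannot be removed: if ∑ M_μ k_μ + Sω has no jump, integrating the jump of the
ambient gradient of ω once around the equator gives M = 0 (`eq_zero_of_isGlobal`). Hence the NUT
charges of every potential of SΦ are 2α̂ (`nut_of_potential`). Two potentials with the same curl and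
the same transition function differ by Sω with ω regular (`magnetic_eq_iff`), and ω is unique up to
translations. Both ways of fixing the supertranslations follow from these facts. -/

theorem fderiv_partial_left {E F : Type} [NormedAddCommGroup E] [NormedSpace ℝ E]
    [NormedAddCommGroup F] [NormedSpace ℝ F] {f : E → ℝ → F} (hf : ContDiff ℝ 1 (Function.uncurry f)) (x : E)
    (s : ℝ) : HasFDerivAt (fun x => f x s)
      ((fderiv ℝ (Function.uncurry f) (x, s)).comp (ContinuousLinearMap.inl ℝ E ℝ)) x := by
  have h1 : HasFDerivAt (Function.uncurry f) (fderiv ℝ (Function.uncurry f) (x, s)) (x, s) :=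
    (hf.differentiable one_ne_zero _).hasFDerivAt
  have h2 : HasFDerivAt (fun x : E => (x, s)) (ContinuousLinearMap.inl ℝ E ℝ) x :=
    hasFDerivAt_prodMk_left x s
  exact h1.comp x h2

/-- The derivative of the integrand is jointly continuous, hence bounded on the compact product of a
closed unit ball and the interval of integration. This constant is the dominating function. -/
theorem hasFDerivAt_intervalIntegral {E F : Type} [NormedAddCommGroup E] [NormedSpace ℝ E]
    [ProperSpace E] [NormedAddCommGroup F] [NormedSpace ℝ F] {f : E → ℝ → F} (hf : ContDiff ℝ 1 (Function.uncurry f))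
    (a b : ℝ) (x₀ : E) :
    HasFDerivAt (fun x => ∫ s in a..b, f x s) (∫ s in a..b, fderiv ℝ (fun x => f x s) x₀) x₀ := by
  have hc : Continuous fun q : E × ℝ => fderiv ℝ (fun x => f x q.2) q.1 := by
    have : (fun q : E × ℝ => fderiv ℝ (fun x => f x q.2) q.1) = fun q =>
        (fderiv ℝ (Function.uncurry f) q).comp (ContinuousLinearMap.inl ℝ E ℝ) := by
      funext q
      exact (fderiv_partial_left hf q.1 q.2).fderiv
    rw [this]
    exact (hf.continuous_fderiv one_ne_zero).clm_comp continuous_const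
  obtain ⟨C, hC⟩ := ((isCompact_closedBall x₀ 1).prod
    (isCompact_uIcc (a := a) (b := b))).exists_bound_of_continuousOn hc.continuousOn
  have hsec : ∀ x, Continuous (f x) := fun x => 
    hf.continuous.comp (by fun_prop : Continuous fun s : ℝ => (x, s))
  refine intervalIntegral.hasFDerivAt_integral_of_dominated_of_fderiv_le
    (F' := fun x s => fderiv ℝ (fun x => f x s) x) (bound := fun _ => C)
    (Metric.closedBall_mem_nhds x₀ one_pos) ?_ ?_ ?_ ?_ ?_ ?_
  · exact Eventually.of_forall fun x => (hsec x).aestronglyMeasurable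
  · exact (hsec x₀).intervalIntegrable a b
  · have : Continuous fun s : ℝ => fderiv ℝ (fun x => f x s) x₀ :=
      hc.comp (by fun_prop : Continuous fun s : ℝ => (x₀, s))
    exact this.aestronglyMeasurable
  · exact Eventually.of_forall fun s hs x hx => hC (x, s) ⟨hx, uIoc_subset_uIcc hs⟩
  · exact intervalIntegrable_const
  · exact Eventually.of_forall fun s _ x _ =>
      (fderiv_partial_left hf x s).differentiableAt.hasFDerivAt

/-- Induction on the order. The spaces are quantified inside, because the induction step is applied
to the derivative, which takes values in `E →L[ℝ] F`. One order of differentiability is given away,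
which costs nothing for smooth integrands. -/
theorem contDiff_nat_intervalIntegral (n : ℕ) : ∀ {E F : Type} [NormedAddCommGroup E]
    [NormedSpace ℝ E] [ProperSpace E] [NormedAddCommGroup F] [NormedSpace ℝ F] [CompleteSpace F]
    {f : E → ℝ → F}, ContDiff ℝ (n + 1 : ℕ) (Function.uncurry f) → ∀ a b : ℝ,
    ContDiff ℝ n (fun x => ∫ s in a..b, f x s) := by
  induction n with
  | zero =>
    intro E F _ _ _ _ _ _ f hf a b
    rw [Nat.cast_zero, contDiff_zero]
    exact Differentiable.continuous fun x =>
      (hasFDerivAt_intervalIntegral (by simpa using hf) a b x).differentiableAt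
  | succ n ih =>
    intro E F _ _ _ _ _ _ f hf a b
    have h1 : ContDiff ℝ 1 (Function.uncurry f) := hf.of_le (by norm_cast; omega)
    rw [Nat.cast_succ, contDiff_succ_iff_fderiv]
    refine ⟨fun x => (hasFDerivAt_intervalIntegral h1 a b x).differentiableAt, by simp, ?_⟩
    have e : fderiv ℝ (fun x => ∫ s in a..b, f x s) =
        fun x => ∫ s in a..b, fderiv ℝ (fun x => f x s) x :=
      funext fun x => (hasFDerivAt_intervalIntegral h1 a b x).fderiv
    rw [e]
    refine ih (f := fun x s => fderiv ℝ (fun x => f x s) x) ?_ a b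
    have e' : (Function.uncurry fun x s => fderiv ℝ (fun x => f x s) x) = fun q : E × ℝ =>
        (fderiv ℝ (Function.uncurry f) q).comp (ContinuousLinearMap.inl ℝ E ℝ) := by
      funext q
      exact (fderiv_partial_left h1 q.1 q.2).fderiv
    rw [e']
    have := hf.fderiv_right (m := (n + 1 : ℕ)) (by norm_cast)
    exact this.clm_comp contDiff_const

/-- Infinitely differentiable. -/
abbrev Smooth {E F : Type} [NormedAddCommGroup E] [NormedSpace ℝ E] [NormedAddCommGroup F]
    [NormedSpace ℝ F] (f : E → F) : Prop := ContDiff ℝ (⊤ : ℕ∞) f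

section Parametric

variable {E F : Type} [NormedAddCommGroup E] [NormedSpace ℝ E] [ProperSpace E]
  [NormedAddCommGroup F] [NormedSpace ℝ F] [CompleteSpace F]

theorem smooth_intervalIntegral {f : E → ℝ → F} (hf : Smooth (Function.uncurry f)) (a b : ℝ) :
    Smooth (fun x => ∫ s in a..b, f x s) :=
  contDiff_infty.2 fun n =>
    contDiff_nat_intervalIntegral n (hf.of_le (by exact_mod_cast le_top)) a b

theorem fderiv_intervalIntegral_apply {f : E → ℝ → F} (hf : Smooth (Function.uncurry f))
    (a b : ℝ) (x v : E) :
    fderiv ℝ (fun x => ∫ s in a..b, f x s) x v = ∫ s in a..b, fderiv ℝ (fun x => f x s) x v := by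
  have h1 : ContDiff ℝ 1 (Function.uncurry f) := hf.of_le (by exact_mod_cast le_top)
  rw [(hasFDerivAt_intervalIntegral h1 a b x).fderiv]
  rw [← ContinuousLinearMap.intervalIntegral_apply]
  have e : (fun s => fderiv ℝ (fun x => f x s) x) = fun s =>
        (fderiv ℝ (Function.uncurry f) (x, s)).comp (ContinuousLinearMap.inl ℝ E ℝ) :=
    funext fun s => (fderiv_partial_left h1 x s).fderiv
  rw [e]
  refine Continuous.intervalIntegrable ?_ a b
  exact ((h1.continuous_fderiv one_ne_zero).comp (by fun_prop)).clm_comp continuous_const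

end Parametric

/-! ### Partial derivatives on coordinate space -/

variable {f g : Coord → ℝ} {x : Coord}

theorem Smooth.diff {E F : Type} [NormedAddCommGroup E] [NormedSpace ℝ E] [NormedAddCommGroup F]
    [NormedSpace ℝ F] {f : E → F} (hf : Smooth f) : Differentiable ℝ f :=
  ContDiff.differentiable hf (by simp)

theorem pd_add (a : Fin 3) (hf : DifferentiableAt ℝ f x) (hg : DifferentiableAt ℝ g x) :
    pd a (fun y => f y + g y) x = pd a f x + pd a g x := by
  simp [pd, fderiv_fun_add hf hg]

theorem pd_sub (a : Fin 3) (hf : DifferentiableAt ℝ f x) (hg : DifferentiableAt ℝ g x) :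
    pd a (fun y => f y - g y) x = pd a f x - pd a g x := by
  simp [pd, fderiv_fun_sub hf hg]

theorem pd_neg (a : Fin 3) (f : Coord → ℝ) (x : Coord) :
    pd a (fun y => -f y) x = -pd a f x := by
  simp [pd, fderiv_fun_neg]

theorem pd_mul (a : Fin 3) (hf : DifferentiableAt ℝ f x) (hg : DifferentiableAt ℝ g x) :
    pd a (fun y => f y * g y) x = pd a f x * g x + f x * pd a g x := by
  simp [pd, fderiv_fun_mul hf hg]; ring

theorem pd_const (a : Fin 3) (c : ℝ) (x : Coord) : pd a (fun _ => c) x = 0 := by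
  simp [pd]

theorem pd_const_mul (a : Fin 3) (c : ℝ) (hf : DifferentiableAt ℝ f x) :
    pd a (fun y => c * f y) x = c * pd a f x := by
  rw [pd_mul a (differentiableAt_const c) hf, pd_const]; ring

theorem pd_sum {ι : Type} (s : Finset ι) (F : ι → Coord → ℝ) (a : Fin 3)
    (hF : ∀ i ∈ s, DifferentiableAt ℝ (F i) x) :
    pd a (fun y => ∑ i ∈ s, F i y) x = ∑ i ∈ s, pd a (F i) x := by
  unfold pd
  rw [fderiv_fun_sum hF]
  simp

theorem pd_coord (a b : Fin 3) (x : Coord) : pd a (fun y => y b) x = if a = b then 1 else 0 := by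
  have : HasFDerivAt (fun z : Coord => z b)
      (ContinuousLinearMap.proj (R := ℝ) (φ := fun _ : Fin 3 => ℝ) b) x := hasFDerivAt_apply b x
  unfold pd
  rw [this.fderiv]
  simp [Pi.single_apply, eq_comm]

theorem smooth_pd (a : Fin 3) (hf : Smooth f) : Smooth (pd a f) := by
  have := ContDiff.fderiv_right (m := (⊤ : ℕ∞)) hf (by simp)
  exact this.clm_apply contDiff_const

theorem pd_comm (a b : Fin 3) (hf : Smooth f) (x : Coord) :
    pd a (pd b f) x = pd b (pd a f) x := by
  have h2 : ContDiff ℝ 2 f := contDiff_infty.1 hf 2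
  have hd : DifferentiableAt ℝ (fderiv ℝ f) x :=
    (h2.fderiv_right (m := 1) (by norm_num)).differentiable one_ne_zero x
  have key : ∀ c d : Fin 3, pd c (pd d f) x =
      fderiv ℝ (fderiv ℝ f) x (Pi.single c 1) (Pi.single d 1) := by
    intro c d
    change fderiv ℝ (fun y => fderiv ℝ f y (Pi.single d 1)) x (Pi.single c 1) = _
    rw [fderiv_clm_apply hd (differentiableAt_const _)]
    simp
  rw [key, key]
  exact (h2.contDiffAt.isSymmSndFDerivAt (by simp)) _ _

theorem fderiv_eq_sum_pd (f : Coord → ℝ) (x v : Coord) :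
    fderiv ℝ f x v = ∑ a, v a * pd a f x := by
  have : v = ∑ a, v a • (Pi.single a 1 : Coord) := by
    ext i
    simp [Finset.sum_apply, Pi.single_apply]
  conv_lhs => rw [this]
  simp [pd, map_sum]

theorem pd_congr {a : Fin 3} (h : f =ᶠ[𝓝 x] g) : pd a f x = pd a g x := by
  simp only [pd, h.fderiv_eq]

theorem pd_intervalIntegral {F : Coord → ℝ → ℝ} (hF : Smooth (Function.uncurry F)) (u v : ℝ)
    (a : Fin 3) (x : Coord) :
    pd a (fun y => ∫ s in u..v, F y s) x = ∫ s in u..v, pd a (fun y => F y s) x :=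
  fderiv_intervalIntegral_apply hF u v x _

/-- One-variable chain rule. -/
theorem pd_comp {h : ℝ → ℝ} {h' : ℝ} (a : Fin 3) (hh : HasDerivAt h h' (f x))
    (hf : DifferentiableAt ℝ f x) : pd a (fun y => h (f y)) x = h' * pd a f x := by
  have := hh.comp_hasFDerivAt x hf.hasFDerivAt
  unfold pd
  rw [show (fun y => h (f y)) = h ∘ f from rfl, this.fderiv]
  simp

theorem eq_of_pd_eq_zero (hf : Differentiable ℝ f) (h : ∀ a x, pd a f x = 0) (x y : Coord) :
    f x = f y := by
  refine is_const_of_fderiv_eq_zero hf (fun z => ?_) x y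
  ext v
  simp [fderiv_eq_sum_pd, h]

/-! ### The Levi-Civita connection in the charts -/

/-- `2 / (1 + x² + y²)`. -/
def lam (x : Coord) : ℝ := 2 / (1 + x 1 ^ 2 + x 2 ^ 2)

/-- The conformal factor of the spatial part of the metric. -/
def conf (x : Coord) : ℝ := lam x ^ 2 * Real.cosh (x 0) ^ 2

/-- Half the logarithmic derivatives of the conformal factor. -/
def logD (a : Fin 3) (x : Coord) : ℝ := ![Real.tanh (x 0), -(lam x * x 1), -(lam x * x 2)] a

theorem lam_den_pos (x : Coord) : 0 < 1 + x 1 ^ 2 + x 2 ^ 2 := by positivity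

theorem lam_pos (x : Coord) : 0 < lam x := div_pos two_pos (lam_den_pos x)

theorem conf_pos (x : Coord) : 0 < conf x :=
  mul_pos (pow_pos (lam_pos x) 2) (pow_pos (Real.cosh_pos _) 2)

theorem conf_ne (x : Coord) : conf x ≠ 0 := (conf_pos x).ne'

theorem lam_rel (x : Coord) : (lam x * x 1) ^ 2 + (lam x * x 2) ^ 2 = 2 * lam x - lam x ^ 2 := by
  have := (lam_den_pos x).ne'
  unfold lam
  field_simp
  ring

theorem smooth_coord (i : Fin 3) : Smooth (fun x : Coord => x i) := contDiff_apply ℝ ℝ i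

theorem smooth_lam : Smooth lam := by
  unfold lam
  exact contDiff_const.div ((contDiff_const.add ((smooth_coord 1).pow 2)).add
    ((smooth_coord 2).pow 2)) fun x => (lam_den_pos x).ne'

theorem smooth_cosh0 : Smooth (fun x : Coord => Real.cosh (x 0)) :=
  Real.contDiff_cosh.comp (smooth_coord 0)

theorem smooth_sinh0 : Smooth (fun x : Coord => Real.sinh (x 0)) :=
  Real.contDiff_sinh.comp (smooth_coord 0)

theorem smooth_tanh0 : Smooth (fun x : Coord => Real.tanh (x 0)) := by
  have : (fun x : Coord => Real.tanh (x 0)) = fun x => Real.sinh (x 0) / Real.cosh (x 0) :=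
    funext fun x => Real.tanh_eq_sinh_div_cosh _
  rw [this]
  exact smooth_sinh0.div smooth_cosh0 fun x => (Real.cosh_pos _).ne'

theorem smooth_conf : Smooth conf := (smooth_lam.pow 2).mul (smooth_cosh0.pow 2)

theorem smooth_confInv : Smooth (fun x => (conf x)⁻¹) := smooth_conf.inv conf_ne

theorem smooth_logD (a : Fin 3) : Smooth (logD a) := by
  fin_cases a
  · exact smooth_tanh0
  · exact (smooth_lam.mul (smooth_coord 1)).neg
  · exact (smooth_lam.mul (smooth_coord 2)).neg

theorem pd_lam (a : Fin 3) (x : Coord) :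
    pd a lam x = ![0, logD 1 x * lam x, logD 2 x * lam x] a := by
  have hd := (lam_den_pos x).ne'
  have h : HasDerivAt (fun s : ℝ => 2 / s) (-(2 / (1 + x 1 ^ 2 + x 2 ^ 2) ^ 2))
      (1 + x 1 ^ 2 + x 2 ^ 2) := by
    have := (hasDerivAt_inv hd).const_mul 2
    simp only [← div_eq_mul_inv] at this
    refine this.congr_deriv ?_
    ring
  have h1 := smooth_coord 1
  have h2 := smooth_coord 2
  have e : pd a (fun x : Coord => 1 + x 1 ^ 2 + x 2 ^ 2) x =
      2 * x 1 * (if a = 1 then 1 else 0) + 2 * x 2 * (if a = 2 then 1 else 0) := by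
    have : (fun x : Coord => 1 + x 1 ^ 2 + x 2 ^ 2) = fun x => 1 + x 1 * x 1 + x 2 * x 2 := by
      funext x; ring
    rw [this, pd_add a (by fun_prop) (by fun_prop), pd_add a (by fun_prop) (by fun_prop), pd_const,
      pd_mul a (by fun_prop) (by fun_prop), pd_mul a (by fun_prop) (by fun_prop), pd_coord,
      pd_coord]
    ring
  have := pd_comp (f := fun x : Coord => 1 + x 1 ^ 2 + x 2 ^ 2) (x := x) a h (by fun_prop)
  change pd a (fun y => 2 / (1 + y 1 ^ 2 + y 2 ^ 2)) x = _
  rw [this, e]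
  fin_cases a <;> simp [logD, lam] <;> field_simp

theorem pd_cosh0 (a : Fin 3) (x : Coord) :
    pd a (fun y => Real.cosh (y 0)) x = ![Real.sinh (x 0), 0, 0] a := by
  rw [pd_comp (f := fun y : Coord => y 0) a (Real.hasDerivAt_cosh (x 0)) (by fun_prop), pd_coord]
  fin_cases a <;> simp

theorem pd_sinh0 (a : Fin 3) (x : Coord) :
    pd a (fun y => Real.sinh (y 0)) x = ![Real.cosh (x 0), 0, 0] a := by
  rw [pd_comp (f := fun y : Coord => y 0) a (Real.hasDerivAt_sinh (x 0)) (by fun_prop), pd_coord]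
  fin_cases a <;> simp

theorem pd_conf (a : Fin 3) (x : Coord) : pd a conf x = 2 * logD a x * conf x := by
  have hl := smooth_lam.diff
  have hc := smooth_cosh0.diff
  have e : conf = fun x => (lam x * lam x) * (Real.cosh (x 0) * Real.cosh (x 0)) := by
    funext x; unfold conf; ring
  rw [e, pd_mul a ((hl x).fun_mul (hl x)) ((hc x).fun_mul (hc x)), pd_mul a (hl x) (hl x),
    pd_mul a (hc x) (hc x), pd_lam, pd_cosh0]
  have := (Real.cosh_pos (x 0)).ne'
  fin_cases a <;> simp [logD, Real.tanh_eq_sinh_div_cosh] <;> field_simp <;> ring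

theorem pd_confInv (a : Fin 3) (x : Coord) :
    pd a (fun y => (conf y)⁻¹) x = -2 * logD a x * (conf x)⁻¹ := by
  rw [pd_comp a (hasDerivAt_inv (conf_ne x)) (smooth_conf.diff x), pd_conf]
  have := conf_ne x
  field_simp

/-- Only the relations needed later are recorded, with the remaining second derivatives left as
unknowns. The last entry is Liouville's equation ∂₁² log λ + ∂₂² log λ = -λ², which says that the
spheres have curvature one. -/
theorem pd_logD (a b : Fin 3) (x : Coord) :
    pd a (logD b) x = ![![1 - logD 0 x ^ 2, 0, 0],
      ![0, pd 1 (logD 1) x, pd 1 (logD 2) x],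
      ![0, pd 1 (logD 2) x, -(conf x * (1 - logD 0 x ^ 2)) - pd 1 (logD 1) x]] a b := by
  have hl := smooth_lam.diff
  have h0 : ∀ a, pd a (logD 0) x = ![1 - logD 0 x ^ 2, 0, 0] a := by
    intro a
    have hC := (Real.cosh_pos (x 0)).ne'
    have ht : HasDerivAt Real.tanh (1 - Real.tanh (x 0) ^ 2) (x 0) := by
      have := (Real.hasDerivAt_sinh (x 0)).fun_div (Real.hasDerivAt_cosh (x 0)) hC
      have e : Real.tanh = fun t => Real.sinh t / Real.cosh t :=
        funext fun t => Real.tanh_eq_sinh_div_cosh t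
      rw [← e] at this
      refine this.congr_deriv ?_
      rw [Real.tanh_eq_sinh_div_cosh]
      field_simp
    change pd a (fun y => Real.tanh (y 0)) x = _
    rw [pd_comp (f := fun y : Coord => y 0) a ht (by fun_prop), pd_coord]
    fin_cases a <;> simp [logD]
  have h1 : ∀ a, pd a (logD 1) x = -((![0, logD 1 x * lam x, logD 2 x * lam x] a) * x 1
      + lam x * (if a = 1 then 1 else 0)) := by
    intro a
    change pd a (fun y => -(lam y * y 1)) x = _
    rw [pd_neg, pd_mul a (hl x) (by fun_prop), pd_lam, pd_coord]
  have h2 : ∀ a, pd a (logD 2) x = -((![0, logD 1 x * lam x, logD 2 x * lam x] a) * x 2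
      + lam x * (if a = 2 then 1 else 0)) := by
    intro a
    change pd a (fun y => -(lam y * y 2)) x = _
    rw [pd_neg, pd_mul a (hl x) (by fun_prop), pd_lam, pd_coord]
  have hr := lam_rel x
  have hc : conf x * (1 - logD 0 x ^ 2) = lam x ^ 2 := by
    have hC := (Real.cosh_pos (x 0)).ne'
    simp only [conf, logD, Matrix.cons_val, Real.tanh_eq_sinh_div_cosh]
    field_simp
    rw [Real.cosh_sq]; ring
  rw [hc]
  fin_cases b
  · have := h0 a
    fin_cases a <;> simpa using this
  · simp only [Fin.mk_one, h1, h2]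
    fin_cases a <;> simp [logD]; ring
  · simp only [Fin.reduceFinMk, h1, h2]
    fin_cases a <;> simp [logD]
    linarith

theorem metric_eq (x : Coord) : metric x = Matrix.diagonal ![-1, conf x, conf x] := by
  have : 4 * Real.cosh (x 0) ^ 2 / (1 + x 1 ^ 2 + x 2 ^ 2) ^ 2 = conf x := by
    have := (lam_den_pos x).ne'
    unfold conf lam
    field_simp
    ring
  simp only [metric, this]

theorem metricInv_eq (x : Coord) :
    metricInv x = Matrix.diagonal ![-1, (conf x)⁻¹, (conf x)⁻¹] := by
  have := conf_ne x
  unfold metricInv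
  rw [metric_eq]
  refine Matrix.inv_eq_right_inv ?_
  rw [Matrix.diagonal_mul_diagonal, ← Matrix.diagonal_one]
  congr 1
  funext i
  fin_cases i <;> simp [this]

/-- The Christoffel symbols `Γᵉ_ab` in terms of the conformal factor. -/
def gam (x : Coord) : Fin 3 → Fin 3 → Fin 3 → ℝ :=
  ![![![0, 0, 0], ![0, conf x * logD 0 x, 0], ![0, 0, conf x * logD 0 x]],
    ![![0, logD 0 x, 0], ![logD 0 x, logD 1 x, logD 2 x], ![0, logD 2 x, -logD 1 x]],
    ![![0, 0, logD 0 x], ![0, -logD 2 x, logD 1 x], ![logD 0 x, logD 1 x, logD 2 x]]]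

theorem metric_fun (a b : Fin 3) : (fun y => metric y a b) =
    ![![fun _ => -1, fun _ => 0, fun _ => 0], ![fun _ => 0, conf, fun _ => 0],
      ![fun _ => 0, fun _ => 0, conf]] a b := by
  funext y
  rw [metric_eq]
  fin_cases a <;> fin_cases b <;> simp

theorem christoffel_eq (x : Coord) (e a b : Fin 3) : christoffel x e a b = gam x e a b := by
  have h := conf_ne x
  unfold christoffel
  rw [metricInv_eq]
  simp only [metric_fun, Fin.sum_univ_three]
  fin_cases e <;> fin_cases a <;> fin_cases b <;>
    simp [gam, pd_const, pd_conf] <;> field_simp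

theorem smooth_christoffel (e a b : Fin 3) : Smooth (fun y => christoffel y e a b) := by
  have h : (fun y => christoffel y e a b) = fun y => gam y e a b :=
    funext fun y => christoffel_eq y e a b
  have hu := smooth_conf
  have h0 := smooth_logD 0
  have h1 := smooth_logD 1
  have h2 := smooth_logD 2
  rw [h]
  fin_cases e <;> fin_cases a <;> fin_cases b <;>
    first
      | exact contDiff_const
      | exact hu.mul h0
      | exact h0
      | exact h1
      | exact h2
      | exact h1.neg
      | exact h2.neg

/-- The partial derivatives `∂_d Γᵉ_ab`. -/
def dgam (x : Coord) (d : Fin 3) : Fin 3 → Fin 3 → Fin 3 → ℝ :=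
  let P := fun b => pd d (logD b) x
  ![![![0, 0, 0], ![0, 2 * logD d x * conf x * logD 0 x + conf x * P 0, 0],
      ![0, 0, 2 * logD d x * conf x * logD 0 x + conf x * P 0]],
    ![![0, P 0, 0], ![P 0, P 1, P 2], ![0, P 2, -P 1]],
    ![![0, 0, P 0], ![0, -P 2, P 1], ![P 0, P 1, P 2]]]

theorem pd_christoffel (x : Coord) (d e a b : Fin 3) :
    pd d (fun y => christoffel y e a b) x = dgam x d e a b := by
  have h : (fun y => christoffel y e a b) = fun y => gam y e a b :=
    funext fun y => christoffel_eq y e a b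
  have hu := smooth_conf.diff
  have h0 := (smooth_logD 0).diff
  have e0 : pd d (fun y => conf y * logD 0 y) x =
      2 * logD d x * conf x * logD 0 x + conf x * pd d (logD 0) x := by
    rw [pd_mul d (hu x) (h0 x), pd_conf]
  rw [h]
  fin_cases e <;> fin_cases a <;> fin_cases b <;>
    first
      | exact pd_const d 0 x
      | exact e0
      | rfl
      | exact pd_neg d _ x

/-! ### Component formulas for the differential operators on tensors. -/

variable {T : Coord → Fin 3 → Fin 3 → ℝ}

theorem smooth_comp2 (hT : Smooth T) (a b : Fin 3) : Smooth (fun y => T y a b) :=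
  contDiff_pi.1 (contDiff_pi.1 hT a) b

theorem smooth_comp1 {V : Coord → Fin 3 → ℝ} (hV : Smooth V) (a : Fin 3) :
    Smooth (fun y => V y a) := contDiff_pi.1 hV a

theorem smooth_tensor (h : ∀ a b, Smooth (fun y => T y a b)) : Smooth T :=
  contDiff_pi.2 fun a => contDiff_pi.2 fun b => h a b

theorem smooth_covD2 (hT : Smooth T) (c a b : Fin 3) : Smooth (fun y => covD2 T y c a b) := by
  unfold covD2
  exact ((smooth_pd c (smooth_comp2 hT a b)).sub (ContDiff.sum fun e _ =>
    (smooth_christoffel e c a).mul (smooth_comp2 hT e b))).sub (ContDiff.sum fun e _ =>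
    (smooth_christoffel e c b).mul (smooth_comp2 hT a e))

theorem pd_covD2 (hT : Smooth T) (d c a b : Fin 3) (x : Coord) :
    pd d (fun y => covD2 T y c a b) x = pd d (pd c (fun y => T y a b)) x
      - ∑ e, (dgam x d e c a * T x e b + gam x e c a * pd d (fun y => T y e b) x)
      - ∑ e, (dgam x d e c b * T x a e + gam x e c b * pd d (fun y => T y a e) x) := by
  have hG := fun e a b => (smooth_christoffel e a b).diff x
  have h := fun a b => (smooth_comp2 hT a b).diff x
  unfold covD2
  have hs1 : DifferentiableAt ℝ (fun y => ∑ e, christoffel y e c a * T y e b) x :=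
    DifferentiableAt.fun_sum fun e _ => (hG e c a).mul (h e b)
  have hs2 : DifferentiableAt ℝ (fun y => ∑ e, christoffel y e c b * T y a e) x :=
    DifferentiableAt.fun_sum fun e _ => (hG e c b).mul (h a e)
  have hp := (smooth_pd c (smooth_comp2 hT a b)).diff x
  rw [pd_sub d (hp.fun_sub hs1) hs2, pd_sub d hp hs1,
    pd_sum _ _ d (fun e _ => (hG e c a).fun_mul (h e b)),
    pd_sum _ _ d (fun e _ => (hG e c b).fun_mul (h a e))]
  have hm : ∀ e a b c f, pd d (fun y => christoffel y e a b * T y c f) x =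
      dgam x d e a b * T x c f + gam x e a b * pd d (fun y => T y c f) x := fun e a b c f => by
    rw [pd_mul d (hG e a b) (h c f), pd_christoffel, christoffel_eq]
  simp only [hm]

theorem volumeForm_eq (x : Coord) (a b c : Fin 3) :
    volumeForm x a b c = conf x * levi a b c := by
  have h : (metric x).det = -(conf x) ^ 2 := by
    rw [metric_eq, Matrix.det_diagonal]
    simp [Fin.prod_univ_three]; ring
  unfold volumeForm
  rw [h, abs_neg, abs_of_nonneg (sq_nonneg _), Real.sqrt_sq (conf_pos x).le]

/-- The metric is diagonal, so each row keeps one pair of terms. In the time row two spatial inverse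
factors meet one factor of the volume form; in the spatial rows these factors cancel and the sign of
the time direction decides the order. -/
theorem curl_eq (T : Coord → Fin 3 → Fin 3 → ℝ) (x : Coord) (a b : Fin 3) :
    curl T x a b = ![(conf x)⁻¹ * (covD2 T x 1 2 b - covD2 T x 2 1 b),
      covD2 T x 0 2 b - covD2 T x 2 0 b, covD2 T x 1 0 b - covD2 T x 0 1 b] a := by
  have h := conf_ne x
  unfold curl
  simp only [volumeForm_eq, metricInv_eq, Fin.sum_univ_three]
  fin_cases a <;> simp [levi] <;> field_simp <;> ring

theorem trace_eq (T : Coord → Fin 3 → Fin 3 → ℝ) (x : Coord) :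
    trace T x = -T x 0 0 + (conf x)⁻¹ * (T x 1 1 + T x 2 2) := by
  unfold trace
  simp only [metricInv_eq, Fin.sum_univ_three]
  simp; ring

theorem divergence_eq (T : Coord → Fin 3 → Fin 3 → ℝ) (x : Coord) (a : Fin 3) :
    divergence T x a = -covD2 T x 0 a 0 + (conf x)⁻¹ * (covD2 T x 1 a 1 + covD2 T x 2 a 2) := by
  unfold divergence
  simp only [metricInv_eq, Fin.sum_univ_three]
  simp; ring

theorem boxTensor_eq (T : Coord → Fin 3 → Fin 3 → ℝ) (x : Coord) (a b : Fin 3) :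
    boxTensor T x a b = -covD3 (covD2 T) x 0 0 a b
      + (conf x)⁻¹ * (covD3 (covD2 T) x 1 1 a b + covD3 (covD2 T) x 2 2 a b) := by
  unfold boxTensor
  simp only [metricInv_eq, Fin.sum_univ_three]
  simp; ring

theorem boxScalar_eq (Φ : Coord → ℝ) (x : Coord) :
    boxScalar Φ x = -hess Φ x 0 0 + (conf x)⁻¹ * (hess Φ x 1 1 + hess Φ x 2 2) := by
  unfold boxScalar
  simp only [metricInv_eq, Fin.sum_univ_three]
  simp; ring

theorem smooth_curl (hT : Smooth T) : Smooth (curl T) := by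
  refine smooth_tensor fun a b => ?_
  have h := fun c a => smooth_covD2 hT c a b
  have e : (fun y => curl T y a b) = _ := funext fun y => curl_eq T y a b
  rw [e]
  fin_cases a
  · exact smooth_confInv.mul ((h 1 2).sub (h 2 1))
  · exact (h 0 2).sub (h 2 0)
  · exact (h 1 0).sub (h 0 1)

theorem smooth_trace (hT : Smooth T) : Smooth (trace T) := by
  have e : trace T = _ := funext fun y => trace_eq T y
  rw [e]
  exact (smooth_comp2 hT 0 0).neg.add (smooth_confInv.mul ((smooth_comp2 hT 1 1).add
    (smooth_comp2 hT 2 2)))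

theorem pd_curl (hT : Smooth T) (d a b : Fin 3) (x : Coord) :
    pd d (fun y => curl T y a b) x =
      ![-2 * logD d x * (conf x)⁻¹ * (covD2 T x 1 2 b - covD2 T x 2 1 b) + (conf x)⁻¹ *
          (pd d (fun y => covD2 T y 1 2 b) x - pd d (fun y => covD2 T y 2 1 b) x),
        pd d (fun y => covD2 T y 0 2 b) x - pd d (fun y => covD2 T y 2 0 b) x,
        pd d (fun y => covD2 T y 1 0 b) x - pd d (fun y => covD2 T y 0 1 b) x] a := by
  have h := fun c a => (smooth_covD2 hT c a b).diff x
  have hv := smooth_confInv.diff x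
  have e : (fun y => curl T y a b) = _ := funext fun y => curl_eq T y a b
  rw [e]
  fin_cases a
  · refine (pd_mul d hv ((h 1 2).fun_sub (h 2 1))).trans ?_
    rw [pd_sub d (h 1 2) (h 2 1), pd_confInv]
    rfl
  · exact pd_sub d (h 0 2) (h 2 0)
  · exact pd_sub d (h 1 0) (h 0 1)

theorem pd_divergence (hT : Smooth T) (d a : Fin 3) (x : Coord) :
    pd d (fun y => divergence T y a) x = -pd d (fun y => covD2 T y 0 a 0) x
      + (-2 * logD d x * (conf x)⁻¹ * (covD2 T x 1 a 1 + covD2 T x 2 a 2) + (conf x)⁻¹ *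
          (pd d (fun y => covD2 T y 1 a 1) x + pd d (fun y => covD2 T y 2 a 2) x)) := by
  have h := fun c b => (smooth_covD2 hT c a b).diff x
  have hv := smooth_confInv.diff x
  have e : (fun y => divergence T y a) = _ := funext fun y => divergence_eq T y a
  rw [e, pd_add d (h 0 0).fun_neg (hv.fun_mul ((h 1 1).fun_add (h 2 2))), pd_neg,
    pd_mul d hv ((h 1 1).fun_add (h 2 2)), pd_confInv, pd_add d (h 1 1) (h 2 2)]

theorem pd_trace (hT : Smooth T) (d : Fin 3) (x : Coord) :
    pd d (trace T) x = -pd d (fun y => T y 0 0) x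
      + (-2 * logD d x * (conf x)⁻¹ * (T x 1 1 + T x 2 2) + (conf x)⁻¹ *
          (pd d (fun y => T y 1 1) x + pd d (fun y => T y 2 2) x)) := by
  have h := fun a b => (smooth_comp2 hT a b).diff x
  have hv := smooth_confInv.diff x
  have e : trace T = _ := funext fun y => trace_eq T y
  rw [e, pd_add d (h 0 0).fun_neg (hv.fun_mul ((h 1 1).fun_add (h 2 2))), pd_neg,
    pd_mul d hv ((h 1 1).fun_add (h 2 2)), pd_confInv, pd_add d (h 1 1) (h 2 2)]

variable {T : Coord → Fin 3 → Fin 3 → ℝ}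

/-! ### Identities for symmetric tensors -/

theorem covD2_symm (hs : ∀ x a b, T x a b = T x b a) (x : Coord) (c a b : Fin 3) :
    covD2 T x c a b = covD2 T x c b a := by
  have e : (fun y => T y a b) = fun y => T y b a := funext fun y => hs y a b
  unfold covD2
  rw [e]
  simp only [fun e b => hs x e b]
  ring

/-- `curl` of a symmetric tensor is traceless. -/
theorem trace_curl (hs : ∀ x a b, T x a b = T x b a) (x : Coord) : trace (curl T) x = 0 := by
  rw [trace_eq]
  simp only [curl_eq, Matrix.cons_val]
  rw [covD2_symm hs x 1 2 0, covD2_symm hs x 2 1 0, covD2_symm hs x 0 2 1]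
  ring

theorem covD1_eq (V : Coord → Fin 3 → ℝ) (x : Coord) (a b : Fin 3) :
    covD1 V x a b = pd a (fun y => V y b) x - ∑ e, gam x e a b * V x e := by
  simp only [covD1, christoffel_eq]

theorem covD2_eq (T : Coord → Fin 3 → Fin 3 → ℝ) (x : Coord) (c a b : Fin 3) :
    covD2 T x c a b = pd c (fun y => T y a b) x - ∑ e, gam x e c a * T x e b
      - ∑ e, gam x e c b * T x a e := by
  simp only [covD2, christoffel_eq]

theorem covD3_eq (U : Coord → Fin 3 → Fin 3 → Fin 3 → ℝ) (x : Coord) (d c a b : Fin 3) :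
    covD3 U x d c a b = pd d (fun y => U y c a b) x - ∑ e, gam x e d c * U x e a b
      - ∑ e, gam x e d a * U x c e b - ∑ e, gam x e d b * U x c a e := by
  simp only [covD3, christoffel_eq]

/-- `D_c (tr T)` in terms of `D T`. -/
theorem pd_trace_eq_covD2 (hT : Smooth T) (hs : ∀ x a b, T x a b = T x b a) (c : Fin 3) (x : Coord) :
    pd c (trace T) x =
      -covD2 T x c 0 0 + (conf x)⁻¹ * (covD2 T x c 1 1 + covD2 T x c 2 2) := by
  have h := conf_ne x
  rw [pd_trace hT]
  simp only [covD2_eq, Fin.sum_univ_three, hs x 1 0, hs x 2 0, hs x 2 1]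
  fin_cases c <;> simp [gam] <;> field_simp <;> ring

/-- The antisymmetric part of `curl T` is the dual of `Dᵇ T_ab - D_a T`. -/
theorem curl_symm_iff (hT : Smooth T) (hs : ∀ x a b, T x a b = T x b a) (x : Coord) :
    (∀ a b, curl T x a b = curl T x b a) ↔ ∀ a, divergence T x a = pd a (trace T) x := by
  have h := conf_ne x
  simp only [curl_eq, divergence_eq, pd_trace_eq_covD2 hT hs]
  have s1 := fun c => covD2_symm hs x c 1 0
  have s2 := fun c => covD2_symm hs x c 2 0
  have s3 := fun c => covD2_symm hs x c 2 1
  simp only [Fin.forall_fin_succ, Fin.isValue, Matrix.cons_val_zero, Matrix.cons_val_succ,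
    Fin.succ_zero_eq_one, Fin.succ_one_eq_two, IsEmpty.forall_iff, and_true,
    true_and, s1, s2, s3]
  constructor
  · rintro ⟨⟨h1, h2⟩, ⟨h3, h4⟩, h5, h6⟩
    refine ⟨?_, ?_, ?_⟩
    · field_simp
      linear_combination -h4
    · linear_combination -h2
    · linear_combination h1
  · rintro ⟨h1, h2, h3⟩
    have h4 : covD2 T x 0 1 1 + covD2 T x 0 2 2 - covD2 T x 1 0 1 - covD2 T x 2 0 2 = 0 := by
      field_simp at h1
      linear_combination -h1
    refine ⟨⟨?_, ?_⟩, ⟨?_, ?_⟩, ?_, ?_⟩ <;> first | linear_combination h3 | linear_combination -h3 | linear_combination h2 | linear_combination -h2 | linear_combination h4 | linear_combination -h4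

set_option maxHeartbeats 4000000 in
/-- `curl curl T = (□ - 3) T + (tr T) h - D (div T)` for symmetric `T`. -/
theorem curl_curl (hT : Smooth T) (hs : ∀ x a b, T x a b = T x b a) (x : Coord) (a b : Fin 3) :
    curl (curl T) x a b = boxTensor T x a b - 3 * T x a b + trace T x * metric x a b
      - covD1 (divergence T) x a b := by
  have h := conf_ne x
  have s10 : (fun y => T y 1 0) = fun y => T y 0 1 := funext fun y => hs y _ _
  have s20 : (fun y => T y 2 0) = fun y => T y 0 2 := funext fun y => hs y _ _
  have s21 : (fun y => T y 2 1) = fun y => T y 1 2 := funext fun y => hs y _ _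
  have c10 := fun a b => pd_comm 1 0 (smooth_comp2 hT a b) x
  have c20 := fun a b => pd_comm 2 0 (smooth_comp2 hT a b) x
  have c21 := fun a b => pd_comm 2 1 (smooth_comp2 hT a b) x
  rw [curl_eq, boxTensor_eq, trace_eq, metric_eq]
  simp only [covD2_eq (curl T), covD1_eq, covD3_eq, pd_curl hT, pd_divergence hT]
  simp only [pd_covD2 hT, divergence_eq]
  simp only [curl_eq]
  simp only [covD2_eq, Fin.sum_univ_three]
  -- These values carry the constant curvature of the space: `p00` is the Riccati equation of tanh,
  -- `p22` is Liouville's equation for the unit sphere. Everything else is the commutation of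
  -- partial derivatives.
  have p00 : pd 0 (logD 0) x = 1 - logD 0 x ^ 2 := pd_logD 0 0 x
  have p01 : pd 0 (logD 1) x = 0 := pd_logD 0 1 x
  have p02 : pd 0 (logD 2) x = 0 := pd_logD 0 2 x
  have p10 : pd 1 (logD 0) x = 0 := pd_logD 1 0 x
  have p20 : pd 2 (logD 0) x = 0 := pd_logD 2 0 x
  have p21 : pd 2 (logD 1) x = pd 1 (logD 2) x := pd_logD 2 1 x
  have p22 : pd 2 (logD 2) x = -(conf x * (1 - logD 0 x ^ 2)) - pd 1 (logD 1) x := pd_logD 2 2 x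
  fin_cases a <;> fin_cases b <;>
    simp only [Fin.zero_eta, Fin.isValue, Fin.mk_one, Fin.reduceFinMk, gam, dgam, p00, p01, p02,
      p10, p20, p21, p22,
      Matrix.cons_val, s10, s20, s21, c10, c20, c21, hs x 1 0, hs x 2 0, hs x 2 1,
      Matrix.diagonal_apply, if_true, if_false, Fin.reduceEq, mul_zero, zero_mul, add_zero, zero_add] <;>
    field_simp <;> ring

/-! ### The embedding into Minkowski space -/

/-- The Minkowski metric. -/
def eta (μ : Fin 4) : ℝ := ![-1, 1, 1, 1] μ

/-- The sign with which `n₁` and `n₃` change between the charts. -/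
def Patch.sgn : Patch → ℝ
  | .north => 1
  | .south => -1

theorem Patch.sgn_sq (p : Patch) : p.sgn ^ 2 = 1 := by cases p <;> simp [Patch.sgn]

/-- Written in this way, the embedding functions and all their derivatives are polynomials in cosh,
sinh, `lam`, `logD 1`, `logD 2`. The later identities reduce to algebra modulo `logD_rel` and cosh²
- sinh² = 1. The charts differ by the rotation by π about the n₂ axis, hence the signs for n₁ and
n₃. -/
theorem zeta_eq (μ : Fin 4) (p : Patch) : zeta μ p =
    ![fun x => Real.sinh (x 0), fun x => p.sgn * (Real.cosh (x 0) * (lam x - 1)),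
      fun x => -(Real.cosh (x 0) * logD 1 x), fun x => -(p.sgn * (Real.cosh (x 0) * logD 2 x))] μ := by
  funext x
  have h := (lam_den_pos x).ne'
  cases p <;> fin_cases μ <;> simp [zeta, dir, Patch.sgn, logD, lam] <;>
    field_simp <;> grind

theorem smooth_zeta (μ : Fin 4) (p : Patch) : Smooth (zeta μ p) := by
  rw [zeta_eq]
  fin_cases μ
  · exact smooth_sinh0
  · exact contDiff_const.mul (smooth_cosh0.mul (smooth_lam.sub contDiff_const))
  · exact (smooth_cosh0.mul (smooth_logD 1)).neg
  · exact (contDiff_const.mul (smooth_cosh0.mul (smooth_logD 2))).neg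

theorem pd_logD_one (a : Fin 3) (x : Coord) : pd a (logD 1) x =
    ![0, logD 1 x ^ 2 - lam x, logD 1 x * logD 2 x] a := by
  have hl := smooth_lam.diff
  change pd a (fun y => -(lam y * y 1)) x = _
  rw [pd_neg, pd_mul a (hl x) (by fun_prop), pd_lam, pd_coord]
  fin_cases a <;> simp [logD] <;> ring

theorem pd_logD_two (a : Fin 3) (x : Coord) : pd a (logD 2) x =
    ![0, logD 1 x * logD 2 x, logD 2 x ^ 2 - lam x] a := by
  have hl := smooth_lam.diff
  change pd a (fun y => -(lam y * y 2)) x = _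
  rw [pd_neg, pd_mul a (hl x) (by fun_prop), pd_lam, pd_coord]
  fin_cases a <;> simp [logD] <;> ring

theorem logD_rel (x : Coord) : logD 1 x ^ 2 + logD 2 x ^ 2 = 2 * lam x - lam x ^ 2 := by
  have := lam_rel x
  simp only [logD, Matrix.cons_val]
  linarith

theorem pd_zeta (a : Fin 3) (μ : Fin 4) (p : Patch) : pd a (zeta μ p) =
    ![![fun x => Real.cosh (x 0), fun _ => 0, fun _ => 0],
      ![fun x => p.sgn * (Real.sinh (x 0) * (lam x - 1)),
        fun x => p.sgn * (Real.cosh (x 0) * (logD 1 x * lam x)),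
        fun x => p.sgn * (Real.cosh (x 0) * (logD 2 x * lam x))],
      ![fun x => -(Real.sinh (x 0) * logD 1 x),
        fun x => Real.cosh (x 0) * (lam x - logD 1 x * logD 1 x),
        fun x => -(Real.cosh (x 0) * (logD 1 x * logD 2 x))],
      ![fun x => -(p.sgn * (Real.sinh (x 0) * logD 2 x)),
        fun x => -(p.sgn * (Real.cosh (x 0) * (logD 1 x * logD 2 x))),
        fun x => p.sgn * (Real.cosh (x 0) * (lam x - logD 2 x * logD 2 x))]] μ a := by
  funext x
  have hl := smooth_lam.diff x
  have hc := smooth_cosh0.diff x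
  have h1 := (smooth_logD 1).diff x
  have h2 := (smooth_logD 2).diff x
  have hl1 : DifferentiableAt ℝ (fun y => lam y - 1) x := hl.fun_sub (differentiableAt_const _)
  have e : pd a (fun y => lam y - 1) x = pd a lam x := by
    rw [pd_sub a hl (differentiableAt_const _), pd_const, sub_zero]
  rw [zeta_eq]
  fin_cases μ
  · refine (pd_sinh0 a x).trans ?_
    fin_cases a <;> simp
  · refine (pd_const_mul a _ (hc.fun_mul hl1)).trans ?_
    rw [pd_mul a hc hl1, pd_cosh0, e, pd_lam]
    fin_cases a <;> simp
  · refine (pd_neg a _ x).trans ?_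
    rw [pd_mul a hc h1, pd_cosh0, pd_logD_one]
    fin_cases a <;> simp
    ring
  · refine (pd_neg a _ x).trans ?_
    rw [pd_const_mul a _ (hc.fun_mul h2), pd_mul a hc h2, pd_cosh0, pd_logD_two]
    fin_cases a <;> simp
    ring

/-- A linear function on Minkowski space has no second derivatives, so its Hessian on the
hyperboloid is only the contribution of the second fundamental form, which for X·X = 1 is the
metric. -/
theorem hess_zeta (μ : Fin 4) (p : Patch) (x : Coord) (a b : Fin 3) :
    hess (zeta μ p) x a b = -(metric x a b * zeta μ p x) := by
  have hl := smooth_lam.diff x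
  have hc := smooth_cosh0.diff x
  have hs := smooth_sinh0.diff x
  have h1 := (smooth_logD 1).diff x
  have h2 := (smooth_logD 2).diff x
  have hl1 : DifferentiableAt ℝ (fun y => lam y - 1) x := hl.fun_sub (differentiableAt_const _)
  have e : ∀ a, pd a (fun y => lam y - 1) x = pd a lam x := fun a => by
    rw [pd_sub a hl (differentiableAt_const _), pd_const, sub_zero]
  have hC := (Real.cosh_pos (x 0)).ne'
  have hCS := Real.cosh_sq (x 0)
  have hr := logD_rel x
  have h11 := h1.fun_mul h1
  have h12 := h1.fun_mul h2
  have h22 := h2.fun_mul h2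
  have hl11 := hl.fun_sub h11
  have hl22 := hl.fun_sub h22
  have h1l := h1.fun_mul hl
  have h2l := h2.fun_mul hl
  have L0 : logD 0 x = Real.sinh (x 0) / Real.cosh (x 0) := Real.tanh_eq_sinh_div_cosh _
  unfold hess
  rw [covD1_eq, metric_eq]
  simp only [pd_zeta, Fin.sum_univ_three]
  rw [zeta_eq]
  fin_cases μ <;> fin_cases a <;> fin_cases b <;>
    simp [pd_neg, pd_const, pd_const_mul, pd_mul, pd_sub, hc, hs, hl, h1, h2, hl1, e, pd_cosh0,
      pd_sinh0, pd_lam, pd_logD_one, pd_logD_two, gam, h11, h12, h22, hl11, hl22, h1l, h2l] <;>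
    try simp only [L0, conf]
  all_goals try field_simp
  all_goals grind

/-- This and the next two relations say that X maps each chart isometrically into the hyperboloid
and that X itself is the unit normal. -/
theorem sum_eta_zeta_sq (p : Patch) (x : Coord) : ∑ μ, eta μ * zeta μ p x * zeta μ p x = 1 := by
  have hr := logD_rel x
  have hC := Real.cosh_sq (x 0)
  have hs := p.sgn_sq
  simp only [zeta_eq, Fin.sum_univ_four, eta, Matrix.cons_val]
  grind

theorem sum_eta_pd_zeta (p : Patch) (x : Coord) (a b : Fin 3) :
    ∑ μ, eta μ * pd a (zeta μ p) x * pd b (zeta μ p) x = metric x a b := by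
  have hr := logD_rel x
  have hC := Real.cosh_sq (x 0)
  have hs := p.sgn_sq
  simp only [pd_zeta, Fin.sum_univ_four, eta, metric_eq]
  fin_cases a <;> fin_cases b <;> simp [conf] <;> grind

theorem sum_eta_zeta_pd (p : Patch) (x : Coord) (a : Fin 3) :
    ∑ μ, eta μ * zeta μ p x * pd a (zeta μ p) x = 0 := by
  have hr := logD_rel x
  have hC := Real.cosh_sq (x 0)
  have hs := p.sgn_sq
  simp only [pd_zeta, Fin.sum_univ_four, eta]
  simp only [zeta_eq]
  fin_cases a <;> simp <;> grind

/-- `E^{bμ} = h^{bc} ∂_c X^μ`. -/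
def frame (p : Patch) (μ : Fin 4) (b : Fin 3) (x : Coord) : ℝ :=
  ![-1, (conf x)⁻¹, (conf x)⁻¹] b * pd b (zeta μ p) x

theorem frame_eq (p : Patch) (μ : Fin 4) (b : Fin 3) (x : Coord) :
    frame p μ b x = ∑ c, metricInv x b c * pd c (zeta μ p) x := by
  rw [metricInv_eq]
  simp [frame, Matrix.diagonal_apply]

theorem smooth_frame (p : Patch) (μ : Fin 4) (b : Fin 3) : Smooth (frame p μ b) := by
  have h := smooth_pd b (smooth_zeta μ p)
  fin_cases b
  · exact contDiff_const.mul h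
  · exact smooth_confInv.mul h
  · exact smooth_confInv.mul h

/-- Completeness of the basis formed by the tangent frame and the normal X, that is, η^{μν} split
into its tangential and normal parts. -/
theorem sum_frame_zeta (p : Patch) (x : Coord) (μ ν : Fin 4) :
    ∑ b, frame p μ b x * pd b (zeta ν p) x =
      (if μ = ν then eta μ else 0) - zeta μ p x * zeta ν p x := by
  have hr := logD_rel x
  have hC := Real.cosh_sq (x 0)
  have hs := p.sgn_sq
  have hC := (Real.cosh_pos (x 0)).ne'
  have hl := (lam_pos x).ne'
  simp only [frame, pd_zeta, Fin.sum_univ_three, eta]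
  simp only [zeta_eq]
  fin_cases μ <;> fin_cases ν <;> simp [conf] <;> field_simp <;> grind

theorem sum_eta_frame (p : Patch) (x : Coord) (a b : Fin 3) :
    ∑ μ, eta μ * frame p μ a x * pd b (zeta μ p) x = if a = b then 1 else 0 := by
  have h := sum_eta_pd_zeta p x a b
  have hu := conf_ne x
  have e : ∑ μ, eta μ * frame p μ a x * pd b (zeta μ p) x =
      ![-1, (conf x)⁻¹, (conf x)⁻¹] a * ∑ μ, eta μ * pd a (zeta μ p) x * pd b (zeta μ p) x := by
    rw [Finset.mul_sum]
    exact Finset.sum_congr rfl fun μ _ => by unfold frame; ring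
  rw [e, h, metric_eq]
  fin_cases a <;> fin_cases b <;> simp [hu]

theorem sum_eta_frame_zeta (p : Patch) (x : Coord) (a : Fin 3) :
    ∑ μ, eta μ * frame p μ a x * zeta μ p x = 0 := by
  have e : ∑ μ, eta μ * frame p μ a x * zeta μ p x =
      ![-1, (conf x)⁻¹, (conf x)⁻¹] a * ∑ μ, eta μ * zeta μ p x * pd a (zeta μ p) x := by
    rw [Finset.mul_sum]
    exact Finset.sum_congr rfl fun μ _ => by unfold frame; ring
  rw [e, sum_eta_zeta_pd, mul_zero]

theorem pd_pd_zeta (p : Patch) (μ : Fin 4) (a b : Fin 3) (x : Coord) :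
    pd a (pd b (zeta μ p)) x =
      ∑ e, gam x e a b * pd e (zeta μ p) x - metric x a b * zeta μ p x := by
  have := hess_zeta μ p x a b
  unfold hess at this
  rw [covD1_eq] at this
  linear_combination this

theorem pd_zeta_eq_frame (p : Patch) (μ : Fin 4) (a : Fin 3) (x : Coord) :
    pd a (zeta μ p) x = ∑ b, metric x a b * frame p μ b x := by
  have hu := conf_ne x
  rw [metric_eq]
  fin_cases a <;> simp [frame, Fin.sum_univ_three, hu]

/-- The Gauss formula with the frame index raised: the Christoffel terms are tangential, and the
remaining term points along the normal X. -/
theorem pd_frame (p : Patch) (μ : Fin 4) (c b : Fin 3) (x : Coord) :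
    pd c (frame p μ b) x =
      -∑ e, gam x b c e * frame p μ e x - (if c = b then 1 else 0) * zeta μ p x := by
  have hu := conf_ne x
  have hv := smooth_confInv.diff x
  have hz := fun b => (smooth_pd b (smooth_zeta μ p)).diff x
  have e : pd c (frame p μ b) x =
      ![0, -2 * logD c x * (conf x)⁻¹, -2 * logD c x * (conf x)⁻¹] b * pd b (zeta μ p) x +
      ![-1, (conf x)⁻¹, (conf x)⁻¹] b * pd c (pd b (zeta μ p)) x := by
    fin_cases b
    · refine (pd_const_mul c (-1) (hz 0)).trans ?_
      simp
    · refine (pd_mul c hv (hz 1)).trans ?_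
      rw [pd_confInv]; simp
    · refine (pd_mul c hv (hz 2)).trans ?_
      rw [pd_confInv]; simp
  rw [e, pd_pd_zeta, metric_eq]
  simp only [Fin.sum_univ_three, frame]
  fin_cases b <;> fin_cases c <;> simp [gam] <;> field_simp <;> ring

variable {T : Coord → Fin 3 → Fin 3 → ℝ}

/-! ### Potentials of closed forms and of curl-free tensors on a chart -/

/-- The Poincaré lemma on ℝ³, with the radial primitive f(x) = ∫₀¹ x·A(tx) dt. -/
theorem exists_pd_eq {A : Coord → Fin 3 → ℝ} (hA : Smooth A)
    (hc : ∀ a b x, pd a (fun y => A y b) x = pd b (fun y => A y a) x) :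
    ∃ f : Coord → ℝ, Smooth f ∧ ∀ a x, pd a f x = A x a := by
  have hAa := fun a => smooth_comp1 hA a
  have hsm : Smooth (fun q : Coord × ℝ => ∑ a, q.1 a * A (q.2 • q.1) a) :=
    ContDiff.sum fun a _ => ((smooth_coord a).comp contDiff_fst).mul
      ((hAa a).comp (contDiff_snd.smul contDiff_fst))
  refine ⟨fun x => ∫ t in (0 : ℝ)..1, ∑ a, x a * A (t • x) a, smooth_intervalIntegral hsm 0 1,
    fun b x => ?_⟩
  rw [pd_intervalIntegral (F := fun (y : Coord) (t : ℝ) => ∑ a, y a * A (t • y) a) hsm]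
  have hscale : ∀ (g : Coord → ℝ) (_ : Smooth g) (t : ℝ) (c : Fin 3),
      pd c (fun y => g (t • y)) x = t * pd c g (t • x) := by
    intro g hg t c
    have h1 : HasFDerivAt (fun y : Coord => t • y) (t • ContinuousLinearMap.id ℝ Coord) x :=
      (hasFDerivAt_id x).const_smul t
    have := (hg.diff (t • x)).hasFDerivAt.comp x h1
    unfold pd
    rw [show (fun y => g (t • y)) = g ∘ fun y => t • y from rfl, this.fderiv]
    simp
  -- Closedness turns the x_b-derivative of the integrand into the t-derivative of t A_b(tx), so the
  -- integral can be evaluated at the end points.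
  have hline : ∀ t : ℝ, HasDerivAt (fun t : ℝ => t * A (t • x) b)
      (pd b (fun y => ∑ a, y a * A (t • y) a) x) t := by
    intro t
    have h1 : HasDerivAt (fun t : ℝ => t • x) x t := by
      simpa using (hasDerivAt_id t).smul_const x
    have h2 := ((hAa b).diff (t • x)).hasFDerivAt.comp_hasDerivAt t h1
    have h3 := (hasDerivAt_id t).mul h2
    refine h3.congr_deriv ?_
    have hd : ∀ a, DifferentiableAt ℝ (fun y => A (t • y) a) x := fun a =>
      (((hAa a).comp (contDiff_const_smul t)).differentiable (by simp)) x
    rw [pd_sum _ _ b (fun a _ => ((smooth_coord a).diff x).fun_mul (hd a)), fderiv_eq_sum_pd]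
    simp only [fun a => pd_mul b ((smooth_coord a).diff x) (hd a), pd_coord,
      fun a => hscale _ (hAa a) t b, hc b]
    simp [Finset.sum_add_distrib, Finset.mul_sum]
    ring_nf
  have hcont : Continuous fun t : ℝ => pd b (fun y => ∑ a, y a * A (t • y) a) x := by
    have h1 := hsm.fderiv_right (m := (⊤ : ℕ∞)) (by simp)
    have h2 : (fun t : ℝ => pd b (fun y => ∑ a, y a * A (t • y) a) x) = fun t =>
        fderiv ℝ (fun q : Coord × ℝ => ∑ a, q.1 a * A (q.2 • q.1) a) (x, t)
          (Pi.single b 1, 0) := by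
      funext t
      have := fderiv_partial_left (f := fun (y : Coord) (t : ℝ) => ∑ a, y a * A (t • y) a)
        (hsm.of_le (by exact_mod_cast le_top)) x t
      unfold pd
      rw [this.fderiv]
      rfl
    rw [h2]
    exact (h1.continuous.comp (by fun_prop : Continuous fun t : ℝ => (x, t))).clm_apply
      continuous_const
  rw [intervalIntegral.integral_eq_sub_of_hasDerivAt (fun t _ => hline t)
    (hcont.intervalIntegrable 0 1)]
  simp

/-- The form `A_a = ∑ T_ab E^{bμ}`. -/
def formOf (p : Patch) (μ : Fin 4) (T : Coord → Fin 3 → Fin 3 → ℝ) (x : Coord) (a : Fin 3) : ℝ :=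
  ∑ b, T x a b * frame p μ b x

theorem smooth_formOf (p : Patch) (μ : Fin 4) (hT : Smooth T) : Smooth (formOf p μ T) :=
  contDiff_pi.2 fun a => ContDiff.sum fun b _ => (smooth_comp2 hT a b).mul (smooth_frame p μ b)

/-- By the Gauss formula, the connection terms complete the partial derivatives to covariant ones,
up to terms symmetric in the form indices. The normal part of the derivative of the frame sees only
the antisymmetric part of T. -/
theorem ext_deriv_formOf (p : Patch) (μ : Fin 4) (hT : Smooth T) (x : Coord) (c a : Fin 3) :
    pd c (fun y => formOf p μ T y a) x - pd a (fun y => formOf p μ T y c) x =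
      ∑ b, (covD2 T x c a b - covD2 T x a c b) * frame p μ b x
        - (T x a c - T x c a) * zeta μ p x := by
  have h := fun a b => (smooth_comp2 hT a b).diff x
  have hf := fun b => (smooth_frame p μ b).diff x
  unfold formOf
  rw [pd_sum _ _ c (fun b _ => (h a b).fun_mul (hf b)),
    pd_sum _ _ a (fun b _ => (h c b).fun_mul (hf b))]
  simp only [fun a b c => pd_mul c (h a b) (hf b), pd_frame, covD2_eq, Fin.sum_univ_three]
  fin_cases c <;> fin_cases a <;> simp [gam] <;> ring

/-- A tensor is determined by its contractions with the frame. -/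
theorem eq_of_sum_frame (p : Patch) (x : Coord) {V W : Fin 3 → ℝ}
    (h : ∀ μ, ∑ b, V b * frame p μ b x = ∑ b, W b * frame p μ b x) : V = W := by
  funext a
  have key : ∀ U : Fin 3 → ℝ, ∑ μ, eta μ * pd a (zeta μ p) x * ∑ b, U b * frame p μ b x = U a := by
    intro U
    simp only [Finset.mul_sum]
    rw [Finset.sum_comm]
    have : ∀ b, ∑ μ, eta μ * pd a (zeta μ p) x * (U b * frame p μ b x) =
        U b * if b = a then 1 else 0 := fun b => by
      rw [← sum_eta_frame p x b a, Finset.mul_sum]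
      exact Finset.sum_congr rfl fun μ _ => by ring
    simp [this]
  rw [← key V, ← key W]
  simp only [h]

theorem curl_eq_zero_iff (T : Coord → Fin 3 → Fin 3 → ℝ) (x : Coord) :
    (∀ a b, curl T x a b = 0) ↔ ∀ c a b, covD2 T x c a b = covD2 T x a c b := by
  have h := conf_ne x
  simp only [curl_eq]
  constructor
  · intro H c a b
    have h0 := H 0 b
    have h1 := H 1 b
    have h2 := H 2 b
    simp [h] at h0 h1 h2
    fin_cases c <;> fin_cases a <;> simp <;> linarith
  · intro H a b
    fin_cases a
    · simp [H 1 2 b]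
    · simp [H 0 2 b]
    · simp [H 1 0 b]

/-- For symmetric T the normal term of the exterior derivative drops out. What remains is the
antisymmetrized derivative of T contracted with the frame, and the frame spans the tangent space. -/
theorem closed_formOf_iff (p : Patch) (hT : Smooth T) (hs : ∀ x a b, T x a b = T x b a)
    (x : Coord) : (∀ a b, curl T x a b = 0) ↔ ∀ μ c a,
      pd c (fun y => formOf p μ T y a) x = pd a (fun y => formOf p μ T y c) x := by
  have key : ∀ μ c a, pd c (fun y => formOf p μ T y a) x - pd a (fun y => formOf p μ T y c) x =
      ∑ b, covD2 T x c a b * frame p μ b x - ∑ b, covD2 T x a c b * frame p μ b x := by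
    intro μ c a
    rw [ext_deriv_formOf p μ hT x c a, hs x a c, ← Finset.sum_sub_distrib]
    simp [sub_mul]
  rw [curl_eq_zero_iff]
  constructor
  · intro H μ c a
    have := key μ c a
    simp only [H c a] at this
    linarith
  · intro H c a b
    refine congrFun (eq_of_sum_frame p x (V := covD2 T x c a) (W := covD2 T x a c) fun μ => ?_) b
    have := key μ c a
    have := H μ c a
    linarith

/-! ### The operator `S` on a chart -/

/-- `D_a D_b Φ + h_ab Φ` on a chart. -/
def hessPlusAt (Φ : Coord → ℝ) (x : Coord) (a b : Fin 3) : ℝ := hess Φ x a b + metric x a b * Φ x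

/-- The ambient derivative `D^bΦ ∂_bX^μ + Φ X^μ` of the extension of `Φ` of degree one. -/
def ambGrad (p : Patch) (μ : Fin 4) (Φ : Coord → ℝ) (x : Coord) : ℝ :=
  ∑ b, pd b Φ x * frame p μ b x + Φ x * zeta μ p x

variable {Φ : Coord → ℝ}

theorem smooth_ambGrad (p : Patch) (μ : Fin 4) (hΦ : Smooth Φ) : Smooth (ambGrad p μ Φ) :=
  (ContDiff.sum fun b _ => (smooth_pd b hΦ).mul (smooth_frame p μ b)).add
    (hΦ.mul (smooth_zeta μ p))

theorem metric_fun_smooth (a b : Fin 3) : Smooth (fun y => metric y a b) := by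
  rw [metric_fun]
  fin_cases a <;> fin_cases b <;> first | exact contDiff_const | exact smooth_conf

theorem hess_eq (Φ : Coord → ℝ) (x : Coord) (a b : Fin 3) :
    hess Φ x a b = pd a (pd b Φ) x - ∑ e, gam x e a b * pd e Φ x := by
  unfold hess
  rw [covD1_eq]

theorem smooth_hess (hΦ : Smooth Φ) (a b : Fin 3) : Smooth (fun y => hess Φ y a b) := by
  unfold hess covD1
  exact (smooth_pd a (smooth_pd b hΦ)).sub (ContDiff.sum fun e _ =>
    (smooth_christoffel e a b).mul (smooth_pd e hΦ))

theorem smooth_hessPlusAt (hΦ : Smooth Φ) : Smooth (hessPlusAt Φ) :=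
  smooth_tensor fun a b => (smooth_hess hΦ a b).add ((metric_fun_smooth a b).mul hΦ)

theorem gam_symm (x : Coord) (e a b : Fin 3) : gam x e a b = gam x e b a := by
  fin_cases e <;> fin_cases a <;> fin_cases b <;> rfl

theorem metric_symm (x : Coord) (a b : Fin 3) : metric x a b = metric x b a := by
  rw [metric_eq]
  fin_cases a <;> fin_cases b <;> simp

theorem hessPlusAt_symm (hΦ : Smooth Φ) (x : Coord) (a b : Fin 3) :
    hessPlusAt Φ x a b = hessPlusAt Φ x b a := by
  unfold hessPlusAt
  rw [hess_eq, hess_eq, pd_comm a b hΦ, metric_symm x a b]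
  simp only [gam_symm x _ a b]

/-- The normal part of the derivative of the frame cancels against ∂_aΦ X^μ. The surviving terms are
the Hessian contracted with the frame and Φ ∂_aX^μ, which together make up SΦ. -/
theorem pd_ambGrad (p : Patch) (μ : Fin 4) (hΦ : Smooth Φ) (a : Fin 3) (x : Coord) :
    pd a (ambGrad p μ Φ) x = formOf p μ (hessPlusAt Φ) x a := by
  have hp := fun b => (smooth_pd b hΦ).diff x
  have hf := fun b => (smooth_frame p μ b).diff x
  have hz := (smooth_zeta μ p).diff x
  have hs : DifferentiableAt ℝ (fun y => ∑ b, pd b Φ y * frame p μ b y) x :=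
    DifferentiableAt.fun_sum fun b _ => (hp b).fun_mul (hf b)
  unfold ambGrad formOf hessPlusAt
  rw [pd_add a hs ((hΦ.diff x).fun_mul hz), pd_sum _ _ a (fun b _ => (hp b).fun_mul (hf b)),
    pd_mul a (hΦ.diff x) hz, pd_zeta_eq_frame]
  simp only [fun b => pd_mul a (hp b) (hf b), pd_frame, hess_eq, Fin.sum_univ_three]
  fin_cases a <;> simp [gam] <;> ring

/-- Euler's relation for a function of degree one: Φ is recovered from its ambient gradient. -/
theorem sum_eta_ambGrad_zeta (p : Patch) (Φ : Coord → ℝ) (x : Coord) :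
    ∑ μ, eta μ * zeta μ p x * ambGrad p μ Φ x = Φ x := by
  have h1 := sum_eta_zeta_sq p x
  have h2 := sum_eta_frame_zeta p x
  have e : ∑ μ, eta μ * zeta μ p x * ambGrad p μ Φ x =
      ∑ b, pd b Φ x * ∑ μ, eta μ * frame p μ b x * zeta μ p x +
        Φ x * ∑ μ, eta μ * zeta μ p x * zeta μ p x := by
    simp only [ambGrad, Fin.sum_univ_four, Fin.sum_univ_three]
    ring
  rw [e, h1]
  simp [h2]

/-- `T = ∑ η dA^μ ⊗ dX_μ`. -/
theorem sum_eta_formOf_pd (p : Patch) (T : Coord → Fin 3 → Fin 3 → ℝ) (x : Coord) (a b : Fin 3) :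
    ∑ μ, eta μ * formOf p μ T x a * pd b (zeta μ p) x = T x a b := by
  have h := fun c => sum_eta_frame p x c b
  have e : ∑ μ, eta μ * formOf p μ T x a * pd b (zeta μ p) x =
      ∑ c, T x a c * ∑ μ, eta μ * frame p μ c x * pd b (zeta μ p) x := by
    simp only [formOf, Fin.sum_univ_four, Fin.sum_univ_three]
    ring
  rw [e]
  simp [h]

theorem formOf_zeta (p : Patch) (T : Coord → Fin 3 → Fin 3 → ℝ) (x : Coord) (a : Fin 3) :
    ∑ μ, eta μ * formOf p μ T x a * zeta μ p x = 0 := by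
  have h := sum_eta_frame_zeta p x
  have e : ∑ μ, eta μ * formOf p μ T x a * zeta μ p x =
      ∑ c, T x a c * ∑ μ, eta μ * frame p μ c x * zeta μ p x := by
    simp only [formOf, Fin.sum_univ_four, Fin.sum_univ_three]
    ring
  rw [e]
  simp [h]

/-- The converse of `pd_ambGrad`. Given primitives F^μ of the forms of T, put Φ = X·F. The forms are
tangential, so ∂Φ = ∂X·F, and a second derivative produces T from dF and -hΦ from the second
derivatives of X. -/
theorem hessPlusAt_of_form (p : Patch) {F : Fin 4 → Coord → ℝ} (hF : ∀ μ, Smooth (F μ))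
    (h : ∀ μ a x, pd a (F μ) x = formOf p μ T x a) :
    Smooth (fun x => ∑ μ, eta μ * zeta μ p x * F μ x) ∧
      hessPlusAt (fun x => ∑ μ, eta μ * zeta μ p x * F μ x) = T := by
  have hz := fun μ => smooth_zeta μ p
  refine ⟨ContDiff.sum fun μ _ => (contDiff_const.mul (hz μ)).mul (hF μ), ?_⟩
  have e1 : ∀ b, pd b (fun x => ∑ μ, eta μ * zeta μ p x * F μ x) =
      fun x => ∑ μ, eta μ * pd b (zeta μ p) x * F μ x := by
    intro b
    funext x
    rw [pd_sum _ _ b (fun μ _ => (((hz μ).diff x).const_mul (eta μ)).fun_mul ((hF μ).diff x))]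
    have := fun μ => pd_mul b (((hz μ).diff x).const_mul (eta μ)) ((hF μ).diff x)
    simp only [this, h, fun μ => pd_const_mul b (eta μ) ((hz μ).diff x), Finset.sum_add_distrib]
    have h0 := formOf_zeta p T x b
    rw [add_eq_left, ← h0]
    exact Finset.sum_congr rfl fun μ _ => by ring
  funext x a b
  have hp := fun μ => (smooth_pd b (hz μ)).diff x
  unfold hessPlusAt
  rw [hess_eq]
  simp only [e1]
  rw [pd_sum _ _ a (fun μ _ => ((hp μ).const_mul (eta μ)).fun_mul ((hF μ).diff x))]
  have := fun μ => pd_mul a ((hp μ).const_mul (eta μ)) ((hF μ).diff x)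
  simp only [this, h, fun μ => pd_const_mul a (eta μ) (hp μ), pd_pd_zeta]
  rw [← sum_eta_formOf_pd p T x a b]
  simp only [Fin.sum_univ_four, Fin.sum_univ_three]
  ring

/-- The forms of SΦ are exact, hence closed. -/
theorem curl_hessPlusAt (hΦ : Smooth Φ) (x : Coord) (a b : Fin 3) :
    curl (hessPlusAt Φ) x a b = 0 := by
  refine (closed_formOf_iff .north (smooth_hessPlusAt hΦ) (hessPlusAt_symm hΦ) x).2
    (fun μ c a => ?_) a b
  have e : ∀ a, (fun y => formOf .north μ (hessPlusAt Φ) y a) = pd a (ambGrad .north μ Φ) :=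
    fun a => funext fun y => (pd_ambGrad .north μ hΦ a y).symm
  rw [e, e, pd_comm c a (smooth_ambGrad .north μ hΦ)]

/-- A curl-free symmetric tensor on a chart is `S Φ`. -/
theorem exists_hessPlusAt (hT : Smooth T) (hs : ∀ x a b, T x a b = T x b a)
    (hc : ∀ x a b, curl T x a b = 0) : ∃ Φ : Coord → ℝ, Smooth Φ ∧ hessPlusAt Φ = T := by
  have h : ∀ μ, ∃ f : Coord → ℝ, Smooth f ∧ ∀ a x, pd a f x = formOf .north μ T x a := fun μ =>
    exists_pd_eq (smooth_formOf .north μ hT) fun a b x =>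
      (closed_formOf_iff .north hT hs x).1 (hc x) μ a b
  choose F hF hF' using h
  exact ⟨_, hessPlusAt_of_form .north hF hF'⟩

/-- The four constants obtained here are the coefficients of a translation, up to the signs in η. -/
theorem ambGrad_const_of_hessPlusAt_eq_zero (hΦ : Smooth Φ) (h : hessPlusAt Φ = 0) (p : Patch)
    (μ : Fin 4) (x y : Coord) : ambGrad p μ Φ x = ambGrad p μ Φ y := by
  refine eq_of_pd_eq_zero (smooth_ambGrad p μ hΦ).diff (fun a z => ?_) x y
  rw [pd_ambGrad p μ hΦ, h]
  simp [formOf]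

theorem hessPlusAt_add {Ψ : Coord → ℝ} (hΦ : Smooth Φ) (hΨ : Smooth Ψ) :
    hessPlusAt (fun x => Φ x + Ψ x) = fun x a b => hessPlusAt Φ x a b + hessPlusAt Ψ x a b := by
  funext x a b
  have e : ∀ c, pd c (fun x => Φ x + Ψ x) = fun x => pd c Φ x + pd c Ψ x := fun c =>
    funext fun x => pd_add c (hΦ.diff x) (hΨ.diff x)
  unfold hessPlusAt
  simp only [hess_eq, e, pd_add a ((smooth_pd b hΦ).diff x) ((smooth_pd b hΨ).diff x),
    Fin.sum_univ_three]
  ring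

theorem hessPlusAt_const_mul (c : ℝ) (hΦ : Smooth Φ) :
    hessPlusAt (fun x => c * Φ x) = fun x a b => c * hessPlusAt Φ x a b := by
  funext x a b
  have e : ∀ d, pd d (fun x => c * Φ x) = fun x => c * pd d Φ x := fun d =>
    funext fun x => pd_const_mul d c (hΦ.diff x)
  unfold hessPlusAt
  simp only [hess_eq, e, pd_const_mul a c ((smooth_pd b hΦ).diff x), Fin.sum_univ_three]
  ring

theorem hessPlusAt_zeta (μ : Fin 4) (p : Patch) : hessPlusAt (zeta μ p) = 0 := by
  funext x a b
  simp [hessPlusAt, hess_zeta]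

theorem trace_hessPlusAt (Φ : Coord → ℝ) (x : Coord) :
    trace (hessPlusAt Φ) x = boxScalar Φ x + 3 * Φ x := by
  have h := conf_ne x
  rw [trace_eq, boxScalar_eq]
  unfold hessPlusAt
  rw [metric_eq]
  simp
  field_simp
  ring

/-! ### Gluing of forms and tensors on the overlap -/

/-- Jacobian matrix of the chart coordinates with respect to spherical coordinates. -/
def jac (p : Patch) (y : Coord) (a c : Fin 3) : ℝ := pd a (fun z => sphChart p z c) y

theorem isOpen_overlap : IsOpen {y | InOverlap y} := by
  have h1 : IsOpen {y : Coord | 0 < y 1} := isOpen_lt continuous_const (continuous_apply 1)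
  have h2 : IsOpen {y : Coord | y 1 < Real.pi} := isOpen_lt (continuous_apply 1) continuous_const
  exact h1.inter h2

theorem convex_overlap : Convex ℝ {y | InOverlap y} := by
  have h : {y : Coord | InOverlap y} = (fun y : Coord => y 1) ⁻¹' Ioo 0 Real.pi := rfl
  rw [h]
  exact (convex_Ioo (0 : ℝ) Real.pi).is_linear_preimage
    (LinearMap.isLinear (LinearMap.proj (R := ℝ) (φ := fun _ : Fin 3 => ℝ) 1))

theorem contDiffAt_tan_half {y : Coord} (hy : InOverlap y) :
    ContDiffAt ℝ (⊤ : ℕ∞) (fun z : Coord => Real.tan (z 1 / 2)) y :=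
  ContDiffAt.comp (f := fun z : Coord => z 1 / 2) (g := Real.tan) y
    (Real.contDiffAt_tan.2 (half_angle_ne y hy).2) ((smooth_coord 1).div_const 2).contDiffAt

theorem contDiffAt_sphChart (p : Patch) {y : Coord} (hy : InOverlap y) :
    ContDiffAt ℝ (⊤ : ℕ∞) (sphChart p) y := by
  have ht := contDiffAt_tan_half hy
  have hn : Real.tan (y 1 / 2) ≠ 0 := by
    rw [Real.tan_eq_sin_div_cos]
    exact div_ne_zero (half_angle_ne y hy).1 (half_angle_ne y hy).2
  have hti := ht.inv hn
  have hc : ContDiffAt ℝ (⊤ : ℕ∞) (fun z : Coord => Real.cos (z 2)) y :=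
    (Real.contDiff_cos.comp (smooth_coord 2)).contDiffAt
  have hs : ContDiffAt ℝ (⊤ : ℕ∞) (fun z : Coord => Real.sin (z 2)) y :=
    (Real.contDiff_sin.comp (smooth_coord 2)).contDiffAt
  refine contDiffAt_pi.2 fun c => ?_
  cases p <;> fin_cases c
  · exact (smooth_coord 0).contDiffAt
  · exact ht.mul hc
  · exact ht.mul hs
  · exact (smooth_coord 0).contDiffAt
  · exact hti.mul hc
  · exact (hti.mul hs).neg

theorem pd_comp_sphChart (p : Patch) {y : Coord} (hy : InOverlap y) {f : Coord → ℝ}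
    (hf : DifferentiableAt ℝ f (sphChart p y)) (a : Fin 3) :
    pd a (fun z => f (sphChart p z)) y = ∑ c, jac p y a c * pd c f (sphChart p y) := by
  have h1 : DifferentiableAt ℝ (sphChart p) y :=
    (contDiffAt_sphChart p hy).differentiableAt (by simp)
  have h2 := hf.hasFDerivAt.comp y h1.hasFDerivAt
  unfold pd
  rw [show (fun z => f (sphChart p z)) = f ∘ sphChart p from rfl, h2.fderiv]
  rw [ContinuousLinearMap.comp_apply, fderiv_eq_sum_pd]
  refine Finset.sum_congr rfl fun c _ => ?_
  congr 1
  unfold jac pd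
  have h3 : fderiv ℝ (fun z => sphChart p z c) y =
      (ContinuousLinearMap.proj (R := ℝ) (φ := fun _ : Fin 3 => ℝ) c).comp
        (fderiv ℝ (sphChart p) y) :=
    ((ContinuousLinearMap.proj (R := ℝ) (φ := fun _ : Fin 3 => ℝ) c).hasFDerivAt.comp y
      h1.hasFDerivAt).fderiv
  rw [h3]
  rfl

/-- Components in `(τ, θ, φ)` of a one-form on the patch `p`. -/
def sphForm (A : Patch → Coord → Fin 3 → ℝ) (p : Patch) (y : Coord) (a : Fin 3) : ℝ :=
  ∑ c, jac p y a c * A p (sphChart p y) c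

/-- The two parts of a one-form agree on the overlap. -/
def FormGlobal (A : Patch → Coord → Fin 3 → ℝ) : Prop :=
  ∀ y, InOverlap y → sphForm A .north y = sphForm A .south y

/-- The diagonal of the inverse metric in spherical coordinates. -/
def sphInv (y : Coord) : Fin 3 → ℝ :=
  ![-1, (Real.cosh (y 0) ^ 2)⁻¹, (Real.cosh (y 0) ^ 2 * Real.sin (y 1) ^ 2)⁻¹]

/-- The inverse of the relation J M Jᵀ = diag for the metric. It allows contractions in either chart
to be evaluated in the common spherical coordinates, which is how traces and contractions are seen
to be globally defined. -/
theorem metricInv_sphChart (p : Patch) {y : Coord} (hy : InOverlap y) (c d : Fin 3) :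
    metricInv (sphChart p y) c d = ∑ a, jac p y a c * sphInv y a * jac p y a d := by
  have hs : Real.sin (y 1) ≠ 0 := (Real.sin_pos_of_pos_of_lt_pi hy.1 hy.2).ne'
  have hC := (Real.cosh_pos (y 0)).ne'
  set J : Matrix (Fin 3) (Fin 3) ℝ := Matrix.of (jac p y) with hJ
  set M := metric (sphChart p y) with hM
  have h1 : J * M * J.transpose = Matrix.diagonal ![-1, Real.cosh (y 0) ^ 2,
      Real.cosh (y 0) ^ 2 * Real.sin (y 1) ^ 2] := by
    rw [← sphComponents_metric p y hy]
    ext a b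
    simp only [Matrix.mul_apply, Matrix.of_apply, Matrix.transpose_apply, sphComponents, hJ, hM,
      jac, Finset.sum_mul]
    rw [Finset.sum_comm]
    exact Finset.sum_congr rfl fun c _ => Finset.sum_congr rfl fun d _ => by ring
  have h2 : J * (M * (J.transpose * Matrix.diagonal (sphInv y))) = 1 := by
    rw [← Matrix.mul_assoc, ← Matrix.mul_assoc, h1, Matrix.diagonal_mul_diagonal,
      ← Matrix.diagonal_one]
    congr 1
    funext i
    fin_cases i <;> simp [sphInv]
    · field_simp
    · field_simp
  have h3 := mul_eq_one_comm.1 h2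
  rw [Matrix.mul_assoc] at h3
  have h4 : M⁻¹ = J.transpose * Matrix.diagonal (sphInv y) * J := Matrix.inv_eq_right_inv h3
  unfold metricInv
  rw [← hM, h4]
  simp [Matrix.mul_apply, Matrix.diagonal_apply, hJ]

theorem sphComponents_eq (T : TensorField) (p : Patch) (y : Coord) (a b : Fin 3) :
    sphComponents T p y a b = ∑ c, ∑ d, jac p y a c * jac p y b d * T p (sphChart p y) c d := rfl

variable {T U : TensorField} {A B : Patch → Coord → Fin 3 → ℝ} {Φ Ψ : ScalarField}

theorem sphComponents_mul (A B : Patch → Coord → Fin 3 → ℝ) (p : Patch) (y : Coord)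
    (a b : Fin 3) : sphComponents (fun p x a b => A p x a * B p x b) p y a b =
      sphForm A p y a * sphForm B p y b := by
  rw [sphComponents_eq]
  simp only [sphForm, Fin.sum_univ_three]
  ring

theorem FormGlobal.mul (hA : FormGlobal A) (hB : FormGlobal B) :
    TensorField.IsGlobal (fun p x a b => A p x a * B p x b) := by
  intro y hy
  funext a b
  rw [sphComponents_mul, sphComponents_mul, hA y hy, hB y hy]

theorem ScalarField.IsGlobal.formGlobal (hs : Φ.IsSmooth) (hΦ : Φ.IsGlobal) :
    FormGlobal (fun p x a => pd a (Φ p) x) := by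
  intro y hy
  funext a
  unfold sphForm
  rw [← pd_comp_sphChart .north hy ((hs _).differentiable (by simp) _),
    ← pd_comp_sphChart .south hy ((hs _).differentiable (by simp) _)]
  refine pd_congr ?_
  filter_upwards [isOpen_overlap.mem_nhds hy] with z hz using hΦ z hz

theorem FormGlobal.smul (hΦ : Φ.IsGlobal) (hA : FormGlobal A) :
    FormGlobal (fun p x a => Φ p x * A p x a) := by
  intro y hy
  have := congrFun (hA y hy)
  funext a
  have h := this a
  simp only [sphForm, Fin.sum_univ_three] at h ⊢
  rw [hΦ y hy]
  linear_combination Φ .south (sphChart .south y) * h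

theorem FormGlobal.add (hA : FormGlobal A) (hB : FormGlobal B) :
    FormGlobal (fun p x a => A p x a + B p x a) := by
  intro y hy
  funext a
  have h1 := congrFun (hA y hy) a
  have h2 := congrFun (hB y hy) a
  simp only [sphForm, mul_add, Finset.sum_add_distrib] at h1 h2 ⊢
  rw [h1, h2]

theorem FormGlobal.sum {ι : Type} (s : Finset ι) {A : ι → Patch → Coord → Fin 3 → ℝ}
    (hA : ∀ i, FormGlobal (A i)) : FormGlobal (fun p x a => ∑ i ∈ s, A i p x a) := by
  intro y hy
  funext a
  have h1 := fun i => congrFun (hA i y hy) a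
  simp only [sphForm, Finset.mul_sum] at h1 ⊢
  rw [Finset.sum_comm, Finset.sum_comm (s := Finset.univ)]
  exact Finset.sum_congr rfl fun i _ => h1 i

theorem sphComponents_add (T U : TensorField) (p : Patch) (y : Coord) :
    sphComponents (T + U) p y = sphComponents T p y + sphComponents U p y := by
  funext a b
  simp only [sphComponents_eq, Pi.add_apply, mul_add, Finset.sum_add_distrib]

theorem sphComponents_sub (T U : TensorField) (p : Patch) (y : Coord) :
    sphComponents (T - U) p y = sphComponents T p y - sphComponents U p y := by
  funext a b
  simp only [sphComponents_eq, Pi.sub_apply, mul_sub, Finset.sum_sub_distrib]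

theorem sphComponents_smul (c : ℝ) (T : TensorField) (p : Patch) (y : Coord) :
    sphComponents (c • T) p y = c • sphComponents T p y := by
  funext a b
  simp only [sphComponents_eq, Pi.smul_apply, smul_eq_mul, Finset.mul_sum]
  exact Finset.sum_congr rfl fun i _ => Finset.sum_congr rfl fun j _ => by ring

theorem sphComponents_sum {ι : Type} (s : Finset ι) (T : ι → TensorField) (p : Patch)
    (y : Coord) : sphComponents (∑ i ∈ s, T i) p y = ∑ i ∈ s, sphComponents (T i) p y := by
  classical
  induction s using Finset.induction_on with
  | empty => funext a b; simp [sphComponents_eq]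
  | insert i s hi ih => rw [Finset.sum_insert hi, Finset.sum_insert hi, sphComponents_add, ih]

theorem TensorField.IsGlobal.add (hT : T.IsGlobal) (hU : U.IsGlobal) : (T + U).IsGlobal :=
  fun y hy => by rw [sphComponents_add, sphComponents_add, hT y hy, hU y hy]

theorem TensorField.IsGlobal.sub (hT : T.IsGlobal) (hU : U.IsGlobal) : (T - U).IsGlobal :=
  fun y hy => by rw [sphComponents_sub, sphComponents_sub, hT y hy, hU y hy]

theorem TensorField.IsGlobal.smul (c : ℝ) (hT : T.IsGlobal) : (c • T).IsGlobal :=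
  fun y hy => by rw [sphComponents_smul, sphComponents_smul, hT y hy]

theorem TensorField.IsGlobal.sum {ι : Type} (s : Finset ι) {T : ι → TensorField}
    (hT : ∀ i, (T i).IsGlobal) : (∑ i ∈ s, T i).IsGlobal :=
  fun y hy => by
    rw [sphComponents_sum, sphComponents_sum]
    exact Finset.sum_congr rfl fun i _ => hT i y hy

/-- Contraction of the second index of a tensor with a one-form. -/
theorem sphForm_contract (T : TensorField) (A : Patch → Coord → Fin 3 → ℝ) (p : Patch)
    {y : Coord} (hy : InOverlap y) (a : Fin 3) :
    sphForm (fun p x a => ∑ b, ∑ c, T p x a b * metricInv x b c * A p x c) p y a =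
      ∑ e, sphComponents T p y a e * sphInv y e * sphForm A p y e := by
  simp only [sphForm, sphComponents_eq, metricInv_sphChart p hy, Fin.sum_univ_three]
  ring

theorem FormGlobal.contract (hT : T.IsGlobal) (hA : FormGlobal A) :
    FormGlobal (fun p x a => ∑ b, ∑ c, T p x a b * metricInv x b c * A p x c) := by
  intro y hy
  funext a
  rw [sphForm_contract _ _ _ hy, sphForm_contract _ _ _ hy, hT y hy, hA y hy]

theorem trace_sphChart (T : TensorField) (p : Patch) {y : Coord} (hy : InOverlap y) :
    trace (T p) (sphChart p y) = ∑ e, sphInv y e * sphComponents T p y e e := by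
  simp only [trace, sphComponents_eq, metricInv_sphChart p hy, Fin.sum_univ_three]
  ring

theorem TensorField.IsGlobal.trace (hT : T.IsGlobal) :
    ScalarField.IsGlobal (fun p => DeSitter.trace (T p)) := by
  intro y hy
  dsimp only
  rw [trace_sphChart T _ hy, trace_sphChart T _ hy, hT y hy]

theorem zeta_sphChart (μ : Fin 4) (p : Patch) {y : Coord} (hy : InOverlap y) :
    zeta μ p (sphChart p y) =
      ![Real.sinh (y 0), Real.cosh (y 0), Real.cosh (y 0), Real.cosh (y 0)] μ
        * sphHarmonic y μ := by
  have h0 : sphChart p y 0 = y 0 := by cases p <;> rfl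
  have h := dir_sphChart p y hy
  unfold zeta
  rw [h0]
  fin_cases μ
  · simp [sphHarmonic]
  · exact congrArg _ (h 0)
  · exact congrArg _ (h 1)
  · exact congrArg _ (h 2)

theorem zeta_regular (μ : Fin 4) : (zeta μ).IsRegular :=
  ⟨smooth_zeta μ, fun y hy => by rw [zeta_sphChart μ _ hy, zeta_sphChart μ _ hy]⟩

theorem ScalarField.IsGlobal.add (hΦ : Φ.IsGlobal) (hΨ : Ψ.IsGlobal) : (Φ + Ψ).IsGlobal :=
  fun y hy => by simp [hΦ y hy, hΨ y hy]

theorem ScalarField.IsGlobal.mul (hΦ : Φ.IsGlobal) (hΨ : Ψ.IsGlobal) :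
    ScalarField.IsGlobal (fun p x => Φ p x * Ψ p x) :=
  fun y hy => by simp [hΦ y hy, hΨ y hy]

theorem inner_global (hA : FormGlobal A) (hB : FormGlobal B) :
    ScalarField.IsGlobal (fun p x => ∑ a, ∑ b, metricInv x a b * (A p x a * B p x b)) :=
  (hA.mul hB).trace

theorem ambGrad_eq (p : Patch) (μ : Fin 4) (Φ : Coord → ℝ) (x : Coord) :
    ambGrad p μ Φ x = ∑ a, ∑ b, metricInv x a b * (pd a Φ x * pd b (zeta μ p) x)
      + Φ x * zeta μ p x := by
  unfold ambGrad
  simp only [frame_eq, Finset.mul_sum]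
  congr 1
  exact Finset.sum_congr rfl fun i _ => Finset.sum_congr rfl fun j _ => by ring

theorem ScalarField.IsRegular.ambGrad (hΦ : Φ.IsRegular) (μ : Fin 4) :
    ScalarField.IsRegular (fun p => ambGrad p μ (Φ p)) := by
  have hz := zeta_regular μ
  refine ⟨fun p => smooth_ambGrad p μ (hΦ.1 p), ?_⟩
  have h := (inner_global (hΦ.2.formGlobal hΦ.1) (hz.2.formGlobal hz.1)).add
    (hΦ.2.mul hz.2)
  intro y hy
  have := h y hy
  simp only [ambGrad_eq]
  exact this

theorem hessPlus_eq (Φ : ScalarField) (p : Patch) : hessPlus Φ p = hessPlusAt (Φ p) := rfl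

theorem TensorField.isGlobal_of_forms {A B : Fin 4 → Patch → Coord → Fin 3 → ℝ}
    (hA : ∀ μ, FormGlobal (A μ)) (hB : ∀ μ, FormGlobal (B μ))
    (h : ∀ p x a b, T p x a b = ∑ μ, eta μ * (A μ p x a * B μ p x b)) : T.IsGlobal := by
  have e : T = ∑ μ, eta μ • (fun p x a b => A μ p x a * B μ p x b : TensorField) := by
    funext p x a b
    simp [h, Finset.sum_apply]
  rw [e]
  exact TensorField.IsGlobal.sum _ fun μ => ((hA μ).mul (hB μ)).smul _

/-- `S Φ` is a smooth tensor field on `dS₃` if `Φ` is a smooth function on `dS₃`. -/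
theorem ScalarField.IsRegular.hessPlus (hΦ : Φ.IsRegular) : (hessPlus Φ).IsRegular := by
  refine ⟨fun p => smooth_hessPlusAt (hΦ.1 p), ?_⟩
  -- SΦ is a sum of products of differentials of global functions, ∑ η dF^μ ⊗ dX_μ, so second
  -- derivatives never have to be transformed between the charts.
  refine TensorField.isGlobal_of_forms
    (A := fun μ p x a => pd a (DeSitter.ambGrad p μ (Φ p)) x)
    (B := fun μ p x a => pd a (zeta μ p) x)
    (fun μ => (hΦ.ambGrad μ).2.formGlobal (hΦ.ambGrad μ).1)
    (fun μ => (zeta_regular μ).2.formGlobal (zeta_regular μ).1) fun p x a b => ?_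
  have := sum_eta_formOf_pd p (hessPlusAt (Φ p)) x a b
  rw [hessPlus_eq, ← this]
  exact Finset.sum_congr rfl fun μ _ => by rw [pd_ambGrad p μ (hΦ.1 p)]; ring

theorem formOf_global (hT : T.IsGlobal) (μ : Fin 4) : FormGlobal (fun p => formOf p μ (T p)) := by
  have h := FormGlobal.contract hT ((zeta_regular μ).2.formGlobal (zeta_regular μ).1)
  have e : (fun p => formOf p μ (T p)) =
      fun p x a => ∑ b, ∑ c, T p x a b * metricInv x b c * pd c (zeta μ p) x := by
    funext p x a
    simp only [formOf, frame_eq, Finset.mul_sum, mul_assoc]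
  rw [e]
  exact h

theorem overlap_point : InOverlap ![0, Real.pi / 2, 0] := by
  constructor
  · simpa using Real.pi_pos
  · simpa using Real.pi_pos

/-- In spherical coordinates with φ ranging over all of ℝ, the overlap is convex and therefore
connected. -/
theorem eq_of_pd_eq_zero_overlap {f : Coord → ℝ} (hf : ∀ y, InOverlap y → DifferentiableAt ℝ f y)
    (h : ∀ a y, InOverlap y → pd a f y = 0) {y z : Coord} (hy : InOverlap y) (hz : InOverlap z) :
    f y = f z := by
  refine isOpen_overlap.is_const_of_fderiv_eq_zero convex_overlap.isPreconnected
    (fun w hw => (hf w hw).differentiableWithinAt) (fun w hw => ?_) hy hz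
  ext v
  simp [fderiv_eq_sum_pd, fun a => h a w hw]

/-- A smooth symmetric curl-free tensor field on `dS₃` is `S Φ`. -/
theorem exists_hessPlus_eq (hT : T.IsRegular) (hs : T.IsSymmetric) (hc : T.IsCurlFree) :
    ∃ Φ : ScalarField, Φ.IsRegular ∧ hessPlus Φ = T := by
  choose Φ hΦ hΦT using fun p => exists_hessPlusAt (hT.1 p) (hs p) (hc p)
  set F := fun p μ => ambGrad p μ (Φ p) with hF
  have hFs : ∀ p μ, Smooth (F p μ) := fun p μ => smooth_ambGrad p μ (hΦ p)
  -- The forms of T agree on the overlap, so their primitives on the two charts differ there by a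
  -- constant, which is read off at one point of the equator.
  have hconst : ∀ μ y, InOverlap y → F .north μ (sphChart .north y) =
      F .south μ (sphChart .south y) + (F .north μ (sphChart .north ![0, Real.pi / 2, 0]) -
        F .south μ (sphChart .south ![0, Real.pi / 2, 0])) := by
    intro μ y hy
    have hd : ∀ p z, InOverlap z → DifferentiableAt ℝ (fun w => F p μ (sphChart p w)) z :=
      fun p z hz => ((hFs p μ).diff _).comp z ((contDiffAt_sphChart p hz).differentiableAt
        (by simp))
    have := eq_of_pd_eq_zero_overlap
      (f := fun w => F .north μ (sphChart .north w) - F .south μ (sphChart .south w))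
      (fun z hz => (hd .north z hz).fun_sub (hd .south z hz)) (fun a z hz => ?_) hy overlap_point
    · linarith
    · rw [pd_sub a (hd .north z hz) (hd .south z hz), pd_comp_sphChart .north hz ((hFs _ _).diff _),
        pd_comp_sphChart .south hz ((hFs _ _).diff _)]
      have h1 := congrFun (formOf_global hT.2 μ z hz) a
      simp only [sphForm] at h1
      simp only [hF, pd_ambGrad _ μ (hΦ _), hΦT, h1, sub_self]
  set c : Fin 4 → ℝ := fun μ => F .north μ (sphChart .north ![0, Real.pi / 2, 0]) -
        F .south μ (sphChart .south ![0, Real.pi / 2, 0]) with hcdef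
  -- The constants are absorbed into the southern primitives. The function X·F rebuilt from the
  -- corrected primitives has the same image under S and no jump.
  set d : Patch → Fin 4 → ℝ := fun p μ => match p with
    | .north => 0
    | .south => c μ with hd
  have hk := fun p => hessPlusAt_of_form p (T := T p) (F := fun μ x => F p μ x + d p μ)
    (fun μ => (hFs p μ).add contDiff_const) fun μ a x => by
      rw [pd_add a ((hFs p μ).diff x) (differentiableAt_const _), pd_const, add_zero]
      simp only [hF]
      rw [pd_ambGrad p μ (hΦ p), hΦT]
  refine ⟨fun p x => ∑ μ, eta μ * zeta μ p x * (F p μ x + d p μ), ⟨fun p => (hk p).1, ?_⟩,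
    funext fun p => (hk p).2⟩
  intro y hy
  refine Finset.sum_congr rfl fun μ _ => ?_
  rw [(zeta_regular μ).2 y hy]
  congr 1
  exact (add_zero _).trans (hconst μ y hy)

theorem isTranslation_of_hessPlus_eq_zero (hΦ : Φ.IsRegular) (h : hessPlus Φ = 0) :
    IsTranslation Φ := by
  have hp : ∀ p, hessPlusAt (Φ p) = 0 := fun p => congrFun h p
  refine ⟨fun μ => eta μ * ambGrad .north μ (Φ .north) (sphChart .north ![0, Real.pi / 2, 0]), ?_⟩
  funext p x
  have h1 := sum_eta_ambGrad_zeta p (Φ p) x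
  -- The ambient gradient is constant on each chart and has no jump, so both charts see the same
  -- constants.
  have h2 : ∀ μ, ambGrad p μ (Φ p) x =
      ambGrad .north μ (Φ .north) (sphChart .north ![0, Real.pi / 2, 0]) := by
    intro μ
    rw [ambGrad_const_of_hessPlusAt_eq_zero (hΦ.1 p) (hp p) p μ x
      (sphChart p ![0, Real.pi / 2, 0])]
    cases p
    · rfl
    · exact ((hΦ.ambGrad μ).2 _ overlap_point).symm
  rw [← h1]
  simp only [h2, Finset.sum_apply, Pi.smul_apply, smul_eq_mul]
  exact Finset.sum_congr rfl fun μ _ => by ring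

/-! ### Linearity of `S` and the ambiguity of scalar potentials. -/

theorem hessPlus_add (hΦ : Φ.IsSmooth) (hΨ : Ψ.IsSmooth) :
    hessPlus (Φ + Ψ) = hessPlus Φ + hessPlus Ψ :=
  funext fun p => hessPlusAt_add (hΦ p) (hΨ p)

theorem hessPlus_smul (c : ℝ) (hΦ : Φ.IsSmooth) : hessPlus (c • Φ) = c • hessPlus Φ :=
  funext fun p => hessPlusAt_const_mul c (hΦ p)

theorem ScalarField.IsSmooth.add (hΦ : Φ.IsSmooth) (hΨ : Ψ.IsSmooth) : (Φ + Ψ).IsSmooth :=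
  fun p => ContDiff.add (hΦ p) (hΨ p)

theorem ScalarField.IsSmooth.smul (c : ℝ) (hΦ : Φ.IsSmooth) : (c • Φ).IsSmooth :=
  fun p => ContDiff.const_smul c (hΦ p)

theorem ScalarField.IsRegular.add (hΦ : Φ.IsRegular) (hΨ : Ψ.IsRegular) : (Φ + Ψ).IsRegular :=
  ⟨hΦ.1.add hΨ.1, hΦ.2.add hΨ.2⟩

theorem ScalarField.IsRegular.smul (c : ℝ) (hΦ : Φ.IsRegular) : (c • Φ).IsRegular :=
  ⟨hΦ.1.smul c, fun y hy => by simp [hΦ.2 y hy]⟩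

theorem ScalarField.IsRegular.neg (hΦ : Φ.IsRegular) : (-Φ).IsRegular := by
  have := hΦ.smul (-1)
  rwa [neg_one_smul] at this

theorem ScalarField.IsRegular.sub (hΦ : Φ.IsRegular) (hΨ : Ψ.IsRegular) : (Φ - Ψ).IsRegular := by
  rw [sub_eq_add_neg]
  exact hΦ.add hΨ.neg

theorem ScalarField.isRegular_zero : (0 : ScalarField).IsRegular :=
  ⟨fun _ => contDiff_const, fun _ _ => rfl⟩

theorem ScalarField.isRegular_sum {ι : Type} (s : Finset ι) {Φ : ι → ScalarField}
    (h : ∀ i, (Φ i).IsRegular) : (∑ i ∈ s, Φ i).IsRegular := by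
  classical
  induction s using Finset.induction_on with
  | empty => exact isRegular_zero
  | insert i s hi ih => rw [Finset.sum_insert hi]; exact (h i).add ih

theorem hessPlus_neg (hΦ : Φ.IsSmooth) : hessPlus (-Φ) = -hessPlus Φ := by
  rw [← neg_one_smul ℝ Φ, hessPlus_smul _ hΦ, neg_one_smul]

theorem hessPlus_sub (hΦ : Φ.IsRegular) (hΨ : Ψ.IsRegular) :
    hessPlus (Φ - Ψ) = hessPlus Φ - hessPlus Ψ := by
  rw [sub_eq_add_neg, hessPlus_add hΦ.1 hΨ.neg.1, hessPlus_neg hΨ.1, sub_eq_add_neg]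

theorem hessPlus_sum_smul {ι : Type} (s : Finset ι) (c : ι → ℝ) {Φ : ι → ScalarField}
    (h : ∀ i, (Φ i).IsRegular) :
    hessPlus (∑ i ∈ s, c i • Φ i) = ∑ i ∈ s, c i • hessPlus (Φ i) := by
  classical
  induction s using Finset.induction_on with
  | empty =>
    have := hessPlus_smul (0 : ℝ) ScalarField.isRegular_zero.1
    simpa using this
  | insert i s hi ih =>
    rw [Finset.sum_insert hi, Finset.sum_insert hi, hessPlus_add ((h i).smul _).1
      (ScalarField.isRegular_sum s fun i => (h i).smul _).1, ih, hessPlus_smul _ (h i).1]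

theorem hessPlus_zeta (μ : Fin 4) : hessPlus (zeta μ) = 0 := funext fun p => hessPlusAt_zeta μ p

theorem hessPlus_eq_iff (hΦ : Φ.IsRegular) (hΨ : Ψ.IsRegular) :
    hessPlus Ψ = hessPlus Φ ↔ IsTranslation (Ψ - Φ) := by
  rw [← sub_eq_zero, ← hessPlus_sub hΨ hΦ]
  constructor
  · exact isTranslation_of_hessPlus_eq_zero (hΨ.sub hΦ)
  · rintro ⟨c, hc⟩
    rw [hc, hessPlus_sum_smul _ _ zeta_regular]
    simp [hessPlus_zeta]

/-! ### Electric and magnetic parts -/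

section Chart

variable {T U : Coord → Fin 3 → Fin 3 → ℝ}

theorem covD2_add (hT : Smooth T) (hU : Smooth U) (x : Coord) (c a b : Fin 3) :
    covD2 (T + U) x c a b = covD2 T x c a b + covD2 U x c a b := by
  have e : (fun y => (T + U) y a b) = fun y => T y a b + U y a b := rfl
  rw [covD2_eq, covD2_eq, covD2_eq, e,
    pd_add c ((smooth_comp2 hT a b).diff x) ((smooth_comp2 hU a b).diff x)]
  simp only [Pi.add_apply, Fin.sum_univ_three]
  ring

theorem covD2_smul (r : ℝ) (hT : Smooth T) (x : Coord) (c a b : Fin 3) :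
    covD2 (r • T) x c a b = r * covD2 T x c a b := by
  have e : (fun y => (r • T) y a b) = fun y => r * T y a b := rfl
  rw [covD2_eq, covD2_eq, e, pd_const_mul c r ((smooth_comp2 hT a b).diff x)]
  simp only [Pi.smul_apply, smul_eq_mul, Fin.sum_univ_three]
  ring

theorem curl_add (hT : Smooth T) (hU : Smooth U) : curl (T + U) = curl T + curl U := by
  funext x a b
  simp only [Pi.add_apply, curl_eq, covD2_add hT hU]
  fin_cases a <;> simp <;> ring

theorem curl_smul (r : ℝ) (hT : Smooth T) : curl (r • T) = r • curl T := by
  funext x a b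
  simp only [Pi.smul_apply, smul_eq_mul, curl_eq, covD2_smul r hT]
  fin_cases a <;> simp <;> ring

theorem trace_add (T U : Coord → Fin 3 → Fin 3 → ℝ) : trace (T + U) = trace T + trace U := by
  funext x
  simp only [Pi.add_apply, trace_eq]
  ring

theorem trace_smul (r : ℝ) (T : Coord → Fin 3 → Fin 3 → ℝ) : trace (r • T) = r • trace T := by
  funext x
  simp only [Pi.smul_apply, smul_eq_mul, trace_eq]
  ring

theorem divergence_eq_zero (hT : Smooth T) (hs : ∀ x a b, T x a b = T x b a)
    (ht : ∀ x, trace T x = 0) (hc : ∀ x a b, curl T x a b = curl T x b a) (x : Coord)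
    (a : Fin 3) : divergence T x a = 0 := by
  rw [(curl_symm_iff hT hs x).1 (hc x) a, show trace T = fun _ => 0 from funext ht, pd_const]

/-- The identity for curl curl, in which trace and divergence no longer contribute. -/
theorem boxTensor_eq_zero (hT : Smooth T) (hs : ∀ x a b, T x a b = T x b a)
    (ht : ∀ x, trace T x = 0) (hc : ∀ x a b, curl T x a b = curl T x b a)
    (hcc : ∀ x a b, curl (curl T) x a b = 0) (x : Coord) (a b : Fin 3) :
    boxTensor T x a b - 3 * T x a b = 0 := by
  have h := curl_curl hT hs x a b
  have hd : divergence T = fun _ _ => 0 :=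
    funext fun x => funext fun a => divergence_eq_zero hT hs ht hc x a
  rw [hcc, ht, hd, covD1_eq, pd_const] at h
  simp at h
  linarith

theorem curl_zero : curl (0 : Coord → Fin 3 → Fin 3 → ℝ) = 0 := by
  have := curl_smul (0 : ℝ) (T := 0) contDiff_const
  simpa using this

end Chart

variable {T U : TensorField} {Φ Ψ σ : ScalarField}

theorem TensorField.IsSmooth.add (hT : T.IsSmooth) (hU : U.IsSmooth) : (T + U).IsSmooth :=
  fun p => ContDiff.add (hT p) (hU p)

theorem TensorField.IsSmooth.smul (c : ℝ) (hT : T.IsSmooth) : (c • T).IsSmooth :=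
  fun p => ContDiff.const_smul c (hT p)

theorem TensorField.IsSmooth.sub (hT : T.IsSmooth) (hU : U.IsSmooth) : (T - U).IsSmooth :=
  fun p => ContDiff.sub (hT p) (hU p)

theorem TensorField.isSmooth_sum {ι : Type} (s : Finset ι) {T : ι → TensorField}
    (h : ∀ i, (T i).IsSmooth) : (∑ i ∈ s, T i).IsSmooth := by
  classical
  induction s using Finset.induction_on with
  | empty => exact fun p => contDiff_const
  | insert i s hi ih => rw [Finset.sum_insert hi]; exact (h i).add ih

theorem magnetic_eq (k : TensorField) (p : Patch) : magnetic k p = (1 / 2 : ℝ) • curl (k p) := rfl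

theorem magnetic_add (hT : T.IsSmooth) (hU : U.IsSmooth) :
    magnetic (T + U) = magnetic T + magnetic U := by
  funext p
  rw [Pi.add_apply, magnetic_eq, magnetic_eq, magnetic_eq, Pi.add_apply, curl_add (hT p) (hU p),
    smul_add]

theorem magnetic_smul (c : ℝ) (hT : T.IsSmooth) : magnetic (c • T) = c • magnetic T := by
  funext p
  rw [Pi.smul_apply, magnetic_eq, magnetic_eq, Pi.smul_apply, curl_smul c (hT p), smul_comm]

theorem magnetic_sub (hT : T.IsSmooth) (hU : U.IsSmooth) :
    magnetic (T - U) = magnetic T - magnetic U := by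
  have := magnetic_smul (-1) hU
  rw [neg_one_smul, neg_one_smul] at this
  rw [sub_eq_add_neg, magnetic_add hT, this, sub_eq_add_neg]
  rw [← neg_one_smul ℝ U]
  exact hU.smul _

theorem magnetic_sum {ι : Type} (s : Finset ι) {T : ι → TensorField}
    (h : ∀ i, (T i).IsSmooth) : magnetic (∑ i ∈ s, T i) = ∑ i ∈ s, magnetic (T i) := by
  classical
  induction s using Finset.induction_on with
  | empty =>
    funext p
    rw [Finset.sum_empty, Finset.sum_empty, magnetic_eq]
    exact (congrArg _ curl_zero).trans (smul_zero _)
  | insert i s hi ih =>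
    rw [Finset.sum_insert hi, Finset.sum_insert hi,
      magnetic_add (h i) (TensorField.isSmooth_sum s h), ih]

theorem magnetic_hessPlus (hΦ : Φ.IsSmooth) : magnetic (hessPlus Φ) = 0 := by
  funext p x a b
  rw [magnetic_eq]
  simp [hessPlus_eq, curl_hessPlusAt (hΦ p)]

theorem magnetic_eq_zero_iff : magnetic T = 0 ↔ T.IsCurlFree := by
  constructor
  · intro h p x a b
    have := congrFun (congrFun (congrFun (congrFun h p) x) a) b
    simpa [magnetic] using this
  · intro h
    funext p x a b
    simp [magnetic, h p x a b]

theorem hessPlus_isSymmetric (hΦ : Φ.IsSmooth) : (hessPlus Φ).IsSymmetric :=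
  fun p => hessPlusAt_symm (hΦ p)

theorem hessPlus_isTraceless_iff : (hessPlus Φ).IsTraceless ↔ Φ.BoxPlusThree :=
  forall_congr' fun p => forall_congr' fun x => by rw [hessPlus_eq, trace_hessPlusAt]

theorem electric_eq (hσ : σ.IsSmooth) : electric σ = hessPlus (-σ) := by
  rw [hessPlus_neg hσ]
  funext p x a b
  simp only [electric, hessPlus, Pi.neg_apply]
  ring

theorem boxPlusThree_neg (hσ : σ.IsSmooth) : (-σ).BoxPlusThree ↔ σ.BoxPlusThree := by
  rw [← hessPlus_isTraceless_iff, ← hessPlus_isTraceless_iff, hessPlus_neg hσ]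
  refine forall_congr' fun p => forall_congr' fun x => ?_
  rw [← neg_one_smul ℝ (hessPlus σ), Pi.smul_apply, trace_smul]
  simp

theorem IsWeylType.isDivFree (hT : IsWeylType T) : T.IsDivFree := fun p =>
  divergence_eq_zero (hT.regular.1 p) (hT.symmetric p) (hT.traceless p) fun x a b => by
    rw [hT.curlFree p x a b, hT.curlFree p x b a]

theorem IsWeylType.boxMinusThree (hT : IsWeylType T) : T.BoxMinusThree := fun p =>
  boxTensor_eq_zero (hT.regular.1 p) (hT.symmetric p) (hT.traceless p)
    (fun x a b => by rw [hT.curlFree p x a b, hT.curlFree p x b a]) fun x a b => by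
      rw [show curl (T p) = 0 from funext fun x => funext fun a => funext fun b =>
        hT.curlFree p x a b, curl_zero]
      rfl

theorem isWeylType_hessPlus (hΦ : Φ.IsRegular) (h : Φ.BoxPlusThree) : IsWeylType (hessPlus Φ) :=
  ⟨hΦ.hessPlus, hessPlus_isSymmetric hΦ.1, hessPlus_isTraceless_iff.2 h,
    fun p => curl_hessPlusAt (hΦ.1 p)⟩

theorem IsWeylType.exists_potential (hT : IsWeylType T) :
    ∃ Φ : ScalarField, Φ.IsRegular ∧ Φ.BoxPlusThree ∧ T = hessPlus Φ := by
  obtain ⟨Φ, h, e⟩ := exists_hessPlus_eq hT.regular hT.symmetric hT.curlFree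
  refine ⟨Φ, h, hessPlus_isTraceless_iff.1 ?_, e.symm⟩
  rw [e]
  exact hT.traceless

variable {h1 : TensorField}

theorem tensorPotential_eq (σ : ScalarField) (h1 : TensorField) :
    tensorPotential σ h1 = h1 + fun p x a b => 2 * σ p x * metric x a b := rfl

theorem IsConfiguration.smooth_tensorPotential (h : IsConfiguration σ h1) :
    (tensorPotential σ h1).IsSmooth := fun p =>
  ContDiff.add (h.smooth p) (smooth_tensor (T := fun x a b => 2 * σ p x * metric x a b)
    fun a b => (contDiff_const.mul (h.regular_mass_aspect.1 p)).mul (metric_fun_smooth a b))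

theorem IsConfiguration.symmetric_tensorPotential (h : IsConfiguration σ h1) :
    (tensorPotential σ h1).IsSymmetric := fun p x a b => by
  simp only [tensorPotential, h.symmetric p x a b, metric_symm x a b]

theorem magnetic_isSmooth (hT : T.IsSmooth) : (magnetic T).IsSmooth := fun p => by
  rw [magnetic_eq]
  exact
  ContDiff.const_smul (1 / 2 : ℝ) (smooth_curl (hT p))

theorem magnetic_isTraceless (hs : T.IsSymmetric) : (magnetic T).IsTraceless := fun p x => by
  rw [magnetic_eq, trace_smul, Pi.smul_apply, trace_curl (hs p), smul_zero]

/-- The three field equations correspond one by one to the three properties: the scalar equation to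
the trace of E, the vector equation to the antisymmetric part of B, the tensor equation to the curl
of B. -/
theorem onShell_iff (h : IsConfiguration σ h1) :
    OnShell σ (tensorPotential σ h1) ↔ (electric σ).IsTraceless ∧
      (magnetic (tensorPotential σ h1)).IsSymmetric ∧
      (magnetic (tensorPotential σ h1)).IsCurlFree := by
  have hk := h.smooth_tensorPotential
  have hs := h.symmetric_tensorPotential
  set k := tensorPotential σ h1 with hkdef
  have hσ := h.regular_mass_aspect.1
  rw [electric_eq hσ, hessPlus_isTraceless_iff, boxPlusThree_neg hσ]
  have e2 : (magnetic k).IsSymmetric ↔ ∀ p x a, divergence (k p) x a - pd a (trace (k p)) x = 0 := by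
    refine forall_congr' fun p => forall_congr' fun x => ?_
    simp only [sub_eq_zero]
    rw [← curl_symm_iff (hk p) (hs p) x]
    simp [magnetic]
  -- With div k = D tr k, the right side of the identity for curl curl k is the tensor equation. The
  -- equivalence is therefore available only after the vector equation.
  have e3 : (∀ p x a, divergence (k p) x a - pd a (trace (k p)) x = 0) →
      ((magnetic k).IsCurlFree ↔ ∀ p x a b, (boxTensor (k p) x a b - 3 * k p x a b) +
        trace (k p) x * metric x a b - hess (trace (k p)) x a b = 0) := by
    intro hv
    refine forall_congr' fun p => forall_congr' fun x => forall_congr' fun a => forall_congr'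
      fun b => ?_
    have hd : divergence (k p) = fun x a => pd a (trace (k p)) x :=
      funext fun x => funext fun a => sub_eq_zero.1 (hv p x a)
    rw [magnetic_eq, curl_smul _ (smooth_curl (hk p))]
    simp only [Pi.smul_apply, smul_eq_mul, curl_curl (hk p) (hs p), hd]
    rw [mul_eq_zero]
    simp [hess]
  constructor
  · rintro ⟨h1, h2, h3⟩
    exact ⟨h1, e2.2 h2, (e3 h2).2 h3⟩
  · rintro ⟨h1, h2, h3⟩
    exact ⟨h1, e2.1 h2, (e3 (e2.1 h2)).1 h3⟩

theorem IsConfiguration.isWeylType_electric (h : IsConfiguration σ h1)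
    (ho : OnShell σ (tensorPotential σ h1)) : IsWeylType (electric σ) := by
  rw [electric_eq h.regular_mass_aspect.1]
  exact isWeylType_hessPlus h.regular_mass_aspect.neg
    ((boxPlusThree_neg h.regular_mass_aspect.1).2 ho.eq_scalar)

theorem IsConfiguration.isWeylType_magnetic (h : IsConfiguration σ h1)
    (ho : OnShell σ (tensorPotential σ h1)) :
    IsWeylType (magnetic (tensorPotential σ h1)) := by
  obtain ⟨-, h2, h3⟩ := (onShell_iff h).1 ho
  exact ⟨⟨magnetic_isSmooth h.smooth_tensorPotential, h.curvature_global⟩, h2,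
    magnetic_isTraceless h.symmetric_tensorPotential, h3⟩

/-! ### Supertranslations and the ambiguity of tensor potentials. -/

theorem tensorPotential_add_hessPlus (σ : ScalarField) (h1 : TensorField) (ω : ScalarField) :
    tensorPotential σ (h1 + hessPlus ω) = tensorPotential σ h1 + hessPlus ω := by
  rw [tensorPotential_eq, tensorPotential_eq, add_right_comm]

variable {ω : ScalarField}

theorem IsConfiguration.supertranslate (h : IsConfiguration σ h1) (hω : ω.IsRegular) :
    IsConfiguration σ (h1 + hessPlus ω) where
  regular_mass_aspect := h.regular_mass_aspect
  smooth := h.smooth.add hω.hessPlus.1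
  symmetric := fun p x a b => by
    simp only [Pi.add_apply, h.symmetric p x a b, hessPlus_isSymmetric hω.1 p x a b]
  curvature_global := by
    rw [tensorPotential_add_hessPlus, magnetic_add h.smooth_tensorPotential hω.hessPlus.1,
      magnetic_hessPlus hω.1, add_zero]
    exact h.curvature_global

theorem magnetic_supertranslate (hT : T.IsSmooth) (hω : ω.IsSmooth) :
    magnetic (T + hessPlus ω) = magnetic T := by
  have h : (hessPlus ω).IsSmooth := fun p => smooth_hessPlusAt (hω p)
  rw [magnetic_add hT h, magnetic_hessPlus hω, add_zero]

theorem HasNUTTransition.add_global {N : Fin 4 → ℝ} (h : HasNUTTransition T N) (hU : U.IsGlobal) :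
    HasNUTTransition (T + U) N := fun y hy => by
  rw [sphComponents_add, sphComponents_add, hU y hy, add_sub_add_right_eq_sub]
  exact h y hy

/-- By `onShell_iff` the field equations depend only on E and B, and neither changes. -/
theorem OnShell.supertranslate (h : IsConfiguration σ h1) (hω : ω.IsRegular)
    (ho : OnShell σ (tensorPotential σ h1)) :
    OnShell σ (tensorPotential σ h1 + hessPlus ω) := by
  rw [← tensorPotential_add_hessPlus, onShell_iff (h.supertranslate hω),
    tensorPotential_add_hessPlus, magnetic_supertranslate h.smooth_tensorPotential hω.1]
  exact (onShell_iff h).1 ho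

theorem isTraceless_add_hessPlus_iff (hT : T.IsTraceless) :
    (T + hessPlus ω).IsTraceless ↔ ω.BoxPlusThree := by
  rw [← hessPlus_isTraceless_iff]
  refine forall_congr' fun p => forall_congr' fun x => ?_
  rw [Pi.add_apply, trace_add, Pi.add_apply, hT p x, zero_add]

theorem TensorField.IsSymmetric.sub (hT : T.IsSymmetric) (hU : U.IsSymmetric) :
    (T - U).IsSymmetric := fun p x a b => by
  simp only [Pi.sub_apply, hT p x a b, hU p x a b]

theorem TensorField.IsSymmetric.add (hT : T.IsSymmetric) (hU : U.IsSymmetric) :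
    (T + U).IsSymmetric := fun p x a b => by
  simp only [Pi.add_apply, hT p x a b, hU p x a b]

/-- The difference of the potentials is symmetric, curl-free and without jump, so
`exists_hessPlus_eq` applies to it and makes ω a function on dS₃. -/
theorem magnetic_eq_iff (hT : T.IsSmooth) (hU : U.IsSmooth) (hTs : T.IsSymmetric)
    (hUs : U.IsSymmetric) (hg : (U - T).IsGlobal) :
    magnetic U = magnetic T ↔ ∃ ω : ScalarField, ω.IsRegular ∧ U = T + hessPlus ω := by
  constructor
  · intro h
    obtain ⟨ω, hω, e⟩ := exists_hessPlus_eq ⟨hU.sub hT, hg⟩ (hUs.sub hTs)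
      (magnetic_eq_zero_iff.1 (by rw [magnetic_sub hU hT, h, sub_self]))
    exact ⟨ω, hω, by rw [e]; abel⟩
  · rintro ⟨ω, hω, rfl⟩
    exact magnetic_supertranslate hT hω.1

/-- On each patch, tensor potentials of the same tensor differ by `S ω`. -/
theorem exists_eq_add_hessPlus (hT : T.IsSmooth) (hU : U.IsSmooth) (hTs : T.IsSymmetric)
    (hUs : U.IsSymmetric) (h : magnetic U = magnetic T) :
    ∃ ω : ScalarField, ω.IsSmooth ∧ U = T + hessPlus ω := by
  have hc : (U - T).IsCurlFree :=
    magnetic_eq_zero_iff.1 (by rw [magnetic_sub hU hT, h, sub_self])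
  choose ω hω e using fun p => exists_hessPlusAt ((hU.sub hT) p) (hUs.sub hTs p) (hc p)
  refine ⟨ω, hω, ?_⟩
  have : hessPlus ω = U - T := funext e
  rw [this]; abel

/-! ### The singular representatives in chart coordinates -/

/-- `cosh τ`. -/
def ch (x : Coord) : ℝ := Real.cosh (x 0)

theorem pd_ch (a : Fin 3) (x : Coord) : pd a ch x = ![logD 0 x * ch x, 0, 0] a := by
  have hC := (Real.cosh_pos (x 0)).ne'
  have := pd_cosh0 a x
  change pd a (fun y => Real.cosh (y 0)) x = _
  rw [this]
  fin_cases a <;> simp [logD, ch, Real.tanh_eq_sinh_div_cosh, hC]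

theorem smooth_ch : Smooth ch := smooth_cosh0

theorem ch_rel (x : Coord) : ch x ^ 2 * (1 - logD 0 x ^ 2) = 1 := by
  have hC := (Real.cosh_pos (x 0)).ne'
  simp only [logD, ch, Matrix.cons_val, Real.tanh_eq_sinh_div_cosh]
  field_simp
  rw [Real.cosh_sq]; ring

/-- The components of `k_(μ)`, up to sign, in the chart of either patch. -/
def singChart (μ : Fin 4) (x : Coord) : Fin 3 → Fin 3 → ℝ :=
  let C := ch x
  let t := logD 0 x
  let l := lam x
  let u := logD 1 x
  let v := logD 2 x
  ![symArray 0 (2 * v * (C * (1 - t ^ 2))) (-2 * u * (C * (1 - t ^ 2)))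
      (-2 * (t * C) * (u * v)) (t * C * (u ^ 2 - v ^ 2)) (2 * (t * C) * (u * v)),
    symArray 0 (-3 * (t * (C * (1 - t ^ 2))) * l * v) (3 * (t * (C * (1 - t ^ 2))) * l * u)
      (2 * C * (l + 1) * (u * v)) (-C * (l + 1) * (u ^ 2 - v ^ 2)) (-2 * C * (l + 1) * (u * v)),
    symArray 0 (3 * (t * (C * (1 - t ^ 2))) * (u * v))
      (3 * (t * (C * (1 - t ^ 2))) * (l - u ^ 2))
      (-2 * C * v * (u ^ 2 - (l + 1))) (-C * u * (2 * (l + 1) - (u ^ 2 - v ^ 2)))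
      (2 * C * v * (u ^ 2 - (l + 1))),
    symArray 0 (-3 * (t * (C * (1 - t ^ 2))) * (l - v ^ 2))
      (-3 * (t * (C * (1 - t ^ 2))) * (u * v))
      (-2 * C * u * (v ^ 2 - (l + 1))) (C * v * (2 * (l + 1) - (v ^ 2 - u ^ 2)))
      (2 * C * u * (v ^ 2 - (l + 1)))] μ

/-- The sign of `ζ_μ` under the rotation `(n₁, n₂, n₃) ↦ (-n₁, n₂, -n₃)` that exchanges the
charts. -/
def flip (p : Patch) (μ : Fin 4) : ℝ := ![1, p.sgn, 1, p.sgn] μ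

/-- The two-patch tensor `k_(μ)`. -/
def sing (μ : Fin 4) : TensorField := fun p x a b => flip p μ * singChart μ x a b

theorem singChart_apply_smooth (μ : Fin 4) (a b : Fin 3) :
    Smooth (fun x => singChart μ x a b) := by
  have hC := smooth_ch
  have h0 := smooth_logD 0
  have h1 := smooth_logD 1
  have h2 := smooth_logD 2
  have hl := smooth_lam
  fin_cases μ <;> fin_cases a <;> fin_cases b <;>
    simp only [singChart, symArray, Fin.zero_eta, Fin.isValue, Fin.mk_one, Fin.reduceFinMk,
      Matrix.cons_val] <;> unfold Smooth at * <;> fun_prop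

theorem smooth_singChart (μ : Fin 4) : Smooth (singChart μ) :=
  smooth_tensor (singChart_apply_smooth μ)

theorem sing_smooth (μ : Fin 4) : (sing μ).IsSmooth := fun _ =>
  smooth_tensor fun a b => contDiff_const.mul (singChart_apply_smooth μ a b)

theorem sing_symm (μ : Fin 4) : (sing μ).IsSymmetric := fun p x a b => by
  unfold sing singChart symArray
  fin_cases μ <;> fin_cases a <;> fin_cases b <;> rfl

theorem sing_traceless (μ : Fin 4) : (sing μ).IsTraceless := fun p x => by
  rw [trace_eq]
  unfold sing singChart symArray
  fin_cases μ <;> simp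

/-- `ζ̂_μ` in the chart of either patch, up to sign. -/
def hatChart (μ : Fin 4) (x : Coord) : ℝ :=
  let C := ch x
  let t := logD 0 x
  ![C * (1 + t ^ 2), (3 * t - t ^ 3) * C * (lam x - 1), -((3 * t - t ^ 3) * C * logD 1 x),
    -((3 * t - t ^ 3) * C * logD 2 x)] μ

/-- Up to the sign `flip`, both charts see the same function, because they are exchanged by a
rotation that maps each ζ̂_μ to ±ζ̂_μ. The radial factors are rewritten as polynomials in cosh τ and
tanh τ so that differentiation does not leave the class of polynomials. -/
theorem zetaHat_eq (μ : Fin 4) (p : Patch) : zetaHat μ p = fun x => flip p μ * hatChart μ x := by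
  funext x
  have h := (lam_den_pos x).ne'
  have hC := (Real.cosh_pos (x 0)).ne'
  have hC2 := Real.cosh_sq (x 0)
  cases p <;> fin_cases μ <;>
    simp [zetaHat, dir, hatChart, flip, Patch.sgn, logD, lam, ch, Real.tanh_eq_sinh_div_cosh,
      Real.cosh_two_mul] <;> field_simp <;> grind

theorem smooth_hatChart (μ : Fin 4) : Smooth (hatChart μ) := by
  have hC := smooth_ch
  have h0 := smooth_logD 0
  have h1 := smooth_logD 1
  have h2 := smooth_logD 2
  have hl := smooth_lam
  unfold hatChart
  fin_cases μ <;> simp only [Fin.zero_eta, Fin.isValue, Fin.mk_one, Fin.reduceFinMk,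
      Matrix.cons_val] <;> unfold Smooth at * <;> fun_prop

theorem pd_pow (a : Fin 3) {f : Coord → ℝ} {x : Coord} (n : ℕ) (hf : DifferentiableAt ℝ f x) :
    pd a (fun y => f y ^ n) x = n * f x ^ (n - 1) * pd a f x :=
  pd_comp a (hasDerivAt_pow n (f x)) hf

theorem hatChart_fun (μ : Fin 4) : hatChart μ = ![fun x => ch x * (1 + logD 0 x ^ 2),
    fun x => (3 * logD 0 x - logD 0 x ^ 3) * ch x * (lam x - 1),
    fun x => -((3 * logD 0 x - logD 0 x ^ 3) * ch x * logD 1 x),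
    fun x => -((3 * logD 0 x - logD 0 x ^ 3) * ch x * logD 2 x)] μ := by
  fin_cases μ <;> rfl

theorem pd_hatChart (μ : Fin 4) (b : Fin 3) : pd b (hatChart μ) =
    ![![fun x => (3 * logD 0 x - logD 0 x ^ 3) * ch x, fun _ => 0, fun _ => 0],
      ![fun x => ch x * (3 - 3 * logD 0 x ^ 2 + 2 * logD 0 x ^ 4) * (lam x - 1),
        fun x => (3 * logD 0 x - logD 0 x ^ 3) * ch x * (lam x * logD 1 x),
        fun x => (3 * logD 0 x - logD 0 x ^ 3) * ch x * (lam x * logD 2 x)],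
      ![fun x => -(ch x * (3 - 3 * logD 0 x ^ 2 + 2 * logD 0 x ^ 4) * logD 1 x),
        fun x => -((3 * logD 0 x - logD 0 x ^ 3) * ch x * (logD 1 x ^ 2 - lam x)),
        fun x => -((3 * logD 0 x - logD 0 x ^ 3) * ch x * (logD 1 x * logD 2 x))],
      ![fun x => -(ch x * (3 - 3 * logD 0 x ^ 2 + 2 * logD 0 x ^ 4) * logD 2 x),
        fun x => -((3 * logD 0 x - logD 0 x ^ 3) * ch x * (logD 1 x * logD 2 x)),
        fun x => -((3 * logD 0 x - logD 0 x ^ 3) * ch x * (logD 2 x ^ 2 - lam x))]] μ b := by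
  have hC := smooth_ch.diff
  have h0 := (smooth_logD 0).diff
  have h1 := (smooth_logD 1).diff
  have h2 := (smooth_logD 2).diff
  have hl := smooth_lam.diff
  have p00 : ∀ x, pd 0 (logD 0) x = 1 - logD 0 x ^ 2 := fun x => pd_logD 0 0 x
  have p10 : ∀ x, pd 1 (logD 0) x = 0 := fun x => pd_logD 1 0 x
  have p20 : ∀ x, pd 2 (logD 0) x = 0 := fun x => pd_logD 2 0 x
  rw [hatChart_fun]
  funext x
  fin_cases μ <;> fin_cases b <;>
    simp (disch := fun_prop) [pd_mul, pd_add, pd_sub, pd_neg, pd_const, pd_pow, pd_ch,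
      pd_lam, pd_logD_one, pd_logD_two, p00, p10, p20] <;> ring_nf <;> simp

-- An explicit verification. All components are polynomials in `ch`, `lam` and `logD`, whose
-- derivatives are again such polynomials, and each of the components of the identity follows from
-- `ch_rel` and `logD_rel`.
set_option maxHeartbeats 8000000 in
theorem curl_singChart (μ : Fin 4) (x : Coord) (a b : Fin 3) :
    curl (singChart μ) x a b = hessPlusAt (hatChart μ) x a b := by
  have hC := smooth_ch.diff
  have h0 := (smooth_logD 0).diff
  have h1 := (smooth_logD 1).diff
  have h2 := (smooth_logD 2).diff
  have hl := smooth_lam.diff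
  have p00 : ∀ x, pd 0 (logD 0) x = 1 - logD 0 x ^ 2 := fun x => pd_logD 0 0 x
  have p10 : ∀ x, pd 1 (logD 0) x = 0 := fun x => pd_logD 1 0 x
  have p20 : ∀ x, pd 2 (logD 0) x = 0 := fun x => pd_logD 2 0 x
  have r1 := ch_rel x
  have r2 := logD_rel x
  have hu : conf x = lam x ^ 2 * ch x ^ 2 := rfl
  have n1 := (lam_pos x).ne'
  have n2 : ch x ≠ 0 := (Real.cosh_pos _).ne'
  rw [curl_eq]
  unfold hessPlusAt
  rw [hess_eq, metric_eq]
  simp only [covD2_eq, Fin.sum_univ_three, pd_hatChart]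
  rw [hatChart_fun]
  fin_cases μ <;> fin_cases a <;> fin_cases b <;>
    simp [gam, singChart, symArray, hu] <;>
    simp (disch := fun_prop) only [pd_mul, pd_add, pd_sub, pd_neg, pd_const, pd_pow, pd_ch, pd_lam,
      pd_logD_one, pd_logD_two, p00, p10, p20] <;> simp <;>
    clear hC h0 h1 h2 hl p00 p10 p20 hu <;> field_simp <;> grind

/-! ### Spherical components of the singular representatives -/

/-- The value of the Jacobian matrix. -/
def jacVal (y : Coord) : Patch → Fin 3 → Fin 3 → ℝ
  | .north => ![![1, 0, 0],
      ![0, (2 * Real.cos (y 1 / 2) ^ 2)⁻¹ * Real.cos (y 2),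
        (2 * Real.cos (y 1 / 2) ^ 2)⁻¹ * Real.sin (y 2)],
      ![0, -(Real.sin (y 1 / 2) / Real.cos (y 1 / 2) * Real.sin (y 2)),
        Real.sin (y 1 / 2) / Real.cos (y 1 / 2) * Real.cos (y 2)]]
  | .south => ![![1, 0, 0],
      ![0, -((2 * Real.sin (y 1 / 2) ^ 2)⁻¹ * Real.cos (y 2)),
        (2 * Real.sin (y 1 / 2) ^ 2)⁻¹ * Real.sin (y 2)],
      ![0, -(Real.cos (y 1 / 2) / Real.sin (y 1 / 2) * Real.sin (y 2)),
        -(Real.cos (y 1 / 2) / Real.sin (y 1 / 2) * Real.cos (y 2))]]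

theorem jac_eq (p : Patch) {y : Coord} (hy : InOverlap y) (a c : Fin 3) :
    jac p y a c = jacVal y p a c := by
  obtain ⟨hs, hc⟩ := half_angle_ne y hy
  have dt : HasDerivAt (fun t : ℝ => Real.tan (t / 2)) (1 / Real.cos (y 1 / 2) ^ 2 * (1 / 2))
      (y 1) := HasDerivAt.comp (h := fun t : ℝ => t / 2) (h₂ := Real.tan) (y 1)
        (Real.hasDerivAt_tan hc) ((hasDerivAt_id' (y 1)).div_const 2)
  have ht : Real.tan (y 1 / 2) ≠ 0 := by
    rw [Real.tan_eq_sin_div_cos]; exact div_ne_zero hs hc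
  have dti := dt.fun_inv ht
  have dc := Real.hasDerivAt_cos (y 2)
  have ds := Real.hasDerivAt_sin (y 2)
  have ds' : HasDerivAt (fun t : ℝ => -Real.sin t) (-Real.cos (y 2)) (y 2) := ds.fun_neg
  cases p with
  | north =>
    have j0 : ∀ a, pd a (fun z => sphChart .north z 0) y = _ := fun a => pd_time a y
    have j1 : ∀ a, pd a (fun z => sphChart .north z 1) y = _ := fun a => pd_radial_mul dt dc a
    have j2 : ∀ a, pd a (fun z => sphChart .north z 2) y = _ := fun a => pd_radial_mul dt ds a
    unfold jac
    fin_cases c <;> fin_cases a <;> simp [j0, j1, j2, jacVal, Real.tan_eq_sin_div_cos] <;> ring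
  | south =>
    have j0 : ∀ a, pd a (fun z => sphChart .south z 0) y = _ := fun a => pd_time a y
    have j1 : ∀ a, pd a (fun z => sphChart .south z 1) y = _ := fun a => pd_radial_mul dti dc a
    have j2 : ∀ a, pd a (fun z => sphChart .south z 2) y = _ := fun a => by
      have := pd_radial_mul dti ds' a
      simp only [mul_neg] at this
      exact this
    unfold jac
    fin_cases c <;> fin_cases a <;> simp [j0, j1, j2, jacVal, Real.tan_eq_sin_div_cos] <;>
      field_simp

/-- `2 / (1 + x² + y²)` on the patch `p`, in spherical coordinates. -/
def sphLam (y : Coord) : Patch → ℝ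
  | .north => 2 * Real.cos (y 1 / 2) ^ 2
  | .south => 2 * Real.sin (y 1 / 2) ^ 2

theorem lam_sphChart (p : Patch) {y : Coord} (hy : InOverlap y) :
    lam (sphChart p y) = sphLam y p := by
  obtain ⟨hs, hc⟩ := half_angle_ne y hy
  have q1 := Real.sin_sq_add_cos_sq (y 1 / 2)
  have q2 := Real.sin_sq_add_cos_sq (y 2)
  unfold lam
  rw [div_eq_iff (lam_den_pos _).ne']
  cases p <;> simp [sphChart, sphLam, Real.tan_eq_sin_div_cos] <;> field_simp <;> grind

theorem logD_sphChart (p : Patch) {y : Coord} (hy : InOverlap y) :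
    logD 1 (sphChart p y) = -(2 * Real.sin (y 1 / 2) * Real.cos (y 1 / 2) * Real.cos (y 2)) ∧
    logD 2 (sphChart p y) =
      -(p.sgn * (2 * Real.sin (y 1 / 2) * Real.cos (y 1 / 2) * Real.sin (y 2))) := by
  obtain ⟨hs, hc⟩ := half_angle_ne y hy
  simp only [logD, lam_sphChart p hy]
  cases p <;> simp [sphChart, sphLam, Real.tan_eq_sin_div_cos, Patch.sgn] <;>
    constructor <;> field_simp

-- Connects the chart expressions, which are visibly smooth at the pole of their patch, with the
-- prescribed spherical components. The two values of c are the two values of `Patch.sgn`.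
set_option maxHeartbeats 4000000 in
theorem sphComponents_sing (μ : Fin 4) (p : Patch) {y : Coord} (hy : InOverlap y) :
    sphComponents (sing μ) p y = singularComponents p.sgn μ y := by
  obtain ⟨hs, hc⟩ := half_angle_ne y hy
  have hC := (Real.cosh_pos (y 0)).ne'
  have hC2 := Real.cosh_sq (y 0)
  have q1 := Real.sin_sq_add_cos_sq (y 1 / 2)
  have q2 := Real.sin_sq_add_cos_sq (y 2)
  have e : Real.sin (y 1) = 2 * Real.sin (y 1 / 2) * Real.cos (y 1 / 2) := by
    rw [← Real.sin_two_mul]; ring_nf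
  have e' : Real.cos (y 1) = Real.cos (y 1 / 2) ^ 2 - Real.sin (y 1 / 2) ^ 2 := by
    rw [← Real.cos_two_mul']; ring_nf
  have hch : ch (sphChart p y) = Real.cosh (y 0) := by cases p <;> rfl
  have h0 : logD 0 (sphChart p y) = Real.tanh (y 0) := by cases p <;> rfl
  have h1 := (logD_sphChart p hy).1
  have h2 := (logD_sphChart p hy).2
  funext a b
  rw [sphComponents_eq]
  cases p <;> simp only [jac_eq _ hy, jacVal, sphLam, Fin.sum_univ_three, sing, singChart, hch, h0, h1, h2, lam_sphChart _ hy,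
    singularComponents, Real.cos_three_mul, Real.cos_two_mul, e, e', Real.tanh_eq_sinh_div_cosh] <;>
    -- In terms of the half angle θ/2 everything is rational. With the trigonometric and hyperbolic
    -- functions replaced by unknowns, only their three quadratic relations are used.
    generalize Real.sin (y 1 / 2) = s at * <;>
    generalize Real.cos (y 1 / 2) = c at * <;>
    generalize Real.sin (y 2) = Q at * <;>
    generalize Real.cos (y 2) = R at * <;>
    generalize Real.cosh (y 0) = C at * <;>
    generalize Real.sinh (y 0) = S at * <;>
    clear e e' h0 h1 h2 hch <;>
    fin_cases μ <;> fin_cases a <;> fin_cases b <;>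
    simp [symArray, flip, Patch.sgn] <;> field_simp <;> grind

theorem zetaHat_smooth (μ : Fin 4) : (zetaHat μ).IsSmooth := fun p => by
  rw [zetaHat_eq]
  exact contDiff_const.mul (smooth_hatChart μ)

theorem zetaHat_sphChart (μ : Fin 4) (p : Patch) {y : Coord} (hy : InOverlap y) :
    zetaHat μ p (sphChart p y) = ![Real.cosh (2 * y 0) / Real.cosh (y 0),
      (2 * Real.sinh (y 0) + Real.tanh (y 0) / Real.cosh (y 0)) * sphHarmonic y 1,
      (2 * Real.sinh (y 0) + Real.tanh (y 0) / Real.cosh (y 0)) * sphHarmonic y 2,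
      (2 * Real.sinh (y 0) + Real.tanh (y 0) / Real.cosh (y 0)) * sphHarmonic y 3] μ := by
  have h0 : sphChart p y 0 = y 0 := by cases p <;> rfl
  have h1 := dir_sphChart p y hy 0
  have h2 := dir_sphChart p y hy 1
  have h3 := dir_sphChart p y hy 2
  simp only [Fin.succ_zero_eq_one, Fin.succ_one_eq_two] at h1 h2
  rw [show (2 : Fin 3).succ = 3 from rfl] at h3
  unfold zetaHat
  rw [h0, h1, h2, h3]

theorem zetaHat_regular (μ : Fin 4) : (zetaHat μ).IsRegular :=
  ⟨zetaHat_smooth μ, fun y hy => by rw [zetaHat_sphChart μ _ hy, zetaHat_sphChart μ _ hy]⟩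

theorem magnetic_two_sing (μ : Fin 4) : magnetic ((2 : ℝ) • sing μ) = hessPlus (zetaHat μ) := by
  funext p
  have e : sing μ p = flip p μ • singChart μ := rfl
  have e' : zetaHat μ p = fun x => flip p μ * hatChart μ x := zetaHat_eq μ p
  have e'' : curl (singChart μ) = hessPlusAt (hatChart μ) := by
    funext x a b
    exact curl_singChart μ x a b
  rw [magnetic_smul _ (sing_smooth μ), Pi.smul_apply, magnetic_eq, smul_smul, e,
    curl_smul _ (smooth_singChart μ), hessPlus_eq, e', hessPlusAt_const_mul _ (smooth_hatChart μ), e'']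
  norm_num
  rfl

theorem magnetic_sing (μ : Fin 4) : magnetic (sing μ) = (1 / 2 : ℝ) • hessPlus (zetaHat μ) := by
  rw [← magnetic_two_sing, magnetic_smul _ (sing_smooth μ), smul_smul]
  norm_num

theorem curl_sing (μ : Fin 4) (p : Patch) : curl (sing μ p) = hessPlusAt (zetaHat μ p) := by
  have := congrFun (magnetic_two_sing μ) p
  rw [magnetic_smul _ (sing_smooth μ), Pi.smul_apply, magnetic_eq, smul_smul] at this
  norm_num at this
  rw [this, hessPlus_eq]

theorem sing_divFree (μ : Fin 4) : (sing μ).IsDivFree := fun p =>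
  divergence_eq_zero (sing_smooth μ p) (sing_symm μ p) (sing_traceless μ p) fun x a b => by
    rw [curl_sing, hessPlusAt_symm (zetaHat_smooth μ p)]

theorem sing_boxMinusThree (μ : Fin 4) : (sing μ).BoxMinusThree := fun p =>
  boxTensor_eq_zero (sing_smooth μ p) (sing_symm μ p) (sing_traceless μ p) (fun x a b => by
    rw [curl_sing, hessPlusAt_symm (zetaHat_smooth μ p)]) fun x a b => by
    rw [curl_sing, curl_hessPlusAt (zetaHat_smooth μ p)]

theorem sing_isSingularRepresentative (μ : Fin 4) : IsSingularRepresentative μ (sing μ) :=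
  ⟨sing_smooth μ, fun _ hy => sphComponents_sing μ .north hy,
    fun _ hy => sphComponents_sing μ .south hy⟩

theorem singularComponents_sub (μ : Fin 4) {y : Coord} (hy : InOverlap y) :
    singularComponents (-1) μ y - singularComponents 1 μ y = deltaK μ y := by
  have hs : Real.sin (y 1) ≠ 0 := (Real.sin_pos_of_pos_of_lt_pi hy.1 hy.2).ne'
  have hC := (Real.cosh_pos (y 0)).ne'
  funext a b
  fin_cases μ <;> fin_cases a <;> fin_cases b <;>
    simp [singularComponents, deltaK, symArray] <;> field_simp <;> ring

theorem hasNUTTransition_sum_sing (N : Fin 4 → ℝ) : HasNUTTransition (∑ μ, N μ • sing μ) N := by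
  intro y hy
  rw [sphComponents_sum, sphComponents_sum, ← Finset.sum_sub_distrib]
  refine Finset.sum_congr rfl fun μ _ => ?_
  rw [sphComponents_smul, sphComponents_smul, ← smul_sub, sphComponents_sing μ _ hy,
    sphComponents_sing μ _ hy]
  exact congrArg _ (singularComponents_sub μ hy)

theorem sum_sing_smooth (N : Fin 4 → ℝ) : (∑ μ, N μ • sing μ).IsSmooth :=
  TensorField.isSmooth_sum _ fun μ => (sing_smooth μ).smul (N μ)

theorem magnetic_sum_sing (N : Fin 4 → ℝ) :
    magnetic (∑ μ, N μ • sing μ) = hessPlus (∑ μ, (N μ / 2) • zetaHat μ) := by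
  rw [magnetic_sum _ fun μ => (sing_smooth μ).smul (N μ),
    hessPlus_sum_smul _ _ zetaHat_regular]
  refine Finset.sum_congr rfl fun μ _ => ?_
  rw [magnetic_smul _ (sing_smooth μ), magnetic_sing, smul_smul]
  congr 1; ring

theorem sum_sing_symm (N : Fin 4 → ℝ) : (∑ μ, N μ • sing μ).IsSymmetric := fun p x a b => by
  simp only [Finset.sum_apply, Pi.smul_apply, smul_eq_mul]
  exact Finset.sum_congr rfl fun μ _ => by rw [sing_symm]

theorem sum_sing_traceless (N : Fin 4 → ℝ) : (∑ μ, N μ • sing μ).IsTraceless := fun p x => by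
  have := fun μ => sing_traceless μ p x
  simp only [trace_eq, Finset.sum_apply, Pi.add_apply, Pi.smul_apply, smul_eq_mul,
    Fin.sum_univ_four] at *
  linear_combination N 0 * this 0 + N 1 * this 1 + N 2 * this 2 + N 3 * this 3

theorem TensorField.IsTraceless.add {T U : TensorField} (hT : T.IsTraceless) (hU : U.IsTraceless) :
    (T + U).IsTraceless := fun p x => by
  rw [Pi.add_apply, trace_add, Pi.add_apply, hT, hU, add_zero]

/-- A symmetric traceless potential of a symmetric tensor is divergence-free. -/
theorem isDivFree_of_magnetic {T : TensorField} {Φ : ScalarField} (hT : T.IsSmooth)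
    (hs : T.IsSymmetric) (ht : T.IsTraceless) (hΦ : Φ.IsSmooth) (h : magnetic T = hessPlus Φ) :
    T.IsDivFree := fun p =>
  divergence_eq_zero (hT p) (hs p) (ht p) fun x a b => by
    have h1 := congrFun (congrFun (congrFun (congrFun h p) x) a) b
    have h2 := congrFun (congrFun (congrFun (congrFun h p) x) b) a
    rw [hessPlus_eq, hessPlusAt_symm (hΦ p), ← hessPlus_eq, ← h2] at h1
    simpa [magnetic] using h1

/-! ### The circulation of the transition functions around the equator -/

/-- Point of the equator of the sphere `τ = 0`. -/
def equator (φ : ℝ) : Coord := ![0, Real.pi / 2, φ]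

theorem equator_overlap (φ : ℝ) : InOverlap (equator φ) :=
  ⟨by simpa [equator] using Real.pi_pos, by simpa [equator] using Real.pi_pos⟩

theorem hasDerivAt_equator {f : Coord → ℝ} {φ : ℝ} (hf : DifferentiableAt ℝ f (equator φ)) :
    HasDerivAt (fun t => f (equator t)) (pd 2 f (equator φ)) φ := by
  have h : HasDerivAt equator (Pi.single 2 1 : Coord) φ := by
    refine hasDerivAt_pi.2 fun i => ?_
    fin_cases i
    · simpa [equator] using hasDerivAt_const φ (0 : ℝ)
    · simpa [equator] using hasDerivAt_const φ (Real.pi / 2)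
    · simpa [equator] using hasDerivAt_id' φ
  exact hf.hasFDerivAt.comp_hasDerivAt φ h

theorem sphForm_pd (Φ : ScalarField) (hΦ : Φ.IsSmooth) (p : Patch) {y : Coord} (hy : InOverlap y)
    (a : Fin 3) : sphForm (fun p x a => pd a (Φ p) x) p y a = pd a (fun z => Φ p (sphChart p z)) y :=
  (pd_comp_sphChart p hy (Smooth.diff (hΦ p) _) a).symm

theorem sphForm_formOf (T : TensorField) (μ : Fin 4) (p : Patch) {y : Coord} (hy : InOverlap y)
    (a : Fin 3) : sphForm (fun p => formOf p μ (T p)) p y a =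
      ∑ e, sphComponents T p y a e * sphInv y e *
        pd e (fun z => zeta μ p (sphChart p z)) y := by
  have e : (fun p => formOf p μ (T p)) =
      fun p x a => ∑ b, ∑ c, T p x a b * metricInv x b c * pd c (zeta μ p) x := by
    funext p x a
    simp only [formOf, frame_eq, Finset.mul_sum, mul_assoc]
  rw [e, sphForm_contract T (fun p x c => pd c (zeta μ p) x) p hy]
  exact Finset.sum_congr rfl fun e _ => by rw [sphForm_pd _ (smooth_zeta μ) p hy]

theorem pd_zeta_equator (μ : Fin 4) (p : Patch) (φ : ℝ) (e : Fin 3) :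
    pd e (fun z => zeta μ p (sphChart p z)) (equator φ) =
      ![![1, 0, 0], ![0, -1, 0], ![0, 0, -Real.sin φ], ![0, 0, Real.cos φ]] μ e := by
  have h1 : pd e (fun z => zeta μ p (sphChart p z)) (equator φ) =
      pd e (fun y => ![Real.sinh (y 0), Real.cosh (y 0), Real.cosh (y 0), Real.cosh (y 0)] μ
        * sphHarmonic y μ) (equator φ) := by
    refine pd_congr ?_
    filter_upwards [isOpen_overlap.mem_nhds (equator_overlap φ)] with z hz
    exact zeta_sphChart μ p hz
  have hd : ∀ i (x : Coord), DifferentiableAt ℝ (fun y : Coord => y i) x := fun i x => by fun_prop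
  have hsinh : ∀ x, pd e (fun y : Coord => Real.sinh (y 0)) x = Real.cosh (x 0) * pd e (fun y => y 0) x :=
    fun x => pd_comp e (Real.hasDerivAt_sinh (x 0)) (hd 0 x)
  have hcosh : ∀ x, pd e (fun y : Coord => Real.cosh (y 0)) x = Real.sinh (x 0) * pd e (fun y => y 0) x :=
    fun x => pd_comp e (Real.hasDerivAt_cosh (x 0)) (hd 0 x)
  have hsin : ∀ i x, pd e (fun y : Coord => Real.sin (y i)) x = Real.cos (x i) * pd e (fun y => y i) x :=
    fun i x => pd_comp e (Real.hasDerivAt_sin (x i)) (hd i x)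
  have hcos : ∀ i x, pd e (fun y : Coord => Real.cos (y i)) x = -Real.sin (x i) * pd e (fun y => y i) x :=
    fun i x => pd_comp e (Real.hasDerivAt_cos (x i)) (hd i x)
  rw [h1]
  fin_cases μ <;> simp (disch := fun_prop) [sphHarmonic, pd_mul, hsinh, hcosh, hsin, hcos,
    pd_coord, equator] <;> fin_cases e <;> simp

/-- If `∑ M_μ k_μ + S ω` does not jump, then `M = 0`. -/
theorem eq_zero_of_isGlobal {M : Fin 4 → ℝ} {ω : ScalarField} (hω : ω.IsSmooth)
    (h : (∑ μ, M μ • sing μ + hessPlus ω).IsGlobal) : M = 0 := by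
  -- Since the sum does not jump, the jump of Sω is the negative of that of the singular terms.
  have hj : ∀ y, InOverlap y → ∀ a b, sphComponents (hessPlus ω) .south y a b -
      sphComponents (hessPlus ω) .north y a b = -(∑ μ, M μ • deltaK μ y) a b := by
    intro y hy a b
    have h1 := congrFun (congrFun (hasNUTTransition_sum_sing M y hy) a) b
    have h2 := congrFun (congrFun (h y hy) a) b
    rw [sphComponents_add, sphComponents_add] at h2
    simp only [Pi.add_apply, Pi.sub_apply] at h1 h2
    linarith
  set D : Fin 4 → Patch → Coord → ℝ := fun μ p y => ambGrad p μ (ω p) (sphChart p y) with hD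
  have hDd : ∀ μ p φ, DifferentiableAt ℝ (D μ p) (equator φ) := fun μ p φ =>
    ((smooth_ambGrad p μ (hω p)).diff _).comp _
      ((contDiffAt_sphChart p (equator_overlap φ)).differentiableAt (by simp))
  have hDp : ∀ μ p φ, pd 2 (D μ p) (equator φ) =
      ∑ e, sphComponents (hessPlus ω) p (equator φ) 2 e * sphInv (equator φ) e *
        ![![1, 0, 0], ![0, -1, 0], ![0, 0, -Real.sin φ], ![0, 0, Real.cos φ]] μ e := by
    intro μ p φ
    have hy := equator_overlap φ
    have h1 := pd_comp_sphChart p hy ((smooth_ambGrad p μ (hω p)).diff _) 2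
    rw [hD]
    simp only [h1, pd_ambGrad p μ (hω p)]
    have := sphForm_formOf (hessPlus ω) μ p hy 2
    simp only [pd_zeta_equator] at this
    exact this
  -- Along the equator of τ = 0, the derivative of the jump of F^μ is the jump of (Sω)_φb contracted
  -- with the frame, so it is an explicit function of φ that is linear in M.
  have hg : ∀ μ φ, HasDerivAt (fun t => D μ .south (equator t) - D μ .north (equator t))
      (![-4 * M 0, 4 * M 1, 8 * Real.sin φ * (Real.sin φ * M 2 - Real.cos φ * M 3),
        -(8 * Real.cos φ * (Real.sin φ * M 2 - Real.cos φ * M 3))] μ) φ := by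
    intro μ φ
    refine ((hasDerivAt_equator (hDd μ .south φ)).fun_sub
      (hasDerivAt_equator (hDd μ .north φ))).congr_deriv ?_
    rw [hDp, hDp, ← Finset.sum_sub_distrib]
    have hj' := hj (equator φ) (equator_overlap φ) 2
    have e : ∀ e, sphComponents (hessPlus ω) .south (equator φ) 2 e =
        sphComponents (hessPlus ω) .north (equator φ) 2 e - (∑ μ, M μ • deltaK μ (equator φ)) 2 e :=
      fun e => by linarith [hj' e]
    simp only [e]
    fin_cases μ <;> simp [Fin.sum_univ_three, Fin.sum_univ_four, deltaK, symArray, equator, sphInv]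
      <;> ring
  -- F^μ is single-valued on each patch, so its jump returns to its initial value after one turn.
  have hper : ∀ μ, D μ .south (equator (2 * Real.pi)) - D μ .north (equator (2 * Real.pi)) =
      D μ .south (equator 0) - D μ .north (equator 0) := by
    intro μ
    have : ∀ p, sphChart p (equator (2 * Real.pi)) = sphChart p (equator 0) := by
      intro p; cases p <;> simp [sphChart, equator]
    simp only [hD, this]
  -- Any primitive of the derivative in `hg` differs from the jump by a constant and is therefore
  -- periodic as well. For the explicit primitives below this gives 8π M_μ = 0 up to sign; the terms
  -- with M₂ and M₃ mixed have period 2π and drop out.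
  have key : ∀ μ (f : ℝ → ℝ), (∀ φ, HasDerivAt f
      (![-4 * M 0, 4 * M 1, 8 * Real.sin φ * (Real.sin φ * M 2 - Real.cos φ * M 3),
        -(8 * Real.cos φ * (Real.sin φ * M 2 - Real.cos φ * M 3))] μ) φ) →
      f (2 * Real.pi) = f 0 := by
    intro μ f hf
    have hc : ∀ t, HasDerivAt (fun t => (D μ .south (equator t) - D μ .north (equator t)) - f t) 0 t :=
      fun t => ((hg μ t).fun_sub (hf t)).congr_deriv (sub_self _)
    have := is_const_of_deriv_eq_zero (fun t => (hc t).differentiableAt) (fun t => (hc t).deriv)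
      (2 * Real.pi) 0
    simp only [hper μ] at this
    linarith
  have k0 := key 0 (fun t => -4 * M 0 * t) fun φ => by
    simpa using (hasDerivAt_id' φ).const_mul (-4 * M 0)
  have k1 := key 1 (fun t => 4 * M 1 * t) fun φ => by
    simpa using (hasDerivAt_id' φ).const_mul (4 * M 1)
  have hsc := fun φ => (Real.hasDerivAt_sin φ).fun_mul (Real.hasDerivAt_cos φ)
  have hss := fun φ => (Real.hasDerivAt_sin φ).fun_mul (Real.hasDerivAt_sin φ)
  have k2 := key 2 (fun t => 4 * M 2 * (t - Real.sin t * Real.cos t)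
      - 4 * M 3 * (Real.sin t * Real.sin t)) fun φ => by
    refine ((((hasDerivAt_id' φ).fun_sub (hsc φ)).const_mul (4 * M 2)).fun_sub
      ((hss φ).const_mul (4 * M 3))).congr_deriv ?_
    simp
    linear_combination (-4 * M 2) * Real.sin_sq_add_cos_sq φ
  have k3 := key 3 (fun t => 4 * M 3 * (t + Real.sin t * Real.cos t)
      - 4 * M 2 * (Real.sin t * Real.sin t)) fun φ => by
    refine ((((hasDerivAt_id' φ).fun_add (hsc φ)).const_mul (4 * M 3)).fun_sub
      ((hss φ).const_mul (4 * M 2))).congr_deriv ?_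
    simp
    linear_combination (-4 * M 3) * Real.sin_sq_add_cos_sq φ
  have hπ := Real.pi_pos.ne'
  funext μ
  fin_cases μ
  · simpa [hπ] using k0
  · simpa [hπ] using k1
  · simpa [hπ] using k2
  · simpa [hπ] using k3

/-! ### Functions on de Sitter space as homogeneous functions on Minkowski space -/

/-- `X₁² + X₂² + X₃²`. -/
def spatialSq (X : Fin 4 → ℝ) : ℝ := X 1 ^ 2 + X 2 ^ 2 + X 3 ^ 2

/-- `X₁² + X₂² + X₃² - X₀²`. -/
def rhoSq (X : Fin 4 → ℝ) : ℝ := spatialSq X - X 0 ^ 2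

theorem smooth_spatialSq : Smooth spatialSq := by
  unfold Smooth spatialSq; fun_prop

theorem smooth_rhoSq : Smooth rhoSq := by
  unfold Smooth rhoSq spatialSq; fun_prop

theorem spatialSq_pos {X : Fin 4 → ℝ} (hX : 0 < rhoSq X) : 0 < spatialSq X := by
  unfold rhoSq at hX; nlinarith [sq_nonneg (X 0)]

/-- Coordinates, in the chart of a patch, of the ray through `X`. -/
def ambChart : Patch → (Fin 4 → ℝ) → Coord
  | .north, X => ![Real.arsinh (X 0 / Real.sqrt (rhoSq X)), X 2 / (Real.sqrt (spatialSq X) + X 1),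
      X 3 / (Real.sqrt (spatialSq X) + X 1)]
  | .south, X => ![Real.arsinh (X 0 / Real.sqrt (rhoSq X)), X 2 / (Real.sqrt (spatialSq X) - X 1),
      -(X 3 / (Real.sqrt (spatialSq X) - X 1))]

/-- The extension of a function on de Sitter space to the region `X · X > 0`, homogeneous of
degree zero. -/
def amb (f : ScalarField) (X : Fin 4 → ℝ) : ℝ :=
  if 0 ≤ X 1 then f .north (ambChart .north X) else f .south (ambChart .south X)

theorem contDiffAt_ambChart (p : Patch) {X : Fin 4 → ℝ} (hX : 0 < rhoSq X)
    (hp : 0 < Real.sqrt (spatialSq X) + p.sgn * X 1) :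
    ContDiffAt ℝ (⊤ : ℕ∞) (ambChart p) X := by
  have h1 : ContDiffAt ℝ (⊤ : ℕ∞) (fun X => Real.sqrt (rhoSq X)) X :=
    smooth_rhoSq.contDiffAt.sqrt hX.ne'
  have h2 : ContDiffAt ℝ (⊤ : ℕ∞) (fun X => Real.sqrt (spatialSq X)) X :=
    smooth_spatialSq.contDiffAt.sqrt (spatialSq_pos hX).ne'
  have hc : ∀ i : Fin 4, ContDiffAt ℝ (⊤ : ℕ∞) (fun X : Fin 4 → ℝ => X i) X := fun i =>
    (contDiff_apply ℝ ℝ i).contDiffAt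
  have h3 : ContDiffAt ℝ (⊤ : ℕ∞) (fun X => Real.arsinh (X 0 / Real.sqrt (rhoSq X))) X :=
    ((hc 0).div h1 (Real.sqrt_pos.2 hX).ne').arsinh
  refine contDiffAt_pi.2 fun c => ?_
  cases p
  · have hn : Real.sqrt (spatialSq X) + X 1 ≠ 0 := by simpa [Patch.sgn] using hp.ne'
    fin_cases c
    · exact h3
    · exact (hc 2).div (h2.add (hc 1)) hn
    · exact (hc 3).div (h2.add (hc 1)) hn
  · have hn : Real.sqrt (spatialSq X) - X 1 ≠ 0 := by
      have := hp.ne'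
      simp only [Patch.sgn] at this
      rwa [neg_one_mul, ← sub_eq_add_neg] at this
    fin_cases c
    · exact h3
    · exact (hc 2).div (h2.sub (hc 1)) hn
    · exact ((hc 3).div (h2.sub (hc 1)) hn).neg

/-- Off the polar axis, take θ = arccos (X₁/r) and φ = arg (X₂ + i X₃). The half-angle formula gives
tan (θ/2) = |z|/(r + X₁), and |z|² = (r + X₁)(r - X₁) gives the cotangent for the southern chart. -/
theorem exists_sphChart_eq {X : Fin 4 → ℝ} (hn : 0 < Real.sqrt (spatialSq X) + X 1)
    (hs : 0 < Real.sqrt (spatialSq X) - X 1) :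
    ∃ y, InOverlap y ∧ ∀ p, sphChart p y = ambChart p X := by
  set r := Real.sqrt (spatialSq X) with hr
  have hr0 : 0 < r := by linarith
  have hr2 : r ^ 2 = X 1 ^ 2 + X 2 ^ 2 + X 3 ^ 2 := by
    rw [hr, Real.sq_sqrt]
    · rfl
    · unfold spatialSq; positivity
  set z : ℂ := ⟨X 2, X 3⟩ with hz
  have hz2 : ‖z‖ ^ 2 = X 2 ^ 2 + X 3 ^ 2 := by
    rw [Complex.sq_norm, Complex.normSq_apply]; ring
  have hq : ‖z‖ ^ 2 = (r + X 1) * (r - X 1) := by rw [hz2]; linear_combination -hr2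
  have hzp : 0 < ‖z‖ := by
    have : 0 < ‖z‖ ^ 2 := by rw [hq]; positivity
    refine lt_of_le_of_ne (norm_nonneg z) fun h => ?_
    rw [← h] at this
    norm_num at this
  have hc : ‖z‖ * Real.cos z.arg = X 2 := Complex.norm_mul_cos_arg z
  have hsn : ‖z‖ * Real.sin z.arg = X 3 := Complex.norm_mul_sin_arg z
  have hu : -1 < X 1 / r := by rw [lt_div_iff₀ hr0]; linarith
  have hv : X 1 / r < 1 := by rw [div_lt_one hr0]; linarith
  set θ := Real.arccos (X 1 / r) with hθ
  have hθc : Real.cos θ = X 1 / r := Real.cos_arccos hu.le hv.le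
  have hθ0 : 0 < θ := Real.arccos_pos.2 hv
  have hθπ : θ < Real.pi := lt_of_le_of_ne (Real.arccos_le_pi _) fun h => by
    rw [h, Real.cos_pi] at hθc
    linarith
  have hθs : Real.sin θ = ‖z‖ / r := by
    have h1 : 0 < Real.sin θ := Real.sin_pos_of_pos_of_lt_pi hθ0 hθπ
    have h2 := Real.sin_sq_add_cos_sq θ
    have h3 : Real.sin θ ^ 2 = (‖z‖ / r) ^ 2 := by
      rw [div_pow, hq]
      rw [hθc] at h2
      field_simp at h2 ⊢
      linarith
    exact (pow_left_inj₀ h1.le (by positivity) two_ne_zero).1 h3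
  have hy : InOverlap ![Real.arsinh (X 0 / Real.sqrt (rhoSq X)), θ, z.arg] := ⟨hθ0, hθπ⟩
  obtain ⟨hsh, hch⟩ := half_angle_ne _ hy
  have ht : Real.tan (θ / 2) = ‖z‖ / (r + X 1) := by
    have e1 : Real.sin θ = 2 * Real.sin (θ / 2) * Real.cos (θ / 2) := by
      rw [← Real.sin_two_mul]; ring_nf
    have e2 : Real.cos θ = 2 * Real.cos (θ / 2) ^ 2 - 1 := by
      rw [← Real.cos_two_mul]; ring_nf
    rw [hθs] at e1
    rw [hθc] at e2
    have hch' : Real.cos (θ / 2) ≠ 0 := hch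
    rw [Real.tan_eq_sin_div_cos, div_eq_div_iff hch' hn.ne']
    field_simp at e1 e2
    have e3 : r + X 1 = r * (2 * Real.cos (θ / 2) ^ 2) := by linarith
    rw [e3, e1]; ring
  have hti : (Real.tan (θ / 2))⁻¹ = ‖z‖ / (r - X 1) := by
    rw [ht, inv_div, div_eq_div_iff hzp.ne' hs.ne', ← sq, hq]
  refine ⟨_, hy, fun p => ?_⟩
  cases p
  · simp only [sphChart, ambChart, Matrix.cons_val, ht]
    rw [div_mul_eq_mul_div, div_mul_eq_mul_div, hc, hsn]
  · simp only [sphChart, ambChart, Matrix.cons_val, hti]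
    rw [div_mul_eq_mul_div, div_mul_eq_mul_div, hc, hsn]

/-- The case distinction in `amb` is immaterial: wherever both charts are defined, they give the
same value. -/
theorem amb_eq {f : ScalarField} (hf : f.IsGlobal) (p : Patch) {X : Fin 4 → ℝ}
    (hX : 0 < rhoSq X) (hp : 0 < Real.sqrt (spatialSq X) + p.sgn * X 1) :
    amb f X = f p (ambChart p X) := by
  have h0 := Real.sqrt_pos.2 (spatialSq_pos hX)
  have key : 0 < Real.sqrt (spatialSq X) + X 1 → 0 < Real.sqrt (spatialSq X) - X 1 →
      f .north (ambChart .north X) = f .south (ambChart .south X) := fun h1 h2 => by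
    obtain ⟨y, hy, h⟩ := exists_sphChart_eq h1 h2
    rw [← h, ← h, hf y hy]
  unfold amb
  cases p
  · simp only [Patch.sgn, one_mul] at hp
    split_ifs with h
    · rfl
    · exact (key hp (by linarith)).symm
  · simp only [Patch.sgn, neg_one_mul, ← sub_eq_add_neg] at hp
    split_ifs with h
    · exact key (by linarith) hp
    · rfl

/-- At every X at least one of the charts is available, and by continuity it remains available
nearby. The hyperplane X₁ = 0, where the definition changes its branch, is thus harmless. -/
theorem contDiffAt_amb {f : ScalarField} (hf : f.IsRegular) {X : Fin 4 → ℝ} (hX : 0 < rhoSq X) :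
    ContDiffAt ℝ (⊤ : ℕ∞) (amb f) X := by
  have h0 := Real.sqrt_pos.2 (spatialSq_pos hX)
  obtain ⟨p, hp⟩ : ∃ p : Patch, 0 < Real.sqrt (spatialSq X) + p.sgn * X 1 := by
    rcases le_total 0 (X 1) with h | h
    · exact ⟨.north, by simp only [Patch.sgn]; linarith⟩
    · exact ⟨.south, by simp only [Patch.sgn]; linarith⟩
  refine ((hf.1 p).contDiffAt.comp X (contDiffAt_ambChart p hX hp)).congr_of_eventuallyEq ?_
  have c1 : Continuous rhoSq := smooth_rhoSq.continuous
  have c2 : Continuous fun X : Fin 4 → ℝ => Real.sqrt (spatialSq X) + p.sgn * X 1 :=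
    smooth_spatialSq.continuous.sqrt.add (continuous_const.mul (continuous_apply 1))
  filter_upwards [c1.continuousAt.eventually (lt_mem_nhds hX),
    c2.continuousAt.eventually (lt_mem_nhds hp)] with Y h1 h2 using amb_eq hf.2 p h1 h2

theorem rhoSq_smul (c : ℝ) (X : Fin 4 → ℝ) : rhoSq (c • X) = c ^ 2 * rhoSq X := by
  simp [rhoSq, spatialSq]; ring

theorem spatialSq_smul (c : ℝ) (X : Fin 4 → ℝ) : spatialSq (c • X) = c ^ 2 * spatialSq X := by
  simp [spatialSq]; ring

theorem amb_smul (f : ScalarField) {c : ℝ} (hc : 0 < c) (X : Fin 4 → ℝ) :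
    amb f (c • X) = amb f X := by
  have h1 : ∀ p, ambChart p (c • X) = ambChart p X := by
    intro p
    have e1 : Real.sqrt (rhoSq (c • X)) = c * Real.sqrt (rhoSq X) := by
      rw [rhoSq_smul, Real.sqrt_mul (sq_nonneg c), Real.sqrt_sq hc.le]
    have e2 : Real.sqrt (spatialSq (c • X)) = c * Real.sqrt (spatialSq X) := by
      rw [spatialSq_smul, Real.sqrt_mul (sq_nonneg c), Real.sqrt_sq hc.le]
    cases p <;> simp only [ambChart, e1, e2, Pi.smul_apply, smul_eq_mul, ← mul_add, ← mul_sub,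
      mul_div_mul_left _ _ hc.ne']
  unfold amb
  rw [h1, h1]
  simp [hc]

theorem rhoSq_zeta (p : Patch) (x : Coord) : rhoSq (fun μ => zeta μ p x) = 1 := by
  have := sum_eta_zeta_sq p x
  simp [Fin.sum_univ_four, eta] at this
  unfold rhoSq spatialSq
  linarith

theorem spatialSq_zeta (p : Patch) (x : Coord) :
    Real.sqrt (spatialSq fun μ => zeta μ p x) = Real.cosh (x 0) := by
  have h := rhoSq_zeta p x
  unfold rhoSq at h
  rw [Real.sqrt_eq_iff_mul_self_eq_of_pos (Real.cosh_pos _), ← sq, Real.cosh_sq]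
  simp only [zeta, Matrix.cons_val] at h ⊢
  linarith

theorem amb_zeta {f : ScalarField} (hf : f.IsGlobal) (p : Patch) (x : Coord) :
    amb f (fun μ => zeta μ p x) = f p x := by
  have hd := (lam_den_pos x).ne'
  have hC := (Real.cosh_pos (x 0))
  have hl := lam_pos x
  have e : Real.sqrt (spatialSq fun μ => zeta μ p x) + p.sgn * zeta 1 p x =
      Real.cosh (x 0) * lam x := by
    rw [spatialSq_zeta]
    cases p <;> simp [zeta, dir, Patch.sgn, lam] <;> field_simp <;> ring
  rw [amb_eq hf p (by rw [rhoSq_zeta]; exact one_pos) (by rw [e]; positivity)]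
  congr 1
  have h0 : Real.arsinh (zeta 0 p x / Real.sqrt (rhoSq fun μ => zeta μ p x)) = x 0 := by
    rw [rhoSq_zeta]; simp [zeta]
  have hn : ∀ s : ℝ, Real.cosh (x 0) * s / (Real.cosh (x 0) * lam x) = s / lam x := fun s =>
    mul_div_mul_left _ _ hC.ne'
  funext c
  cases p
  · rw [Patch.sgn, one_mul] at e
    simp only [ambChart, e, h0]
    fin_cases c
    · rfl
    · simp [zeta, dir, hn, lam]; field_simp
    · simp [zeta, dir, hn, lam]; field_simp
  · rw [Patch.sgn, neg_one_mul, ← sub_eq_add_neg] at e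
    simp only [ambChart, e, h0]
    fin_cases c
    · rfl
    · simp [zeta, dir, hn, lam]; field_simp
    · simp [zeta, dir, neg_div, hn, lam]; field_simp

/-- The ambient coordinates of the point with spherical coordinates `y`. -/
def sphAmb (y : Coord) (μ : Fin 4) : ℝ :=
  ![Real.sinh (y 0), Real.cosh (y 0), Real.cosh (y 0), Real.cosh (y 0)] μ * sphHarmonic y μ

theorem smooth_sphHarmonic (μ : Fin 4) : Smooth (fun y => sphHarmonic y μ) := by
  have h1 := Real.contDiff_cos (n := (⊤ : ℕ∞))
  have h2 := Real.contDiff_sin (n := (⊤ : ℕ∞))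
  fin_cases μ <;> simp only [sphHarmonic, Fin.zero_eta, Fin.isValue, Fin.mk_one, Fin.reduceFinMk,
      Matrix.cons_val] <;> unfold Smooth <;> fun_prop

theorem smooth_sphAmb : Smooth sphAmb := by
  refine contDiff_pi.2 fun μ => ContDiff.mul ?_ (smooth_sphHarmonic μ)
  fin_cases μ
  · exact smooth_sinh0
  · exact smooth_cosh0
  · exact smooth_cosh0
  · exact smooth_cosh0

theorem rhoSq_sphAmb (y : Coord) : rhoSq (sphAmb y) = 1 := by
  simp [rhoSq, spatialSq, sphAmb, sphHarmonic]
  have h1 := Real.sin_sq_add_cos_sq (y 1)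
  have h2 := Real.sin_sq_add_cos_sq (y 2)
  have h3 := Real.cosh_sq (y 0)
  linear_combination Real.cosh (y 0) ^ 2 * h1 + Real.cosh (y 0) ^ 2 * Real.sin (y 1) ^ 2 * h2 + h3

/-- A function on de Sitter space in spherical coordinates, extended to all values of these. -/
def sphFun (f : ScalarField) (y : Coord) : ℝ := amb f (sphAmb y)

/-- Smoothness for all values of the angles, poles included, comes from the factorization through
the ambient space. It allows integrations over the whole sphere without any discussion of the
boundary of the coordinate range. -/
theorem smooth_sphFun {f : ScalarField} (hf : f.IsRegular) : Smooth (sphFun f) :=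
  contDiff_iff_contDiffAt.2 fun y =>
    (contDiffAt_amb hf (by rw [rhoSq_sphAmb]; exact one_pos)).comp y smooth_sphAmb.contDiffAt

theorem sphFun_eq {f : ScalarField} (hf : f.IsGlobal) (p : Patch) {y : Coord} (hy : InOverlap y) :
    sphFun f y = f p (sphChart p y) := by
  rw [← amb_zeta hf p]
  exact congrArg _ (funext fun μ => (zeta_sphChart μ p hy).symm)

/-! ### Integration over the spheres `τ = const` -/

theorem pd_comp_map {f : Coord → ℝ} {g : Coord → Coord} {x : Coord}
    (hf : DifferentiableAt ℝ f (g x)) (hg : DifferentiableAt ℝ g x) (a : Fin 3) :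
    pd a (fun y => f (g y)) x = ∑ c, pd a (fun y => g y c) x * pd c f (g x) := by
  have h2 := hf.hasFDerivAt.comp x hg.hasFDerivAt
  unfold pd
  rw [show (fun z => f (g z)) = f ∘ g from rfl, h2.fderiv]
  rw [ContinuousLinearMap.comp_apply, fderiv_eq_sum_pd]
  refine Finset.sum_congr rfl fun c _ => ?_
  congr 1
  have h3 : fderiv ℝ (fun z => g z c) x =
      (ContinuousLinearMap.proj (R := ℝ) (φ := fun _ : Fin 3 => ℝ) c).comp (fderiv ℝ g x) :=
    ((ContinuousLinearMap.proj (R := ℝ) (φ := fun _ : Fin 3 => ℝ) c).hasFDerivAt.comp x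
      hg.hasFDerivAt).fderiv
  rw [h3]
  rfl

theorem hasDerivAt_comp_line {f : Coord → ℝ} {g : ℝ → Coord} {t : ℝ} {a : Fin 3}
    (hf : DifferentiableAt ℝ f (g t)) (hg : HasDerivAt g (Pi.single a 1) t) :
    HasDerivAt (fun s => f (g s)) (pd a f (g t)) t :=
  hf.hasFDerivAt.comp_hasDerivAt t hg

theorem hasDerivAt_zero_line (u v t : ℝ) :
    HasDerivAt (fun s => (![s, u, v] : Coord)) (Pi.single 0 1) t := by
  refine hasDerivAt_pi.2 fun i => ?_
  fin_cases i
  · simpa using hasDerivAt_id' t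
  · simpa using hasDerivAt_const t u
  · simpa using hasDerivAt_const t v

theorem hasDerivAt_one_line (u v t : ℝ) :
    HasDerivAt (fun s => (![u, s, v] : Coord)) (Pi.single 1 1) t := by
  refine hasDerivAt_pi.2 fun i => ?_
  fin_cases i
  · simpa using hasDerivAt_const t u
  · simpa using hasDerivAt_id' t
  · simpa using hasDerivAt_const t v

theorem hasDerivAt_two_line (u v t : ℝ) :
    HasDerivAt (fun s => (![u, v, s] : Coord)) (Pi.single 2 1) t := by
  refine hasDerivAt_pi.2 fun i => ?_
  fin_cases i
  · simpa using hasDerivAt_const t u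
  · simpa using hasDerivAt_const t v
  · simpa using hasDerivAt_id' t

theorem smooth_vec {E : Type} [NormedAddCommGroup E] [NormedSpace ℝ E] {u v w : E → ℝ}
    (hu : Smooth u) (hv : Smooth v) (hw : Smooth w) :
    Smooth (fun x => (![u x, v x, w x] : Coord)) := by
  refine contDiff_pi.2 fun i => ?_
  fin_cases i
  · exact hu
  · exact hv
  · exact hw

/-- Integral over `φ`. -/
def azInt (f : Coord → ℝ) (y : Coord) : ℝ := ∫ φ in (0 : ℝ)..(2 * Real.pi), f ![y 0, y 1, φ]

/-- Integral over `θ` and `φ`. -/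
def sphInt (f : Coord → ℝ) (τ : ℝ) : ℝ :=
  ∫ θ in (0 : ℝ)..Real.pi, ∫ φ in (0 : ℝ)..(2 * Real.pi), f ![τ, θ, φ]

theorem sphInt_eq (f : Coord → ℝ) (τ : ℝ) :
    sphInt f τ = ∫ θ in (0 : ℝ)..Real.pi, azInt f ![τ, θ, 0] := rfl

section

variable {f g : Coord → ℝ}

theorem smooth_azInt_integrand (hf : Smooth f) :
    Smooth (Function.uncurry fun (y : Coord) (φ : ℝ) => f ![y 0, y 1, φ]) :=
  ContDiff.comp hf (smooth_vec ((smooth_coord 0).comp contDiff_fst)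
    ((smooth_coord 1).comp contDiff_fst) contDiff_snd)

theorem smooth_azInt (hf : Smooth f) : Smooth (azInt f) :=
  smooth_intervalIntegral (smooth_azInt_integrand hf) 0 (2 * Real.pi)

theorem pd_azInt (hf : Smooth f) (y : Coord) :
    pd 0 (azInt f) y = azInt (pd 0 f) y ∧ pd 1 (azInt f) y = azInt (pd 1 f) y := by
  have h : ∀ (a : Fin 3) (φ : ℝ), pd a (fun y : Coord => f ![y 0, y 1, φ]) y =
      (if a = 0 then 1 else 0) * pd 0 f ![y 0, y 1, φ] +
        (if a = 1 then 1 else 0) * pd 1 f ![y 0, y 1, φ] := by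
    intro a φ
    have hg : Smooth (fun y : Coord => (![y 0, y 1, φ] : Coord)) :=
      smooth_vec (smooth_coord 0) (smooth_coord 1) contDiff_const
    rw [pd_comp_map (f := f) (hf.diff _) (hg.diff y) a, Fin.sum_univ_three]
    simp [pd_coord, pd_const]
  constructor
  · have := pd_intervalIntegral (F := fun y φ => f ![y 0, y 1, φ]) (smooth_azInt_integrand hf) 0
      (2 * Real.pi) 0 y
    simp only [h] at this
    simp at this
    exact this
  · have := pd_intervalIntegral (F := fun y φ => f ![y 0, y 1, φ]) (smooth_azInt_integrand hf) 0
      (2 * Real.pi) 1 y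
    simp only [h] at this
    simp at this
    exact this

theorem hasDerivAt_sphInt (hf : Smooth f) (τ : ℝ) :
    HasDerivAt (sphInt f) (sphInt (pd 0 f) τ) τ := by
  have h0 := smooth_azInt hf
  have h1 : Smooth (Function.uncurry fun τ θ : ℝ => azInt f ![τ, θ, 0]) :=
    ContDiff.comp h0 (smooth_vec contDiff_fst contDiff_snd contDiff_const)
  have h2 := (smooth_intervalIntegral h1 0 Real.pi).diff τ
  have h3 := h2.hasDerivAt
  have h4 := fderiv_intervalIntegral_apply h1 0 Real.pi τ 1
  rw [← fderiv_apply_one_eq_deriv, h4] at h3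
  refine h3.congr_deriv ?_
  rw [sphInt_eq]
  refine intervalIntegral.integral_congr fun θ _ => ?_
  have := hasDerivAt_comp_line (h0.diff ![τ, θ, 0]) (hasDerivAt_zero_line θ 0 τ)
  rw [← (pd_azInt hf _).1, ← this.deriv]
  exact fderiv_apply_one_eq_deriv

/-- The integral over θ runs over (0, π], and the remaining end point π is a null set. -/
theorem sphInt_congr (h : ∀ y, InOverlap y → f y = g y) : sphInt f = sphInt g := by
  funext τ
  refine intervalIntegral.integral_congr_ae ?_
  have : ∀ᵐ θ : ℝ, θ ≠ Real.pi := by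
    simp [ae_iff]
  filter_upwards [this] with θ h1 h2
  rw [uIoc_of_le Real.pi_pos.le] at h2
  have hy : ∀ φ, InOverlap ![τ, θ, φ] := fun φ => ⟨h2.1, lt_of_le_of_ne h2.2 h1⟩
  simp only [h _ (hy _)]

theorem azInt_continuous (hf : Smooth f) (τ : ℝ) : Continuous fun θ : ℝ => azInt f ![τ, θ, 0] :=
  (smooth_azInt hf).continuous.comp
    (smooth_vec (E := ℝ) contDiff_const contDiff_id contDiff_const).continuous

theorem line_continuous (hf : Smooth f) (y : Coord) : Continuous fun φ : ℝ => f ![y 0, y 1, φ] :=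
  hf.continuous.comp
    (smooth_vec (E := ℝ) contDiff_const contDiff_const contDiff_id).continuous

theorem azInt_add (hf : Smooth f) (hg : Smooth g) (y : Coord) :
    azInt (fun y => f y + g y) y = azInt f y + azInt g y :=
  intervalIntegral.integral_add ((line_continuous hf y).intervalIntegrable _ _)
    ((line_continuous hg y).intervalIntegrable _ _)

theorem azInt_const_mul (c : ℝ) (y : Coord) : azInt (fun y => c * f y) y = c * azInt f y :=
  intervalIntegral.integral_const_mul _ _

theorem sphInt_add (hf : Smooth f) (hg : Smooth g) (τ : ℝ) :
    sphInt (fun y => f y + g y) τ = sphInt f τ + sphInt g τ := by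
  simp only [sphInt_eq, azInt_add hf hg]
  exact intervalIntegral.integral_add ((azInt_continuous hf τ).intervalIntegrable _ _)
    ((azInt_continuous hg τ).intervalIntegrable _ _)

theorem sphInt_mul_left (c : ℝ → ℝ) (τ : ℝ) :
    sphInt (fun y => c (y 0) * f y) τ = c τ * sphInt f τ := by
  unfold sphInt
  simp

theorem sphInt_const_mul (c : ℝ) (τ : ℝ) : sphInt (fun y => c * f y) τ = c * sphInt f τ :=
  sphInt_mul_left (fun _ => c) τ

/-- The divergence theorem on the sphere. -/
theorem sphInt_eq_zero {U V K : Coord → ℝ} (hU : Smooth U) (hV : Smooth V)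
    (hU0 : ∀ τ φ, U ![τ, 0, φ] = 0) (hU1 : ∀ τ φ, U ![τ, Real.pi, φ] = 0)
    (hVp : ∀ τ θ, V ![τ, θ, 2 * Real.pi] = V ![τ, θ, 0])
    (h : ∀ y, InOverlap y → Real.sin (y 1) * pd 1 U y + pd 2 V y = Real.sin (y 1) * K y) (τ : ℝ) :
    sphInt K τ = 0 := by
  -- The φ-derivative integrates to zero over a period.
  have hV' : ∀ τ θ, azInt (pd 2 V) ![τ, θ, 0] = 0 := fun τ θ => by
    have := intervalIntegral.integral_eq_sub_of_hasDerivAt (a := 0) (b := 2 * Real.pi)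
      (fun φ _ => hasDerivAt_comp_line (hV.diff ![τ, θ, φ]) (hasDerivAt_two_line τ θ φ))
      ((line_continuous (smooth_pd 2 hV) ![τ, θ, 0]).intervalIntegrable _ _)
    rw [hVp, sub_self] at this
    exact this
  -- After the integration over φ only the θ-derivative of U remains, and the factor sin θ can be
  -- cancelled except at θ = π. The integral over θ is then a boundary term, and U vanishes at both
  -- poles.
  have h1 : sphInt K τ = sphInt (pd 1 U) τ := by
    have hae : ∀ᵐ θ : ℝ, θ ≠ Real.pi := by simp [ae_iff]
    rw [sphInt_eq, sphInt_eq]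
    refine intervalIntegral.integral_congr_ae ?_
    filter_upwards [hae] with θ h1 h2
    rw [uIoc_of_le Real.pi_pos.le] at h2
    have hy : ∀ φ, InOverlap ![τ, θ, φ] := fun φ => ⟨h2.1, lt_of_le_of_ne h2.2 h1⟩
    have hs : Real.sin θ ≠ 0 := (Real.sin_pos_of_pos_of_lt_pi (hy 0).1 (hy 0).2).ne'
    have h3 : azInt (fun y => Real.sin θ * pd 1 U y + pd 2 V y) ![τ, θ, 0] =
        azInt (fun y => Real.sin θ * K y) ![τ, θ, 0] :=
      intervalIntegral.integral_congr fun φ _ => h ![τ, θ, φ] (hy φ)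
    rw [azInt_add (contDiff_const.mul (smooth_pd 1 hU)) (smooth_pd 2 hV), azInt_const_mul,
      azInt_const_mul, hV', add_zero] at h3
    exact (mul_left_cancel₀ hs h3).symm
  rw [h1, sphInt_eq]
  have h2 : ∀ θ : ℝ, HasDerivAt (fun t => azInt U ![τ, t, 0]) (azInt (pd 1 U) ![τ, θ, 0]) θ :=
    fun θ => (hasDerivAt_comp_line ((smooth_azInt hU).diff ![τ, θ, 0])
      (hasDerivAt_one_line τ 0 θ)).congr_deriv (pd_azInt hU _).2
  rw [intervalIntegral.integral_eq_sub_of_hasDerivAt (fun θ _ => h2 θ)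
    ((azInt_continuous (smooth_pd 1 hU) τ).intervalIntegrable _ _)]
  have e0 : azInt U ![τ, 0, 0] = 0 := by
    change ∫ φ in (0 : ℝ)..(2 * Real.pi), U ![τ, 0, φ] = 0
    simp [hU0]
  have e1 : azInt U ![τ, Real.pi, 0] = 0 := by
    change ∫ φ in (0 : ℝ)..(2 * Real.pi), U ![τ, Real.pi, φ] = 0
    simp [hU1]
  rw [e0, e1, sub_zero]

end

/-! ### The wave equation in spherical coordinates -/

theorem sin_eq_lam (p : Patch) {y : Coord} (hy : InOverlap y) : Real.sin (y 1) ^ 2 =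
    lam (sphChart p y) ^ 2 * (sphChart p y 1 ^ 2 + sphChart p y 2 ^ 2) := by
  obtain ⟨hs, hc⟩ := half_angle_ne y hy
  have e : Real.sin (y 1) = 2 * Real.sin (y 1 / 2) * Real.cos (y 1 / 2) := by
    rw [← Real.sin_two_mul]; ring_nf
  rw [lam_sphChart p hy, e]
  have q2 := Real.sin_sq_add_cos_sq (y 2)
  cases p <;> simp [sphChart, sphLam, Real.tan_eq_sin_div_cos] <;> field_simp <;> grind

/-- With r = tan (θ/2) one has sin θ dr/dθ = r, so sin θ ∂_θ is the Euler field of the stereographic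
chart. -/
theorem sin_mul_pd_one {f : Coord → ℝ} (hf : Smooth f) {y : Coord} (hy : InOverlap y) :
    Real.sin (y 1) * pd 1 (fun z => f (sphChart .north z)) y =
      (fun x : Coord => x 1 * pd 1 f x + x 2 * pd 2 f x) (sphChart .north y) := by
  obtain ⟨hs, hc⟩ := half_angle_ne y hy
  have e : Real.sin (y 1) = 2 * Real.sin (y 1 / 2) * Real.cos (y 1 / 2) := by
    rw [← Real.sin_two_mul]; ring_nf
  rw [pd_comp_sphChart .north hy (hf.diff _), Fin.sum_univ_three]
  simp [jac_eq _ hy, jacVal, e, sphChart, Real.tan_eq_sin_div_cos]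
  field_simp

theorem pd_two_sphChart {f : Coord → ℝ} (hf : Smooth f) {y : Coord} (hy : InOverlap y) :
    pd 2 (fun z => f (sphChart .north z)) y =
      (fun x : Coord => x 1 * pd 2 f x - x 2 * pd 1 f x) (sphChart .north y) := by
  rw [pd_comp_sphChart .north hy (hf.diff _), Fin.sum_univ_three]
  simp [jac_eq _ hy, jacVal, sphChart, Real.tan_eq_sin_div_cos]
  ring

theorem pd_zero_sphChart {f : Coord → ℝ} (hf : Smooth f) {y : Coord} (hy : InOverlap y) :
    pd 0 (fun z => f (sphChart .north z)) y = pd 0 f (sphChart .north y) := by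
  rw [pd_comp_sphChart .north hy (hf.diff _), Fin.sum_univ_three]
  simp [jac_eq _ hy, jacVal]

theorem pd_sphFun {f : ScalarField} (hf : f.IsRegular) (a : Fin 3) {y : Coord} (hy : InOverlap y) :
    pd a (sphFun f) y = pd a (fun z => f .north (sphChart .north z)) y :=
  pd_congr (by
    filter_upwards [isOpen_overlap.mem_nhds hy] with z hz using sphFun_eq hf.2 .north hz)

/-- The squares of the Euler field and of the rotation field add up to r² times the flat Laplacian
of the chart, and λ²r² = sin² θ. This form of the equation has no denominators at the poles. -/
theorem sphFun_wave {Φ : ScalarField} (hΦ : Φ.IsRegular) (h : Φ.BoxPlusThree) {y : Coord}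
    (hy : InOverlap y) :
    Real.sin (y 1) * pd 1 (fun z => Real.sin (z 1) * pd 1 (sphFun Φ) z) y +
      pd 2 (pd 2 (sphFun Φ)) y = Real.sin (y 1) ^ 2 * Real.cosh (y 0) ^ 2 *
        (pd 0 (pd 0 (sphFun Φ)) y + 2 * Real.tanh (y 0) * pd 0 (sphFun Φ) y - 3 * sphFun Φ y) := by
  set f := Φ .north with hf
  have hs : Smooth f := hΦ.1 .north
  have hp := fun a => smooth_pd a hs
  have hE : Smooth (fun x : Coord => x 1 * pd 1 f x + x 2 * pd 2 f x) :=
    ((smooth_coord 1).mul (hp 1)).add ((smooth_coord 2).mul (hp 2))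
  have hR : Smooth (fun x : Coord => x 1 * pd 2 f x - x 2 * pd 1 f x) :=
    ((smooth_coord 1).mul (hp 2)).sub ((smooth_coord 2).mul (hp 1))
  have hn := isOpen_overlap.mem_nhds hy
  have e1 : pd 1 (fun z => Real.sin (z 1) * pd 1 (sphFun Φ) z) y =
      pd 1 (fun z => (fun x : Coord => x 1 * pd 1 f x + x 2 * pd 2 f x) (sphChart .north z)) y := by
    refine pd_congr ?_
    filter_upwards [hn] with z hz
    rw [pd_sphFun hΦ 1 hz]; exact sin_mul_pd_one hs hz
  have e2 : pd 2 (pd 2 (sphFun Φ)) y =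
      pd 2 (fun z => (fun x : Coord => x 1 * pd 2 f x - x 2 * pd 1 f x) (sphChart .north z)) y := by
    refine pd_congr ?_
    filter_upwards [hn] with z hz
    rw [pd_sphFun hΦ 2 hz]; exact pd_two_sphChart hs hz
  have e0 : pd 0 (pd 0 (sphFun Φ)) y = pd 0 (pd 0 f) (sphChart .north y) := by
    rw [← pd_zero_sphChart (hp 0) hy]
    refine pd_congr ?_
    filter_upwards [hn] with z hz
    rw [pd_sphFun hΦ 0 hz, ← pd_zero_sphChart hs hz]
  rw [e1, sin_mul_pd_one hE hy, e2, pd_two_sphChart hR hy, e0, pd_sphFun hΦ 0 hy,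
    pd_zero_sphChart hs hy, sphFun_eq hΦ.2 .north hy, sin_eq_lam .north hy]
  have hbox := h .north (sphChart .north y)
  have hc0 : Real.cosh (y 0) = Real.cosh (sphChart .north y 0) := rfl
  have ht0 : Real.tanh (y 0) = logD 0 (sphChart .north y) := rfl
  rw [hc0, ht0]
  generalize sphChart .north y = x at *
  have hcx := (smooth_coord 1).diff x
  have hcy := (smooth_coord 2).diff x
  have hd := fun a => (hp a).diff x
  have hu := conf_ne x
  have hu' : conf x = lam x ^ 2 * Real.cosh (x 0) ^ 2 := rfl
  have hcomm := pd_comm 1 2 hs x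
  rw [boxScalar_eq] at hbox
  simp only [hess_eq, Fin.sum_univ_three, gam, Matrix.cons_val] at hbox
  have hA : ∀ a, pd a (fun x : Coord => x 1 * pd 1 f x + x 2 * pd 2 f x) x =
      (if a = 1 then 1 else 0) * pd 1 f x + x 1 * pd a (pd 1 f) x +
        ((if a = 2 then 1 else 0) * pd 2 f x + x 2 * pd a (pd 2 f) x) := fun a => by
    rw [pd_add a (hcx.fun_mul (hd 1)) (hcy.fun_mul (hd 2)), pd_mul a hcx (hd 1),
      pd_mul a hcy (hd 2), pd_coord, pd_coord]
  have hB : ∀ a, pd a (fun x : Coord => x 1 * pd 2 f x - x 2 * pd 1 f x) x =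
      (if a = 1 then 1 else 0) * pd 2 f x + x 1 * pd a (pd 2 f) x -
        ((if a = 2 then 1 else 0) * pd 1 f x + x 2 * pd a (pd 1 f) x) := fun a => by
    rw [pd_sub a (hcx.fun_mul (hd 2)) (hcy.fun_mul (hd 1)), pd_mul a hcx (hd 2),
      pd_mul a hcy (hd 1), pd_coord, pd_coord]
  simp only [hA, hB, hcomm]
  -- The Laplacian in two dimensions is conformally covariant, so the Christoffel terms of the
  -- spatial part cancel and only the time part keeps a first derivative.
  have key : pd 1 (pd 1 f) x + pd 2 (pd 2 f) x = conf x *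
      (pd 0 (pd 0 f) x + 2 * logD 0 x * pd 0 f x - 3 * f x) := by
    field_simp at hbox
    simp at hbox
    linear_combination hbox
  rw [hu'] at key
  simp
  linear_combination (x 1 ^ 2 + x 2 ^ 2) * key

/-! ### The lowest harmonics of a solution -/

/-- `Y_ν sin θ`. -/
def weight (ν : Fin 4) (y : Coord) : ℝ := sphHarmonic y ν * Real.sin (y 1)

/-- `∂Y_ν/∂θ`. -/
def harmTheta (ν : Fin 4) (y : Coord) : ℝ :=
  ![0, -Real.sin (y 1), Real.cos (y 1) * Real.cos (y 2), Real.cos (y 1) * Real.sin (y 2)] ν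

/-- `(∂Y_ν/∂φ) / sin θ`. -/
def harmPhi (ν : Fin 4) (y : Coord) : ℝ := ![0, 0, -Real.sin (y 2), Real.cos (y 2)] ν

/-- `l (l + 1)`. -/
def harmEigen (ν : Fin 4) : ℝ := ![0, 2, 2, 2] ν

theorem smooth_sin (i : Fin 3) : Smooth (fun y : Coord => Real.sin (y i)) :=
  Real.contDiff_sin.comp (smooth_coord i)

theorem smooth_weight (ν : Fin 4) : Smooth (weight ν) := (smooth_sphHarmonic ν).mul (smooth_sin 1)

theorem smooth_harmTheta (ν : Fin 4) : Smooth (harmTheta ν) := by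
  have h1 := Real.contDiff_cos (n := (⊤ : ℕ∞))
  have h2 := Real.contDiff_sin (n := (⊤ : ℕ∞))
  unfold harmTheta Smooth
  fin_cases ν <;> simp only [Fin.zero_eta, Fin.isValue, Fin.mk_one, Fin.reduceFinMk,
      Matrix.cons_val] <;> fun_prop

theorem smooth_harmPhi (ν : Fin 4) : Smooth (harmPhi ν) := by
  have h1 := Real.contDiff_cos (n := (⊤ : ℕ∞))
  have h2 := Real.contDiff_sin (n := (⊤ : ℕ∞))
  unfold harmPhi Smooth
  fin_cases ν <;> simp only [Fin.zero_eta, Fin.isValue, Fin.mk_one, Fin.reduceFinMk,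
      Matrix.cons_val] <;> fun_prop

theorem pd_sin (a i : Fin 3) (x : Coord) :
    pd a (fun y : Coord => Real.sin (y i)) x = if a = i then Real.cos (x i) else 0 := by
  have := pd_comp a (Real.hasDerivAt_sin (x i)) ((smooth_coord i).diff x)
  rw [this, pd_coord]
  simp

theorem pd_cos (a i : Fin 3) (x : Coord) :
    pd a (fun y : Coord => Real.cos (y i)) x = if a = i then -Real.sin (x i) else 0 := by
  have := pd_comp a (Real.hasDerivAt_cos (x i)) ((smooth_coord i).diff x)
  rw [this, pd_coord]
  simp

theorem pd_sphHarmonic (a : Fin 3) (ν : Fin 4) (x : Coord) : pd a (fun y => sphHarmonic y ν) x =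
    ![0, harmTheta ν x, Real.sin (x 1) * harmPhi ν x] a := by
  unfold sphHarmonic harmTheta harmPhi
  fin_cases ν <;> fin_cases a <;> simp (disch := fun_prop) [pd_mul, pd_const, pd_sin, pd_cos]

/-- The eigenvalue equation of the harmonics on the sphere, multiplied by sin² θ. -/
theorem pd_harmTheta (ν : Fin 4) (x : Coord) :
    Real.sin (x 1) * pd 1 (fun y => Real.sin (y 1) * harmTheta ν y) x +
      Real.sin (x 1) * pd 2 (harmPhi ν) x = -harmEigen ν * Real.sin (x 1) ^ 2 * sphHarmonic x ν := by
  unfold sphHarmonic harmEigen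
  have e1 := Real.sin_sq_add_cos_sq (x 1)
  have h2 : ∀ ν, harmPhi ν = ![fun _ => 0, fun _ => 0, fun y => -Real.sin (y 2), fun y => Real.cos (y 2)] ν := by
    intro ν; fin_cases ν <;> rfl
  have h3 : ∀ ν, harmTheta ν = ![fun _ => 0, fun y => -Real.sin (y 1),
    fun y => Real.cos (y 1) * Real.cos (y 2), fun y => Real.cos (y 1) * Real.sin (y 2)] ν := by
    intro ν; fin_cases ν <;> rfl
  rw [h2, h3]
  fin_cases ν <;> simp (disch := fun_prop) [pd_mul, pd_neg, pd_const, pd_sin, pd_cos] <;> grind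

theorem sphHarmonic_periodic (ν : Fin 4) (τ θ : ℝ) :
    sphHarmonic ![τ, θ, 2 * Real.pi] ν = sphHarmonic ![τ, θ, 0] ν ∧
      harmPhi ν ![τ, θ, 2 * Real.pi] = harmPhi ν ![τ, θ, 0] := by
  fin_cases ν <;> simp [sphHarmonic, harmPhi]

theorem sphFun_periodic (f : ScalarField) (y : Coord) :
    sphFun f (fun i => y i + ![0, 0, 2 * Real.pi] i) = sphFun f y := by
  unfold sphFun
  congr 1
  funext μ
  unfold sphAmb sphHarmonic
  fin_cases μ <;> simp

theorem pd_sphFun_periodic {f : ScalarField} (hf : f.IsRegular) (a : Fin 3) (τ θ : ℝ) :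
    pd a (sphFun f) ![τ, θ, 2 * Real.pi] = pd a (sphFun f) ![τ, θ, 0] := by
  have e : sphFun f = fun y => sphFun f (fun i => y i + ![0, 0, 2 * Real.pi] i) :=
    funext fun y => (sphFun_periodic f y).symm
  have hg : Smooth (fun y : Coord => (fun i => y i + ![0, 0, 2 * Real.pi] i : Coord)) :=
    contDiff_pi.2 fun i => (smooth_coord i).add contDiff_const
  conv_rhs => rw [e]
  rw [pd_comp_map ((smooth_sphFun hf).diff _) (hg.diff _)]
  have h : ∀ c, pd a (fun y : Coord => y c + ![0, 0, 2 * Real.pi] c) ![τ, θ, 0] =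
      if a = c then 1 else 0 := fun c => by
    rw [pd_add a ((smooth_coord c).diff _) (differentiableAt_const _), pd_coord, pd_const, add_zero]
  simp only [h]
  have e2 : (fun i => (![τ, θ, 0] : Coord) i + ![0, 0, 2 * Real.pi] i : Coord) =
      ![τ, θ, 2 * Real.pi] := by
    funext i; fin_cases i <;> simp
  simp [e2]

theorem sphFun_periodic' (f : ScalarField) (τ θ : ℝ) :
    sphFun f ![τ, θ, 2 * Real.pi] = sphFun f ![τ, θ, 0] := by
  rw [← sphFun_periodic f ![τ, θ, 0]]
  congr 1
  funext i; fin_cases i <;> simp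

section

variable {Φ : ScalarField}

/-- The moment of `Φ` with `Y_ν` on the spheres `τ = const`. -/
def moment (Φ : ScalarField) (ν : Fin 4) : ℝ → ℝ := sphInt fun y => sphFun Φ y * weight ν y

/-- The derivative of `moment`. -/
def moment₁ (Φ : ScalarField) (ν : Fin 4) : ℝ → ℝ := sphInt fun y => pd 0 (sphFun Φ) y * weight ν y

/-- The second derivative of `moment`. -/
def moment₂ (Φ : ScalarField) (ν : Fin 4) : ℝ → ℝ :=
  sphInt fun y => pd 0 (pd 0 (sphFun Φ)) y * weight ν y

theorem pd_zero_weight (ν : Fin 4) (x : Coord) : pd 0 (weight ν) x = 0 := by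
  have h := pd_mul 0 ((smooth_sphHarmonic ν).diff x) ((smooth_sin 1).diff x)
  rw [pd_sphHarmonic, pd_sin] at h
  simp at h
  exact h

theorem pd_zero_mul_weight (ν : Fin 4) {f : Coord → ℝ} (hf : Smooth f) :
    pd 0 (fun y => f y * weight ν y) = fun y => pd 0 f y * weight ν y := by
  funext x
  rw [pd_mul 0 (hf.diff x) ((smooth_weight ν).diff x), pd_zero_weight, mul_zero, add_zero]

theorem hasDerivAt_moment (hΦ : Φ.IsRegular) (ν : Fin 4) (τ : ℝ) :
    HasDerivAt (moment Φ ν) (moment₁ Φ ν τ) τ := by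
  have h := hasDerivAt_sphInt ((smooth_sphFun hΦ).mul (smooth_weight ν)) τ
  rwa [pd_zero_mul_weight ν (smooth_sphFun hΦ)] at h

theorem hasDerivAt_moment₁ (hΦ : Φ.IsRegular) (ν : Fin 4) (τ : ℝ) :
    HasDerivAt (moment₁ Φ ν) (moment₂ Φ ν τ) τ := by
  have hs := smooth_pd 0 (smooth_sphFun hΦ)
  have h := hasDerivAt_sphInt (hs.mul (smooth_weight ν)) τ
  rwa [pd_zero_mul_weight ν hs] at h

/-- Green's identity on the sphere for H and Y_ν, with the Laplacian of H replaced by means of the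
wave equation and that of Y_ν by its eigenvalue. -/
theorem moment_ode (hΦ : Φ.IsRegular) (h : Φ.BoxPlusThree) (ν : Fin 4) (τ : ℝ) :
    Real.cosh τ ^ 2 * (moment₂ Φ ν τ + 2 * Real.tanh τ * moment₁ Φ ν τ - 3 * moment Φ ν τ) +
      harmEigen ν * moment Φ ν τ = 0 := by
  set H := sphFun Φ with hH
  have hs : Smooth H := smooth_sphFun hΦ
  have hp := fun a => smooth_pd a hs
  have hY := smooth_sphHarmonic ν
  have ht := smooth_harmTheta ν
  have hf := smooth_harmPhi ν
  have hw := smooth_weight ν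
  have hsin := smooth_sin 1
  have hst : Smooth (fun y : Coord => Real.sin (y 1) * harmTheta ν y) := hsin.mul ht
  have hsH : Smooth (fun y : Coord => Real.sin (y 1) * pd 1 H y) := hsin.mul (hp 1)
  have hsf : Smooth (fun y : Coord => Real.sin (y 1) * harmPhi ν y) := hsin.mul hf
  have m1 : Smooth (fun y => sphHarmonic y ν * (Real.sin (y 1) * pd 1 H y)) := hY.mul hsH
  have m2 : Smooth (fun y => Real.sin (y 1) * harmTheta ν y * H y) := hst.mul hs
  have m3 : Smooth (fun y => sphHarmonic y ν * pd 2 H y) := hY.mul (hp 2)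
  have m4 : Smooth (fun y => Real.sin (y 1) * harmPhi ν y * H y) := hsf.mul hs
  -- The flux is Y∇H - H∇Y. Its θ-component carries a factor sin θ and so vanishes at the poles; its
  -- φ-component is periodic.
  have key := sphInt_eq_zero
    (U := fun y => sphHarmonic y ν * (Real.sin (y 1) * pd 1 H y) -
      Real.sin (y 1) * harmTheta ν y * H y)
    (V := fun y => sphHarmonic y ν * pd 2 H y - Real.sin (y 1) * harmPhi ν y * H y)
    (K := fun y => Real.cosh (y 0) ^ 2 * (pd 0 (pd 0 H) y * weight ν y) +
      (2 * Real.cosh (y 0) ^ 2 * Real.tanh (y 0) * (pd 0 H y * weight ν y) +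
        (-3 * Real.cosh (y 0) ^ 2 + harmEigen ν) * (H y * weight ν y)))
    (m1.sub m2) (m3.sub m4)
    (fun τ φ => by simp) (fun τ φ => by simp)
    (fun τ θ => by
      simp only [sphHarmonic_periodic, hH, sphFun_periodic', pd_sphFun_periodic hΦ]; simp)
    (fun y hy => by
      have hwave := sphFun_wave hΦ h hy
      rw [← hH] at hwave
      have hLY := pd_harmTheta ν y
      rw [pd_sub 1 (m1.diff y) (m2.diff y),
        pd_sub 2 (m3.diff y) (m4.diff y),
        pd_mul 1 (hY.diff y) (hsH.diff y), pd_mul 1 (hst.diff y) (hs.diff y),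
        pd_mul 2 (hY.diff y) ((hp 2).diff y), pd_mul 2 (hsf.diff y) (hs.diff y),
        pd_mul 2 (hsin.diff y) (hf.diff y), pd_sphHarmonic, pd_sphHarmonic, pd_sin]
      simp
      unfold weight
      linear_combination sphHarmonic y ν * hwave - H y * hLY) τ
  have hc0 : Smooth (fun y : Coord => Real.cosh (y 0)) := smooth_cosh0
  have ht0 : Smooth (fun y : Coord => Real.tanh (y 0)) := smooth_tanh0
  have g2 : Smooth (fun y => Real.cosh (y 0) ^ 2 * (pd 0 (pd 0 H) y * weight ν y)) :=
    (hc0.pow 2).mul ((smooth_pd 0 (hp 0)).mul hw)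
  have g1 : Smooth (fun y => 2 * Real.cosh (y 0) ^ 2 * Real.tanh (y 0) * (pd 0 H y * weight ν y)) :=
    ((contDiff_const.mul (hc0.pow 2)).mul ht0).mul ((hp 0).mul hw)
  have g0 : Smooth (fun y => (-3 * Real.cosh (y 0) ^ 2 + harmEigen ν) * (H y * weight ν y)) :=
    ((contDiff_const.mul (hc0.pow 2)).add contDiff_const).mul (hs.mul hw)
  rw [sphInt_add g2 (g1.add g0), sphInt_add g1 g0,
    sphInt_mul_left (fun τ => Real.cosh τ ^ 2),
    sphInt_mul_left (fun τ => 2 * Real.cosh τ ^ 2 * Real.tanh τ),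
    sphInt_mul_left (fun τ => -3 * Real.cosh τ ^ 2 + harmEigen ν)] at key
  unfold moment₂ moment₁ moment
  linear_combination key

end

/-! ### The radial equation and its fundamental systems. -/

/-- Solutions of the radial equation, with their first two derivatives. -/
structure RadialSol (l : ℝ) (a a₁ a₂ : ℝ → ℝ) : Prop where
  deriv : ∀ τ, HasDerivAt a (a₁ τ) τ
  deriv₁ : ∀ τ, HasDerivAt a₁ (a₂ τ) τ
  eq : ∀ τ, Real.cosh τ ^ 2 * (a₂ τ + 2 * Real.tanh τ * a₁ τ - 3 * a τ) + l * a τ = 0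

/-- Abel's formula: the damping coefficient 2 tanh τ is the logarithmic derivative of cosh² τ. -/
theorem RadialSol.wronskian {l : ℝ} {a a₁ a₂ b b₁ b₂ : ℝ → ℝ} (ha : RadialSol l a a₁ a₂)
    (hb : RadialSol l b b₁ b₂) (τ : ℝ) : Real.cosh τ ^ 2 * (a τ * b₁ τ - a₁ τ * b τ) =
      a 0 * b₁ 0 - a₁ 0 * b 0 := by
  have h : ∀ t, HasDerivAt (fun t => Real.cosh t ^ 2 * (a t * b₁ t - a₁ t * b t)) 0 t := by
    intro t
    have hC := (Real.cosh_pos t).ne'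
    refine (((Real.hasDerivAt_cosh t).fun_pow 2).fun_mul (((ha.deriv t).fun_mul (hb.deriv₁ t)).fun_sub
      ((ha.deriv₁ t).fun_mul (hb.deriv t)))).congr_deriv ?_
    have e1 := ha.eq t
    have e2 := hb.eq t
    rw [Real.tanh_eq_sinh_div_cosh] at e1 e2
    field_simp at e1 e2
    simp
    linear_combination a t * e2 - b t * e1
  have := is_const_of_deriv_eq_zero (fun t => (h t).differentiableAt) (fun t => (h t).deriv) τ 0
  simpa using this

/-- The radial factor of `ζ_ν`. -/
def radF (ν : Fin 4) (τ : ℝ) : ℝ :=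
  ![Real.sinh τ, Real.cosh τ, Real.cosh τ, Real.cosh τ] ν

/-- The radial factor of `ζ̂_ν`. -/
def radG (ν : Fin 4) (τ : ℝ) : ℝ :=
  ![Real.cosh (2 * τ) / Real.cosh τ, 2 * Real.sinh τ + Real.tanh τ / Real.cosh τ,
    2 * Real.sinh τ + Real.tanh τ / Real.cosh τ, 2 * Real.sinh τ + Real.tanh τ / Real.cosh τ] ν

theorem radialSol_sinh : RadialSol 0 Real.sinh Real.cosh Real.sinh where
  deriv := Real.hasDerivAt_sinh
  deriv₁ := Real.hasDerivAt_cosh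
  eq τ := by
    have hC := (Real.cosh_pos τ).ne'
    rw [Real.tanh_eq_sinh_div_cosh]; field_simp; ring

theorem radialSol_cosh : RadialSol 2 Real.cosh Real.sinh Real.cosh where
  deriv := Real.hasDerivAt_cosh
  deriv₁ := Real.hasDerivAt_sinh
  eq τ := by
    have hC := (Real.cosh_pos τ).ne'
    have h := Real.cosh_sq τ
    rw [Real.tanh_eq_sinh_div_cosh]; field_simp; rw [h]; ring

/-- The slope at τ = 0 is recorded here and in `radialSol_two` because it enters the Wronskian with
the partner solution, which is -1 in this case and 3 in the other. -/
theorem radialSol_zero : ∃ g₁ g₂, g₁ 0 = 0 ∧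
    RadialSol 0 (fun τ => Real.cosh (2 * τ) / Real.cosh τ) g₁ g₂ := by
  refine ⟨fun τ => 2 * Real.sinh τ + Real.sinh τ / Real.cosh τ ^ 2,
    fun τ => 2 * Real.cosh τ + 1 / Real.cosh τ - 2 * Real.sinh τ ^ 2 / Real.cosh τ ^ 3,
    by simp, fun τ => ?_, fun τ => ?_, fun τ => ?_⟩
  all_goals
    have hC := (Real.cosh_pos τ).ne'
    have h := Real.cosh_sq τ
    have hc := Real.hasDerivAt_cosh τ
    have hs := Real.hasDerivAt_sinh τ
  · have e : (fun τ => Real.cosh (2 * τ) / Real.cosh τ) =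
        fun τ => 2 * Real.cosh τ - (Real.cosh τ)⁻¹ := by
      funext t
      have hC := (Real.cosh_pos t).ne'
      rw [Real.cosh_two_mul, Real.sinh_sq]; field_simp; ring
    rw [e]
    refine ((hc.const_mul 2).fun_sub (hc.fun_inv hC)).congr_deriv ?_
    ring
  · refine ((hs.const_mul 2).fun_add (hs.fun_div (hc.fun_pow 2) (pow_ne_zero 2 hC))).congr_deriv ?_
    simp; field_simp; ring
  · rw [Real.tanh_eq_sinh_div_cosh, Real.cosh_two_mul]
    field_simp
    grind

theorem radialSol_two : ∃ g₁ g₂, g₁ 0 = 3 ∧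
    RadialSol 2 (fun τ => 2 * Real.sinh τ + Real.tanh τ / Real.cosh τ) g₁ g₂ := by
  refine ⟨fun τ => 2 * Real.cosh τ + 1 / Real.cosh τ - 2 * Real.sinh τ ^ 2 / Real.cosh τ ^ 3,
    fun τ => 2 * Real.sinh τ - 5 * Real.sinh τ / Real.cosh τ ^ 2 +
      6 * Real.sinh τ ^ 3 / Real.cosh τ ^ 4, by simp; norm_num, fun τ => ?_, fun τ => ?_, fun τ => ?_⟩
  all_goals
    have hC := (Real.cosh_pos τ).ne'
    have h := Real.cosh_sq τ
    have hc := Real.hasDerivAt_cosh τ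
    have hs := Real.hasDerivAt_sinh τ
  · have e : (fun τ => 2 * Real.sinh τ + Real.tanh τ / Real.cosh τ) =
        fun τ => 2 * Real.sinh τ + Real.sinh τ / Real.cosh τ ^ 2 := by
      funext t
      have hC := (Real.cosh_pos t).ne'
      rw [Real.tanh_eq_sinh_div_cosh]; field_simp
    rw [e]
    refine ((hs.const_mul 2).fun_add (hs.fun_div (hc.fun_pow 2) (pow_ne_zero 2 hC))).congr_deriv ?_
    simp; field_simp; ring
  · refine (((hc.const_mul 2).fun_add ((hasDerivAt_const τ (1 : ℝ)).fun_div hc hC)).fun_sub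
      (((hs.fun_pow 2).const_mul 2).fun_div (hc.fun_pow 3) (pow_ne_zero 3 hC))).congr_deriv ?_
    simp; field_simp; ring
  · rw [Real.tanh_eq_sinh_div_cosh]
    field_simp
    grind

theorem exists_moment_eq {Φ : ScalarField} (hΦ : Φ.IsRegular) (h : Φ.BoxPlusThree) (ν : Fin 4) :
    ∃ α β : ℝ, ∀ τ, moment Φ ν τ = α * radF ν τ + β * radG ν τ := by
  have ha : RadialSol (harmEigen ν) (moment Φ ν) (moment₁ Φ ν) (moment₂ Φ ν) :=
    ⟨hasDerivAt_moment hΦ ν, hasDerivAt_moment₁ hΦ ν, moment_ode hΦ h ν⟩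
  obtain ⟨l, f, f₁, f₂, g, g₁, g₂, hf, hg, hl, hfν, hgν, hw⟩ : ∃ (l : ℝ) (f f₁ f₂ g g₁ g₂ : ℝ → ℝ),
      RadialSol l f f₁ f₂ ∧ RadialSol l g g₁ g₂ ∧ harmEigen ν = l ∧ radF ν = f ∧ radG ν = g ∧
        f 0 * g₁ 0 - f₁ 0 * g 0 ≠ 0 := by
    obtain ⟨u₁, u₂, hu, hus⟩ := radialSol_zero
    obtain ⟨v₁, v₂, hv, hvs⟩ := radialSol_two
    fin_cases ν
    · exact ⟨_, _, _, _, _, _, _, radialSol_sinh, hus, rfl, rfl, rfl, by simp⟩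
    all_goals exact ⟨_, _, _, _, _, _, _, radialSol_cosh, hvs, rfl, rfl, rfl, by simp [hv]⟩
  rw [hl] at ha
  rw [hfν, hgν]
  set W := f 0 * g₁ 0 - f₁ 0 * g 0 with hW
  -- Cramer's rule. Each Wronskian times cosh² τ is constant, so the coefficients formed from the
  -- data at τ = 0 may be evaluated at any τ.
  refine ⟨(moment Φ ν 0 * g₁ 0 - moment₁ Φ ν 0 * g 0) / W,
    -(moment Φ ν 0 * f₁ 0 - moment₁ Φ ν 0 * f 0) / W, fun τ => ?_⟩
  have e1 := ha.wronskian hg τ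
  have e2 := ha.wronskian hf τ
  have e3 := hf.wronskian hg τ
  rw [← hW] at e3
  rw [← e1, ← e2]
  field_simp
  rw [← e3]
  ring

/-! ### Orthogonality of the harmonics and the coefficients α, α̂. -/

/-- `∫ Y_ν²` over the unit sphere. -/
def harmNorm (ν : Fin 4) : ℝ :=
  ![4 * Real.pi, 4 / 3 * Real.pi, 4 / 3 * Real.pi, 4 / 3 * Real.pi] ν

/-- The harmonics are products of a function of θ and one of φ, so the integrals reduce to
one-dimensional ones. -/
theorem integral_sphHarmonic (μ ν : Fin 4) (τ : ℝ) :
    sphInt (fun y => sphHarmonic y μ * weight ν y) τ = if μ = ν then harmNorm ν else 0 := by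
  have e1 : ∀ p q : ℝ → ℝ, (∫ θ in (0 : ℝ)..Real.pi, ∫ φ in (0 : ℝ)..(2 * Real.pi), p θ * q φ) =
      (∫ θ in (0 : ℝ)..Real.pi, p θ) * ∫ φ in (0 : ℝ)..(2 * Real.pi), q φ := fun p q => by
    simp
  have t1 : ∫ θ in (0 : ℝ)..Real.pi, Real.sin θ = 2 := by simp; norm_num
  have t2 : ∫ θ in (0 : ℝ)..Real.pi, Real.sin θ * Real.cos θ = 0 := by
    rw [integral_sin_mul_cos₁]; simp
  have t4 : ∫ θ in (0 : ℝ)..Real.pi, Real.sin θ ^ 3 = 4 / 3 := by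
    rw [integral_sin_pow]; simp; norm_num
  have t3 : ∫ θ in (0 : ℝ)..Real.pi, Real.cos θ ^ 2 * Real.sin θ = 2 / 3 := by
    have e : (fun θ => Real.cos θ ^ 2 * Real.sin θ) = fun θ => Real.sin θ - Real.sin θ ^ 3 := by
      funext θ; rw [Real.cos_sq']; ring
    rw [e, intervalIntegral.integral_sub (Real.continuous_sin.intervalIntegrable _ _)
      ((by fun_prop : Continuous fun θ => Real.sin θ ^ 3).intervalIntegrable _ _), t1, t4]
    norm_num
  have p1 : ∫ φ in (0 : ℝ)..(2 * Real.pi), Real.cos φ = 0 := by simp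
  have p2 : ∫ φ in (0 : ℝ)..(2 * Real.pi), Real.sin φ = 0 := by simp
  have p3 : ∫ φ in (0 : ℝ)..(2 * Real.pi), Real.cos φ ^ 2 = Real.pi := by
    rw [integral_cos_sq]; simp
  have p4 : ∫ φ in (0 : ℝ)..(2 * Real.pi), Real.sin φ ^ 2 = Real.pi := by
    rw [integral_sin_sq]; simp
  have p5 : ∫ φ in (0 : ℝ)..(2 * Real.pi), Real.sin φ * Real.cos φ = 0 := by
    rw [integral_sin_mul_cos₁]; simp
  have p0 : ∫ φ in (0 : ℝ)..(2 * Real.pi), (1 : ℝ) = 2 * Real.pi := by simp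
  set P : Fin 4 → ℝ → ℝ := fun μ θ => ![1, Real.cos θ, Real.sin θ, Real.sin θ] μ with hP
  set Q : Fin 4 → ℝ → ℝ := fun μ φ => ![1, 1, Real.cos φ, Real.sin φ] μ with hQ
  have e2 : ∀ μ θ φ, sphHarmonic ![τ, θ, φ] μ = P μ θ * Q μ φ := by
    intro μ θ φ; fin_cases μ <;> simp [hP, hQ, sphHarmonic]
  have e3 : sphInt (fun y => sphHarmonic y μ * weight ν y) τ =
      (∫ θ in (0 : ℝ)..Real.pi, P μ θ * P ν θ * Real.sin θ) *
        ∫ φ in (0 : ℝ)..(2 * Real.pi), Q μ φ * Q ν φ := by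
    rw [← e1]
    unfold sphInt weight
    simp only [e2]
    refine intervalIntegral.integral_congr fun θ _ => intervalIntegral.integral_congr fun φ _ => ?_
    simp; ring
  rw [e3]
  have c1 : ∀ θ, Real.cos θ * Real.cos θ * Real.sin θ = Real.cos θ ^ 2 * Real.sin θ :=
    fun θ => by ring
  have c2 : ∀ θ, Real.sin θ ^ 2 * Real.sin θ = Real.sin θ ^ 3 := fun θ => by ring
  have c3 : ∀ θ, Real.cos θ * Real.sin θ = Real.sin θ * Real.cos θ := fun θ => mul_comm _ _
  have c4 : ∀ θ, Real.cos θ * Real.cos θ = Real.cos θ ^ 2 := fun θ => by ring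
  have c5 : ∀ θ, Real.sin θ * Real.sin θ = Real.sin θ ^ 2 := fun θ => by ring
  fin_cases μ <;> fin_cases ν <;>
    simp only [hP, hQ, harmNorm, Fin.zero_eta, Fin.mk_one, Fin.reduceFinMk, Fin.isValue,
      Matrix.cons_val, one_mul, mul_one, c1, c2, c4, c5, c3, t1, t2, t3, t4, p1, p2, p3, p4, p5, p0,
      mul_zero, zero_mul] <;> simp <;> ring

theorem radF_sphHarmonic (μ : Fin 4) (p : Patch) {y : Coord} (hy : InOverlap y) :
    zeta μ p (sphChart p y) = radF μ (y 0) * sphHarmonic y μ ∧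
      zetaHat μ p (sphChart p y) = radG μ (y 0) * sphHarmonic y μ := by
  constructor
  · rw [zeta_sphChart μ p hy]; rfl
  · rw [zetaHat_sphChart μ p hy]
    fin_cases μ <;> simp [radG, sphHarmonic]

theorem smooth_radF (μ : Fin 4) : Smooth (fun y : Coord => radF μ (y 0)) := by
  unfold radF
  fin_cases μ
  · exact smooth_sinh0
  · exact smooth_cosh0
  · exact smooth_cosh0
  · exact smooth_cosh0

theorem smooth_radG (μ : Fin 4) : Smooth (fun y : Coord => radG μ (y 0)) := by
  have hC : ∀ x : Coord, Real.cosh (x 0) ≠ 0 := fun x => (Real.cosh_pos _).ne'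
  have h2 : Smooth (fun y : Coord => Real.cosh (2 * y 0)) :=
    Real.contDiff_cosh.comp (contDiff_const.mul (smooth_coord 0))
  have h : Smooth (fun y : Coord => 2 * Real.sinh (y 0) + Real.tanh (y 0) / Real.cosh (y 0)) :=
    (contDiff_const.mul smooth_sinh0).add (ContDiff.div smooth_tanh0 smooth_cosh0 hC)
  unfold radG
  fin_cases μ
  · exact ContDiff.div h2 smooth_cosh0 hC
  · exact h
  · exact h
  · exact h

/-- Orthogonality decouples the conditions: each ν involves only its own moment and its own pair of
coefficients. -/
theorem hasLowestHarmonics_iff {Φ : ScalarField} (hΦ : Φ.IsRegular) (α β : Fin 4 → ℝ) :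
    HasLowestHarmonics Φ α β ↔
      ∀ τ ν, moment Φ ν τ = harmNorm ν * (α ν * radF ν τ + β ν * radG ν τ) := by
  have hw := smooth_weight
  have hY := smooth_sphHarmonic
  have key : ∀ τ ν, sphInt (fun y => (Φ - ∑ μ, (α μ • zeta μ + β μ • zetaHat μ)) .north
      (sphChart .north y) * sphHarmonic y ν * Real.sin (y 1)) τ =
        moment Φ ν τ - harmNorm ν * (α ν * radF ν τ + β ν * radG ν τ) := by
    intro τ ν
    have e : sphInt (fun y => (Φ - ∑ μ, (α μ • zeta μ + β μ • zetaHat μ)) .north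
        (sphChart .north y) * sphHarmonic y ν * Real.sin (y 1)) =
        sphInt (fun y => sphFun Φ y * weight ν y +
          ((-(α 0 * radF 0 (y 0) + β 0 * radG 0 (y 0))) * (sphHarmonic y 0 * weight ν y) +
          ((-(α 1 * radF 1 (y 0) + β 1 * radG 1 (y 0))) * (sphHarmonic y 1 * weight ν y) +
          ((-(α 2 * radF 2 (y 0) + β 2 * radG 2 (y 0))) * (sphHarmonic y 2 * weight ν y) +
          (-(α 3 * radF 3 (y 0) + β 3 * radG 3 (y 0))) * (sphHarmonic y 3 * weight ν y))))) := by
      refine sphInt_congr fun y hy => ?_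
      have hz := fun μ => (radF_sphHarmonic μ .north hy).1
      have hzh := fun μ => (radF_sphHarmonic μ .north hy).2
      simp only [Pi.sub_apply, Finset.sum_apply, Pi.add_apply, Pi.smul_apply, smul_eq_mul, hz, hzh,
        Fin.sum_univ_four, sphFun_eq hΦ.2 .north hy, weight]
      ring
    have hs : ∀ μ, Smooth (fun y => (-(α μ * radF μ (y 0) + β μ * radG μ (y 0))) *
        (sphHarmonic y μ * weight ν y)) := fun μ =>
      (((contDiff_const.mul (smooth_radF μ)).add (contDiff_const.mul (smooth_radG μ))).neg).mul
        ((hY μ).mul (hw ν))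
    have hi : ∀ μ, sphInt (fun y => (-(α μ * radF μ (y 0) + β μ * radG μ (y 0))) *
        (sphHarmonic y μ * weight ν y)) τ = (-(α μ * radF μ τ + β μ * radG μ τ)) *
          if μ = ν then harmNorm ν else 0 := fun μ => by
      rw [sphInt_mul_left (fun t => -(α μ * radF μ t + β μ * radG μ t)), integral_sphHarmonic]
    rw [e, sphInt_add ((smooth_sphFun hΦ).mul (hw ν))
      ((hs 0).add ((hs 1).add ((hs 2).add (hs 3)))), sphInt_add (hs 0)
      ((hs 1).add ((hs 2).add (hs 3))), sphInt_add (hs 1) ((hs 2).add (hs 3)),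
      sphInt_add (hs 2) (hs 3), hi, hi, hi, hi]
    unfold moment
    fin_cases ν <;> simp <;> ring
  unfold HasLowestHarmonics
  refine forall_congr' fun τ => forall_congr' fun ν => ?_
  have := key τ ν
  rw [← sub_eq_zero (a := moment Φ ν τ), ← this]
  rfl

/-- The coefficients of the lowest harmonics exist and are unique. -/
theorem existsUnique_lowestHarmonics {Φ : ScalarField} (hΦ : Φ.IsRegular) (h : Φ.BoxPlusThree) :
    ∃! α : (Fin 4 → ℝ) × (Fin 4 → ℝ), HasLowestHarmonics Φ α.1 α.2 := by
  have hN : ∀ ν, harmNorm ν ≠ 0 := by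
    have := Real.pi_pos.ne'
    intro ν; fin_cases ν <;> simp [harmNorm, this]
  choose α β hαβ using exists_moment_eq hΦ h
  refine ⟨(fun ν => α ν / harmNorm ν, fun ν => β ν / harmNorm ν), ?_, ?_⟩
  · refine (hasLowestHarmonics_iff hΦ _ _).2 fun τ ν => ?_
    have := hN ν
    rw [hαβ]
    field_simp
  · rintro ⟨a, b⟩ hab
    rw [hasLowestHarmonics_iff hΦ] at hab
    have hlin : ∀ ν τ, (a ν - α ν / harmNorm ν) * radF ν τ + (b ν - β ν / harmNorm ν) * radG ν τ = 0 := by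
      intro ν τ
      have h1 := hab τ ν
      have h2 := hN ν
      rw [hαβ] at h1
      field_simp
      linear_combination -h1
    -- Exactly one radial factor vanishes at τ = 0, sinh for ν = 0 and that of ζ̂ otherwise. The
    -- value at 0 therefore eliminates one coefficient, and the value at 1 the other.
    have hz : ∀ ν, a ν - α ν / harmNorm ν = 0 ∧ b ν - β ν / harmNorm ν = 0 := by
      intro ν
      have h0 := hlin ν 0
      have h1 := hlin ν 1
      have hsinh : Real.sinh 1 ≠ 0 := (Real.sinh_pos_iff.2 one_pos).ne'
      have hpos : 2 * Real.sinh 1 + Real.tanh 1 / Real.cosh 1 ≠ 0 := by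
        rw [Real.tanh_eq_sinh_div_cosh]
        have := Real.sinh_pos_iff.2 (one_pos (α := ℝ))
        have := Real.cosh_pos 1
        positivity
      generalize a ν - α ν / harmNorm ν = u at *
      generalize b ν - β ν / harmNorm ν = v at *
      fin_cases ν
      · simp [radF, radG] at h0 h1
        subst h0
        simpa [hsinh] using h1
      all_goals
        simp [radF, radG] at h0 h1
        subst h0
        simpa [hpos] using h1
    exact Prod.ext (funext fun ν => sub_eq_zero.1 (hz ν).1) (funext fun ν => sub_eq_zero.1 (hz ν).2)

/-! ### Charges of a solution without lowest harmonics -/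

section

variable {Φ : ScalarField}

/-- Integration by parts: ∫ ∇Y·∇H = l(l+1) ∫ Y H, in a form where the factor sin θ of the measure
has been distributed over the components. -/
theorem moment_grad (hΦ : Φ.IsRegular) (ν : Fin 4) (τ : ℝ) :
    sphInt (fun y => Real.sin (y 1) * harmTheta ν y * pd 1 (sphFun Φ) y +
      harmPhi ν y * pd 2 (sphFun Φ) y) τ = harmEigen ν * moment Φ ν τ := by
  set H := sphFun Φ with hH
  have hs : Smooth H := smooth_sphFun hΦ
  have hp := fun a => smooth_pd a hs
  have ht := smooth_harmTheta ν
  have hf := smooth_harmPhi ν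
  have hw := smooth_weight ν
  have hsin := smooth_sin 1
  have hst : Smooth (fun y : Coord => Real.sin (y 1) * harmTheta ν y) := hsin.mul ht
  have hsf : Smooth (fun y : Coord => Real.sin (y 1) * harmPhi ν y) := hsin.mul hf
  have m1 : Smooth (fun y => Real.sin (y 1) * harmTheta ν y * H y) := hst.mul hs
  have m2 : Smooth (fun y => Real.sin (y 1) * harmPhi ν y * H y) := hsf.mul hs
  have m3 : Smooth (fun y => Real.sin (y 1) * harmTheta ν y * pd 1 H y + harmPhi ν y * pd 2 H y) :=
    (hst.mul (hp 1)).add (hf.mul (hp 2))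
  have m4 : Smooth (fun y => -harmEigen ν * (H y * weight ν y)) := contDiff_const.mul (hs.mul hw)
  have key := sphInt_eq_zero
    (K := fun y => (Real.sin (y 1) * harmTheta ν y * pd 1 H y + harmPhi ν y * pd 2 H y) +
      (-harmEigen ν) * (H y * weight ν y)) m1 m2
    (fun τ φ => by simp) (fun τ φ => by simp)
    (fun τ θ => by simp [sphHarmonic_periodic, hH, sphFun_periodic'])
    (fun y hy => by
      have hLY := pd_harmTheta ν y
      rw [pd_mul 1 (hst.diff y) (hs.diff y), pd_mul 2 (hsf.diff y) (hs.diff y),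
        pd_mul 2 (hsin.diff y) (hf.diff y), pd_sin]
      simp
      unfold weight
      linear_combination H y * hLY) τ
  rw [sphInt_add m3 m4, sphInt_const_mul] at key
  unfold moment
  linear_combination key

theorem pd_radF_sphHarmonic (μ : Fin 4) (y : Coord) (e : Fin 3) :
    pd e (fun z => radF μ (z 0) * sphHarmonic z μ) y =
      ![![Real.cosh (y 0), Real.sinh (y 0), Real.sinh (y 0), Real.sinh (y 0)] μ * sphHarmonic y μ,
        radF μ (y 0) * harmTheta μ y, radF μ (y 0) * (Real.sin (y 1) * harmPhi μ y)] e := by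
  have hr : pd e (fun z : Coord => radF μ (z 0)) y =
      ![![Real.cosh (y 0), Real.sinh (y 0), Real.sinh (y 0), Real.sinh (y 0)] μ, 0, 0] e := by
    have h1 := pd_sinh0 e y
    have h2 := pd_cosh0 e y
    unfold radF
    fin_cases μ
    · exact h1.trans (by fin_cases e <;> rfl)
    all_goals exact h2.trans (by fin_cases e <;> rfl)
  rw [pd_mul e ((smooth_radF μ).diff y) ((smooth_sphHarmonic μ).diff y), hr, pd_sphHarmonic]
  fin_cases e <;> simp

/-- Multiplied by sin θ, each term of the ambient gradient is a function of τ times the integrand of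
a moment with Y_μ. The divisor `sphHarmonic y 0` equals 1. -/
theorem sphFun_ambGrad (hΦ : Φ.IsRegular) (μ : Fin 4) {y : Coord} (hy : InOverlap y) :
    sphFun (fun p => ambGrad p μ (Φ p)) y * Real.sin (y 1) =
      -(![Real.cosh (y 0), Real.sinh (y 0), Real.sinh (y 0), Real.sinh (y 0)] μ *
        (pd 0 (sphFun Φ) y * weight μ y)) + radF μ (y 0) / Real.cosh (y 0) ^ 2 *
        (Real.sin (y 1) * harmTheta μ y * pd 1 (sphFun Φ) y + harmPhi μ y * pd 2 (sphFun Φ) y) +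
        radF μ (y 0) * (sphFun Φ y * weight μ y) / sphHarmonic y 0 := by
  have hs : Real.sin (y 1) ≠ 0 := (Real.sin_pos_of_pos_of_lt_pi hy.1 hy.2).ne'
  have hC := (Real.cosh_pos (y 0)).ne'
  have hreg := hΦ.ambGrad μ
  have hz := zeta_regular μ
  rw [sphFun_eq hreg.2 .north hy]
  have e1 := trace_sphChart (fun p x a b => pd a (Φ p) x * pd b (zeta μ p) x) .north hy
  have e2 : ∀ a, sphForm (fun p x a => pd a (Φ p) x) .north y a = pd a (sphFun Φ) y := fun a => by
    rw [sphForm_pd _ hΦ.1 .north hy, pd_sphFun hΦ a hy]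
  have e3 : ∀ a, sphForm (fun p x a => pd a (zeta μ p) x) .north y a =
      pd a (fun z => radF μ (z 0) * sphHarmonic z μ) y := fun a => by
    rw [sphForm_pd _ hz.1 .north hy]
    refine pd_congr ?_
    filter_upwards [isOpen_overlap.mem_nhds hy] with z hz using (radF_sphHarmonic μ .north hz).1
  have e4 : ∀ a, sphComponents (fun p x a b => pd a (Φ p) x * pd b (zeta μ p) x) .north y a a =
      pd a (sphFun Φ) y * pd a (fun z => radF μ (z 0) * sphHarmonic z μ) y := fun a => by
    rw [sphComponents_mul (fun p x a => pd a (Φ p) x) (fun p x b => pd b (zeta μ p) x), e2, e3]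
  simp only [e4, pd_radF_sphHarmonic] at e1
  rw [ambGrad_eq, (radF_sphHarmonic μ .north hy).1, ← sphFun_eq hΦ.2 .north hy]
  have e5 : (∑ a, ∑ b, metricInv (sphChart .north y) a b * (pd a (Φ .north) (sphChart .north y) *
      pd b (zeta μ .north) (sphChart .north y))) =
      trace (fun x a b => pd a (Φ .north) x * pd b (zeta μ .north) x) (sphChart .north y) := rfl
  rw [e5, e1, Fin.sum_univ_three]
  simp [sphInv, weight, sphHarmonic]
  field_simp
  ring

/-- The monopole of F^μ is a combination of the moment of Φ with Y_μ and its τ-derivative. It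
vanishes for all τ, hence so does its derivative, which is the flux of dF^μ through the sphere. -/
theorem moment_ambGrad (hΦ : Φ.IsRegular) (hm : ∀ ν τ, moment Φ ν τ = 0) (μ : Fin 4) (τ : ℝ) :
    moment (fun p => ambGrad p μ (Φ p)) 0 τ = 0 := by
  have hs : Smooth (sphFun Φ) := smooth_sphFun hΦ
  have hp := fun a => smooth_pd a hs
  have hw := smooth_weight μ
  have hm1 : moment₁ Φ μ τ = 0 := by
    have h := hasDerivAt_moment hΦ μ τ
    rw [show moment Φ μ = fun _ => 0 from funext (hm μ)] at h
    exact h.unique (hasDerivAt_const τ 0)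
  set C : ℝ → ℝ := fun t => -![Real.cosh t, Real.sinh t, Real.sinh t, Real.sinh t] μ with hCdef
  have hC : Smooth (fun y : Coord => C (y 0)) := by
    have h1 : Smooth (fun y : Coord => -Real.cosh (y 0)) := ContDiff.neg smooth_cosh0
    have h2 : Smooth (fun y : Coord => -Real.sinh (y 0)) := ContDiff.neg smooth_sinh0
    rw [hCdef]
    fin_cases μ
    · exact h1
    all_goals exact h2
  have hR : Smooth (fun y : Coord => radF μ (y 0) / Real.cosh (y 0) ^ 2) :=
    ContDiff.div (smooth_radF μ) (ContDiff.pow smooth_cosh0 2) fun x =>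
      pow_ne_zero 2 (Real.cosh_pos _).ne'
  have m3 : Smooth (fun y => Real.sin (y 1) * harmTheta μ y * pd 1 (sphFun Φ) y +
      harmPhi μ y * pd 2 (sphFun Φ) y) :=
    (((smooth_sin 1).mul (smooth_harmTheta μ)).mul (hp 1)).add ((smooth_harmPhi μ).mul (hp 2))
  have s1 : Smooth (fun y => C (y 0) * (pd 0 (sphFun Φ) y * weight μ y)) := hC.mul ((hp 0).mul hw)
  have s2 : Smooth (fun y => radF μ (y 0) / Real.cosh (y 0) ^ 2 *
      (Real.sin (y 1) * harmTheta μ y * pd 1 (sphFun Φ) y + harmPhi μ y * pd 2 (sphFun Φ) y)) :=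
    hR.mul m3
  have s3 : Smooth (fun y => radF μ (y 0) * (sphFun Φ y * weight μ y)) :=
    (smooth_radF μ).mul (hs.mul hw)
  have e : sphInt (fun y => sphFun (fun p => ambGrad p μ (Φ p)) y * weight 0 y) =
      sphInt (fun y => C (y 0) * (pd 0 (sphFun Φ) y * weight μ y) +
        (radF μ (y 0) / Real.cosh (y 0) ^ 2 *
        (Real.sin (y 1) * harmTheta μ y * pd 1 (sphFun Φ) y + harmPhi μ y * pd 2 (sphFun Φ) y) +
        radF μ (y 0) * (sphFun Φ y * weight μ y))) := by
    refine sphInt_congr fun y hy => ?_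
    have h := sphFun_ambGrad hΦ μ hy
    have h0 : weight 0 y = Real.sin (y 1) := by simp [weight, sphHarmonic]
    have h1 : sphHarmonic y 0 = 1 := rfl
    rw [h1, div_one] at h
    rw [h0, h, hCdef]
    ring
  unfold moment
  rw [e, sphInt_add s1 (s2.add s3), sphInt_add s2 s3, sphInt_mul_left C,
    sphInt_mul_left (fun t => radF μ t / Real.cosh t ^ 2), sphInt_mul_left (radF μ),
    moment_grad hΦ]
  have hm0 : sphInt (fun y => sphFun Φ y * weight μ y) τ = 0 := hm μ τ
  have hm1' : sphInt (fun y => pd 0 (sphFun Φ) y * weight μ y) τ = 0 := hm1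
  rw [hm0, hm1', hm]
  ring

theorem moment₁_ambGrad (hΦ : Φ.IsRegular) (hm : ∀ ν τ, moment Φ ν τ = 0) (μ : Fin 4) (τ : ℝ) :
    moment₁ (fun p => ambGrad p μ (Φ p)) 0 τ = 0 := by
  have h := hasDerivAt_moment (hΦ.ambGrad μ) 0 τ
  rw [show moment (fun p => ambGrad p μ (Φ p)) 0 = fun _ => 0 from
    funext (moment_ambGrad hΦ hm μ)] at h
  exact h.unique (hasDerivAt_const τ 0)

end

/-- The gradient of `ambGrad` is divergence-free. -/
theorem boxScalar_ambGrad {Φ : Coord → ℝ} (hΦ : Smooth Φ) (h : ∀ x, boxScalar Φ x + 3 * Φ x = 0)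
    (p : Patch) (μ : Fin 4) (x : Coord) : boxScalar (ambGrad p μ Φ) x = 0 := by
  set T := hessPlusAt Φ with hT
  have hTs : Smooth T := smooth_hessPlusAt hΦ
  have htr : ∀ x, trace T x = 0 := fun x => by rw [hT, trace_hessPlusAt, h]
  have hsymm : ∀ x a b, T x a b = T x b a := fun x a b => hessPlusAt_symm hΦ x a b
  have hdiv : ∀ a, divergence T x a = 0 := fun a =>
    divergence_eq_zero hTs hsymm htr (fun x a b => by
      rw [curl_hessPlusAt hΦ, curl_hessPlusAt hΦ]) x a
  have hg : ∀ a, pd a (ambGrad p μ Φ) = fun x => formOf p μ T x a := fun a =>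
    funext fun x => pd_ambGrad p μ hΦ a x
  have hc := fun a b => (smooth_comp2 hTs a b).diff x
  have hf := fun b => (smooth_frame p μ b).diff x
  have htr' := htr x
  have hu := conf_ne x
  rw [boxScalar_eq]
  simp only [hess_eq, hg]
  unfold formOf
  have hpd : ∀ a c, pd c (fun x => ∑ b, T x a b * frame p μ b x) x =
      ∑ b, (pd c (fun y => T y a b) x * frame p μ b x + T x a b * pd c (frame p μ b) x) := by
    intro a c
    rw [pd_sum _ _ c (fun b _ => (hc a b).fun_mul (hf b))]
    exact Finset.sum_congr rfl fun b _ => pd_mul c (hc a b) (hf b)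
  simp only [hpd, pd_frame]
  have d0 := hdiv 0
  have d1 := hdiv 1
  have d2 := hdiv 2
  rw [trace_eq] at htr'
  rw [divergence_eq] at d0 d1 d2
  simp only [covD2_eq, Fin.sum_univ_three, gam, Matrix.cons_val] at d0 d1 d2 ⊢
  have s01 := hsymm x 0 1
  have s02 := hsymm x 0 2
  have s12 := hsymm x 1 2
  have g01 : (fun y => T y 1 0) = fun y => T y 0 1 := funext fun y => hsymm y 1 0
  have g02 : (fun y => T y 2 0) = fun y => T y 0 2 := funext fun y => hsymm y 2 0
  have g12 : (fun y => T y 2 1) = fun y => T y 1 2 := funext fun y => hsymm y 2 1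
  simp only [g01, g02, g12, ← s01, ← s02, ← s12] at d0 d1 d2 ⊢
  have huv : conf x * (conf x)⁻¹ = 1 := mul_inv_cancel₀ hu
  generalize (conf x)⁻¹ = v at *
  simp
  -- Since dF^μ = T_ab E^{bμ} with T = SΦ, its divergence is (div T)·E^μ - X^μ tr T, and both terms
  -- vanish.
  linear_combination frame p μ 0 x * d0 + frame p μ 1 x * d1 + frame p μ 2 x * d2 -
    zeta μ p x * htr'

/-! ### Two-forms with vanishing integral over the sphere are exact -/

/-- Projection to the sphere `τ = 0`. -/
def slice (x : Coord) : Coord := ![0, x 1, x 2]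

theorem smooth_slice : Smooth slice := smooth_vec contDiff_const (smooth_coord 1) (smooth_coord 2)

theorem pd_zero_of_slice {f : Coord → ℝ} (hf : Smooth f) (h : ∀ x, f x = f (slice x)) (x : Coord) :
    pd 0 f x = 0 := by
  have e : f = fun y => f (slice y) := funext h
  rw [e, pd_comp_map (f := f) (hf.diff _) (smooth_slice.diff x), Fin.sum_univ_three]
  simp [slice, pd_const, pd_coord]

/-! ### Averaging over the azimuth. -/

/-- Rotation of the sphere `τ = 0` about its axis. -/
def rotAz (p : Patch) (t : ℝ) (x : Coord) : Coord :=
  ![0, Real.cos t * x 1 - p.sgn * (Real.sin t * x 2), p.sgn * (Real.sin t * x 1) + Real.cos t * x 2]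

theorem smooth_rotAz (p : Patch) : Smooth (Function.uncurry fun (x : Coord) (t : ℝ) => rotAz p t x) := by
  have h1 : Smooth (fun q : Coord × ℝ => Real.cos q.2) := Real.contDiff_cos.comp contDiff_snd
  have h2 : Smooth (fun q : Coord × ℝ => Real.sin q.2) := Real.contDiff_sin.comp contDiff_snd
  have c1 : Smooth (fun q : Coord × ℝ => q.1 1) := (smooth_coord 1).comp contDiff_fst
  have c2 : Smooth (fun q : Coord × ℝ => q.1 2) := (smooth_coord 2).comp contDiff_fst
  have d1 : Smooth (fun q : Coord × ℝ => Real.cos q.2 * q.1 1 - p.sgn * (Real.sin q.2 * q.1 2)) :=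
    (h1.mul c1).sub (contDiff_const.mul (h2.mul c2))
  have d2 : Smooth (fun q : Coord × ℝ => p.sgn * (Real.sin q.2 * q.1 1) + Real.cos q.2 * q.1 2) :=
    (contDiff_const.mul (h2.mul c1)).add (h1.mul c2)
  exact smooth_vec contDiff_const d1 d2

theorem smooth_rotAz_left (p : Patch) (t : ℝ) : Smooth (rotAz p t) :=
  ContDiff.comp (g := Function.uncurry fun (x : Coord) (t : ℝ) => rotAz p t x)
    (f := fun x : Coord => (x, t)) (smooth_rotAz p) (contDiff_id.prodMk contDiff_const)

/-- The sign in `rotAz` makes it the shift of φ in both charts, so averages taken in the charts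
agree on the overlap. -/
theorem sphChart_shift (p : Patch) (y : Coord) (t : ℝ) :
    sphChart p ![0, y 1, y 2 + t] = rotAz p t (sphChart p y) := by
  funext c
  cases p <;> fin_cases c <;> simp [sphChart, rotAz, Patch.sgn, Real.cos_add, Real.sin_add] <;> ring

section

variable {f : Coord → ℝ}

theorem hasDerivAt_rotAz (hf : Smooth f) (p : Patch) (x : Coord) (t : ℝ) :
    HasDerivAt (fun t => f (rotAz p t x)) (p.sgn * (x 1 * pd 2 (fun y => f (rotAz p t y)) x -
      x 2 * pd 1 (fun y => f (rotAz p t y)) x)) t := by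
  have h : HasDerivAt (fun t => rotAz p t x) ![0, -Real.sin t * x 1 - p.sgn * (Real.cos t * x 2),
      p.sgn * (Real.cos t * x 1) + -Real.sin t * x 2] t := by
    have hc := Real.hasDerivAt_cos t
    have hs := Real.hasDerivAt_sin t
    refine hasDerivAt_pi.2 fun i => ?_
    fin_cases i
    · exact hasDerivAt_const t (0 : ℝ)
    · exact (hc.mul_const (x 1)).fun_sub ((hs.mul_const (x 2)).const_mul p.sgn)
    · exact ((hs.mul_const (x 1)).const_mul p.sgn).fun_add (hc.mul_const (x 2))
  refine ((hf.diff _).hasFDerivAt.comp_hasDerivAt t h).congr_deriv ?_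
  have hd := fun a => pd_comp_map (f := f) (hf.diff _) ((smooth_rotAz_left p t).diff x) a
  have h1 := (smooth_coord 1).diff x
  have h2 := (smooth_coord 2).diff x
  have e1 : ∀ a, pd a (fun y => rotAz p t y 1) x =
      Real.cos t * (if a = 1 then 1 else 0) - p.sgn * (Real.sin t * if a = 2 then 1 else 0) := by
    intro a
    change pd a (fun y => Real.cos t * y 1 - p.sgn * (Real.sin t * y 2)) x = _
    rw [pd_sub a (h1.const_mul _) ((h2.const_mul _).const_mul _), pd_const_mul a _ h1,
      pd_const_mul a _ (h2.const_mul _), pd_const_mul a _ h2, pd_coord, pd_coord]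
  have e2 : ∀ a, pd a (fun y => rotAz p t y 2) x =
      p.sgn * (Real.sin t * if a = 1 then 1 else 0) + Real.cos t * (if a = 2 then 1 else 0) := by
    intro a
    change pd a (fun y => p.sgn * (Real.sin t * y 1) + Real.cos t * y 2) x = _
    rw [pd_add a ((h1.const_mul _).const_mul _) (h2.const_mul _), pd_const_mul a _ h2,
      pd_const_mul a _ (h1.const_mul _), pd_const_mul a _ h1, pd_coord, pd_coord]
  have e0 : ∀ a, pd a (fun y => rotAz p t y 0) x = 0 := fun a => pd_const a 0 x
  have hsq := p.sgn_sq
  rw [fderiv_eq_sum_pd, hd, hd]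
  simp only [Fin.sum_univ_three, e0, e1, e2]
  simp
  linear_combination (Real.sin t * x 1 * pd 1 f (rotAz p t x) +
    Real.sin t * x 2 * pd 2 f (rotAz p t x)) * hsq

theorem smooth_comp_rotAz (hf : Smooth f) (p : Patch) :
    Smooth (Function.uncurry fun (x : Coord) (t : ℝ) => f (rotAz p t x)) :=
  ContDiff.comp hf (smooth_rotAz p)

/-- Average over rotations. -/
def azMean (p : Patch) (f : Coord → ℝ) (x : Coord) : ℝ :=
  (2 * Real.pi)⁻¹ * ∫ t in (0 : ℝ)..(2 * Real.pi), f (rotAz p t x)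

/-- Primitive, along the rotations, of the deviation from the average. -/
def azPrim (p : Patch) (f : Coord → ℝ) (x : Coord) : ℝ :=
  (2 * Real.pi)⁻¹ * ∫ t in (0 : ℝ)..(2 * Real.pi), t * f (rotAz p t x)

theorem smooth_azMean (hf : Smooth f) (p : Patch) : Smooth (azMean p f) :=
  contDiff_const.mul (smooth_intervalIntegral (smooth_comp_rotAz hf p) 0 _)

theorem smooth_mul_comp_rotAz (hf : Smooth f) (p : Patch) :
    Smooth (Function.uncurry fun (x : Coord) (t : ℝ) => t * f (rotAz p t x)) :=
  ContDiff.mul contDiff_snd (smooth_comp_rotAz hf p)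

theorem smooth_azPrim (hf : Smooth f) (p : Patch) : Smooth (azPrim p f) :=
  contDiff_const.mul (smooth_intervalIntegral (smooth_mul_comp_rotAz hf p) 0 _)

-- Integrate the derivative of t f(R_t x) over one period. The generator of the rotations commutes
-- with R_t, so it may be pulled out of the integral, and what is left is f minus its average.
set_option maxHeartbeats 1000000 in
theorem azPrim_spec (hf : Smooth f) (p : Patch) (x : Coord) :
    p.sgn * (x 1 * pd 2 (azPrim p f) x - x 2 * pd 1 (azPrim p f) x) =
      f (slice x) - azMean p f x := by
  have hπ := Real.pi_pos.ne'
  have h1 : ∀ t, Smooth (fun y => f (rotAz p t y)) := fun t => ContDiff.comp hf (smooth_rotAz_left p t)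
  have hpd : ∀ a, pd a (azPrim p f) x =
      (2 * Real.pi)⁻¹ * ∫ t in (0 : ℝ)..(2 * Real.pi), t * pd a (fun y => f (rotAz p t y)) x := by
    intro a
    unfold azPrim
    rw [pd_const_mul a _ ((smooth_intervalIntegral (smooth_mul_comp_rotAz hf p) 0 _).diff x),
      pd_intervalIntegral (F := fun y t => t * f (rotAz p t y)) (smooth_mul_comp_rotAz hf p)]
    congr 1
    exact intervalIntegral.integral_congr fun t _ => pd_const_mul a t ((h1 t).diff x)
  have hc0 : Continuous fun t => f (rotAz p t x) :=
    Continuous.comp (g := Function.uncurry fun (x : Coord) (t : ℝ) => f (rotAz p t x))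
      (f := fun t : ℝ => (x, t)) (smooth_comp_rotAz hf p).continuous
      (continuous_const.prodMk continuous_id)
  have hcp : ∀ a, Continuous fun t => pd a (fun y => f (rotAz p t y)) x := by
    intro a
    have e : (fun t => pd a (fun y => f (rotAz p t y)) x) = fun t =>
        fderiv ℝ (Function.uncurry fun (x : Coord) (t : ℝ) => f (rotAz p t x)) (x, t)
          (Pi.single a 1, 0) := by
      funext t
      unfold pd
      rw [(fderiv_partial_left (f := fun (x : Coord) (t : ℝ) => f (rotAz p t x))
        ((smooth_comp_rotAz hf p).of_le (by exact_mod_cast le_top)) x t).fderiv]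
      simp
    rw [e]
    have hcf := (smooth_comp_rotAz hf p).continuous_fderiv (by simp)
    have := Continuous.comp (g := fderiv ℝ (Function.uncurry fun (x : Coord) (t : ℝ) =>
      f (rotAz p t x))) (f := fun t : ℝ => (x, t)) hcf (continuous_const.prodMk continuous_id)
    exact this.clm_apply continuous_const
  have hd := fun t => hasDerivAt_rotAz hf p x t
  have hF : ∀ t, HasDerivAt (fun t => t * f (rotAz p t x)) (1 * f (rotAz p t x) +
      t * (p.sgn * (x 1 * pd 2 (fun y => f (rotAz p t y)) x -
      x 2 * pd 1 (fun y => f (rotAz p t y)) x))) t := fun t => (hasDerivAt_id' t).fun_mul (hd t)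
  have hcd : Continuous fun t => t * (p.sgn * (x 1 * pd 2 (fun y => f (rotAz p t y)) x -
      x 2 * pd 1 (fun y => f (rotAz p t y)) x)) :=
    continuous_id.mul (continuous_const.mul ((continuous_const.mul (hcp 2)).sub
      (continuous_const.mul (hcp 1))))
  have hc1 : Continuous fun t => 1 * f (rotAz p t x) := continuous_const.mul hc0
  have hc2 : ∀ i a, Continuous fun t => x i * (t * pd a (fun y => f (rotAz p t y)) x) := fun i a =>
    continuous_const.mul (continuous_id.mul (hcp a))
  have hint := intervalIntegral.integral_eq_sub_of_hasDerivAt (a := 0) (b := 2 * Real.pi)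
    (fun t _ => hF t) ((hc1.add hcd).intervalIntegrable _ _)
  rw [intervalIntegral.integral_add (hc1.intervalIntegrable _ _)
    (hcd.intervalIntegrable _ _)] at hint
  have e0 : rotAz p (2 * Real.pi) x = slice x := by simp [rotAz, slice]
  have i2 : (∫ t in (0 : ℝ)..(2 * Real.pi), t * (p.sgn * (x 1 * pd 2 (fun y => f (rotAz p t y)) x -
      x 2 * pd 1 (fun y => f (rotAz p t y)) x))) =
      p.sgn * (x 1 * (∫ t in (0 : ℝ)..(2 * Real.pi), t * pd 2 (fun y => f (rotAz p t y)) x) -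
        x 2 * ∫ t in (0 : ℝ)..(2 * Real.pi), t * pd 1 (fun y => f (rotAz p t y)) x) := by
    rw [← intervalIntegral.integral_const_mul, ← intervalIntegral.integral_const_mul,
      ← intervalIntegral.integral_sub, ← intervalIntegral.integral_const_mul]
    · exact intervalIntegral.integral_congr fun t _ => by ring
    · exact (hc2 1 2).intervalIntegrable _ _
    · exact (hc2 2 1).intervalIntegrable _ _
  rw [i2, e0] at hint
  simp only [one_mul, zero_mul, sub_zero] at hint
  rw [hpd, hpd]
  unfold azMean
  field_simp
  linear_combination hint

theorem azPrim_slice (p : Patch) (f : Coord → ℝ) (x : Coord) : azPrim p f x = azPrim p f (slice x) := rfl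

/-! ### Radial primitives in a chart. -/

/-- Contraction of `τ = 0` to the centre of the chart. -/
def shrink (t : ℝ) (x : Coord) : Coord := ![0, t * x 1, t * x 2]

theorem smooth_shrink : Smooth (Function.uncurry fun (x : Coord) (t : ℝ) => shrink t x) :=
  smooth_vec contDiff_const (contDiff_snd.mul ((smooth_coord 1).comp contDiff_fst))
    (contDiff_snd.mul ((smooth_coord 2).comp contDiff_fst))

/-- The radial mean `∫₀¹ t f(t x) dt`. -/
def radMean (f : Coord → ℝ) (x : Coord) : ℝ := ∫ t in (0 : ℝ)..1, t * f (shrink t x)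

theorem smooth_radMean_integrand (hf : Smooth f) :
    Smooth (Function.uncurry fun (x : Coord) (t : ℝ) => t * f (shrink t x)) :=
  ContDiff.mul contDiff_snd (ContDiff.comp hf smooth_shrink)

theorem smooth_radMean (hf : Smooth f) : Smooth (radMean f) :=
  smooth_intervalIntegral (smooth_radMean_integrand hf) 0 1

/-- Integration of the t-derivative of t² f(tx) from 0 to 1. The result says that ρ (x dy - y dx)
with ρ = `radMean f` is a smooth primitive of f dx∧dy. -/
theorem radMean_spec (hf : Smooth f) (x : Coord) :
    2 * radMean f x + (x 1 * pd 1 (radMean f) x + x 2 * pd 2 (radMean f) x) = f (slice x) := by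
  have hsh : ∀ t, Smooth (shrink t) := fun t => smooth_shrink.comp (contDiff_id.prodMk contDiff_const)
  have hpd : ∀ a, a ≠ 0 → pd a (radMean f) x = ∫ t in (0 : ℝ)..1, t * (t * pd a f (shrink t x)) := by
    intro a ha
    unfold radMean
    rw [pd_intervalIntegral (F := fun y t => t * f (shrink t y)) (smooth_radMean_integrand hf)]
    refine intervalIntegral.integral_congr fun t _ => ?_
    have h1 := (smooth_coord 1).diff x
    have h2 := (smooth_coord 2).diff x
    have e0 : pd a (fun y => shrink t y 0) x = 0 := pd_const a 0 x
    have e1 : pd a (fun y => shrink t y 1) x = t * if a = 1 then 1 else 0 := by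
      change pd a (fun y => t * y 1) x = _
      rw [pd_const_mul a _ h1, pd_coord]
    have e2 : pd a (fun y => shrink t y 2) x = t * if a = 2 then 1 else 0 := by
      change pd a (fun y => t * y 2) x = _
      rw [pd_const_mul a _ h2, pd_coord]
    have hd : Smooth (fun y => f (shrink t y)) := ContDiff.comp hf (hsh t)
    change pd a (fun y => t * f (shrink t y)) x = _
    rw [pd_const_mul a _ (hd.diff x), pd_comp_map (f := f) (hf.diff _) ((hsh t).diff x),
      Fin.sum_univ_three, e0, e1, e2]
    fin_cases a
    · exact absurd rfl ha
    · simp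
    · simp
  have hcs : Continuous fun t => shrink t x :=
    smooth_shrink.continuous.comp (continuous_const.prodMk continuous_id)
  have hc0 : Continuous fun t => f (shrink t x) := hf.continuous.comp hcs
  have hcp : ∀ a, Continuous fun t => pd a f (shrink t x) := fun a =>
    (smooth_pd a hf).continuous.comp hcs
  have hF : ∀ t, HasDerivAt (fun t => t * (t * f (shrink t x))) (2 * (t * f (shrink t x)) +
      (x 1 * (t * (t * pd 1 f (shrink t x))) + x 2 * (t * (t * pd 2 f (shrink t x))))) t := by
    intro t
    have h : HasDerivAt (fun t => shrink t x) ![0, 1 * x 1, 1 * x 2] t := by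
      refine hasDerivAt_pi.2 fun i => ?_
      fin_cases i
      · exact hasDerivAt_const t (0 : ℝ)
      · exact (hasDerivAt_id' t).mul_const (x 1)
      · exact (hasDerivAt_id' t).mul_const (x 2)
    have h2 := (hf.diff _).hasFDerivAt.comp_hasDerivAt t h
    refine ((hasDerivAt_id' t).fun_mul ((hasDerivAt_id' t).fun_mul h2)).congr_deriv ?_
    rw [fderiv_eq_sum_pd, Fin.sum_univ_three]
    simp
    ring
  have i0 : Continuous fun t => 2 * (t * f (shrink t x)) :=
    continuous_const.mul (continuous_id.mul hc0)
  have i1 : ∀ a, Continuous fun t => x a * (t * (t * pd a f (shrink t x))) := fun a =>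
    continuous_const.mul (continuous_id.mul (continuous_id.mul (hcp a)))
  have hint := intervalIntegral.integral_eq_sub_of_hasDerivAt (a := 0) (b := 1) (fun t _ => hF t)
    ((i0.add ((i1 1).add (i1 2))).intervalIntegrable _ _)
  have i3 : Continuous fun t => x 1 * (t * (t * pd 1 f (shrink t x))) +
      x 2 * (t * (t * pd 2 f (shrink t x))) := (i1 1).add (i1 2)
  rw [intervalIntegral.integral_add (i0.intervalIntegrable _ _)
    (i3.intervalIntegrable _ _), intervalIntegral.integral_add
    ((i1 1).intervalIntegrable _ _) ((i1 2).intervalIntegrable _ _),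
    intervalIntegral.integral_const_mul, intervalIntegral.integral_const_mul,
    intervalIntegral.integral_const_mul] at hint
  rw [hpd 1 (by decide), hpd 2 (by decide)]
  have e1 : shrink 1 x = slice x := by simp [shrink, slice]
  rw [e1] at hint
  simp only [one_mul, zero_mul, sub_zero] at hint
  exact hint

theorem radMean_slice (f : Coord → ℝ) (x : Coord) : radMean f x = radMean f (slice x) := rfl

/-- The radial mean of `lam² f` as an integral over the polar angle. -/
theorem radMean_polar (hf : Smooth f) {u v : ℝ} (huv : u ^ 2 + v ^ 2 = 1) {θ : ℝ} (h0 : 0 < θ)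
    (h1 : θ < Real.pi) :
    Real.tan (θ / 2) ^ 2 * radMean (fun x => lam x ^ 2 * f x)
      ![0, Real.tan (θ / 2) * u, Real.tan (θ / 2) * v] =
      ∫ t in (0 : ℝ)..θ, Real.sin t * f ![0, Real.tan (t / 2) * u, Real.tan (t / 2) * v] := by
  set F : Coord → ℝ := fun x => lam x ^ 2 * f x with hF
  have hFs : Smooth F := (smooth_lam.pow 2).mul hf
  set ρ := radMean F with hρ
  have hρs : Smooth ρ := smooth_radMean hFs
  -- Along a ray, the equation for ρ integrates to the statement that r²ρ is a primitive of r λ² f.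
  have hq : ∀ r : ℝ, HasDerivAt (fun r : ℝ => r ^ 2 * ρ ![0, r * u, r * v])
      (r * F ![0, r * u, r * v]) r := by
    intro r
    have hl : HasDerivAt (fun r : ℝ => (![0, r * u, r * v] : Coord)) ![0, 1 * u, 1 * v] r := by
      refine hasDerivAt_pi.2 fun i => ?_
      fin_cases i
      · exact hasDerivAt_const r (0 : ℝ)
      · exact (hasDerivAt_id' r).mul_const u
      · exact (hasDerivAt_id' r).mul_const v
    refine ((hasDerivAt_pow 2 r).fun_mul
      ((hρs.diff _).hasFDerivAt.comp_hasDerivAt r hl)).congr_deriv ?_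
    have hsp := radMean_spec hFs ![0, r * u, r * v]
    rw [← hρ] at hsp
    have e : slice ![0, r * u, r * v] = ![0, r * u, r * v] := by simp [slice]
    rw [e] at hsp
    rw [← hsp, fderiv_eq_sum_pd, Fin.sum_univ_three]
    simp
    ring
  -- With r = tan (t/2) one has λ = 2 cos² (t/2), so λ² r dr becomes sin t dt.
  have hθ : ∀ t ∈ uIcc 0 θ, HasDerivAt (fun t : ℝ => Real.tan (t / 2) ^ 2 *
      ρ ![0, Real.tan (t / 2) * u, Real.tan (t / 2) * v])
      (Real.sin t * f ![0, Real.tan (t / 2) * u, Real.tan (t / 2) * v]) t := by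
    intro t ht
    rw [uIcc_of_le h0.le] at ht
    have hc : Real.cos (t / 2) ≠ 0 :=
      (Real.cos_pos_of_mem_Ioo ⟨by linarith [ht.1], by linarith [ht.2]⟩).ne'
    have dt : HasDerivAt (fun t : ℝ => Real.tan (t / 2)) (1 / Real.cos (t / 2) ^ 2 * (1 / 2)) t :=
      HasDerivAt.comp (h := fun t : ℝ => t / 2) (h₂ := Real.tan) t
        (Real.hasDerivAt_tan hc) ((hasDerivAt_id' t).div_const 2)
    have := HasDerivAt.comp t (hq (Real.tan (t / 2))) dt
    refine this.congr_deriv ?_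
    have e : Real.sin t = 2 * Real.sin (t / 2) * Real.cos (t / 2) := by
      rw [← Real.sin_two_mul]; ring_nf
    have q1 := Real.sin_sq_add_cos_sq (t / 2)
    have hl : lam ![0, Real.tan (t / 2) * u, Real.tan (t / 2) * v] = 2 * Real.cos (t / 2) ^ 2 := by
      unfold lam
      rw [div_eq_iff (lam_den_pos _).ne']
      simp [Real.tan_eq_sin_div_cos]
      field_simp
      linear_combination -q1 - Real.sin (t / 2) ^ 2 * huv
    rw [hF]
    simp only [hl, e]
    rw [Real.tan_eq_sin_div_cos]
    field_simp
    
  have hint : IntervalIntegrable (fun t => Real.sin t *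
      f ![0, Real.tan (t / 2) * u, Real.tan (t / 2) * v]) volume 0 θ := by
    refine ContinuousOn.intervalIntegrable ?_
    rw [uIcc_of_le h0.le]
    refine Real.continuous_sin.continuousOn.mul (hf.continuous.comp_continuousOn ?_)
    have ht : ContinuousOn (fun t : ℝ => Real.tan (t / 2)) (Icc 0 θ) := fun t ht =>
      (ContinuousAt.comp (f := fun t : ℝ => t / 2) (g := Real.tan)
        (Real.continuousAt_tan.2 (Real.cos_pos_of_mem_Ioo
          ⟨by linarith [ht.1], by linarith [ht.2]⟩).ne') (by fun_prop)).continuousWithinAt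
    refine continuousOn_pi.2 fun i => ?_
    fin_cases i
    · exact continuousOn_const
    · exact ht.mul continuousOn_const
    · exact ht.mul continuousOn_const
  rw [intervalIntegral.integral_eq_sub_of_hasDerivAt hθ hint]
  simp

end

/-! ### Gluing the primitives of a density on the sphere. -/

/-- `cos θ`, as a function on de Sitter space. -/
def cosTheta : ScalarField := fun p x => p.sgn * (lam x - 1)

theorem cosTheta_regular : cosTheta.IsRegular := by
  refine ⟨fun p => contDiff_const.mul (smooth_lam.sub contDiff_const), fun y hy => ?_⟩
  have q1 := Real.sin_sq_add_cos_sq (y 1 / 2)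
  unfold cosTheta
  rw [lam_sphChart _ hy, lam_sphChart _ hy]
  simp only [sphLam, Patch.sgn]
  linear_combination 2 * q1

theorem pd_cosTheta (p : Patch) (a : Fin 3) (x : Coord) :
    pd a (cosTheta p) x = p.sgn * ![0, logD 1 x * lam x, logD 2 x * lam x] a := by
  have h := smooth_lam.diff x
  unfold cosTheta
  rw [pd_const_mul a _ (h.sub_const 1), pd_sub a h (differentiableAt_const _), pd_lam, pd_const,
    sub_zero]

theorem cos_sin_sphere (φ : ℝ) : Real.cos φ ^ 2 + Real.sin φ ^ 2 = 1 := by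
  rw [add_comm]; exact Real.sin_sq_add_cos_sq φ

theorem azPrim_global {s : ScalarField} (hs : s.IsGlobal) :
    ScalarField.IsGlobal (fun p => azPrim p (s p)) ∧ ScalarField.IsGlobal (fun p => azMean p (s p)) := by
  have h : ∀ y, InOverlap y → ∀ t, s .north (rotAz .north t (sphChart .north y)) =
      s .south (rotAz .south t (sphChart .south y)) := fun y hy t => by
    rw [← sphChart_shift, ← sphChart_shift]
    exact hs _ hy
  constructor <;> intro y hy
  · simp only [azPrim, h y hy]
  · simp only [azMean, h y hy]

/-- Periodicity in φ makes the average independent of the starting angle, so it depends on θ alone.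
-/
theorem azMean_sphChart {s : ScalarField} (hs : s.IsRegular) (p : Patch) {y : Coord}
    (hy : InOverlap y) : azMean p (s p) (sphChart p y) =
      (2 * Real.pi)⁻¹ * azInt (sphFun s) ![0, y 1, 0] := by
  unfold azMean azInt
  congr 1
  have h : ∀ t, s p (rotAz p t (sphChart p y)) = sphFun s ![0, y 1, y 2 + t] := fun t => by
    have hy' : InOverlap ![0, y 1, y 2 + t] := hy
    rw [← sphChart_shift, sphFun_eq hs.2 p hy']
  simp only [h]
  have hper : Function.Periodic (fun t => sphFun s ![0, y 1, t]) (2 * Real.pi) := fun t => by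
    have e := sphFun_periodic s ![0, y 1, t]
    have e' : (fun i => (![0, y 1, t] : Coord) i + ![0, 0, 2 * Real.pi] i : Coord) =
        ![0, y 1, t + 2 * Real.pi] := by
      funext i; fin_cases i <;> simp
    rw [e'] at e
    exact e
  rw [intervalIntegral.integral_comp_add_left (fun t => sphFun s ![0, y 1, t])]
  have := hper.intervalIntegral_add_eq (y 2) 0
  simp only [zero_add, add_zero] at this ⊢
  exact this

/-- The two charts give opposite primitives of an axisymmetric density without total charge. -/
theorem radMean_match {s : ScalarField} (hs : s.IsRegular) (hm : moment s 0 0 = 0) {y : Coord}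
    (hy : InOverlap y) :
    Real.tan (y 1 / 2) ^ 2 * radMean (fun x => lam x ^ 2 * azMean .north (s .north) x)
        (sphChart .north y) +
      (Real.tan (y 1 / 2))⁻¹ ^ 2 * radMean (fun x => lam x ^ 2 * azMean .south (s .south) x)
        (sphChart .south y) = 0 := by
  set h : ℝ → ℝ := fun t => Real.sin t * ((2 * Real.pi)⁻¹ * azInt (sphFun s) ![0, t, 0]) with hh
  have hc : Continuous h := Real.continuous_sin.mul
    (continuous_const.mul (azInt_continuous (smooth_sphFun hs) 0))
  have hcs := cos_sin_sphere (y 2)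
  have hcs' : Real.cos (y 2) ^ 2 + (-Real.sin (y 2)) ^ 2 = 1 := by rw [neg_sq]; exact hcs
  have hN := radMean_polar (smooth_azMean (hs.1 .north) .north) hcs hy.1 hy.2
  have hθ0 : 0 < Real.pi - y 1 := by linarith [hy.2]
  have hθ1 : Real.pi - y 1 < Real.pi := by linarith [hy.1]
  have hS := radMean_polar (smooth_azMean (hs.1 .south) .south) hcs' hθ0 hθ1
  have ht : ∀ t : ℝ, Real.tan ((Real.pi - t) / 2) = (Real.tan (t / 2))⁻¹ := fun t => by
    rw [← Real.tan_pi_div_two_sub]; congr 1; ring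
  have iN : (∫ t in (0 : ℝ)..(y 1), Real.sin t * azMean .north (s .north)
      ![0, Real.tan (t / 2) * Real.cos (y 2), Real.tan (t / 2) * Real.sin (y 2)]) =
      ∫ t in (0 : ℝ)..(y 1), h t := by
    refine intervalIntegral.integral_congr_ae (Filter.Eventually.of_forall fun t ht => ?_)
    rw [uIoc_of_le hy.1.le] at ht
    have hy' : InOverlap ![0, t, y 2] := ⟨ht.1, lt_of_le_of_lt ht.2 hy.2⟩
    have e := azMean_sphChart hs .north hy'
    have e2 : sphChart .north ![0, t, y 2] =
        ![0, Real.tan (t / 2) * Real.cos (y 2), Real.tan (t / 2) * Real.sin (y 2)] := rfl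
    have e3 : (![0, t, y 2] : Coord) 1 = t := rfl
    rw [e2, e3] at e
    rw [e]
  have iS : (∫ t in (0 : ℝ)..(Real.pi - y 1), Real.sin t * azMean .south (s .south)
      ![0, Real.tan (t / 2) * Real.cos (y 2), Real.tan (t / 2) * -Real.sin (y 2)]) =
      -- Reflection t ↦ π - t turns the southern integral into the integral of the same density over
      -- (θ, π). Added to the northern one over (0, θ), it gives the total charge.
      ∫ t in (0 : ℝ)..(Real.pi - y 1), h (Real.pi - t) := by
    refine intervalIntegral.integral_congr_ae (Filter.Eventually.of_forall fun t ht' => ?_)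
    rw [uIoc_of_le hθ0.le] at ht'
    have hy' : InOverlap ![0, Real.pi - t, y 2] :=
      ⟨show 0 < Real.pi - t by linarith [ht'.2, hy.1], show Real.pi - t < Real.pi by linarith [ht'.1]⟩
    have e := azMean_sphChart hs .south hy'
    have e2 : sphChart .south ![0, Real.pi - t, y 2] =
        ![0, Real.tan (t / 2) * Real.cos (y 2), Real.tan (t / 2) * -Real.sin (y 2)] := by
      simp [sphChart, ht]
    have e3 : (![0, Real.pi - t, y 2] : Coord) 1 = Real.pi - t := rfl
    rw [e2, e3] at e
    rw [e]
    simp only [hh, Real.sin_pi_sub]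
  rw [iN] at hN
  rw [iS, intervalIntegral.integral_comp_sub_left h, sub_sub_cancel, sub_zero, ht] at hS
  have eN : radMean (fun x => lam x ^ 2 * azMean .north (s .north) x) (sphChart .north y) =
      radMean (fun x => lam x ^ 2 * azMean .north (s .north) x)
        ![0, Real.tan (y 1 / 2) * Real.cos (y 2), Real.tan (y 1 / 2) * Real.sin (y 2)] := rfl
  have eS : radMean (fun x => lam x ^ 2 * azMean .south (s .south) x) (sphChart .south y) =
      radMean (fun x => lam x ^ 2 * azMean .south (s .south) x)
        ![0, (Real.tan (y 1 / 2))⁻¹ * Real.cos (y 2), (Real.tan (y 1 / 2))⁻¹ * -Real.sin (y 2)] := by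
    rw [radMean_slice]
    congr 1
    simp [slice, sphChart]
  rw [eN, eS, hN, hS, intervalIntegral.integral_add_adjacent_intervals
    (hc.intervalIntegrable _ _) (hc.intervalIntegrable _ _)]
  have e3 : moment s 0 0 = ∫ t in (0 : ℝ)..Real.pi, Real.sin t * azInt (sphFun s) ![0, t, 0] := by
    unfold moment
    rw [sphInt_eq]
    refine intervalIntegral.integral_congr fun t _ => ?_
    have : azInt (fun y => sphFun s y * weight 0 y) ![0, t, 0] =
        azInt (fun y => Real.sin t * sphFun s y) ![0, t, 0] :=
      intervalIntegral.integral_congr fun φ _ => by simp [weight, sphHarmonic, mul_comm]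
    exact this.trans (azInt_const_mul _ _)
  rw [hh]
  have e4 : (fun t => Real.sin t * ((2 * Real.pi)⁻¹ * azInt (sphFun s) ![0, t, 0])) =
      fun t => (2 * Real.pi)⁻¹ * (Real.sin t * azInt (sphFun s) ![0, t, 0]) := by
    funext t; ring
  rw [e4, intervalIntegral.integral_const_mul, ← e3, hm, mul_zero]

/-- A density on the sphere without total charge is the curl of a one-form. -/
theorem exists_sphere_potential {s : ScalarField} (hs : s.IsRegular) (hm : moment s 0 0 = 0) :
    ∃ b : Patch → Coord → Fin 3 → ℝ, (∀ p, Smooth (b p)) ∧ FormGlobal b ∧ (∀ p x, b p x 0 = 0) ∧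
      (∀ p x a, pd 0 (fun y => b p y a) x = 0) ∧
      ∀ p x, pd 1 (fun y => b p y 2) x - pd 2 (fun y => b p y 1) x =
        lam x ^ 2 * s p (slice x) := by
  set g : ScalarField := fun p => azPrim p (s p) with hg
  have hgs : ∀ p, Smooth (g p) := fun p => smooth_azPrim (hs.1 p) p
  set ρ : ScalarField := fun p => radMean (fun x => lam x ^ 2 * azMean p (s p) x) with hρ
  have hfs : ∀ p, Smooth (fun x => lam x ^ 2 * azMean p (s p) x) := fun p =>
    (smooth_lam.pow 2).mul (smooth_azMean (hs.1 p) p)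
  have hρs : ∀ p, Smooth (ρ p) := fun p => smooth_radMean (hfs p)
  have hl := smooth_lam
  have hL := smooth_logD
  -- b = g d(cos θ) + ρ (x dy - y dx). The first term accounts for the deviation of the density from
  -- its azimuthal average, the second for the average itself.
  set b : Patch → Coord → Fin 3 → ℝ := fun p x =>
    ![0, g p x * (p.sgn * (logD 1 x * lam x)) + -(ρ p x * x 2),
      g p x * (p.sgn * (logD 2 x * lam x)) + ρ p x * x 1] with hb
  have h1s : ∀ p a, Smooth (fun x => g p x * (p.sgn * (logD a x * lam x))) := fun p a =>
    (hgs p).mul (contDiff_const.mul ((hL a).mul hl))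
  have h2s : ∀ p a, Smooth (fun x => ρ p x * x a) := fun p a => (hρs p).mul (smooth_coord a)
  have c1 : ∀ p, Smooth (fun x => g p x * (p.sgn * (logD 1 x * lam x)) + -(ρ p x * x 2)) := fun p =>
    (h1s p 1).add (h2s p 2).neg
  have c2 : ∀ p, Smooth (fun x => g p x * (p.sgn * (logD 2 x * lam x)) + ρ p x * x 1) := fun p =>
    (h1s p 2).add (h2s p 1)
  have hbs : ∀ p, Smooth (b p) := fun p => smooth_vec contDiff_const (c1 p) (c2 p)
  refine ⟨b, hbs, ?_, fun p x => rfl, fun p x a => ?_, fun p x => ?_⟩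
  · have f1 : FormGlobal (fun p x a => g p x * pd a (cosTheta p) x) :=
      (cosTheta_regular.2.formGlobal cosTheta_regular.1).smul (azPrim_global hs.2).1
    -- On the overlap, x dy - y dx is tan² (θ/2) dφ in the north and -cot² (θ/2) dφ in the south.
    -- The jump of the second term is thus the sum in `radMean_match`.
    have f2 : FormGlobal (fun p x => ![0, -(ρ p x * x 2), ρ p x * x 1]) := by
      intro y hy
      have hmatch := radMean_match hs hm hy
      obtain ⟨hsn, hcn⟩ := half_angle_ne y hy
      have q2 := Real.sin_sq_add_cos_sq (y 2)
      funext a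
      unfold sphForm
      simp only [jac_eq _ hy, Fin.sum_univ_three, hρ]
      have eN : ∀ c, sphChart .north y c = ![y 0, Real.tan (y 1 / 2) * Real.cos (y 2),
        Real.tan (y 1 / 2) * Real.sin (y 2)] c := fun c => rfl
      have eS : ∀ c, sphChart .south y c = ![y 0, (Real.tan (y 1 / 2))⁻¹ * Real.cos (y 2),
        -((Real.tan (y 1 / 2))⁻¹ * Real.sin (y 2))] c := fun c => rfl
      generalize radMean (fun x => lam x ^ 2 * azMean .north (s .north) x) (sphChart .north y) = u at *
      generalize radMean (fun x => lam x ^ 2 * azMean .south (s .south) x) (sphChart .south y) = v at *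
      simp only [eN, eS]
      rw [Real.tan_eq_sin_div_cos] at hmatch
      fin_cases a <;> simp [jacVal, Real.tan_eq_sin_div_cos]
      · field_simp
        ring
      · field_simp at hmatch ⊢
        linear_combination (Real.sin (y 2) ^ 2 + Real.cos (y 2) ^ 2) * hmatch
    have e : b = fun p x a => g p x * pd a (cosTheta p) x + ![0, -(ρ p x * x 2), ρ p x * x 1] a := by
      funext p x a
      rw [pd_cosTheta]
      fin_cases a <;> simp [hb]
    rw [e]
    exact f1.add f2
  · refine pd_zero_of_slice (smooth_comp1 (hbs p) a) (fun x => ?_) x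
    have e1 : g p x = g p (slice x) := azPrim_slice p _ x
    have e2 : ρ p x = ρ p (slice x) := radMean_slice _ x
    have e3 : lam x = lam (slice x) := rfl
    have e4 : logD 1 x = logD 1 (slice x) := rfl
    have e5 : logD 2 x = logD 2 (slice x) := rfl
    simp only [hb]
    rw [e1, e2, e3, e4, e5]
    fin_cases a <;> rfl
  · have hsp := azPrim_spec (hs.1 p) p x
    have hsr := radMean_spec (hfs p) x
    have em : azMean p (s p) (slice x) = azMean p (s p) x := rfl
    have el : lam (slice x) = lam x := rfl
    simp only [em, el] at hsr
    have hgd := (hgs p).diff x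
    have hρd := (hρs p).diff x
    have hld := hl.diff x
    have hL1 := (hL 1).diff x
    have hL2 := (hL 2).diff x
    have hx1 := (smooth_coord 1).diff x
    have hx2 := (smooth_coord 2).diff x
    have d1 := fun a => (h1s p a).diff x
    have d2 := fun a => (h2s p a).diff x
    have s4 : ∀ a, Smooth (fun x => logD a x * lam x) := fun a => (hL a).mul hl
    have s3 : ∀ a, Smooth (fun x => p.sgn * (logD a x * lam x)) := fun a =>
      contDiff_const.mul (s4 a)
    have d3 := fun a => (s3 a).diff x
    have d4 := fun a => (s4 a).diff x
    have e1 : (fun y => b p y 1) = fun x => g p x * (p.sgn * (logD 1 x * lam x)) + -(ρ p x * x 2) := rfl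
    have e2 : (fun y => b p y 2) = fun x => g p x * (p.sgn * (logD 2 x * lam x)) + ρ p x * x 1 := rfl
    rw [e1, e2, pd_add 1 (d1 2) (d2 1), pd_add 2 (d1 1) (d2 2).fun_neg, pd_neg, pd_mul 1 hgd (d3 2),
      pd_mul 2 hgd (d3 1), pd_mul 1 hρd hx1, pd_mul 2 hρd hx2, pd_const_mul 1 _ (d4 2),
      pd_const_mul 2 _ (d4 1), pd_mul 1 hL2 hld, pd_mul 2 hL1 hld, pd_lam, pd_lam, pd_logD_one,
      pd_logD_two, pd_coord, pd_coord]
    have l1 : logD 1 x = -lam x * x 1 := by simp [logD]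
    have l2 : logD 2 x = -lam x * x 2 := by simp [logD]
    simp [l1, l2]
    linear_combination hsr + lam x ^ 2 * hsp

/-! ### Potentials of conserved currents -/

theorem boxScalar_expand {f : Coord → ℝ} (x : Coord) :
    conf x * boxScalar f x = pd 1 (pd 1 f) x + pd 2 (pd 2 f) x - conf x * pd 0 (pd 0 f) x -
      2 * logD 0 x * conf x * pd 0 f x := by
  have h := conf_ne x
  rw [boxScalar_eq, hess_eq, hess_eq, hess_eq]
  simp [Fin.sum_univ_three, gam]
  field_simp
  ring

/-- The primitive in `τ` that vanishes at `τ = 0`. -/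
def timeInt (f : Coord → ℝ) (x : Coord) : ℝ := ∫ s in (0 : ℝ)..(x 0), f ![s, x 1, x 2]

section

variable {f : Coord → ℝ}

/-- Rescaling to a fixed range of integration moves the dependence on the upper limit into the
integrand. -/
theorem smooth_timeInt (hf : Smooth f) : Smooth (timeInt f) := by
  have e : timeInt f = fun x => x 0 * ∫ t in (0 : ℝ)..1, f ![t * x 0, x 1, x 2] := by
    funext x
    have h := intervalIntegral.smul_integral_comp_mul_right (a := 0) (b := 1)
      (fun s => f ![s, x 1, x 2]) (x 0)
    rw [zero_mul, one_mul, smul_eq_mul] at h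
    exact h.symm
  have h1 : Smooth (fun q : Coord × ℝ => q.2 * q.1 0) :=
    contDiff_snd.mul ((smooth_coord 0).comp contDiff_fst)
  have h : Smooth (Function.uncurry fun (x : Coord) (t : ℝ) => f ![t * x 0, x 1, x 2]) :=
    ContDiff.comp hf (smooth_vec h1 ((smooth_coord 1).comp contDiff_fst)
      ((smooth_coord 2).comp contDiff_fst))
  rw [e]
  exact (smooth_coord 0).mul (smooth_intervalIntegral h 0 1)

theorem continuous_timeLine (hf : Smooth f) (u v : ℝ) : Continuous fun s : ℝ => f ![s, u, v] :=
  hf.continuous.comp (smooth_vec (E := ℝ) contDiff_id contDiff_const contDiff_const).continuous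

theorem vec_eta (x : Coord) : ![x 0, x 1, x 2] = x := by
  funext i; fin_cases i <;> rfl

theorem pd_zero_timeInt (hf : Smooth f) (x : Coord) : pd 0 (timeInt f) x = f x := by
  have h1 : HasDerivAt (fun s : ℝ => timeInt f ![s, x 1, x 2]) (pd 0 (timeInt f) ![x 0, x 1, x 2])
      (x 0) := hasDerivAt_comp_line ((smooth_timeInt hf).diff _) (hasDerivAt_zero_line _ _ _)
  have hc := continuous_timeLine hf (x 1) (x 2)
  have h2 : HasDerivAt (fun s : ℝ => ∫ t in (0 : ℝ)..s, f ![t, x 1, x 2]) (f ![x 0, x 1, x 2])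
      (x 0) := intervalIntegral.integral_hasDerivAt_right (hc.intervalIntegrable _ _)
        (hc.stronglyMeasurableAtFilter _ _) hc.continuousAt
  have := h1.unique h2
  rwa [vec_eta] at this

theorem pd_timeInt_slice (hf : Smooth f) (x : Coord) :
    pd 1 (timeInt f) (slice x) = 0 ∧ pd 2 (timeInt f) (slice x) = 0 := by
  have hs := smooth_timeInt hf
  have z : ∀ a b : ℝ, timeInt f ![0, a, b] = 0 := fun a b => by simp [timeInt]
  constructor
  · have h1 : HasDerivAt (fun s : ℝ => timeInt f ![0, s, x 2]) (pd 1 (timeInt f) ![0, x 1, x 2])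
      (x 1) := hasDerivAt_comp_line (hs.diff _) (hasDerivAt_one_line _ _ _)
    simp only [z] at h1
    exact h1.unique (hasDerivAt_const _ _)
  · have h1 : HasDerivAt (fun s : ℝ => timeInt f ![0, x 1, s]) (pd 2 (timeInt f) ![0, x 1, x 2])
      (x 2) := hasDerivAt_comp_line (hs.diff _) (hasDerivAt_two_line _ _ _)
    simp only [z] at h1
    exact h1.unique (hasDerivAt_const _ _)

theorem eq_slice_of_pd_zero (hf : Smooth f) (h : ∀ x, pd 0 f x = 0) (x : Coord) :
    f x = f (slice x) := by
  have h1 : ∀ s : ℝ, HasDerivAt (fun s : ℝ => f ![s, x 1, x 2]) 0 s := fun s => by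
    have := hasDerivAt_comp_line (hf.diff _) (hasDerivAt_zero_line (x 1) (x 2) s)
    rwa [h] at this
  have := is_const_of_deriv_eq_zero (fun s => (h1 s).differentiableAt) (fun s => (h1 s).deriv) (x 0) 0
  simp only [vec_eta] at this
  exact this

end

/-- The Jacobian matrix between the charts does not depend on τ, so it commutes with integration
over τ. -/
theorem timeInt_formGlobal {V : Patch → Coord → Fin 3 → ℝ} (hs : ∀ p, Smooth (V p))
    (hV : FormGlobal V) (h0 : ∀ p x, V p x 0 = 0) :
    FormGlobal (fun p x a => timeInt (fun z => V p z a) x) := by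
  have key : ∀ p y, InOverlap y → ∀ a, sphForm (fun p x a => timeInt (fun z => V p z a) x) p y a =
      ∫ s in (0 : ℝ)..(y 0), sphForm V p ![s, y 1, y 2] a := by
    intro p y hy a
    have hc : ∀ c, Continuous fun s : ℝ => V p ![s, sphChart p y 1, sphChart p y 2] c := fun c =>
      continuous_timeLine (smooth_comp1 (hs p) c) _ _
    have hj : ∀ s c, jac p ![s, y 1, y 2] a c = jac p y a c := fun s c => by
      rw [jac_eq p hy, jac_eq p (y := ![s, y 1, y 2]) hy]
      cases p <;> rfl
    have hp : ∀ s, sphChart p ![s, y 1, y 2] = ![s, sphChart p y 1, sphChart p y 2] := fun s => by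
      cases p <;> rfl
    have hp0 : sphChart p y 0 = y 0 := by cases p <;> rfl
    simp only [sphForm, hj, hp, timeInt, hp0]
    rw [intervalIntegral.integral_finsetSum fun c _ =>
      ((hc c).const_mul _).intervalIntegrable _ _]
    simp only [intervalIntegral.integral_const_mul]
  intro y hy
  funext a
  rw [key _ y hy, key _ y hy]
  congr 1
  funext s
  have hy' : InOverlap ![s, y 1, y 2] := hy
  rw [hV _ hy']

/-- The Hodge star of the sphere in conformal coordinates: a rotation by a right angle, the same in
both charts because they have the same orientation. -/
theorem rotated_formGlobal {A : Patch → Coord → Fin 3 → ℝ} (hA : FormGlobal A) :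
    FormGlobal (fun p x => ![0, -A p x 2, A p x 1]) := by
  have key : ∀ p y, InOverlap y → sphForm (fun p x => ![0, -A p x 2, A p x 1]) p y =
      ![0, -((Real.sin (y 1))⁻¹ * sphForm A p y 2), Real.sin (y 1) * sphForm A p y 1] := by
    intro p y hy
    obtain ⟨hs, hc⟩ := half_angle_ne y hy
    have e : Real.sin (y 1) = 2 * Real.sin (y 1 / 2) * Real.cos (y 1 / 2) := by
      rw [← Real.sin_two_mul]; ring_nf
    funext a
    simp only [sphForm, jac_eq p hy, Fin.sum_univ_three, e]
    cases p <;> fin_cases a <;> simp [jacVal] <;> field_simp <;> ring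
  intro y hy
  rw [key _ y hy, key _ y hy, hA y hy]

/-- A harmonic function without flux has a conjugate one-form. -/
theorem exists_conjugate_form {F : ScalarField} (hF : F.IsRegular)
    (hb : ∀ p x, boxScalar (F p) x = 0) (hm : moment₁ F 0 0 = 0) :
    ∃ A : Patch → Coord → Fin 3 → ℝ, (∀ p, Smooth (A p)) ∧ FormGlobal A ∧ ∀ p x,
      pd 1 (fun y => A p y 2) x - pd 2 (fun y => A p y 1) x = conf x * pd 0 (F p) x ∧
      pd 0 (fun y => A p y 2) x - pd 2 (fun y => A p y 0) x = pd 1 (F p) x ∧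
      pd 1 (fun y => A p y 0) x - pd 0 (fun y => A p y 1) x = pd 2 (F p) x := by
  have hpd : ∀ p a, Smooth (pd a (F p)) := fun p a => smooth_pd a (hF.1 p)
  have hs : ScalarField.IsRegular (fun p => pd 0 (F p)) := by
    refine ⟨fun p => hpd p 0, fun y hy => ?_⟩
    have := congrFun (hF.2.formGlobal hF.1 y hy) 0
    simpa [sphForm, jac_eq _ hy, jacVal, Fin.sum_univ_three] using this
  have hsm : moment (fun p => pd 0 (F p)) 0 0 = 0 := by
    refine Eq.trans ?_ hm
    refine congrFun (sphInt_congr fun y hy => ?_) 0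
    rw [sphFun_eq hs.2 .north hy, pd_sphFun hF 0 hy, pd_zero_sphChart (hF.1 .north) hy]
  -- A = b + ∫₀^τ *dF. The form b supplies the initial value on τ = 0, where dA has to equal the
  -- density ∂_τF, and it exists because this density has no total charge.
  obtain ⟨b, hbs, hbg, hb0, hbt, hbc⟩ := exists_sphere_potential hs hsm
  set V : Patch → Coord → Fin 3 → ℝ := fun p x => ![0, -pd 2 (F p) x, pd 1 (F p) x] with hV
  have c1 : ∀ p, Smooth (fun x => -pd 2 (F p) x) := fun p => (hpd p 2).neg
  have hVs : ∀ p, Smooth (V p) := fun p => smooth_vec contDiff_const (c1 p) (hpd p 1)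
  have hVg : FormGlobal V := rotated_formGlobal (hF.2.formGlobal hF.1)
  have hVa : ∀ p a, Smooth (fun x => V p x a) := fun p a => smooth_comp1 (hVs p) a
  have hW := fun p a => smooth_timeInt (hVa p a)
  have hba : ∀ p a, Smooth (fun x => b p x a) := fun p a => smooth_comp1 (hbs p) a
  have hpdA : ∀ p a c x, pd c (fun y => b p y a + timeInt (fun z => V p z a) y) x =
      pd c (fun y => b p y a) x + pd c (timeInt fun z => V p z a) x := fun p a c x =>
    pd_add c ((hba p a).diff x) ((hW p a).diff x)
  have hA0 : ∀ p, (fun y => b p y 0 + timeInt (fun z => V p z 0) y) = fun _ => 0 := fun p => by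
    funext y
    rw [hb0]
    simp [hV, timeInt]
  refine ⟨fun p x a => b p x a + timeInt (fun z => V p z a) x,
    fun p => contDiff_pi.2 fun a => (hba p a).add (hW p a),
    hbg.add (timeInt_formGlobal hVs hVg fun p x => rfl), fun p x => ⟨?_, ?_, ?_⟩⟩
  · set D : Coord → ℝ := fun x => pd 1 (fun y => b p y 2 + timeInt (fun z => V p z 2) y) x -
      pd 2 (fun y => b p y 1 + timeInt (fun z => V p z 1) y) x - conf x * pd 0 (F p) x with hD
    have s1 : ∀ a, Smooth (fun y => b p y a + timeInt (fun z => V p z a) y) := fun a =>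
      (hba p a).add (hW p a)
    have s2 := fun c a => smooth_pd c (s1 a)
    have s3 : Smooth (fun x => pd 1 (fun y => b p y 2 + timeInt (fun z => V p z 2) y) x -
      pd 2 (fun y => b p y 1 + timeInt (fun z => V p z 1) y) x) := (s2 1 2).sub (s2 2 1)
    have s4 : Smooth (fun x => conf x * pd 0 (F p) x) := smooth_conf.mul (hpd p 0)
    have hDs : Smooth D := s3.sub s4
    have p0 : ∀ a, pd 0 (fun y => b p y a + timeInt (fun z => V p z a) y) = fun x => V p x a :=
      fun a => by
        funext x
        rw [hpdA, hbt, pd_zero_timeInt (hVa p a), zero_add]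
    -- The spatial equation is propagated in τ: the derivative of its defect D is the wave operator
    -- of F. The defect vanishes at τ = 0 by the choice of b.
    have hz : ∀ x, pd 0 D x = 0 := fun x => by
      rw [hD, pd_sub 0 (s3.diff x) (s4.diff x), pd_sub 0 ((s2 1 2).diff x) ((s2 2 1).diff x),
        pd_mul 0 (smooth_conf.diff x) ((hpd p 0).diff x), pd_conf, pd_comm 0 1 (s1 2),
        pd_comm 0 2 (s1 1), p0, p0]
      have e := boxScalar_expand (f := F p) x
      rw [hb, mul_zero] at e
      have e1 : pd 1 (fun x => V p x 2) x = pd 1 (pd 1 (F p)) x := rfl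
      have e2 : pd 2 (fun x => V p x 1) x = -pd 2 (pd 2 (F p)) x := pd_neg 2 _ x
      rw [e1, e2]
      linear_combination -e
    have h := eq_slice_of_pd_zero hDs hz x
    have h0 : D (slice x) = 0 := by
      simp only [hD, hpdA]
      rw [(pd_timeInt_slice (hVa p 2) x).1, (pd_timeInt_slice (hVa p 1) x).2, add_zero, add_zero,
        hbc p (slice x)]
      have e1 : conf (slice x) = lam (slice x) ^ 2 := by simp [conf, slice]
      have e2 : slice (slice x) = slice x := rfl
      rw [e1, e2, sub_self]
    rw [h0, hD] at h
    linarith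
  · rw [hA0, pd_const, sub_zero, hpdA, hbt, pd_zero_timeInt (hVa p 2), zero_add]
    rfl
  · rw [hA0, pd_const, hpdA, hbt, pd_zero_timeInt (hVa p 1)]
    simp [hV]

/-! ### Tensor potentials from vector-valued one-forms -/

section

variable {p : Patch} {C : Fin 4 → Coord → Fin 3 → ℝ} {T : Coord → Fin 3 → Fin 3 → ℝ}

/-- The tensor `∑ C^μ_a ∂_b X_μ`. -/
def tensorOf (p : Patch) (C : Fin 4 → Coord → Fin 3 → ℝ) (x : Coord) (a b : Fin 3) : ℝ :=
  ∑ μ, eta μ * (C μ x a * pd b (zeta μ p) x)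

theorem smooth_tensorOf (hC : ∀ μ, Smooth (C μ)) : Smooth (tensorOf p C) :=
  smooth_tensor fun a b => ContDiff.sum fun μ _ => contDiff_const.mul
    ((smooth_comp1 (hC μ) a).mul (smooth_pd b (smooth_zeta μ p)))

/-- The two constructions are inverse to each other only on tangential forms: completeness of the
frame loses the component of C along X. -/
theorem formOf_tensorOf {x : Coord} (h : ∀ a, ∑ μ, eta μ * (C μ x a * zeta μ p x) = 0) (μ : Fin 4)
    (a : Fin 3) : formOf p μ (tensorOf p C) x a = C μ x a := by
  have e : formOf p μ (tensorOf p C) x a =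
      ∑ ν, eta ν * C ν x a * ∑ b, frame p μ b x * pd b (zeta ν p) x := by
    unfold formOf tensorOf
    simp only [Fin.sum_univ_three, Fin.sum_univ_four]
    ring
  rw [e]
  simp only [sum_frame_zeta, mul_sub, mul_ite, mul_zero, Finset.sum_sub_distrib,
    Finset.sum_ite_eq, Finset.mem_univ, if_true]
  have e2 : ∑ ν, eta ν * C ν x a * (zeta μ p x * zeta ν p x) = 0 := by
    have := congrArg (fun r => zeta μ p x * r) (h a)
    simp only [Finset.mul_sum, mul_zero] at this
    rw [← this]
    exact Finset.sum_congr rfl fun ν _ => by ring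
  rw [e2, sub_zero]
  fin_cases μ <;> simp [eta]

/-- A tangential vector-valued one-form whose exterior derivatives are dual to those of `T` is
the form of a symmetric tensor with curl `T`. -/
theorem tensorOf_symm_curl (hC : ∀ μ, Smooth (C μ))
    (h0 : ∀ x a, ∑ μ, eta μ * (C μ x a * zeta μ p x) = 0)
    (h1 : ∀ μ x, pd 1 (fun y => C μ y 2) x - pd 2 (fun y => C μ y 1) x = conf x * formOf p μ T x 0)
    (h2 : ∀ μ x, pd 0 (fun y => C μ y 2) x - pd 2 (fun y => C μ y 0) x = formOf p μ T x 1)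
    (h3 : ∀ μ x, pd 1 (fun y => C μ y 0) x - pd 0 (fun y => C μ y 1) x = formOf p μ T x 2) :
    (∀ x a b, tensorOf p C x a b = tensorOf p C x b a) ∧ curl (tensorOf p C) = T := by
  have hCa : ∀ μ a, Smooth (fun x => C μ x a) := fun μ a => smooth_comp1 (hC μ) a
  have hz := fun μ => smooth_zeta μ p
  have hK := smooth_tensorOf (p := p) hC
  -- Differentiating X·C = 0 exchanges ∂X·C for -X·∂C.
  have hd : ∀ x a c, tensorOf p C x a c = -∑ μ, eta μ * (pd c (fun y => C μ y a) x * zeta μ p x) := by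
    intro x a c
    have e : pd c (fun x => ∑ μ, eta μ * (C μ x a * zeta μ p x)) x = 0 := by
      simp only [h0, pd_const]
    have hm : ∀ μ, Smooth (fun x => C μ x a * zeta μ p x) := fun μ => (hCa μ a).mul (hz μ)
    have hm' : ∀ μ, Smooth (fun x => eta μ * (C μ x a * zeta μ p x)) := fun μ =>
      contDiff_const.mul (hm μ)
    rw [pd_sum _ _ _ fun μ _ => (hm' μ).diff x] at e
    simp only [fun μ => pd_const_mul c (eta μ) ((hm μ).diff x),
      fun μ => pd_mul c ((hCa μ a).diff x) ((hz μ).diff x), mul_add, Finset.sum_add_distrib] at e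
    unfold tensorOf
    linarith
  have hsum : ∀ x a, ∑ μ, eta μ * (formOf p μ T x a * zeta μ p x) = 0 := fun x a => by
    rw [← formOf_zeta p T x a]
    exact Finset.sum_congr rfl fun μ _ => by ring
  -- Consequently the antisymmetric part of the tensor is the component of dC along X. It vanishes
  -- because dC is dual to the forms of T, which are tangential.
  have hanti : ∀ x a c, tensorOf p C x a c - tensorOf p C x c a =
      -∑ μ, eta μ * ((pd c (fun y => C μ y a) x - pd a (fun y => C μ y c) x) * zeta μ p x) :=
    fun x a c => by
      rw [hd x a c, hd x c a]
      simp only [sub_mul, mul_sub, Finset.sum_sub_distrib]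
      ring
  have t1 : ∀ x, tensorOf p C x 2 1 = tensorOf p C x 1 2 := fun x => by
    have := hanti x 2 1
    simp only [h1] at this
    have e := congrArg (fun r => conf x * r) (hsum x 0)
    simp only [Finset.mul_sum, mul_zero] at e
    have e' : ∑ μ, eta μ * (conf x * formOf p μ T x 0 * zeta μ p x) = 0 := by
      rw [← e]
      exact Finset.sum_congr rfl fun μ _ => by ring
    rw [e'] at this
    linarith
  have t2 : ∀ x, tensorOf p C x 2 0 = tensorOf p C x 0 2 := fun x => by
    have := hanti x 2 0
    simp only [h2, hsum] at this
    linarith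
  have t3 : ∀ x, tensorOf p C x 0 1 = tensorOf p C x 1 0 := fun x => by
    have := hanti x 0 1
    simp only [h3, hsum] at this
    linarith
  have hs : ∀ x a b, tensorOf p C x a b = tensorOf p C x b a := fun x a b => by
    fin_cases a <;> fin_cases b
    exacts [rfl, t3 x, (t2 x).symm, (t3 x).symm, rfl, (t1 x).symm, t2 x, t1 x, rfl]
  refine ⟨hs, ?_⟩
  have hf : ∀ μ a, (fun y => formOf p μ (tensorOf p C) y a) = fun y => C μ y a := fun μ a =>
    funext fun y => formOf_tensorOf (h0 y) μ a
  have hx : ∀ μ x c a, pd c (fun y => C μ y a) x - pd a (fun y => C μ y c) x =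
      ∑ b, (covD2 (tensorOf p C) x c a b - covD2 (tensorOf p C) x a c b) * frame p μ b x :=
    fun μ x c a => by
      have := ext_deriv_formOf p μ hK x c a
      rw [hf, hf, hs x a c, sub_self, zero_mul, sub_zero] at this
      exact this
  funext x a
  refine eq_of_sum_frame p x fun μ => ?_
  simp only [curl_eq]
  have hu := conf_ne x
  fin_cases a
  · have := h1 μ x
    rw [hx] at this
    change ∑ b, (conf x)⁻¹ * _ * frame p μ b x = formOf p μ T x 0
    simp only [mul_assoc, ← Finset.mul_sum]
    rw [this]
    field_simp
  · have := h2 μ x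
    rw [hx] at this
    exact this
  · have := h3 μ x
    rw [hx] at this
    exact this

end

/-- A solution without `l ≤ 1` harmonics has a regular symmetric tensor potential. -/
theorem exists_symmetric_potential {Φ : ScalarField} (hΦ : Φ.IsRegular) (h : Φ.BoxPlusThree)
    (hm : ∀ ν τ, moment Φ ν τ = 0) :
    ∃ K : TensorField, K.IsRegular ∧ K.IsSymmetric ∧ ∀ p, curl (K p) = hessPlus Φ p := by
  choose A hAs hAg hA using fun μ => exists_conjugate_form (hΦ.ambGrad μ)
    (fun p x => boxScalar_ambGrad (hΦ.1 p) (h p) p μ x) (moment₁_ambGrad hΦ hm μ 0)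
  have hz := zeta_regular
  have hzF := fun μ => (hz μ).2.formGlobal (hz μ).1
  -- V = X·A is the normal part that has to be removed.
  set V : Patch → Coord → Fin 3 → ℝ := fun p x a => ∑ μ, eta μ * zeta μ p x * A μ p x a with hV
  have hVs : ∀ p, Smooth (V p) := fun p => contDiff_pi.2 fun a => ContDiff.sum fun μ _ =>
    (contDiff_const.mul ((hz μ).1 p)).mul (smooth_comp1 (hAs μ p) a)
  have hVg : FormGlobal V := FormGlobal.sum _ fun μ =>
    FormGlobal.smul (Φ := fun p x => eta μ * zeta μ p x)
      (fun y hy => congrArg _ ((hz μ).2 y hy)) (hAg μ)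
  -- V read as a tangent vector in the ambient space. From X·lm = 0 and lm·∂X = V one gets X·d(lm) =
  -- -V, so A + d(lm) is tangential and has the same exterior derivative as A.
  set lm : Fin 4 → ScalarField := fun μ p x => ∑ b, V p x b * frame p μ b x with hlm
  have hl : ∀ μ, (lm μ).IsRegular := fun μ => by
    refine ⟨fun p => ContDiff.sum fun b _ => (smooth_comp1 (hVs p) b).mul (smooth_frame p μ b), ?_⟩
    have e : lm μ = fun p x => ∑ a, ∑ b, metricInv x a b * (V p x a * pd b (zeta μ p) x) := by
      funext p x
      simp only [hlm, frame_eq, Finset.mul_sum]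
      exact Finset.sum_congr rfl fun a _ => Finset.sum_congr rfl fun b _ => by ring
    rw [e]
    exact inner_global hVg (hzF μ)
  have hlF := fun μ => (hl μ).2.formGlobal (hl μ).1
  set C : Fin 4 → Patch → Coord → Fin 3 → ℝ := fun μ p x a => A μ p x a + pd a (lm μ p) x with hC
  have hdl : ∀ μ p a, Smooth (pd a (lm μ p)) := fun μ p a => smooth_pd a ((hl μ).1 p)
  have hAa : ∀ μ p a, Smooth (fun x => A μ p x a) := fun μ p a => smooth_comp1 (hAs μ p) a
  have hCs : ∀ μ p, Smooth (C μ p) := fun μ p => contDiff_pi.2 fun a =>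
    (hAa μ p a).add (hdl μ p a)
  have hlz : ∀ p x, ∑ μ, eta μ * (lm μ p x * zeta μ p x) = 0 := fun p x => by
    have e : ∑ μ, eta μ * (lm μ p x * zeta μ p x) =
        ∑ b, V p x b * ∑ μ, eta μ * frame p μ b x * zeta μ p x := by
      simp only [hlm, Fin.sum_univ_three, Fin.sum_univ_four]; ring
    rw [e]
    simp [sum_eta_frame_zeta]
  have hlp : ∀ p x a, ∑ μ, eta μ * (lm μ p x * pd a (zeta μ p) x) = V p x a := fun p x a => by
    have e : ∑ μ, eta μ * (lm μ p x * pd a (zeta μ p) x) =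
        ∑ b, V p x b * ∑ μ, eta μ * frame p μ b x * pd a (zeta μ p) x := by
      simp only [hlm, Fin.sum_univ_three, Fin.sum_univ_four]; ring
    rw [e]
    simp [sum_eta_frame]
  have h0 : ∀ p x a, ∑ μ, eta μ * (C μ p x a * zeta μ p x) = 0 := fun p x a => by
    have hlS : ∀ μ, Smooth (lm μ p) := fun μ => (hl μ).1 p
    have hzS : ∀ μ, Smooth (zeta μ p) := fun μ => (hz μ).1 p
    have hm : ∀ μ, Smooth (fun x => lm μ p x * zeta μ p x) := fun μ => (hlS μ).mul (hzS μ)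
    have hm' : ∀ μ, Smooth (fun x => eta μ * (lm μ p x * zeta μ p x)) := fun μ =>
      contDiff_const.mul (hm μ)
    have e : pd a (fun x => ∑ μ, eta μ * (lm μ p x * zeta μ p x)) x = 0 := by
      simp only [hlz, pd_const]
    rw [pd_sum _ _ _ fun μ _ => (hm' μ).diff x] at e
    simp only [fun μ => pd_const_mul a (eta μ) ((hm μ).diff x),
      fun μ => pd_mul a ((hlS μ).diff x) ((hzS μ).diff x), mul_add, Finset.sum_add_distrib,
      hlp] at e
    have e2 : ∑ μ, eta μ * (C μ p x a * zeta μ p x) = V p x a +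
        ∑ μ, eta μ * (pd a (lm μ p) x * zeta μ p x) := by
      rw [hV, ← Finset.sum_add_distrib]
      exact Finset.sum_congr rfl fun μ _ => by rw [hC]; ring
    rw [e2]
    linarith
  have hpC : ∀ μ p x c a, pd c (fun y => C μ p y a) x =
      pd c (fun y => A μ p y a) x + pd c (pd a (lm μ p)) x := fun μ p x c a =>
    pd_add c ((hAa μ p a).diff x) ((hdl μ p a).diff x)
  have hcom : ∀ μ p x c a, pd c (pd a (lm μ p)) x = pd a (pd c (lm μ p)) x := fun μ p x c a =>
    pd_comm c a ((hl μ).1 p) x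
  have hfo : ∀ μ p x a, pd a (ambGrad p μ (Φ p)) x = formOf p μ (hessPlus Φ p) x a :=
    fun μ p x a => pd_ambGrad p μ (hΦ.1 p) a x
  have key := fun p => tensorOf_symm_curl (p := p) (C := fun μ => C μ p) (T := hessPlus Φ p)
    (fun μ => hCs μ p) (h0 p)
    (fun μ x => by
      simp only [hpC, hcom μ p x 2 1]; have := (hA μ p x).1; rw [hfo] at this; linarith)
    (fun μ x => by
      simp only [hpC, hcom μ p x 2 0]; have := (hA μ p x).2.1; rw [hfo] at this; linarith)
    (fun μ x => by
      simp only [hpC, hcom μ p x 1 0]; have := (hA μ p x).2.2; rw [hfo] at this; linarith)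
  refine ⟨fun p => tensorOf p fun μ => C μ p, ⟨fun p => smooth_tensorOf fun μ => hCs μ p, ?_⟩,
    fun p => (key p).1, fun p => (key p).2⟩
  exact TensorField.isGlobal_of_forms (fun μ => (hAg μ).add (hlF μ)) hzF fun p x a b => rfl

/-! ### Partial derivatives in the ambient space -/

/-- The ambient space of the hyperboloid. -/
abbrev Amb := Fin 4 → ℝ

/-- Partial derivative in the ambient space. -/
def dd (μ : Fin 4) (G : Amb → ℝ) (X : Amb) : ℝ := fderiv ℝ G X (Pi.single μ 1)

section

variable {G H : Amb → ℝ} {X : Amb}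

theorem smooth_dd (μ : Fin 4) (hG : Smooth G) : Smooth (dd μ G) := by
  have := ContDiff.fderiv_right (m := (⊤ : ℕ∞)) hG (by simp)
  exact this.clm_apply contDiff_const

theorem fderiv_eq_sum_dd (G : Amb → ℝ) (X v : Amb) : fderiv ℝ G X v = ∑ μ, v μ * dd μ G X := by
  have : v = ∑ μ, v μ • (Pi.single μ 1 : Amb) := by
    ext i
    simp [Finset.sum_apply, Pi.single_apply]
  conv_lhs => rw [this]
  simp [dd, map_sum]

theorem dd_add (μ : Fin 4) (hG : DifferentiableAt ℝ G X) (hH : DifferentiableAt ℝ H X) :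
    dd μ (fun Y => G Y + H Y) X = dd μ G X + dd μ H X := by
  simp [dd, fderiv_fun_add hG hH]

theorem dd_const_mul (μ : Fin 4) (c : ℝ) (hG : DifferentiableAt ℝ G X) :
    dd μ (fun Y => c * G Y) X = c * dd μ G X := by
  simp [dd, fderiv_const_mul hG]

theorem dd_congr (μ : Fin 4) (h : G =ᶠ[𝓝 X] H) : dd μ G X = dd μ H X := by
  simp only [dd, h.fderiv_eq]

/-- The chain rule for maps from coordinate space to the ambient space. -/
theorem pd_comp_amb {g : Coord → Amb} {x : Coord} (hG : DifferentiableAt ℝ G (g x))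
    (hg : DifferentiableAt ℝ g x) (a : Fin 3) :
    pd a (fun y => G (g y)) x = ∑ μ, pd a (fun y => g y μ) x * dd μ G (g x) := by
  have h2 := hG.hasFDerivAt.comp x hg.hasFDerivAt
  unfold pd
  rw [show (fun z => G (g z)) = G ∘ g from rfl, h2.fderiv]
  change fderiv ℝ G (g x) (fderiv ℝ g x (Pi.single a 1)) = _
  rw [fderiv_eq_sum_dd]
  refine Finset.sum_congr rfl fun μ _ => ?_
  have := (hasFDerivAt_pi'.1 (hg.hasFDerivAt) μ)
  rw [this.fderiv]
  rfl

end

/-! ### Integrals over the past light cone -/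

/-- The past null vectors `(-1, n)`. -/
def cone (y : Coord) (μ : Fin 4) : ℝ := ![-1, 1, 1, 1] μ * sphHarmonic y μ

theorem smooth_cone : Smooth cone := contDiff_pi.2 fun μ => contDiff_const.mul (smooth_sphHarmonic μ)

section

variable {G : Amb → ℝ}

theorem smooth_coneComp (hG : Smooth G) (X : Amb) : Smooth (fun y : Coord => G (X + y 0 • cone y)) :=
  hG.comp (contDiff_const.add ((smooth_coord 0).smul smooth_cone))

/-- The spherical mean of `G` over the part of the past light cone of `X` at distance `r`, times
`4 π`. -/
def coneMean (G : Amb → ℝ) (X : Amb) (r : ℝ) : ℝ :=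
  sphInt (fun y => Real.sin (y 1) * G (X + y 0 • cone y)) r

theorem smooth_coneIntegrand (hG : Smooth G) : Smooth (fun q : ((Amb × ℝ) × ℝ) × ℝ =>
    Real.sin q.1.2 * G (q.1.1.1 + q.1.1.2 • cone ![q.1.1.2, q.1.2, q.2])) := by
  have h1 : Smooth (fun q : ((Amb × ℝ) × ℝ) × ℝ => q.1.1.1) := by unfold Smooth; fun_prop
  have h2 : Smooth (fun q : ((Amb × ℝ) × ℝ) × ℝ => q.1.1.2) := by unfold Smooth; fun_prop
  have h3 : Smooth (fun q : ((Amb × ℝ) × ℝ) × ℝ => q.1.2) := by unfold Smooth; fun_prop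
  have h4 : Smooth (fun q : ((Amb × ℝ) × ℝ) × ℝ => q.2) := contDiff_snd
  have h5 := smooth_vec h2 h3 h4
  exact (Real.contDiff_sin.comp h3).mul (ContDiff.comp hG (h1.add (h2.smul (smooth_cone.comp h5))))

theorem smooth_coneInner (hG : Smooth G) : Smooth (fun q : (Amb × ℝ) × ℝ =>
    ∫ φ in (0 : ℝ)..(2 * Real.pi), Real.sin q.2 * G (q.1.1 + q.1.2 • cone ![q.1.2, q.2, φ])) :=
  smooth_intervalIntegral (f := fun (q : (Amb × ℝ) × ℝ) (φ : ℝ) =>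
    Real.sin q.2 * G (q.1.1 + q.1.2 • cone ![q.1.2, q.2, φ])) (smooth_coneIntegrand hG) _ _

theorem smooth_coneMean (hG : Smooth G) : Smooth (Function.uncurry (coneMean G)) :=
  smooth_intervalIntegral (f := fun (q : Amb × ℝ) (θ : ℝ) => ∫ φ in (0 : ℝ)..(2 * Real.pi),
    Real.sin θ * G (q.1 + q.2 • cone ![q.2, θ, φ])) (smooth_coneInner hG) _ _

/-- The cone over X is the translate of a fixed cone, so derivatives in X pass to G. -/
theorem dd_coneMean (hG : Smooth G) (μ : Fin 4) (X : Amb) (r : ℝ) :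
    dd μ (fun X => coneMean G X r) X = coneMean (dd μ G) X r := by
  have i1 : Smooth (fun q : Amb × ℝ => ((q.1, r), q.2)) := by unfold Smooth; fun_prop
  have s1 : Smooth (Function.uncurry fun (X : Amb) (θ : ℝ) => ∫ φ in (0 : ℝ)..(2 * Real.pi),
      Real.sin θ * G (X + r • cone ![r, θ, φ])) :=
    ContDiff.comp (g := fun q : (Amb × ℝ) × ℝ => ∫ φ in (0 : ℝ)..(2 * Real.pi),
      Real.sin q.2 * G (q.1.1 + q.1.2 • cone ![q.1.2, q.2, φ]))
      (f := fun q : Amb × ℝ => ((q.1, r), q.2)) (smooth_coneInner hG) i1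
  have e1 : dd μ (fun X => coneMean G X r) X = ∫ θ in (0 : ℝ)..Real.pi,
      dd μ (fun X => ∫ φ in (0 : ℝ)..(2 * Real.pi), Real.sin θ * G (X + r • cone ![r, θ, φ])) X :=
    fderiv_intervalIntegral_apply s1 _ _ _ _
  rw [e1]
  refine intervalIntegral.integral_congr fun θ _ => ?_
  have i2 : Smooth (fun q : Amb × ℝ => (((q.1, r), θ), q.2)) := by unfold Smooth; fun_prop
  have s2 : Smooth (Function.uncurry fun (X : Amb) (φ : ℝ) =>
      Real.sin θ * G (X + r • cone ![r, θ, φ])) :=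
    ContDiff.comp (g := fun q : ((Amb × ℝ) × ℝ) × ℝ =>
      Real.sin q.1.2 * G (q.1.1.1 + q.1.1.2 • cone ![q.1.1.2, q.1.2, q.2]))
      (f := fun q : Amb × ℝ => (((q.1, r), θ), q.2)) (smooth_coneIntegrand hG) i2
  have e2 : dd μ (fun X => ∫ φ in (0 : ℝ)..(2 * Real.pi), Real.sin θ * G (X + r • cone ![r, θ, φ])) X =
      ∫ φ in (0 : ℝ)..(2 * Real.pi), dd μ (fun X => Real.sin θ * G (X + r • cone ![r, θ, φ])) X :=
    fderiv_intervalIntegral_apply s2 _ _ _ _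
  dsimp only
  rw [e2]
  refine intervalIntegral.integral_congr fun φ _ => ?_
  have hsh : Smooth (fun X : Amb => X + r • cone ![r, θ, φ]) := contDiff_id.add contDiff_const
  have hd : DifferentiableAt ℝ (fun X => G (X + r • cone ![r, θ, φ])) X :=
    (hG.diff _).comp X (hsh.diff X)
  rw [dd_const_mul μ _ hd]
  have e3 : dd μ (fun X => G (X + r • cone ![r, θ, φ])) X = dd μ G (X + r • cone ![r, θ, φ]) := by
    unfold dd
    rw [fderiv_comp_add_right]
  rw [e3]
  rfl

theorem pd_cone (a : Fin 3) (μ : Fin 4) (y : Coord) : pd a (fun z => cone z μ) y =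
    ![-1, 1, 1, 1] μ * ![0, harmTheta μ y, Real.sin (y 1) * harmPhi μ y] a := by
  unfold cone
  rw [pd_const_mul a _ ((smooth_sphHarmonic μ).diff y), pd_sphHarmonic]

theorem pd_coneComp (hG : Smooth G) (X : Amb) (a : Fin 3) (y : Coord) :
    pd a (fun y : Coord => G (X + y 0 • cone y)) y =
      ∑ μ, ![cone y μ, y 0 * (![-1, 1, 1, 1] μ * harmTheta μ y),
        y 0 * (![-1, 1, 1, 1] μ * (Real.sin (y 1) * harmPhi μ y))] a * dd μ G (X + y 0 • cone y) := by
  have hg : Smooth (fun y : Coord => X + y 0 • cone y) :=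
    contDiff_const.add ((smooth_coord 0).smul smooth_cone)
  rw [pd_comp_amb (g := fun y : Coord => X + y 0 • cone y) (hG.diff _) (hg.diff y)]
  refine Finset.sum_congr rfl fun μ _ => ?_
  congr 1
  have hcs : Smooth (fun z => cone z μ) := contDiff_pi.1 smooth_cone μ
  have hc := hcs.diff y
  have h0 := (smooth_coord 0).diff y
  have e : (fun y : Coord => (X + y 0 • cone y) μ) = fun y => X μ + y 0 * cone y μ := rfl
  rw [e, pd_add a (differentiableAt_const _) (h0.fun_mul hc), pd_const, pd_mul a h0 hc, pd_coord,
    pd_cone]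
  fin_cases a <;> simp

end

/-! ### Kirchhoff's formula -/

/-- The wave operator of the ambient space. -/
def waveOp (G : Amb → ℝ) (X : Amb) : ℝ := ∑ μ, eta μ * dd μ (dd μ G) X

/-- The unit vectors along θ and φ and the radial vector n form an orthonormal basis of ℝ³. -/
theorem harm_complete (y : Coord) (i j : Fin 3) :
    harmTheta i.succ y * harmTheta j.succ y + harmPhi i.succ y * harmPhi j.succ y +
      sphHarmonic y i.succ * sphHarmonic y j.succ = if i = j then 1 else 0 := by
  have e1 := Real.sin_sq_add_cos_sq (y 1)
  have e2 := Real.sin_sq_add_cos_sq (y 2)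
  unfold harmTheta harmPhi sphHarmonic
  fin_cases i <;> fin_cases j <;> simp <;> grind

theorem harm_zero (y : Coord) : harmTheta 0 y = 0 ∧ harmPhi 0 y = 0 ∧ sphHarmonic y 0 = 1 := by
  simp [harmTheta, harmPhi, sphHarmonic]

theorem dd_comm {G : Amb → ℝ} (hG : Smooth G) (μ ν : Fin 4) (X : Amb) :
    dd μ (dd ν G) X = dd ν (dd μ G) X := by
  have h2 : ContDiff ℝ 2 G := contDiff_infty.1 hG 2
  have hd : DifferentiableAt ℝ (fderiv ℝ G) X :=
    (h2.fderiv_right (m := 1) (by norm_num)).differentiable one_ne_zero X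
  have hs : IsSymmSndFDerivAt ℝ G X := h2.contDiffAt.isSymmSndFDerivAt (by simp)
  have key : ∀ a b : Fin 4, dd a (dd b G) X =
      fderiv ℝ (fderiv ℝ G) X (Pi.single a 1) (Pi.single b 1) := fun a b => by
    unfold dd
    rw [fderiv_clm_apply hd (differentiableAt_const _)]
    simp
  rw [key, key, hs.eq]

section

variable {G : Amb → ℝ}

/-- The integrand of the boundary term in Kirchhoff's formula. -/
def coneBdry (G : Amb → ℝ) (X : Amb) (y : Coord) : ℝ := Real.sin (y 1) *
  (G (X + y 0 • cone y) + y 0 * ∑ μ, sphHarmonic y μ * dd μ G (X + y 0 • cone y))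

theorem smooth_coneBdry (hG : Smooth G) (X : Amb) : Smooth (coneBdry G X) :=
  (smooth_sin 1).mul ((smooth_coneComp hG X).add ((smooth_coord 0).mul
    (ContDiff.sum fun μ _ => (smooth_sphHarmonic μ).mul (smooth_coneComp (smooth_dd μ hG) X))))

theorem smooth_waveOp (hG : Smooth G) : Smooth (waveOp G) :=
  ContDiff.sum fun μ _ => contDiff_const.mul (smooth_dd μ (smooth_dd μ hG))

theorem pd_coneBdry (hG : Smooth G) (X : Amb) (y : Coord) : pd 0 (coneBdry G X) y =
    Real.sin (y 1) * (∑ μ, (cone y μ + sphHarmonic y μ) * dd μ G (X + y 0 • cone y) +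
      y 0 * ∑ μ, ∑ ν, sphHarmonic y μ * cone y ν * dd ν (dd μ G) (X + y 0 • cone y)) := by
  have hs := (smooth_sin 1).diff y
  have h0 := (smooth_coord 0).diff y
  have hg := (smooth_coneComp hG X).diff y
  have hY := fun μ => (smooth_sphHarmonic μ).diff y
  have hgm := fun μ => (smooth_coneComp (smooth_dd μ hG) X).diff y
  have hm : ∀ μ, DifferentiableAt ℝ (fun y => sphHarmonic y μ * dd μ G (X + y 0 • cone y)) y :=
    fun μ => (hY μ).fun_mul (hgm μ)
  have hsum : DifferentiableAt ℝ (fun y => ∑ μ, sphHarmonic y μ * dd μ G (X + y 0 • cone y)) y :=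
    DifferentiableAt.fun_sum fun μ _ => hm μ
  unfold coneBdry
  rw [pd_mul 0 hs (hg.fun_add (h0.fun_mul hsum)), pd_add 0 hg (h0.fun_mul hsum), pd_mul 0 h0 hsum,
    pd_sum _ _ _ fun μ _ => hm μ, pd_coneComp hG, pd_coord, pd_sin]
  simp only [fun μ => pd_mul 0 (hY μ) (hgm μ), pd_sphHarmonic,
    fun μ => pd_coneComp (smooth_dd μ hG) X 0 y]
  simp [Fin.sum_univ_four, -mul_eq_mul_left_iff]
  ring

/-- The surface divergence of the tangential part of ∇G. The eigenvalue l(l+1) = 2 contributes -2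
n·∇G, and by completeness the angular second derivatives are the Laplacian minus the radial ones. In
the derivative of `coneBdry` along the cone the mixed derivatives cancel, and it differs from the
wave operator by exactly these terms. -/
theorem cone_identity (hG : Smooth G) (X : Amb) (y : Coord) :
    Real.sin (y 1) * pd 1 (fun y => ∑ μ, Real.sin (y 1) * harmTheta μ y *
        dd μ G (X + y 0 • cone y)) y +
      pd 2 (fun y => ∑ μ, Real.sin (y 1) * harmPhi μ y * dd μ G (X + y 0 • cone y)) y =
    Real.sin (y 1) * (y 0 * (Real.sin (y 1) * waveOp G (X + y 0 • cone y)) -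
      pd 0 (coneBdry G X) y) := by
  have hs := (smooth_sin 1).diff y
  have hT := fun μ => (smooth_harmTheta μ).diff y
  have hP := fun μ => (smooth_harmPhi μ).diff y
  have hgm := fun μ => (smooth_coneComp (smooth_dd μ hG) X).diff y
  have hsT : ∀ μ, DifferentiableAt ℝ (fun y : Coord => Real.sin (y 1) * harmTheta μ y) y := fun μ =>
    hs.fun_mul (hT μ)
  have hsP : ∀ μ, DifferentiableAt ℝ (fun y : Coord => Real.sin (y 1) * harmPhi μ y) y := fun μ =>
    hs.fun_mul (hP μ)
  rw [pd_sum _ _ _ fun μ _ => (hsT μ).fun_mul (hgm μ), pd_sum _ _ _ fun μ _ => (hsP μ).fun_mul (hgm μ)]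
  simp only [fun μ => pd_mul 1 (hsT μ) (hgm μ), fun μ => pd_mul 2 (hsP μ) (hgm μ),
    fun μ => pd_mul 2 hs (hP μ)]
  rw [pd_coneBdry hG]
  have e2 : pd 2 (fun y : Coord => Real.sin (y 1)) y = 0 := by rw [pd_sin]; simp
  simp only [e2, fun μ => pd_coneComp (smooth_dd μ hG) X 1 y,
    fun μ => pd_coneComp (smooth_dd μ hG) X 2 y]
  have ht := fun μ => pd_harmTheta μ y
  have hc := harm_complete y
  obtain ⟨z1, z2, z3⟩ := harm_zero y
  have c0 : cone y 0 = -1 := by simp [cone, z3]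
  have cs : ∀ i : Fin 3, cone y i.succ = sphHarmonic y i.succ := fun i => by
    unfold cone; fin_cases i <;> simp
  have hsym := fun i : Fin 3 => dd_comm hG 0 i.succ (X + y 0 • cone y)
  generalize hD : (fun μ ν => dd μ (dd ν G) (X + y 0 • cone y)) = D
  have hD' : ∀ μ ν, dd μ (dd ν G) (X + y 0 • cone y) = D μ ν := fun μ ν => by rw [← hD]
  simp only [hD'] at hsym
  unfold waveOp
  simp only [hD']
  generalize hd : (fun μ => dd μ G (X + y 0 • cone y)) = d
  have hd' : ∀ μ, dd μ G (X + y 0 • cone y) = d μ := fun μ => by rw [← hd]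
  simp only [hd']
  have cs1 : cone y 1 = sphHarmonic y 1 := cs 0
  have cs2 : cone y 2 = sphHarmonic y 2 := cs 1
  have cs3 : cone y 3 = sphHarmonic y 3 := cs 2
  have s1 : D 0 1 = D 1 0 := hsym 0
  have s2 : D 0 2 = D 2 0 := hsym 1
  have s3 : D 0 3 = D 3 0 := hsym 2
  have hcc : ∀ i j : Fin 3, harmTheta i.succ y * harmTheta j.succ y * D i.succ j.succ +
      harmPhi i.succ y * harmPhi j.succ y * D i.succ j.succ +
      sphHarmonic y i.succ * sphHarmonic y j.succ * D i.succ j.succ =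
      if i = j then D i.succ j.succ else 0 := fun i j => by
    rw [← add_mul, ← add_mul, hc]; split_ifs <;> simp
  have hS : (∑ i : Fin 3, ∑ j : Fin 3, (harmTheta i.succ y * harmTheta j.succ y * D i.succ j.succ +
      harmPhi i.succ y * harmPhi j.succ y * D i.succ j.succ +
      sphHarmonic y i.succ * sphHarmonic y j.succ * D i.succ j.succ)) = D 1 1 + D 2 2 + D 3 3 := by
    simp only [hcc, Finset.sum_ite_eq, Finset.mem_univ, if_true, Fin.sum_univ_three]
    rfl
  have hH : ∑ μ, (Real.sin (y 1) * pd 1 (fun y => Real.sin (y 1) * harmTheta μ y) y +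
      Real.sin (y 1) * pd 2 (harmPhi μ) y) * d μ =
      ∑ μ, -harmEigen μ * Real.sin (y 1) ^ 2 * sphHarmonic y μ * d μ :=
    Finset.sum_congr rfl fun μ _ => by rw [ht]
  simp only [Fin.sum_univ_three, show Fin.succ (0 : Fin 3) = 1 from rfl,
    show Fin.succ (1 : Fin 3) = 2 from rfl, show Fin.succ (2 : Fin 3) = 3 from rfl] at hS
  simp only [Fin.sum_univ_four, harmEigen, Matrix.cons_val] at hH
  simp only [Fin.sum_univ_four, eta, Matrix.cons_val, z1, z2, z3, c0, cs1, cs2, cs3, s1, s2, s3]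
    at hH ⊢
  linear_combination hH + y 0 * Real.sin (y 1) ^ 2 * hS

end

/-! ### The retarded potential -/

section

variable {G : Amb → ℝ}

/-- The spherical integral of `cone_identity`, in which the surface divergence disappears. -/
theorem hasDerivAt_coneBdry (hG : Smooth G) (X : Amb) (r : ℝ) :
    HasDerivAt (sphInt (coneBdry G X)) (r * coneMean (waveOp G) X r) r := by
  have h := hasDerivAt_sphInt (smooth_coneBdry hG X) r
  have hgm := fun μ => smooth_coneComp (smooth_dd μ hG) X
  have hU : Smooth (fun y : Coord => ∑ μ, Real.sin (y 1) * harmTheta μ y *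
      dd μ G (X + y 0 • cone y)) :=
    ContDiff.sum fun μ _ => ((smooth_sin 1).mul (smooth_harmTheta μ)).mul (hgm μ)
  have hV : Smooth (fun y : Coord => ∑ μ, Real.sin (y 1) * harmPhi μ y *
      dd μ G (X + y 0 • cone y)) :=
    ContDiff.sum fun μ _ => ((smooth_sin 1).mul (smooth_harmPhi μ)).mul (hgm μ)
  have hz := sphInt_eq_zero hU hV (by simp) (by simp) (fun τ θ => ?_)
    (fun y _ => cone_identity hG X y) r
  · have s1 : Smooth (fun y : Coord => Real.sin (y 1) * waveOp G (X + y 0 • cone y)) :=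
      (smooth_sin 1).mul (smooth_coneComp (smooth_waveOp hG) X)
    have s2 : Smooth (fun y : Coord => y 0 * (Real.sin (y 1) * waveOp G (X + y 0 • cone y))) :=
      (smooth_coord 0).mul s1
    have s3 : Smooth (fun y : Coord => -1 * pd 0 (coneBdry G X) y) :=
      contDiff_const.mul (smooth_pd 0 (smooth_coneBdry hG X))
    have e : (fun y : Coord => y 0 * (Real.sin (y 1) * waveOp G (X + y 0 • cone y)) -
        pd 0 (coneBdry G X) y) = fun y : Coord =>
        y 0 * (Real.sin (y 1) * waveOp G (X + y 0 • cone y)) + -1 * pd 0 (coneBdry G X) y := by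
      funext y; ring
    rw [e, sphInt_add s2 s3, sphInt_mul_left (fun r => r), sphInt_const_mul] at hz
    refine h.congr_deriv ?_
    unfold coneMean
    linarith
  · have hc : cone ![τ, θ, 2 * Real.pi] = cone ![τ, θ, 0] := by
      funext μ; simp [cone, sphHarmonic]
    have hp : ∀ μ, harmPhi μ ![τ, θ, 2 * Real.pi] = harmPhi μ ![τ, θ, 0] := fun μ => by
      simp [harmPhi]
    simp only [hc, hp]
    rfl

/-- The derivative of `coneMean` along the cone. -/
theorem hasDerivAt_coneMean (hG : Smooth G) (X : Amb) (r : ℝ) :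
    HasDerivAt (coneMean G X)
      (sphInt (fun y => Real.sin (y 1) * ∑ μ, cone y μ * dd μ G (X + y 0 • cone y)) r) r := by
  have hs : Smooth (fun y : Coord => Real.sin (y 1) * G (X + y 0 • cone y)) :=
    (smooth_sin 1).mul (smooth_coneComp hG X)
  refine (hasDerivAt_sphInt hs r).congr_deriv ?_
  congr 1
  funext y
  rw [pd_mul 0 ((smooth_sin 1).diff y) ((smooth_coneComp hG X).diff y), pd_coneComp hG, pd_sin]
  simp

/-- The direction (1, n) in the boundary term is the null direction (-1, n) of the cone plus twice
the time direction. This expresses the boundary term through derivatives of spherical means. -/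
theorem sphInt_coneBdry (hG : Smooth G) (X : Amb) (r : ℝ) : sphInt (coneBdry G X) r =
    coneMean G X r + r * sphInt (fun y => Real.sin (y 1) * ∑ μ, cone y μ *
      dd μ G (X + y 0 • cone y)) r + 2 * (r * coneMean (dd 0 G) X r) := by
  have s0 : Smooth (fun y : Coord => Real.sin (y 1) * G (X + y 0 • cone y)) :=
    (smooth_sin 1).mul (smooth_coneComp hG X)
  have s1 : Smooth (fun y : Coord => Real.sin (y 1) * dd 0 G (X + y 0 • cone y)) :=
    (smooth_sin 1).mul (smooth_coneComp (smooth_dd 0 hG) X)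
  have s1' : Smooth (fun y : Coord => 2 * (Real.sin (y 1) * dd 0 G (X + y 0 • cone y))) :=
    contDiff_const.mul s1
  have hcone : ∀ μ, Smooth (fun y => cone y μ) := fun μ => contDiff_pi.1 smooth_cone μ
  have s2 : Smooth (fun y : Coord => Real.sin (y 1) * ∑ μ, cone y μ *
      dd μ G (X + y 0 • cone y)) := (smooth_sin 1).mul (ContDiff.sum fun μ _ =>
        (hcone μ).mul (smooth_coneComp (smooth_dd μ hG) X))
  have s3 : Smooth (fun y : Coord => Real.sin (y 1) * (∑ μ, cone y μ * dd μ G (X + y 0 • cone y)) +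
      2 * (Real.sin (y 1) * dd 0 G (X + y 0 • cone y))) := s2.add s1'
  have s4 : Smooth (fun y : Coord => y 0 * (Real.sin (y 1) * (∑ μ, cone y μ *
      dd μ G (X + y 0 • cone y)) + 2 * (Real.sin (y 1) * dd 0 G (X + y 0 • cone y)))) :=
    (smooth_coord 0).mul s3
  have e : coneBdry G X = fun y => Real.sin (y 1) * G (X + y 0 • cone y) +
      y 0 * (Real.sin (y 1) * (∑ μ, cone y μ * dd μ G (X + y 0 • cone y)) +
      2 * (Real.sin (y 1) * dd 0 G (X + y 0 • cone y))) := by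
    funext y
    unfold coneBdry
    have z := (harm_zero y).2.2
    have : ∑ μ, sphHarmonic y μ * dd μ G (X + y 0 • cone y) =
        ∑ μ, cone y μ * dd μ G (X + y 0 • cone y) + 2 * dd 0 G (X + y 0 • cone y) := by
      simp [Fin.sum_univ_four, cone, z]
      ring
    rw [this]
    ring
  rw [e, sphInt_add s0 s4, sphInt_mul_left (fun r => r), sphInt_add s2 s1', sphInt_const_mul]
  unfold coneMean
  ring

theorem coneMean_zero (G : Amb → ℝ) (X : Amb) : coneMean G X 0 = 4 * Real.pi * G X := by
  simp [coneMean, sphInt]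
  ring

end

/-! ### Integrals over 0 < r < t and their derivatives. -/

section

variable {Q : Amb → ℝ → ℝ}

theorem smooth_primitive (hQ : Smooth (Function.uncurry Q)) :
    Smooth (fun q : Amb × ℝ => ∫ r in (0 : ℝ)..q.2, Q q.1 r) := by
  have e : (fun q : Amb × ℝ => ∫ r in (0 : ℝ)..q.2, Q q.1 r) =
      fun q => q.2 * ∫ t in (0 : ℝ)..1, Q q.1 (t * q.2) := by
    funext q
    have h := intervalIntegral.smul_integral_comp_mul_right (a := 0) (b := 1) (fun s => Q q.1 s) q.2
    rw [zero_mul, one_mul, smul_eq_mul] at h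
    exact h.symm
  have i : Smooth (fun q : (Amb × ℝ) × ℝ => (q.1.1, q.2 * q.1.2)) := by unfold Smooth; fun_prop
  have h : Smooth (Function.uncurry fun (q : Amb × ℝ) (t : ℝ) => Q q.1 (t * q.2)) :=
    ContDiff.comp (g := Function.uncurry Q) (f := fun q : (Amb × ℝ) × ℝ => (q.1.1, q.2 * q.1.2)) hQ i
  rw [e]
  exact contDiff_snd.mul (smooth_intervalIntegral h 0 1)

/-- The integral over `0 < r < t`. -/
def radInt (Q : Amb → ℝ → ℝ) (X : Amb) : ℝ := ∫ r in (0 : ℝ)..(X 0), Q X r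

theorem smooth_time : Smooth (fun X : Amb => (X, X 0)) := contDiff_id.prodMk (contDiff_apply ℝ ℝ 0)

theorem smooth_radInt (hQ : Smooth (Function.uncurry Q)) : Smooth (radInt Q) :=
  ContDiff.comp (g := fun q : Amb × ℝ => ∫ r in (0 : ℝ)..q.2, Q q.1 r) (f := fun X : Amb => (X, X 0))
    (smooth_primitive hQ) smooth_time

theorem fderiv_time (X v : Amb) : fderiv ℝ (fun X : Amb => (X, X 0)) X v = (v, 0) + (0, v 0) := by
  have h0 : HasFDerivAt (fun X : Amb => X 0)
      (ContinuousLinearMap.proj (R := ℝ) (φ := fun _ : Fin 4 => ℝ) 0) X := hasFDerivAt_apply 0 X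
  have e : fderiv ℝ (fun X : Amb => (X, X 0)) X = _ := ((hasFDerivAt_id X).prodMk h0).fderiv
  rw [e]
  simp

/-- The chain rule for `X ↦ R (X, t)`. -/
theorem dd_time {R : Amb → ℝ → ℝ} (hR : Smooth (Function.uncurry R)) {R' : ℝ} {X : Amb}
    (h : HasDerivAt (R X) R' (X 0)) (μ : Fin 4) :
    dd μ (fun X => R X (X 0)) X = dd μ (fun Y => R Y (X 0)) X + (Pi.single μ 1 : Amb) 0 * R' := by
  have h1 : DifferentiableAt ℝ (Function.uncurry R) (X, X 0) := hR.diff _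
  have h2 := h1.hasFDerivAt.comp X (smooth_time.diff X).hasFDerivAt
  have e : dd μ (fun X => R X (X 0)) X =
      fderiv ℝ (Function.uncurry R) (X, X 0) (fderiv ℝ (fun X : Amb => (X, X 0)) X (Pi.single μ 1)) := by
    unfold dd
    rw [show (fun X : Amb => R X (X 0)) = Function.uncurry R ∘ fun X : Amb => (X, X 0) from rfl,
      h2.fderiv]
    rfl
  have h3 : HasFDerivAt (fun Y => R Y (X 0)) _ X :=
    fderiv_partial_left (hR.of_le (by exact_mod_cast le_top)) X (X 0)
  have h4 : HasDerivAt (fun t : ℝ => (X, t)) ((0, 1) : Amb × ℝ) (X 0) :=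
    (hasDerivAt_const _ _).prodMk (hasDerivAt_id _)
  have h5 : HasDerivAt (R X) (fderiv ℝ (Function.uncurry R) (X, X 0) (0, 1)) (X 0) :=
    h1.hasFDerivAt.comp_hasDerivAt (X 0) h4
  have e5 : ((0, (Pi.single μ 1 : Amb) 0) : Amb × ℝ) = (Pi.single μ 1 : Amb) 0 • ((0, 1) : Amb × ℝ) := by
    ext <;> simp
  rw [e, fderiv_time, map_add, e5, map_smul, h5.unique h]
  unfold dd
  rw [h3.fderiv]
  simp

/-- Leibniz' rule; only the time derivative sees the upper limit. -/
theorem dd_radInt (hQ : Smooth (Function.uncurry Q)) (μ : Fin 4) (X : Amb) :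
    dd μ (radInt Q) X = radInt (fun X r => dd μ (fun Y => Q Y r) X) X +
      (Pi.single μ 1 : Amb) 0 * Q X (X 0) := by
  have hc : Continuous (Q X) := hQ.continuous.comp (Continuous.prodMk_right X)
  have h2 : HasDerivAt (fun s : ℝ => ∫ t in (0 : ℝ)..s, Q X t) (Q X (X 0)) (X 0) :=
    intervalIntegral.integral_hasDerivAt_right (hc.intervalIntegrable _ _)
      (hc.stronglyMeasurableAtFilter _ _) hc.continuousAt
  have h := dd_time (R := fun X t => ∫ r in (0 : ℝ)..t, Q X r) (smooth_primitive hQ) h2 μ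
  rw [show radInt Q = fun X => ∫ r in (0 : ℝ)..(X 0), Q X r from rfl, h]
  congr 1
  exact fderiv_intervalIntegral_apply hQ _ _ _ _

end

/-- Kirchhoff's retarded potential, times `4 π`. -/
def retarded (G : Amb → ℝ) : Amb → ℝ := radInt fun X r => r * coneMean G X r

section

variable {G : Amb → ℝ}

theorem smooth_retardedIntegrand (hG : Smooth G) :
    Smooth (Function.uncurry fun X r => r * coneMean G X r) :=
  contDiff_snd.mul (smooth_coneMean hG)

theorem smooth_retarded (hG : Smooth G) : Smooth (retarded G) :=
  smooth_radInt (smooth_retardedIntegrand hG)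

theorem dd_retarded (hG : Smooth G) (μ : Fin 4) (X : Amb) : dd μ (retarded G) X =
    retarded (dd μ G) X + (Pi.single μ 1 : Amb) 0 * (X 0 * coneMean G X (X 0)) := by
  unfold retarded
  rw [dd_radInt (smooth_retardedIntegrand hG)]
  have h : ∀ (X : Amb) (r : ℝ), dd μ (fun Y => r * coneMean G Y r) X = r * coneMean (dd μ G) X r :=
    fun X r => by
      have i : Smooth (fun X : Amb => (X, r)) := contDiff_id.prodMk contDiff_const
      have hs : Smooth (fun Y => coneMean G Y r) :=
        ContDiff.comp (g := Function.uncurry (coneMean G)) (f := fun X : Amb => (X, r))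
          (smooth_coneMean hG) i
      rw [dd_const_mul μ r (hs.diff X), dd_coneMean hG]
  simp only [h]

/-- The wave equation for the retarded potential. -/
theorem waveOp_retarded (hG : Smooth G) (X : Amb) :
    waveOp (retarded G) X = -(4 * Real.pi * G X) := by
  have hr := smooth_retarded hG
  have hbs : Smooth (fun X : Amb => X 0 * coneMean G X (X 0)) :=
    (contDiff_apply ℝ ℝ 0).mul (ContDiff.comp (g := Function.uncurry (coneMean G))
      (f := fun X : Amb => (X, X 0)) (smooth_coneMean hG) smooth_time)
  -- Two applications of Leibniz' rule. The factors `Pi.single μ 1 0` confine the boundary terms to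
  -- μ = 0.
  have h1 : ∀ μ, dd μ (dd μ (retarded G)) X = retarded (dd μ (dd μ G)) X +
      (Pi.single μ 1 : Amb) 0 * (X 0 * coneMean (dd μ G) X (X 0)) +
      (Pi.single μ 1 : Amb) 0 * dd μ (fun X => X 0 * coneMean G X (X 0)) X := by
    intro μ
    have e : dd μ (retarded G) = fun X => retarded (dd μ G) X +
        (Pi.single μ 1 : Amb) 0 * (X 0 * coneMean G X (X 0)) := funext (dd_retarded hG μ)
    have hb2 : Smooth (fun X : Amb => (Pi.single μ 1 : Amb) 0 * (X 0 * coneMean G X (X 0))) :=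
      contDiff_const.mul hbs
    rw [e, dd_add μ ((smooth_retarded (smooth_dd μ hG)).diff X) (hb2.diff X),
      dd_const_mul μ _ (hbs.diff X), dd_retarded (smooth_dd μ hG)]
  have hder : HasDerivAt (fun r => r * coneMean G X r) (1 * coneMean G X (X 0) + X 0 *
      sphInt (fun y => Real.sin (y 1) * ∑ μ, cone y μ * dd μ G (X + y 0 • cone y)) (X 0)) (X 0) :=
    (hasDerivAt_id' (X 0)).fun_mul (hasDerivAt_coneMean hG X (X 0))
  have h2 := dd_time (R := fun X r => r * coneMean G X r) (smooth_retardedIntegrand hG) hder 0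
  have h3 : dd 0 (fun Y => X 0 * coneMean G Y (X 0)) X = X 0 * coneMean (dd 0 G) X (X 0) := by
    have i : Smooth (fun Y : Amb => (Y, X 0)) := contDiff_id.prodMk contDiff_const
    have hs : Smooth (fun Y => coneMean G Y (X 0)) :=
      ContDiff.comp (g := Function.uncurry (coneMean G)) (f := fun Y : Amb => (Y, X 0))
        (smooth_coneMean hG) i
    rw [dd_const_mul 0 _ (hs.diff X), dd_coneMean hG]
  have hi : ∀ {H : Amb → ℝ}, Smooth H → IntervalIntegrable (fun r => r * coneMean H X r) volume 0 (X 0) :=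
    fun hH => ((smooth_retardedIntegrand hH).continuous.comp
      (Continuous.prodMk_right X)).intervalIntegrable _ _
  -- The value of the boundary integral at r = t cancels the boundary terms of the second time
  -- derivative. The value at r = 0 leaves 4πG.
  have h4 : ∫ r in (0 : ℝ)..(X 0), r * coneMean (waveOp G) X r =
      sphInt (coneBdry G X) (X 0) - sphInt (coneBdry G X) 0 :=
    intervalIntegral.integral_eq_sub_of_hasDerivAt (fun r _ => hasDerivAt_coneBdry hG X r)
      (hi (smooth_waveOp hG))
  have h5 : ∫ r in (0 : ℝ)..(X 0), r * coneMean (waveOp G) X r =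
      ∑ μ, eta μ * retarded (dd μ (dd μ G)) X := by
    have hdd := fun μ => smooth_dd μ (smooth_dd μ hG)
    have e : ∀ r, r * coneMean (waveOp G) X r = ∑ μ, eta μ * (r * coneMean (dd μ (dd μ G)) X r) := by
      intro r
      have s := fun μ => (smooth_sin 1).mul (smooth_coneComp (hdd μ) X)
      have e1 : coneMean (waveOp G) X r = ∑ μ, eta μ * coneMean (dd μ (dd μ G)) X r := by
        have hh : ∀ μ, Smooth (fun y : Coord => eta μ * (Real.sin (y 1) *
            dd μ (dd μ G) (X + y 0 • cone y))) := fun μ => contDiff_const.mul (s μ)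
        have h01 := (hh 0).add (hh 1)
        have h012 := h01.add (hh 2)
        have e2 : (fun y : Coord => Real.sin (y 1) * waveOp G (X + y 0 • cone y)) = fun y =>
            eta 0 * (Real.sin (y 1) * dd 0 (dd 0 G) (X + y 0 • cone y)) +
            eta 1 * (Real.sin (y 1) * dd 1 (dd 1 G) (X + y 0 • cone y)) +
            eta 2 * (Real.sin (y 1) * dd 2 (dd 2 G) (X + y 0 • cone y)) +
            eta 3 * (Real.sin (y 1) * dd 3 (dd 3 G) (X + y 0 • cone y)) := by
          funext y
          unfold waveOp
          simp only [Fin.sum_univ_four]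
          ring
        rw [show coneMean (waveOp G) X r =
          sphInt (fun y : Coord => Real.sin (y 1) * waveOp G (X + y 0 • cone y)) r from rfl, e2,
          sphInt_add h012 (hh 3), sphInt_add h01 (hh 2), sphInt_add (hh 0) (hh 1)]
        simp only [sphInt_const_mul, Fin.sum_univ_four]
        rfl
      rw [e1, Finset.mul_sum]
      exact Finset.sum_congr rfl fun μ _ => by ring
    simp only [e]
    rw [intervalIntegral.integral_finsetSum fun μ _ => (hi (hdd μ)).const_mul _]
    simp only [intervalIntegral.integral_const_mul]
    rfl
  have h6 : sphInt (coneBdry G X) 0 = 4 * Real.pi * G X := by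
    rw [sphInt_coneBdry hG, coneMean_zero]; ring
  have h7 := sphInt_coneBdry hG X (X 0)
  unfold waveOp
  simp only [h1]
  simp only [Fin.sum_univ_four, eta, Matrix.cons_val] at h5 ⊢
  simp at h2 ⊢
  rw [h2, h3]
  linarith

end

/-! ### The inhomogeneous wave equation on de Sitter space -/

/-- Distance to the light cone of the origin. -/
def coneGap (X : Amb) : ℝ := Real.sqrt (spatialSq X) - |X 0|

theorem continuous_coneGap : Continuous coneGap :=
  smooth_spatialSq.continuous.sqrt.sub (continuous_apply 0).abs

theorem spatialSq_nonneg (X : Amb) : 0 ≤ spatialSq X := by unfold spatialSq; positivity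

theorem sphHarmonic_sq (y : Coord) :
    sphHarmonic y 1 ^ 2 + sphHarmonic y 2 ^ 2 + sphHarmonic y 3 ^ 2 = 1 := by
  have h1 := Real.sin_sq_add_cos_sq (y 1)
  have h2 := Real.sin_sq_add_cos_sq (y 2)
  simp only [sphHarmonic, Matrix.cons_val]
  linear_combination h1 + Real.sin (y 1) ^ 2 * h2

/-- Between `X` and the plane `t = 0`, the past light cone of `X` keeps away from the light cone of
the origin. -/
theorem coneGap_sq_le {X : Amb} (hX : 0 < coneGap X) {r : ℝ} (hr : r ∈ uIcc 0 (X 0)) (y : Coord) :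
    coneGap X ^ 2 ≤ rhoSq (X + r • cone y) := by
  have hw := sphHarmonic_sq y
  have hS := Real.sqrt_nonneg (spatialSq X)
  have hS2 := Real.sq_sqrt (spatialSq_nonneg X)
  unfold coneGap at hX ⊢
  set S := Real.sqrt (spatialSq X)
  -- The cone vectors are null, so the square is affine in r. With |w| ≤ S from the Cauchy–Schwarz
  -- inequality, it is at least (S - |t|)(S + |t| - 2|r|), and |r| ≤ |t|.
  have e : rhoSq (X + r • cone y) = S ^ 2 - X 0 ^ 2 + 2 * r * (X 1 * sphHarmonic y 1 +
      X 2 * sphHarmonic y 2 + X 3 * sphHarmonic y 3 + X 0) := by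
    have z := (harm_zero y).2.2
    rw [hS2]
    simp [rhoSq, spatialSq, cone, z]
    linear_combination r ^ 2 * hw
  have hcs : (X 1 * sphHarmonic y 1 + X 2 * sphHarmonic y 2 + X 3 * sphHarmonic y 3) ^ 2 ≤ S ^ 2 := by
    rw [hS2]
    unfold spatialSq
    have : (X 1 ^ 2 + X 2 ^ 2 + X 3 ^ 2) = (X 1 ^ 2 + X 2 ^ 2 + X 3 ^ 2) *
      (sphHarmonic y 1 ^ 2 + sphHarmonic y 2 ^ 2 + sphHarmonic y 3 ^ 2) := by rw [hw, mul_one]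
    rw [this]
    nlinarith [sq_nonneg (X 1 * sphHarmonic y 2 - X 2 * sphHarmonic y 1),
      sq_nonneg (X 1 * sphHarmonic y 3 - X 3 * sphHarmonic y 1),
      sq_nonneg (X 2 * sphHarmonic y 3 - X 3 * sphHarmonic y 2)]
  have hab := abs_le_of_sq_le_sq' hcs hS
  rw [e]
  set w := X 1 * sphHarmonic y 1 + X 2 * sphHarmonic y 2 + X 3 * sphHarmonic y 3
  rcases le_total 0 (X 0) with h | h
  · rw [uIcc_of_le h] at hr
    rw [abs_of_nonneg h] at hX ⊢
    nlinarith [mul_nonneg hr.1 (by linarith [hab.1] : 0 ≤ w + S),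
      mul_nonneg (sub_nonneg.2 hr.2) hX.le]
  · rw [uIcc_of_ge h] at hr
    rw [abs_of_nonpos h] at hX ⊢
    nlinarith [mul_nonneg (neg_nonneg.2 hr.2) (by linarith [hab.2] : 0 ≤ S - w),
      mul_nonneg (sub_nonneg.2 hr.1) (by linarith : 0 ≤ S + X 0)]

theorem coneGap_sq_le_rhoSq {X : Amb} (hX : 0 < coneGap X) : coneGap X ^ 2 ≤ rhoSq X := by
  have := coneGap_sq_le hX (r := 0) left_mem_uIcc 0
  simpa using this

/-- Domain of dependence: by `coneGap_sq_le`, the integral at X uses G only where the square of the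
distance is at least that of the gap. -/
theorem retarded_congr {G H : Amb → ℝ} {δ : ℝ} (h : ∀ X, δ ≤ rhoSq X → G X = H X) {X : Amb}
    (hX : 0 < coneGap X) (hd : δ ≤ coneGap X ^ 2) : retarded G X = retarded H X := by
  refine intervalIntegral.integral_congr fun r hr => ?_
  have e : ∀ y : Coord, y 0 = r → G (X + y 0 • cone y) = H (X + y 0 • cone y) := fun y hy => by
    rw [hy]
    exact h _ (hd.trans (coneGap_sq_le hX hr y))
  have : coneMean G X r = coneMean H X r := by
    unfold coneMean sphInt
    refine intervalIntegral.integral_congr fun θ _ => intervalIntegral.integral_congr fun φ _ => ?_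
    dsimp only
    rw [e ![r, θ, φ] rfl]
  rw [this]

/-- The extension of `f` of degree `-1`. -/
def ambInv (f : ScalarField) (X : Amb) : ℝ := amb f X / Real.sqrt (rhoSq X)

theorem ambInv_smul (f : ScalarField) {c : ℝ} (hc : 0 < c) (X : Amb) :
    ambInv f (c • X) = c⁻¹ * ambInv f X := by
  unfold ambInv
  rw [amb_smul f hc, rhoSq_smul, Real.sqrt_mul (sq_nonneg c), Real.sqrt_sq hc.le]
  field_simp

/-- The source of degree -1 is singular on the light cone of the origin. The cutoff vanishes for
`rhoSq` below δ/2 and equals 1 above δ, which makes the results for smooth functions on the whole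
ambient space applicable. -/
theorem exists_cutoff {f : ScalarField} (hf : f.IsRegular) {δ : ℝ} (hδ : 0 < δ) :
    ∃ G : Amb → ℝ, Smooth G ∧ ∀ X, δ ≤ rhoSq X → ambInv f X = G X := by
  refine ⟨fun X => Real.smoothTransition (2 * rhoSq X / δ - 1) * ambInv f X,
    contDiff_iff_contDiffAt.2 fun X => ?_, fun X hX => ?_⟩
  · rcases lt_or_ge 0 (rhoSq X) with h | h
    · have h1 : ContDiffAt ℝ (⊤ : ℕ∞) (fun X => Real.smoothTransition (2 * rhoSq X / δ - 1)) X :=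
        (Real.smoothTransition.contDiff.comp
          (((contDiff_const.mul smooth_rhoSq).div_const δ).sub contDiff_const)).contDiffAt
      have h2 : ContDiffAt ℝ (⊤ : ℕ∞) (fun X => Real.sqrt (rhoSq X)) X :=
        smooth_rhoSq.contDiffAt.sqrt h.ne'
      exact h1.mul ((contDiffAt_amb hf h).div h2 (Real.sqrt_pos.2 h).ne')
    · have hev : ∀ᶠ Y in 𝓝 X, rhoSq Y < δ / 2 :=
        smooth_rhoSq.continuous.continuousAt.eventually (gt_mem_nhds (by linarith))
      refine (contDiffAt_const (c := (0 : ℝ))).congr_of_eventuallyEq ?_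
      filter_upwards [hev] with Y hY
      rw [Real.smoothTransition.zero_of_nonpos, zero_mul]
      have : 2 * rhoSq Y / δ ≤ 1 := by rw [div_le_one hδ]; linarith
      linarith
  · have : 1 ≤ 2 * rhoSq X / δ - 1 := by
      have : 2 ≤ 2 * rhoSq X / δ := by rw [le_div_iff₀ hδ]; linarith
      linarith
    have h1 := Real.smoothTransition.one_of_one_le this
    change _ = Real.smoothTransition (2 * rhoSq X / δ - 1) * ambInv f X
    rw [h1, one_mul]

/-- Scaling r contributes c² through r dr, and the source contributes c⁻¹. A source of degree -1
thus yields a potential of degree one, the degree for which the wave operator restricts to □ + 3. -/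
theorem retarded_smul (f : ScalarField) {c : ℝ} (hc : 0 < c) (X : Amb) :
    retarded (ambInv f) (c • X) = c * retarded (ambInv f) X := by
  have h : ∀ r, coneMean (ambInv f) (c • X) (r * c) = c⁻¹ * coneMean (ambInv f) X r := fun r => by
    unfold coneMean
    rw [← sphInt_const_mul]
    unfold sphInt
    refine intervalIntegral.integral_congr fun θ _ => intervalIntegral.integral_congr fun φ _ => ?_
    have e : c • X + (![r * c, θ, φ] : Coord) 0 • cone ![r * c, θ, φ] =
        c • (X + (![r, θ, φ] : Coord) 0 • cone ![r, θ, φ]) := by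
      funext μ
      simp [cone, sphHarmonic]
      ring
    dsimp only
    rw [e, ambInv_smul f hc]
    simp
    ring
  have h2 := intervalIntegral.smul_integral_comp_mul_right (a := 0) (b := X 0)
    (fun r => r * coneMean (ambInv f) (c • X) r) c
  rw [zero_mul, smul_eq_mul] at h2
  have e1 : retarded (ambInv f) (c • X) =
      ∫ r in (0 : ℝ)..(X 0 * c), r * coneMean (ambInv f) (c • X) r := by
    unfold retarded radInt
    rw [show (c • X) 0 = X 0 * c by simp [mul_comm]]
  rw [e1, ← h2]
  congr 1
  refine intervalIntegral.integral_congr fun r _ => ?_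
  rw [h]
  field_simp

/-- The extension of degree one of a solution of the inhomogeneous equation. -/
theorem exists_ambient_solution {f : ScalarField} (hf : f.IsRegular) :
    ∃ F : Amb → ℝ, (∀ c X, 0 < c → F (c • X) = c * F X) ∧ ∀ X, 0 < coneGap X →
      ∃ H : Amb → ℝ, Smooth H ∧ F =ᶠ[𝓝 X] H ∧ waveOp H X = ambInv f X := by
  refine ⟨fun X => -(4 * Real.pi)⁻¹ * retarded (ambInv f) X, fun c X hc => ?_, fun X hX => ?_⟩
  · have h := retarded_smul f hc X
    simp only [h]
    ring
  · set δ := coneGap X ^ 2 / 2 with hδ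
    have hδ0 : 0 < δ := by positivity
    obtain ⟨G, hG, hGe⟩ := exists_cutoff hf hδ0
    have hr := smooth_retarded hG
    refine ⟨fun X => -(4 * Real.pi)⁻¹ * retarded G X, contDiff_const.mul hr, ?_, ?_⟩
    · have h1 : ∀ᶠ Y in 𝓝 X, 0 < coneGap Y :=
        continuous_coneGap.continuousAt.eventually (lt_mem_nhds hX)
      have h2 : ∀ᶠ Y in 𝓝 X, δ < coneGap Y ^ 2 :=
        (continuous_coneGap.pow 2).continuousAt.eventually
          (lt_mem_nhds (show δ < coneGap X ^ 2 by linarith))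
      filter_upwards [h1, h2] with Y hY1 hY2
      rw [retarded_congr hGe hY1 hY2.le]
    · have e1 : ∀ μ, dd μ (fun X => -(4 * Real.pi)⁻¹ * retarded G X) =
          fun X => -(4 * Real.pi)⁻¹ * dd μ (retarded G) X := fun μ =>
        funext fun Y => dd_const_mul μ _ (hr.diff Y)
      have e2 : waveOp (fun X => -(4 * Real.pi)⁻¹ * retarded G X) X =
          -(4 * Real.pi)⁻¹ * waveOp (retarded G) X := by
        unfold waveOp
        simp only [e1, fun μ => dd_const_mul μ (-(4 * Real.pi)⁻¹) ((smooth_dd μ hr).diff X)]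
        rw [Finset.mul_sum]
        exact Finset.sum_congr rfl fun μ _ => by ring
      have hle := coneGap_sq_le_rhoSq hX
      rw [e2, waveOp_retarded hG, hGe X (by linarith)]
      have := Real.pi_pos.ne'
      field_simp

theorem coneGap_zeta (p : Patch) (x : Coord) : 0 < coneGap fun μ => zeta μ p x := by
  unfold coneGap
  rw [spatialSq_zeta]
  have h : |Real.sinh (x 0)| < Real.cosh (x 0) := by
    rw [abs_lt]
    constructor
    · have := Real.exp_pos (x 0); rw [← Real.cosh_add_sinh] at this; linarith
    · exact Real.sinh_lt_cosh _
  exact sub_pos.2 h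

theorem smooth_zetaVec (p : Patch) : Smooth (fun x : Coord => (fun μ => zeta μ p x : Amb)) :=
  contDiff_pi.2 fun μ => smooth_zeta μ p

/-- Solvability of `□Ψ + 3Ψ = f`. -/
theorem exists_box_eq {f : ScalarField} (hf : f.IsRegular) :
    ∃ Ψ : ScalarField, Ψ.IsRegular ∧ ∀ p x, boxScalar (Ψ p) x + 3 * Ψ p x = f p x := by
  obtain ⟨F, hF, hloc⟩ := exists_ambient_solution hf
  have hat : ∀ p x, ContDiffAt ℝ (⊤ : ℕ∞) F (fun μ => zeta μ p x) := fun p x => by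
    obtain ⟨H, hH, he, -⟩ := hloc _ (coneGap_zeta p x)
    exact hH.contDiffAt.congr_of_eventuallyEq he
  have hdat : ∀ p x μ, DifferentiableAt ℝ (dd μ F) (fun ν => zeta ν p x) := fun p x μ => by
    obtain ⟨H, hH, he, -⟩ := hloc _ (coneGap_zeta p x)
    refine ((smooth_dd μ hH).diff _).congr_of_eventuallyEq ?_
    filter_upwards [he.eventuallyEq_nhds] with Y hY using dd_congr μ hY
  set Ψ : ScalarField := fun p x => F (fun μ => zeta μ p x) with hΨ
  have hΨs : ∀ p, Smooth (Ψ p) := fun p => contDiff_iff_contDiffAt.2 fun x =>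
    (hat p x).comp x (smooth_zetaVec p).contDiffAt
  have hd : ∀ p x, DifferentiableAt ℝ F (fun μ => zeta μ p x) := fun p x =>
    (hat p x).differentiableAt (by simp)
  -- Euler's relations
  have hline : ∀ X : Amb, HasDerivAt (fun c : ℝ => c • X) X 1 := fun X => by
    have := (hasDerivAt_id (1 : ℝ)).smul_const X
    simpa using this
  have hE1 : ∀ p x, ∑ μ, zeta μ p x * dd μ F (fun μ => zeta μ p x) = Ψ p x := fun p x => by
    set X : Amb := fun μ => zeta μ p x with hX
    have h1 : HasDerivAt (fun c : ℝ => F (c • X)) (fderiv ℝ F X X) 1 := by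
      have h := (hd p x).hasFDerivAt
      rw [← one_smul ℝ (fun μ => zeta μ p x)] at h
      have := h.comp_hasDerivAt (1 : ℝ) (hline X)
      rwa [one_smul] at this
    have h2 : HasDerivAt (fun c : ℝ => F (c • X)) (F X) 1 := by
      have h3 : HasDerivAt (fun c : ℝ => c * F X) (1 * F X) 1 := (hasDerivAt_id' (1 : ℝ)).mul_const _
      rw [one_mul] at h3
      refine h3.congr_of_eventuallyEq ?_
      filter_upwards [lt_mem_nhds (zero_lt_one' ℝ)] with c hc using hF c X hc
    rw [← fderiv_eq_sum_dd, h1.unique h2]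
  have hhom : ∀ (c : ℝ) p x μ, 0 < c → dd μ F (c • fun ν => zeta ν p x) =
      dd μ F fun ν => zeta ν p x := fun c p x μ hc => by
    have e : (fun Y => F (c • Y)) = fun Y => c * F Y := funext fun Y => hF c Y hc
    have h1 := fderiv_comp_smul (f := F) (x := fun ν => zeta ν p x) c
    rw [e, fderiv_const_mul (hd p x)] at h1
    have h2 := smul_right_injective _ hc.ne' h1
    unfold dd
    rw [h2]
  have hE2 : ∀ p x μ, ∑ ν, zeta ν p x * dd ν (dd μ F) (fun μ => zeta μ p x) = 0 := fun p x μ => by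
    set X : Amb := fun μ => zeta μ p x with hX
    have h1 : HasDerivAt (fun c : ℝ => dd μ F (c • X)) (fderiv ℝ (dd μ F) X X) 1 := by
      have h := (hdat p x μ).hasFDerivAt
      rw [← one_smul ℝ (fun μ => zeta μ p x)] at h
      have := h.comp_hasDerivAt (1 : ℝ) (hline X)
      rwa [one_smul] at this
    have h2 : HasDerivAt (fun c : ℝ => dd μ F (c • X)) 0 1 := by
      refine (hasDerivAt_const (1 : ℝ) (dd μ F X)).congr_of_eventuallyEq ?_
      filter_upwards [lt_mem_nhds (zero_lt_one' ℝ)] with c hc using hhom c p x μ hc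
    rw [← fderiv_eq_sum_dd, h1.unique h2]
  have hpd : ∀ p x b, pd b (Ψ p) x = ∑ μ, pd b (zeta μ p) x * dd μ F (fun μ => zeta μ p x) :=
    fun p x b => pd_comp_amb (g := fun x => (fun μ => zeta μ p x)) (hd p x) ((smooth_zetaVec p).diff x) b
  -- Euler's relation and completeness of the frame identify `ambGrad` with the actual ambient
  -- gradient of F, its index raised with η.
  have hamb : ∀ p μ, ambGrad p μ (Ψ p) = fun x => eta μ * dd μ F (fun ν => zeta ν p x) := by
    intro p μ
    funext x
    have e : ∑ b, pd b (Ψ p) x * frame p μ b x = ∑ ν, dd ν F (fun ν => zeta ν p x) *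
        ∑ b, frame p μ b x * pd b (zeta ν p) x := by
      simp only [hpd, Fin.sum_univ_three, Fin.sum_univ_four]; ring
    unfold ambGrad
    rw [e, ← hE1]
    simp only [sum_frame_zeta]
    fin_cases μ <;> simp [Fin.sum_univ_four] <;> ring
  refine ⟨Ψ, ⟨hΨs, fun y hy => ?_⟩, fun p x => ?_⟩
  · have : (fun μ => zeta μ .north (sphChart .north y)) = fun μ => zeta μ .south (sphChart .south y) :=
      funext fun μ => (zeta_regular μ).2 y hy
    exact congrArg F this
  · set X : Amb := fun μ => zeta μ p x with hX
    have hform : ∀ μ a, formOf p μ (hessPlusAt (Ψ p)) x a =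
        eta μ * ∑ ν, pd a (zeta ν p) x * dd ν (dd μ F) X := fun μ a => by
      have hc : DifferentiableAt ℝ (fun x => dd μ F (fun ν => zeta ν p x)) x :=
        DifferentiableAt.comp (g := dd μ F) (f := fun x => (fun ν => zeta ν p x)) x
          (hdat p x μ) ((smooth_zetaVec p).diff x)
      rw [← pd_ambGrad p μ (hΨs p), hamb, pd_const_mul a _ hc]
      congr 1
      exact pd_comp_amb (g := fun x => (fun μ => zeta μ p x)) (hdat p x μ)
        ((smooth_zetaVec p).diff x) a
    have htr : trace (hessPlusAt (Ψ p)) x = ∑ μ, ∑ ν, eta μ * eta μ * dd ν (dd μ F) X *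
        ∑ b, frame p ν b x * pd b (zeta μ p) x := by
      have e : ∀ a b, hessPlusAt (Ψ p) x a b = ∑ μ, eta μ * formOf p μ (hessPlusAt (Ψ p)) x a *
        pd b (zeta μ p) x := fun a b => (sum_eta_formOf_pd p _ x a b).symm
      unfold trace
      simp only [e, hform, frame_eq]
      simp only [Fin.sum_univ_three, Fin.sum_univ_four, metricInv_eq]
      simp
      ring
    have hw : waveOp F X = f p x := by
      obtain ⟨H, hH, he, hw⟩ := hloc _ (coneGap_zeta p x)
      have e : waveOp F X = waveOp H X := by
        unfold waveOp
        refine Finset.sum_congr rfl fun μ _ => ?_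
        congr 1
        refine dd_congr μ ?_
        filter_upwards [he.eventuallyEq_nhds] with Y hY using dd_congr μ hY
      rw [e, hw, ambInv, rhoSq_zeta, Real.sqrt_one, div_one, amb_zeta hf.2]
    rw [← trace_hessPlusAt, htr, ← hw]
    have h2 := hE2 p x
    simp only [sum_frame_zeta]
    -- The trace over the tangent space is the full ambient trace minus the second derivative along
    -- the normal, and the latter vanishes by Euler's relation.
    have e3 : ∑ μ, ∑ ν, eta μ * eta μ * dd ν (dd μ F) X *
        ((if ν = μ then eta ν else 0) - zeta ν p x * zeta μ p x) =
        waveOp F X - ∑ μ, eta μ * eta μ * zeta μ p x * ∑ ν, zeta ν p x * dd ν (dd μ F) X := by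
      simp only [waveOp, Fin.sum_univ_four, eta]
      simp
      ring
    simp only [← hX] at h2
    rw [e3]
    simp [h2]

/-! ### Tensor potentials and their transition functions -/

variable {Φ σ ω : ScalarField} {T U k h1 : TensorField} {N M : Fin 4 → ℝ}

/-- A solution without `l ≤ 1` harmonics has a regular traceless tensor potential. -/
theorem exists_regular_potential (hΦ : Φ.IsRegular) (h : Φ.BoxPlusThree)
    (hm : ∀ ν τ, moment Φ ν τ = 0) :
    ∃ P : TensorField, P.IsRegular ∧ P.IsSymmetric ∧ P.IsTraceless ∧ magnetic P = hessPlus Φ := by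
  obtain ⟨K, hK, hKs, hKc⟩ := exists_symmetric_potential hΦ h hm
  have hf : ScalarField.IsRegular (fun p x => -trace (K p) x) :=
    ScalarField.IsRegular.neg (Φ := fun p => trace (K p))
      ⟨fun p => smooth_trace (hK.1 p), hK.2.trace⟩
  -- The trace of SΨ is □Ψ + 3Ψ, so Ψ is chosen to cancel tr K; adding SΨ does not change the curl.
  -- The factor 2 below compensates the ½ in the definition of the magnetic part.
  obtain ⟨Ψ, hΨ, hΨe⟩ := exists_box_eq hf
  have hS := hΨ.hessPlus
  have hsum : (K + hessPlus Ψ).IsSymmetric := hKs.add (hessPlus_isSymmetric hΨ.1)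
  refine ⟨(2 : ℝ) • (K + hessPlus Ψ), ⟨(hK.1.add hS.1).smul 2, (hK.2.add hS.2).smul 2⟩,
    fun p x a b => ?_, fun p x => ?_, ?_⟩
  · simp only [Pi.smul_apply, hsum p x a b]
  · rw [Pi.smul_apply, trace_smul, Pi.add_apply, trace_add, Pi.smul_apply, Pi.add_apply, hessPlus_eq,
      trace_hessPlusAt, hΨe, add_neg_cancel, smul_zero]
  · rw [magnetic_smul _ (hK.1.add hS.1), magnetic_supertranslate hK.1 hΨ.1]
    funext p
    rw [Pi.smul_apply, magnetic_eq, hKc, smul_smul]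
    norm_num

/-- The combination of the lowest harmonics with given coefficients. -/
theorem lowest_regular (α β : Fin 4 → ℝ) :
    ScalarField.IsRegular (∑ μ, (α μ • zeta μ + β μ • zetaHat μ)) :=
  ScalarField.isRegular_sum _ fun μ => ((zeta_regular μ).smul _).add ((zetaHat_regular μ).smul _)

theorem hessPlus_lowest (α β : Fin 4 → ℝ) : hessPlus (∑ μ, (α μ • zeta μ + β μ • zetaHat μ)) =
    magnetic (∑ μ, (2 * β μ) • sing μ) := by
  have e : ∀ μ, (2 * β μ) / 2 = β μ := fun μ => by ring
  rw [magnetic_sum_sing, Finset.sum_add_distrib,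
    hessPlus_add (ScalarField.isRegular_sum _ fun μ => (zeta_regular μ).smul _).1
      (ScalarField.isRegular_sum _ fun μ => (zetaHat_regular μ).smul _).1,
    hessPlus_sum_smul _ _ zeta_regular]
  simp [hessPlus_zeta, e]

/-- A tensor potential whose singular part is determined by the lowest harmonics. -/
theorem exists_potential (hΦ : Φ.IsRegular) (h : Φ.BoxPlusThree) {α β : Fin 4 → ℝ}
    (hl : HasLowestHarmonics Φ α β) :
    ∃ P : TensorField, P.IsRegular ∧ P.IsSymmetric ∧ P.IsTraceless ∧ P.IsDivFree ∧
      magnetic (P + ∑ μ, (2 * β μ) • sing μ) = hessPlus Φ := by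
  set D : ScalarField := ∑ μ, (α μ • zeta μ + β μ • zetaHat μ) with hD
  have hDr : D.IsRegular := lowest_regular α β
  have hΦ0 : (Φ - D).IsRegular := hΦ.sub hDr
  have hDH : hessPlus D = magnetic (∑ μ, (2 * β μ) • sing μ) := hessPlus_lowest α β
  have hsub : hessPlus Φ = hessPlus (Φ - D) + hessPlus D := by
    rw [hessPlus_sub hΦ hDr, sub_add_cancel]
  have hDt : (hessPlus D).IsTraceless := by
    rw [hDH]; exact magnetic_isTraceless (sum_sing_symm fun μ => 2 * β μ)
  have hb : (Φ - D).BoxPlusThree := by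
    rw [← hessPlus_isTraceless_iff]
    intro p x
    have := hessPlus_isTraceless_iff.2 h p x
    rwa [hsub, Pi.add_apply, trace_add, Pi.add_apply, hDt p x, add_zero] at this
  -- The remainder satisfies the same condition with all coefficients zero, so its moments with l ≤
  -- 1 vanish.
  have hm : ∀ ν τ, moment (Φ - D) ν τ = 0 := by
    have hl0 : HasLowestHarmonics (Φ - D) 0 0 := fun τ ν => by
      have e : Φ - D - ∑ μ, ((0 : Fin 4 → ℝ) μ • zeta μ + (0 : Fin 4 → ℝ) μ • zetaHat μ) = Φ - D := by
        simp
      rw [e]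
      exact hl τ ν
    intro ν τ
    rw [(hasLowestHarmonics_iff hΦ0 0 0).1 hl0 τ ν]
    simp
  obtain ⟨P, hP, hPs, hPt, hPm⟩ := exists_regular_potential hΦ0 hb hm
  refine ⟨P, hP, hPs, hPt, isDivFree_of_magnetic hP.1 hPs hPt hΦ0.1 hPm, ?_⟩
  rw [magnetic_add hP.1 (sum_sing_smooth fun μ => 2 * β μ), hPm, ← hDH, hsub]

theorem isGlobal_sub_of_transition (hT : HasNUTTransition T N) (hU : HasNUTTransition U N) :
    (T - U).IsGlobal := fun y hy => by
  rw [sphComponents_sub, sphComponents_sub]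
  have := (hT y hy).trans (hU y hy).symm
  rw [sub_eq_sub_iff_sub_eq_sub] at this
  exact this.symm

theorem HasNUTTransition.global_add (hT : HasNUTTransition T N) (hU : U.IsGlobal) :
    HasNUTTransition (U + T) N := by
  rw [add_comm]; exact hT.add_global hU

theorem sum_sing_sub (M N : Fin 4 → ℝ) :
    ∑ μ, (M - N) μ • sing μ = ∑ μ, M μ • sing μ - ∑ μ, N μ • sing μ := by
  rw [← Finset.sum_sub_distrib]
  exact Finset.sum_congr rfl fun μ _ => by rw [Pi.sub_apply, sub_smul]

/-- The NUT charges of `∑ M_μ k_μ + Sω` are `M`. -/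
theorem nut_eq (hω : ω.IsSmooth) (hU : U.IsGlobal)
    (h : HasNUTTransition (U + ∑ μ, M μ • sing μ + hessPlus ω) N) : M = N := by
  have h1 := isGlobal_sub_of_transition h (hasNUTTransition_sum_sing N)
  have h2 := h1.sub hU
  have e : U + ∑ μ, M μ • sing μ + hessPlus ω - ∑ μ, N μ • sing μ - U =
      ∑ μ, (M - N) μ • sing μ + hessPlus ω := by
    rw [sum_sing_sub]; abel
  rw [e] at h2
  exact sub_eq_zero.1 (eq_zero_of_isGlobal hω h2)

theorem isGlobal_zero : TensorField.IsGlobal 0 := fun y _ => by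
  funext a b; simp [sphComponents_eq]

theorem nut_sum_sing (h : HasNUTTransition (∑ μ, M μ • sing μ) N) : M = N := by
  have := nut_eq (ω := 0) (M := M) (N := N) ScalarField.isRegular_zero.1 isGlobal_zero
  refine this ?_
  have h0 : hessPlus (0 : ScalarField) = 0 := by
    have := hessPlus_smul (0 : ℝ) (ScalarField.isRegular_zero.1)
    simpa using this
  rwa [h0, add_zero, zero_add]

/-- The NUT charges of a tensor potential are determined by the lowest harmonics. -/
theorem nut_of_potential (hΦ : Φ.IsRegular) (h : Φ.BoxPlusThree) {α β : Fin 4 → ℝ}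
    (hl : HasLowestHarmonics Φ α β) (hk : k.IsSmooth) (hks : k.IsSymmetric)
    (hm : magnetic k = hessPlus Φ) (hN : HasNUTTransition k N) : (fun μ => 2 * β μ) = N := by
  obtain ⟨P, hP, hPs, -, -, hPm⟩ := exists_potential hΦ h hl
  obtain ⟨ω, hω, e⟩ := exists_eq_add_hessPlus (hP.1.add (sum_sing_smooth fun μ => 2 * β μ)) hk
    (hPs.add (sum_sing_symm fun μ => 2 * β μ)) hks (hm.trans hPm.symm)
  rw [e] at hN
  exact nut_eq hω hP.2 hN

theorem hasNUTTransition_zero_iff : HasNUTTransition T 0 ↔ T.IsGlobal := by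
  refine forall_congr' fun y => forall_congr' fun _ => ?_
  simp [sub_eq_zero, eq_comm]

/-- A regular potential is one with NUT charges zero, and the charges are 2α̂. -/
theorem exists_regular_potential_iff (hΦ : Φ.IsRegular) (h : Φ.BoxPlusThree) {α β : Fin 4 → ℝ}
    (hl : HasLowestHarmonics Φ α β) :
    (∃ P : TensorField, P.IsRegular ∧ P.IsSymmetric ∧ magnetic P = hessPlus Φ) ↔ β = 0 := by
  constructor
  · rintro ⟨P, hP, hPs, hPm⟩
    have := nut_of_potential hΦ h hl hP.1 hPs hPm (hasNUTTransition_zero_iff.2 hP.2)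
    funext μ
    have := congrFun this μ
    simpa using this
  · rintro rfl
    obtain ⟨P, hP, hPs, -, -, hPm⟩ := exists_potential hΦ h hl
    refine ⟨P, hP, hPs, ?_⟩
    simpa using hPm

theorem metric_global (hσ : σ.IsGlobal) :
    TensorField.IsGlobal (fun p x a b => 2 * σ p x * metric x a b) := by
  have key : ∀ p y, InOverlap y → sphComponents (fun p x a b => 2 * σ p x * metric x a b) p y =
      fun a b => 2 * σ p (sphChart p y) * Matrix.diagonal
        ![-1, Real.cosh (y 0) ^ 2, Real.cosh (y 0) ^ 2 * Real.sin (y 1) ^ 2] a b := by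
    intro p y hy
    rw [← sphComponents_metric p y hy]
    funext a b
    rw [Matrix.of_apply, sphComponents_eq, sphComponents_eq (fun _ => metric)]
    simp only [Finset.mul_sum]
    exact Finset.sum_congr rfl fun c _ => Finset.sum_congr rfl fun d _ => by ring
  intro y hy
  rw [key _ y hy, key _ y hy, hσ y hy]

theorem HasNUTTransition.tensorPotential (hN : HasNUTTransition h1 N) (hσ : σ.IsGlobal) :
    HasNUTTransition (tensorPotential σ h1) N := by
  rw [tensorPotential_eq]
  exact hN.add_global (metric_global hσ)

/-- Two tensor potentials with the same magnetic part and the same NUT charges are related by a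
supertranslation. -/
theorem exists_supertranslation (hT : T.IsSmooth) (hU : U.IsSmooth) (hTs : T.IsSymmetric)
    (hUs : U.IsSymmetric) (hTN : HasNUTTransition T N) (hUN : HasNUTTransition U N)
    (hm : magnetic T = magnetic U) : ∃ ω : ScalarField, ω.IsRegular ∧ T + hessPlus ω = U := by
  obtain ⟨ω, hω, e⟩ := (magnetic_eq_iff hT hU hTs hUs (isGlobal_sub_of_transition hUN hTN)).1 hm.symm
  exact ⟨ω, hω, e.symm⟩

/-- If B = ∑ c_μ Sζ̂_μ, then k and ∑ 2c_μ k_μ have the same magnetic part and differ by Sω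
patchwise. Comparison of the transition functions forces 2c = N, after which they agree and ω can be
taken regular. -/
theorem singular_form_iff (h : IsConfiguration σ h1) (hN : HasNUTTransition h1 N) :
    (∃ ω : ScalarField, ω.IsRegular ∧
        tensorPotential σ h1 + hessPlus ω = ∑ μ, N μ • sing μ) ↔
      ∃ c : Fin 4 → ℝ, magnetic (tensorPotential σ h1) = ∑ μ, c μ • hessPlus (zetaHat μ) := by
  have hk := h.smooth_tensorPotential
  have hs := h.symmetric_tensorPotential
  have hkN := hN.tensorPotential h.regular_mass_aspect.2
  have hsum : ∀ M : Fin 4 → ℝ, magnetic (∑ μ, M μ • sing μ) =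
      ∑ μ, (M μ / 2) • hessPlus (zetaHat μ) := fun M => by
    rw [magnetic_sum_sing, hessPlus_sum_smul _ _ zetaHat_regular]
  constructor
  · rintro ⟨ω, hω, e⟩
    exact ⟨fun μ => N μ / 2, by rw [← magnetic_supertranslate hk hω.1, e, hsum]⟩
  · rintro ⟨c, hc⟩
    have hc' : magnetic (tensorPotential σ h1) = magnetic (∑ μ, (2 * c μ) • sing μ) := by
      rw [hc, hsum fun μ => 2 * c μ]
      exact Finset.sum_congr rfl fun μ _ => by congr 1; ring
    obtain ⟨ω, hω, e⟩ := exists_eq_add_hessPlus (sum_sing_smooth fun μ => 2 * c μ) hk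
      (sum_sing_symm fun μ => 2 * c μ) hs hc'
    have hcN : (fun μ => 2 * c μ) = N := by
      refine nut_eq hω isGlobal_zero ?_
      rw [zero_add, ← e]
      exact hkN
    subst hcN
    exact exists_supertranslation hk (sum_sing_smooth _) hs (sum_sing_symm _) hkN
      (hasNUTTransition_sum_sing _) hc'

theorem singular_form_nut (h : IsConfiguration σ h1) (hN : HasNUTTransition h1 N)
    (hω : ω.IsRegular) (e : tensorPotential σ h1 + hessPlus ω = ∑ μ, M μ • sing μ) : M = N := by
  have := (hN.tensorPotential h.regular_mass_aspect.2).add_global hω.hessPlus.2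
  rw [e] at this
  exact nut_sum_sing this

/-- A choice of potential for every admissible T, with the value 0 elsewhere. The admissible T are
of the form SΦ, so the potential constructed from the lowest harmonics of Φ can be used. -/
theorem exists_isCurlInverse : ∃ C, IsCurlInverse C := by
  have h : ∀ T : TensorField, ∃ k : TensorField, IsWeylType T → k.IsSmooth ∧
      (∃ N, HasNUTTransition k N) ∧ k.IsSymmetric ∧ k.IsTraceless ∧ k.IsDivFree ∧
      magnetic k = T := by
    intro T
    by_cases hT : IsWeylType T
    · obtain ⟨Φ, hΦ, hb, rfl⟩ := hT.exists_potential
      obtain ⟨⟨α, β⟩, hl, -⟩ := existsUnique_lowestHarmonics hΦ hb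
      obtain ⟨P, hP, hPs, hPt, -, hPm⟩ := exists_potential hΦ hb hl
      have h1 := hP.1.add (sum_sing_smooth fun μ => 2 * β μ)
      have h2 := hPs.add (sum_sing_symm fun μ => 2 * β μ)
      have h3 := hPt.add (sum_sing_traceless fun μ => 2 * β μ)
      exact ⟨_, fun _ => ⟨h1, ⟨_, (hasNUTTransition_sum_sing fun μ => 2 * β μ).global_add hP.2⟩, h2,
        h3, isDivFree_of_magnetic h1 h2 h3 hΦ.1 hPm, hPm⟩⟩
    · exact ⟨0, fun h => absurd h hT⟩
  choose C hC using h
  exact ⟨C, fun T hT => (hC T hT).1, fun T hT => (hC T hT).2.1, fun T hT => (hC T hT).2.2.1,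
    fun T hT => (hC T hT).2.2.2.1, fun T hT => (hC T hT).2.2.2.2.1,
    fun T hT => (hC T hT).2.2.2.2.2⟩

/-- Both k and C(B) are potentials of the same SΦ, so both have NUT charges 2α̂. Their difference
has no jump and is a supertranslation. -/
theorem IsCurlInverse.exists_supertranslation {C : TensorField → TensorField} (hC : IsCurlInverse C)
    (h : IsConfiguration σ h1) (ho : OnShell σ (tensorPotential σ h1))
    (hN : HasNUTTransition h1 N) : ∃ ω : ScalarField, ω.IsRegular ∧
      tensorPotential σ h1 + hessPlus ω = C (magnetic (tensorPotential σ h1)) := by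
  have hW := h.isWeylType_magnetic ho
  have hk := h.smooth_tensorPotential
  have hs := h.symmetric_tensorPotential
  have hkN := hN.tensorPotential h.regular_mass_aspect.2
  obtain ⟨Φ, hΦ, hb, e⟩ := hW.exists_potential
  obtain ⟨⟨α, β⟩, hl, -⟩ := existsUnique_lowestHarmonics hΦ hb
  obtain ⟨N', hN'⟩ := hC.transition _ hW
  have e1 := nut_of_potential hΦ hb hl hk hs e hkN
  have e2 := nut_of_potential hΦ hb hl (hC.smooth _ hW) (hC.symmetric _ hW)
    ((hC.magnetic_eq _ hW).trans e) hN'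
  rw [← e2, e1] at hN'
  exact DeSitter.exists_supertranslation hk (hC.smooth _ hW) hs (hC.symmetric _ hW) hkN hN'
    (hC.magnetic_eq _ hW).symm

theorem hessPlus_eq_and_isTranslation {ω' : ScalarField} (hω : ω.IsRegular) (hω' : ω'.IsRegular)
    (h : T + hessPlus ω = T + hessPlus ω') :
    hessPlus ω' = hessPlus ω ∧ IsTranslation (ω' - ω) := by
  have e : hessPlus ω' = hessPlus ω := (add_left_cancel h).symm
  exact ⟨e, (hessPlus_eq_iff hω hω').1 e⟩

end DeSitter

end

/-! ### Assembly of the theorem. -/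

theorem mainTheorem3 :
    -- field equations in terms of the electric and magnetic parts
    (∀ (σ : DeSitter.ScalarField) (h1 : DeSitter.TensorField),
      DeSitter.IsConfiguration σ h1 →
        ((DeSitter.electric σ).IsSymmetric ∧ (DeSitter.electric σ).IsCurlFree ∧
          (DeSitter.magnetic (DeSitter.tensorPotential σ h1)).IsTraceless) ∧
        (DeSitter.OnShell σ (DeSitter.tensorPotential σ h1) ↔
          (DeSitter.electric σ).IsTraceless ∧
          (DeSitter.magnetic (DeSitter.tensorPotential σ h1)).IsSymmetric ∧
          (DeSitter.magnetic (DeSitter.tensorPotential σ h1)).IsCurlFree) ∧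
        (DeSitter.OnShell σ (DeSitter.tensorPotential σ h1) →
          ∀ T : DeSitter.TensorField,
            (T = DeSitter.electric σ ∨
              T = DeSitter.magnetic (DeSitter.tensorPotential σ h1)) →
            T.IsRegular ∧ T.IsSymmetric ∧ T.IsTraceless ∧ T.IsCurlFree ∧ T.IsDivFree ∧
              T.BoxMinusThree)) ∧
    -- scalar potentials and their ambiguity
    (∀ (σ : DeSitter.ScalarField) (h1 : DeSitter.TensorField),
      DeSitter.IsConfiguration σ h1 → DeSitter.OnShell σ (DeSitter.tensorPotential σ h1) →
        ((-σ).IsRegular ∧ (-σ).BoxPlusThree ∧ DeSitter.electric σ = DeSitter.hessPlus (-σ)) ∧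
        ∃ σD : DeSitter.ScalarField, σD.IsRegular ∧ σD.BoxPlusThree ∧
          DeSitter.magnetic (DeSitter.tensorPotential σ h1) = DeSitter.hessPlus σD) ∧
    (∀ Φ Φ' : DeSitter.ScalarField, Φ.IsRegular → Φ'.IsRegular →
      (DeSitter.hessPlus Φ' = DeSitter.hessPlus Φ ↔ DeSitter.IsTranslation (Φ' - Φ))) ∧
    -- coefficients of the lowest harmonics
    (∀ Φ : DeSitter.ScalarField, Φ.IsRegular → Φ.BoxPlusThree →
      ∃! α : (Fin 4 → ℝ) × (Fin 4 → ℝ), DeSitter.HasLowestHarmonics Φ α.1 α.2) ∧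
    -- action of supertranslations
    (∀ (σ : DeSitter.ScalarField) (h1 : DeSitter.TensorField) (ω : DeSitter.ScalarField),
      DeSitter.IsConfiguration σ h1 → ω.IsRegular →
        DeSitter.IsConfiguration σ (h1 + DeSitter.hessPlus ω) ∧
        DeSitter.tensorPotential σ (h1 + DeSitter.hessPlus ω) =
          DeSitter.tensorPotential σ h1 + DeSitter.hessPlus ω ∧
        DeSitter.magnetic (DeSitter.tensorPotential σ h1 + DeSitter.hessPlus ω) =
          DeSitter.magnetic (DeSitter.tensorPotential σ h1) ∧
        (∀ N, DeSitter.HasNUTTransition h1 N →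
          DeSitter.HasNUTTransition (h1 + DeSitter.hessPlus ω) N) ∧
        (DeSitter.OnShell σ (DeSitter.tensorPotential σ h1) →
          DeSitter.OnShell σ (DeSitter.tensorPotential σ h1 + DeSitter.hessPlus ω)) ∧
        ((DeSitter.tensorPotential σ h1).IsTraceless →
          ((DeSitter.tensorPotential σ h1 + DeSitter.hessPlus ω).IsTraceless ↔
            ω.BoxPlusThree))) ∧
    -- tensor potentials with the same magnetic part and the same transition function
    (∀ k k' : DeSitter.TensorField, k.IsSmooth → k'.IsSmooth → k.IsSymmetric → k'.IsSymmetric →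
      (k' - k).IsGlobal →
        (DeSitter.magnetic k' = DeSitter.magnetic k ↔
          ∃ ω : DeSitter.ScalarField, ω.IsRegular ∧ k' = k + DeSitter.hessPlus ω) ∧
        (k.IsTraceless → k'.IsTraceless → ∀ ω : DeSitter.ScalarField, ω.IsRegular →
          k' = k + DeSitter.hessPlus ω → ω.BoxPlusThree)) ∧
    ∃ κ : Fin 4 → DeSitter.TensorField,
      -- the four singular representatives
      (∀ μ, DeSitter.IsSingularRepresentative μ (κ μ) ∧ (κ μ).IsSymmetric ∧ (κ μ).IsTraceless ∧
        (κ μ).IsDivFree ∧ (κ μ).BoxMinusThree ∧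
        DeSitter.magnetic ((2 : ℝ) • κ μ) = DeSitter.hessPlus (DeSitter.zetaHat μ)) ∧
      -- tensor potentials: only the harmonics `ζ̂` contribute singular terms
      (∀ (Φ : DeSitter.ScalarField) (α αHat : Fin 4 → ℝ), Φ.IsRegular → Φ.BoxPlusThree →
        DeSitter.HasLowestHarmonics Φ α αHat →
        (∃ P : DeSitter.TensorField, P.IsRegular ∧ P.IsSymmetric ∧ P.IsTraceless ∧ P.IsDivFree ∧
          (P + ∑ μ, (2 * αHat μ) • κ μ).IsTraceless ∧
          (P + ∑ μ, (2 * αHat μ) • κ μ).IsDivFree ∧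
          DeSitter.HasNUTTransition (P + ∑ μ, (2 * αHat μ) • κ μ) (fun μ => 2 * αHat μ) ∧
          DeSitter.magnetic (P + ∑ μ, (2 * αHat μ) • κ μ) = DeSitter.hessPlus Φ ∧
          ∀ k : DeSitter.TensorField, k.IsSmooth → k.IsSymmetric →
            DeSitter.magnetic k = DeSitter.hessPlus Φ →
            ∃ ω : DeSitter.ScalarField, ω.IsSmooth ∧
              k = P + ∑ μ, (2 * αHat μ) • κ μ + DeSitter.hessPlus ω) ∧
        ((∃ P : DeSitter.TensorField, P.IsRegular ∧ P.IsSymmetric ∧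
          DeSitter.magnetic P = DeSitter.hessPlus Φ) ↔ αHat = 0) ∧
        (∀ (k : DeSitter.TensorField) (N : Fin 4 → ℝ), k.IsSmooth → k.IsSymmetric →
          DeSitter.magnetic k = DeSitter.hessPlus Φ → DeSitter.HasNUTTransition k N →
          ∀ μ, N μ = 2 * αHat μ)) ∧
      -- requiring only singular terms fixes the supertranslations
      (∀ (σ : DeSitter.ScalarField) (h1 : DeSitter.TensorField) (N : Fin 4 → ℝ),
        DeSitter.IsConfiguration σ h1 → DeSitter.OnShell σ (DeSitter.tensorPotential σ h1) →
        DeSitter.HasNUTTransition h1 N →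
        ((∃ ω : DeSitter.ScalarField, ω.IsRegular ∧
            DeSitter.tensorPotential σ h1 + DeSitter.hessPlus ω = ∑ μ, N μ • κ μ) ↔
          ∃ c : Fin 4 → ℝ, DeSitter.magnetic (DeSitter.tensorPotential σ h1) =
            ∑ μ, c μ • DeSitter.hessPlus (DeSitter.zetaHat μ)) ∧
        (∀ (ω ω' : DeSitter.ScalarField) (M M' : Fin 4 → ℝ), ω.IsRegular → ω'.IsRegular →
          DeSitter.tensorPotential σ h1 + DeSitter.hessPlus ω = ∑ μ, M μ • κ μ →
          DeSitter.tensorPotential σ h1 + DeSitter.hessPlus ω' = ∑ μ, M' μ • κ μ →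
          M = N ∧ M' = N ∧ DeSitter.hessPlus ω' = DeSitter.hessPlus ω ∧
            DeSitter.IsTranslation (ω' - ω))) ∧
      -- fixing an inverse of the curl operator fixes the supertranslations
      (∃ C, DeSitter.IsCurlInverse C) ∧
      (∀ C, DeSitter.IsCurlInverse C → ∀ (σ : DeSitter.ScalarField) (h1 : DeSitter.TensorField)
        (N : Fin 4 → ℝ),
        DeSitter.IsConfiguration σ h1 → DeSitter.OnShell σ (DeSitter.tensorPotential σ h1) →
        DeSitter.HasNUTTransition h1 N →
        (∃ ω : DeSitter.ScalarField, ω.IsRegular ∧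
          DeSitter.tensorPotential σ h1 + DeSitter.hessPlus ω =
            C (DeSitter.magnetic (DeSitter.tensorPotential σ h1 + DeSitter.hessPlus ω))) ∧
        (∀ ω ω' : DeSitter.ScalarField, ω.IsRegular → ω'.IsRegular →
          DeSitter.tensorPotential σ h1 + DeSitter.hessPlus ω =
            C (DeSitter.magnetic (DeSitter.tensorPotential σ h1 + DeSitter.hessPlus ω)) →
          DeSitter.tensorPotential σ h1 + DeSitter.hessPlus ω' =
            C (DeSitter.magnetic (DeSitter.tensorPotential σ h1 + DeSitter.hessPlus ω')) →
          DeSitter.hessPlus ω' = DeSitter.hessPlus ω ∧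
            DeSitter.IsTranslation (ω' - ω))) := by
  refine ⟨fun σ h1 h => ⟨⟨?_, ?_, ?_⟩, DeSitter.onShell_iff h, fun ho T hT => ?_⟩,
    fun σ h1 h ho => ⟨⟨h.regular_mass_aspect.neg,
      (DeSitter.boxPlusThree_neg h.regular_mass_aspect.1).2 ho.eq_scalar,
      DeSitter.electric_eq h.regular_mass_aspect.1⟩, ?_⟩,
    fun Φ Φ' hΦ hΦ' => DeSitter.hessPlus_eq_iff hΦ hΦ',
    fun Φ hΦ hb => DeSitter.existsUnique_lowestHarmonics hΦ hb,
    fun σ h1 ω h hω => ⟨h.supertranslate hω, DeSitter.tensorPotential_add_hessPlus σ h1 ω,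
      DeSitter.magnetic_supertranslate h.smooth_tensorPotential hω.1,
      fun N hN => hN.add_global hω.hessPlus.2, fun ho => ho.supertranslate h hω,
      fun ht => DeSitter.isTraceless_add_hessPlus_iff ht⟩,
    fun k k' hk hk' hks hks' hg => ⟨DeSitter.magnetic_eq_iff hk hk' hks hks' hg,
      fun ht ht' ω _ e => (DeSitter.isTraceless_add_hessPlus_iff ht).1 (e ▸ ht')⟩,
    DeSitter.sing,
    fun μ => ⟨DeSitter.sing_isSingularRepresentative μ, DeSitter.sing_symm μ,
      DeSitter.sing_traceless μ, DeSitter.sing_divFree μ, DeSitter.sing_boxMinusThree μ,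
      DeSitter.magnetic_two_sing μ⟩,
    fun Φ α αHat hΦ hb hl => ⟨?_, DeSitter.exists_regular_potential_iff hΦ hb hl,
      fun k N hk hks hm hN μ =>
        (congrFun (DeSitter.nut_of_potential hΦ hb hl hk hks hm hN) μ).symm⟩,
    fun σ h1 N h _ hN => ⟨DeSitter.singular_form_iff h hN, fun ω ω' M M' hω hω' e e' => ?_⟩,
    DeSitter.exists_isCurlInverse,
    fun C hC σ h1 N h ho hN => ⟨?_, fun ω ω' hω hω' e e' => ?_⟩⟩
  · rw [DeSitter.electric_eq h.regular_mass_aspect.1]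
    exact DeSitter.hessPlus_isSymmetric h.regular_mass_aspect.neg.1
  · rw [DeSitter.electric_eq h.regular_mass_aspect.1]
    exact fun p => DeSitter.curl_hessPlusAt (h.regular_mass_aspect.neg.1 p)
  · exact DeSitter.magnetic_isTraceless h.symmetric_tensorPotential
  · have hW : DeSitter.IsWeylType T := by
      rcases hT with rfl | rfl
      · exact h.isWeylType_electric ho
      · exact h.isWeylType_magnetic ho
    exact ⟨hW.regular, hW.symmetric, hW.traceless, hW.curlFree, hW.isDivFree, hW.boxMinusThree⟩
  · exact (h.isWeylType_magnetic ho).exists_potential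
  · obtain ⟨P, hP, hPs, hPt, hPd, hPm⟩ := DeSitter.exists_potential hΦ hb hl
    have h1 := hP.1.add (DeSitter.sum_sing_smooth fun μ => 2 * αHat μ)
    have h2 := hPs.add (DeSitter.sum_sing_symm fun μ => 2 * αHat μ)
    have h3 := hPt.add (DeSitter.sum_sing_traceless fun μ => 2 * αHat μ)
    exact ⟨P, hP, hPs, hPt, hPd, h3, DeSitter.isDivFree_of_magnetic h1 h2 h3 hΦ.1 hPm,
      (DeSitter.hasNUTTransition_sum_sing fun μ => 2 * αHat μ).global_add hP.2, hPm,
      fun k hk hks hm => DeSitter.exists_eq_add_hessPlus h1 hk h2 hks (hm.trans hPm.symm)⟩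
  · obtain rfl := DeSitter.singular_form_nut h hN hω e
    obtain rfl := DeSitter.singular_form_nut h hN hω' e'
    exact ⟨rfl, rfl, DeSitter.hessPlus_eq_and_isTranslation hω hω' (e.trans e'.symm)⟩
  · obtain ⟨ω, hω, e⟩ := hC.exists_supertranslation h ho hN
    exact ⟨ω, hω, by rw [DeSitter.magnetic_supertranslate h.smooth_tensorPotential hω.1, e]⟩
  -- B is invariant under supertranslations, so both conditions prescribe the same tensor C(B), and
  -- the two values of Sω coincide.
  · rw [DeSitter.magnetic_supertranslate h.smooth_tensorPotential hω.1] at e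
    rw [DeSitter.magnetic_supertranslate h.smooth_tensorPotential hω'.1] at e'
    exact DeSitter.hessPlus_eq_and_isTranslation hω hω' (e.trans e'.symm)
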